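/- Let $G$ be a (finite-dimensional) complex Lie group with Lie algebra $\mathfrak g$, and let $P$ be an invariant polynomial of degree $2$ on $\mathfrak g$, i.e. an $\mathrm{Ad}(G)$-invariant symmetric bilinear form $P:\mathfrak g\times\mathfrak g\to\mathbb C$. Let $d_j:G^{s+1}\to G^s$ ($0\le j\le s+1$) be the face maps of $BG$ ($d_0$ drops $g_1$, $d_{s+1}$ drops $g_{s+1}$, and $d_j$ replaces $g_j,g_{j+1}$ by $g_jg_{j+1}$ otherwise), and put $\delta=\sum_j(-1)^jd_j^*$. *Bott–Shulman–Stasheff forms.* Let $D_i$ ($0\le i\le n$) be the flat connection on the left principal $G$-bundle $G^{n+1}\to G^n$, $(g_0,\dots,g_n)\mapsto(g_0^{-1}g_1,\dots,g_{n-1}^{-1}g_n)$, for which the section with $g_i=1$ is horizontal (its connection form is $dg_i\,g_i^{-1}$). Let $R$ be the curvature of the connection $\sum_i t_iD_i$ on the pull-back of the bundle to $G^n\times\Delta_n$. Put $\omega_n=\int_{\Delta_n}P(R)$, a $(4-n)$-form on $G^n$, where the simplex directions are inserted last: $\omega_n(v_1,\dots,v_r)=\int_{\Delta_n}P(R)(v_1,\dots,v_r,\partial_{t_1},\dots,\partial_{t_n})\,dt_1\cdots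 dt_n$. Write $\omega=\omega_1$. *Simplices.* Let $U$ be an open neighbourhood of $1$ in $G$. For $l\ge0$ let $W_l\subseteq U^l$ be open neighbourhoods of $(1,\dots,1)$ with $d_j(W_{l+1})\subseteq W_l$ for all $j$, and let $\sigma_l:W_l\times\Delta_l\to U$, $\sigma_{g_1,\dots,g_l}(t)=\sigma_l(g_1,\dots,g_l;t)$, be smooth maps, holomorphic in $(g_1,\dots,g_l)$, with $\sigma_0=1$, with $\sigma_{g_1,\dots,g_l}\circ\delta_0=g_1\cdot\sigma_{g_2,\dots,g_l}$, and with $\sigma_{g_1,\dots,g_l}\circ\delta_j=\sigma_{d_j(g_1,\dots,g_l)}$ for $1\le j\le l$, where $\delta_j:\Delta_{l-1}\to\Delta_l$ is the $j$-th face map. Put $f_{m,q}(g_1,\dots,g_{m+q-1};t)=(g_1,\dots,g_{m-1},\sigma_{g_m,\dots,g_{m+q-1}}(t))\in G^m$, and let $\beta_{m,q}=\int_{\Delta_q}f_{m,q}^*\omega_m$, a $(4-m-q)$-form on $W_{m+q-1}$, where now the simplex directions are inserted first: $\beta_{m,q}(v_1,\dots,v_r)=\int_{\Delta_q}(f_{m,q}^*\omega_m)(\partial_{t_1},\dots,\partial_{t_q},v_1,\dots,v_r)\,dt_1\cdots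 dt_q$. Define $\eta_0=\beta_{1,3}$ (a function on $W_3$) and $\eta_1=\beta_{1,2}+\beta_{2,1}$ (a $1$-form on $W_2$). *Complexes.* The local de Rham double complex $\Omega_{loc}$ of $BG$ has as $(r,s)$-component the germs at $(1,\dots,1)$ of holomorphic $r$-forms on $G^s$, with total degree $r+s$ and total differential $D=d+(-1)^r\delta$. Let $F^2\Omega_{loc}$ be the subcomplex $r\ge2$ and $\sigma_{<2}\Omega_{loc}$ the quotient complex $r\le1$. Then the following hold. 1. $\eta_0$ and $\eta_1$ are holomorphic on $W_3$ and $W_2$; moreover $d\eta_0=\delta\eta_1$ on $W_3$ and $\delta\eta_0=0$ on $W_4$. In particular $(\eta_0,\eta_1)$ is a cocycle of total degree $3$ in the truncated complex $\sigma_{<2}\Omega_{loc}$. 2. $(\omega,\omega_2)$ and $(0,d\eta_1)$ are cocycles of total degree $4$ in $F^2\Omega_{loc}$, and they are cohomologous there. 3. Hence the boundary map $H^3(\sigma_{<2}\Omega_{loc})\to H^4(F^2\Omega_{loc})$ of the exact sequence $0\to F^2\Omega_{loc}\to\Omega_{loc}\to\sigma_{<2}\Omega_{loc}\to0$ sends the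 class of $(\eta_0,\eta_1)$ to the class of the Bott–Shulman–Stasheff cocycle $(\omega,\omega_2)$. -/

import Mathlib

open scoped Manifold ContDiff Topology
open Filter Set

/-! ## Holomorphic differential forms on complex manifolds -/

/-- Differential `k`-forms with values in `V` on a manifold `M` modelled on `F`, with no regularity.
In Mathlib the tangent space `TangentSpace I x` is by definition the model space `F`. -/
abbrev MForm (F M V : Type*) [NormedAddCommGroup F] [NormedSpace ℂ F]
    [NormedAddCommGroup V] [NormedSpace ℂ V] (k : ℕ) : Type _ :=
  M → F [⋀^Fin k]→L[ℂ] V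

section Forms

variable {F : Type*} [NormedAddCommGroup F] [NormedSpace ℂ F]
  {H : Type*} [TopologicalSpace H] (I : ModelWithCorners ℂ F H)
  {M : Type*} [TopologicalSpace M] [ChartedSpace H M]
  {F' : Type*} [NormedAddCommGroup F'] [NormedSpace ℂ F']
  {H' : Type*} [TopologicalSpace H'] (J : ModelWithCorners ℂ F' H')
  {N : Type*} [TopologicalSpace N] [ChartedSpace H' N]
  {V : Type*} [NormedAddCommGroup V] [NormedSpace ℂ V]

/-- The derivative of `f` at `x`, where tangent spaces are written as the model spaces. -/
noncomputable def tangentDeriv (f : M → N) (x : M) : F →L[ℂ] F' := mfderiv I J f x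

/-- The pull-back `f^* α`. -/
noncomputable def MForm.pullback {k : ℕ} (f : M → N) (α : MForm F' N V k) : MForm F M V k :=
  fun x => (α (f x)).compContinuousLinearMap (tangentDeriv I J f x)

/-- The form `α` read in the preferred chart at `x`, i.e. its pull-back under the inverse chart. -/
noncomputable def MForm.inChart {k : ℕ} (α : MForm F M V k) (x : M) : F → F [⋀^Fin k]→L[ℂ] V :=
  MForm.pullback 𝓘(ℂ, F) I (extChartAt I x).symm α

/-- `α` is holomorphic at `x` (for boundaryless manifolds). -/
def MForm.HolomorphicAt {k : ℕ} (α : MForm F M V k) (x : M) : Prop :=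
  ContDiffAt ℂ ∞ (MForm.inChart I α x) (extChartAt I x x)

/-- The exterior derivative `dα` (for boundaryless manifolds), computed in the chart at `x`. -/
noncomputable def MForm.d {k : ℕ} (α : MForm F M V k) : MForm F M V (k + 1) :=
  fun x => (extDeriv (MForm.inChart I α x) (extChartAt I x x)).compContinuousLinearMap
    (tangentDeriv I 𝓘(ℂ, F) (extChartAt I x) x)

end Forms

/-! ## Simplices and integration along the fibre -/

/-- The standard `q`-simplex, in the coordinates `t_1, …, t_q`; the remaining barycentric coordinate
is `t_0 = 1 - t_1 - ⋯ - t_q`. It carries the orientation `dt_1 ∧ ⋯ ∧ dt_q`. -/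
def stdSimp (q : ℕ) : Set (Fin q → ℝ) := {t | (∀ i, 0 ≤ t i) ∧ ∑ i, t i ≤ 1}

/-- The barycentric coordinates `(t_0, …, t_q)` of `(t_1, …, t_q)`. -/
def bary {R : Type*} [Ring R] {q : ℕ} (t : Fin q → R) : Fin (q + 1) → R :=
  Fin.cons (1 - ∑ i, t i) t

/-- The `j`-th face map `δ_j : Δ_q → Δ_{q+1}`: insert `0` as `j`-th barycentric coordinate. -/
def simpFace {q : ℕ} (j : Fin (q + 2)) (t : Fin q → ℝ) : Fin (q + 1) → ℝ :=
  Fin.tail (Fin.insertNth (α := fun _ => ℝ) j 0 (bary t))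

/-- Insert the vectors `u_1, …, u_q` into the first `q` slots of an alternating form:
`(v_1, …, v_r) ↦ a (u_1, …, u_q, v_1, …, v_r)`. -/
noncomputable def contractFirst {F V : Type*} [NormedAddCommGroup F] [NormedSpace ℂ F]
    [NormedAddCommGroup V] [NormedSpace ℂ V] {r : ℕ} :
    (q : ℕ) → (Fin q → F) → F [⋀^Fin (r + q)]→L[ℂ] V → F [⋀^Fin r]→L[ℂ] V
  | 0, _, a => a
  | q + 1, u, a => contractFirst q (Fin.tail u) (a.curryLeft (u 0))

section FiberIntegral

variable {F : Type*} [NormedAddCommGroup F] [NormedSpace ℂ F]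
  {H : Type*} [TopologicalSpace H] (I : ModelWithCorners ℂ F H)
  {M : Type*} [TopologicalSpace M] [ChartedSpace H M]
  {F' : Type*} [NormedAddCommGroup F'] [NormedSpace ℂ F']
  {H' : Type*} [TopologicalSpace H'] (J : ModelWithCorners ℂ F' H')
  {N : Type*} [TopologicalSpace N] [ChartedSpace H' N]

/-- The tangent vector `∂f/∂t_i` at `t ∈ Δ_q` of a real-smooth map `f : Δ_q → N` into a complex
manifold. -/
noncomputable def simpVelocity {q : ℕ} (f : (Fin q → ℝ) → N) (t : Fin q → ℝ) (i : Fin q) : F' :=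
  fderivWithin ℝ (fun s => extChartAt J (f t) (f s)) (stdSimp q) t (Pi.single i 1)

/-- For a family `f : M × Δ_q → N` of simplices, the `r`-form `∫_{Δ_q} f^* α` on `M` obtained by
pulling the `(r+q)`-form `α` back to `M × Δ_q` and integrating over the fibres of
`M × Δ_q → M`. The fibre directions come first: the value on `(v_1, …, v_r)` is
`∫_{Δ_q} (f^* α)(∂_{t_1}, …, ∂_{t_q}, v_1, …, v_r) dt_1 ⋯ dt_q`. -/
noncomputable def fiberIntegral (r q : ℕ) (f : M → (Fin q → ℝ) → N) (α : MForm F' N ℂ (r + q)) :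
    MForm F M ℂ r :=
  fun x => ∫ t in stdSimp q,
    (contractFirst q (simpVelocity J (f x) t) (α (f x t))).compContinuousLinearMap
      (tangentDeriv I J (fun y => f y t) x)

/-- Fibre integration with the fibre directions last: the value on `(v_1, …, v_r)` is
`∫_{Δ_q} (f^* α)(v_1, …, v_r, ∂_{t_1}, …, ∂_{t_q}) dt_1 ⋯ dt_q`. -/
noncomputable def fiberIntegralLast (r q : ℕ) (f : M → (Fin q → ℝ) → N)
    (α : MForm F' N ℂ (r + q)) : MForm F M ℂ r :=
  fun x => (-1 : ℂ) ^ (r * q) • fiberIntegral I J r q f α x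

end FiberIntegral

/-! ## The simplicial manifold `BG` -/

section BG

variable (E : Type*) [NormedAddCommGroup E] [NormedSpace ℂ E]

/-- The model with corners of the complex manifold `G^n`. -/
noncomputable abbrev powModel (n : ℕ) :
    ModelWithCorners ℂ (Fin n → E) (ModelPi fun _ : Fin n => E) :=
  ModelWithCorners.pi fun _ => 𝓘(ℂ, E)

/-- The model with corners of `G^n` as a real manifold. -/
noncomputable abbrev powModelReal (n : ℕ) :
    ModelWithCorners ℝ (Fin n → E) (ModelPi fun _ : Fin n => E) :=
  ModelWithCorners.pi fun _ => 𝓘(ℝ, E)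

/-- The model with corners of `G^n × ℂ^m`. -/
noncomputable abbrev powProdModel (n m : ℕ) :
    ModelWithCorners ℂ ((Fin n → E) × (Fin m → ℂ))
      (ModelProd (ModelPi fun _ : Fin n => E) (Fin m → ℂ)) :=
  (powModel E n).prod 𝓘(ℂ, Fin m → ℂ)

variable (G : Type*) [TopologicalSpace G] [ChartedSpace E G] [Group G]

/-- Complex `r`-forms on `(BG)_s = G^s`. -/
abbrev BGForm (r s : ℕ) : Type _ := MForm (Fin s → E) (Fin s → G) ℂ r

variable {E G}

/-- The face maps `d_0, …, d_{s+1} : G^{s+1} → G^s` of `BG`: `d_0` drops the first entry, the last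
one drops the last entry, and `d_j` multiplies the `j`-th and the `(j+1)`-st entries. -/
def bgFace {s : ℕ} (j : Fin (s + 2)) (g : Fin (s + 1) → G) : Fin s → G :=
  Fin.cases (motive := fun _ => Fin s → G) (Fin.tail g)
    (fun i => Fin.contractNth i (· * ·) g) j

/-- The simplicial differential `∑_j (-1)^j d_j^*`. -/
noncomputable def simplicialD {r s : ℕ} (α : BGForm E G r s) : BGForm E G r (s + 1) :=
  fun g => ∑ j : Fin (s + 2),
    (-1 : ℂ) ^ (j : ℕ) • MForm.pullback (powModel E (s + 1)) (powModel E s) (bgFace j) α g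

/-- The exterior derivative on `G^s`. -/
noncomputable abbrev bgD {r s : ℕ} (α : BGForm E G r s) : BGForm E G (r + 1) s :=
  MForm.d (powModel E s) α

/-- `α` is holomorphic at the point `g` of `G^s`. -/
abbrev bgHolomorphicAt {r s : ℕ} (α : BGForm E G r s) (g : Fin s → G) : Prop :=
  MForm.HolomorphicAt (powModel E s) α g

/-! ## The local de Rham double complex and its truncations

The local double complex has as `(r, s)`-component the germs at `(1, …, 1)` of holomorphic `r`-forms
on `G^s`. Cochains are families of representatives, and equality of germs is eventual equality near
`(1, …, 1)`. For a set `A` of form degrees, the cochains supported in form degrees `r ∈ A` form the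
subcomplex `F^p Ω` for `A = {r | p ≤ r}`, the quotient complex `σ_{<p} Ω` (with the truncated
differential) for `A = {r | r < p}`, and the whole complex for `A = univ`. -/

variable (E G) in
/-- Families of `r`-forms on `G^s`, one for each `(r, s)`. -/
abbrev BGCochain : Type _ := ∀ r s : ℕ, BGForm E G r s

/-- Equality of germs at `(1, …, 1) ∈ G^s`. -/
def GermEq {r s : ℕ} (α α' : BGForm E G r s) : Prop := α =ᶠ[𝓝 (1 : Fin s → G)] α'

/-- The part of the total differential coming from the exterior derivative. -/
noncomputable def totalDR (c : BGCochain E G) : BGCochain E G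
  | 0, _ => 0
  | r + 1, s => bgD (c r s)

/-- The part of the total differential coming from the simplicial differential. -/
noncomputable def totalSimp (c : BGCochain E G) : BGCochain E G
  | _, 0 => 0
  | r, s + 1 => fun g => (-1 : ℂ) ^ r • simplicialD (c r s) g

/-- The total differential `D = d + (-1)^r ∑_j (-1)^j d_j^*` of the double complex. -/
noncomputable def totalD (c : BGCochain E G) : BGCochain E G :=
  fun r s g => totalDR c r s g + totalSimp c r s g

/-- Local holomorphic cochains of total degree `k`, supported in form degrees `r ∈ A`. -/
def IsLocalCochain (A : Set ℕ) (k : ℕ) (c : BGCochain E G) : Prop :=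
  (∀ r s, ∀ᶠ g in 𝓝 (1 : Fin s → G), bgHolomorphicAt (c r s) g) ∧
    ∀ r s, ¬ (r ∈ A ∧ r + s = k) → GermEq (c r s) 0

/-- Local cocycles of total degree `k`. -/
def IsLocalCocycle (A : Set ℕ) (k : ℕ) (c : BGCochain E G) : Prop :=
  IsLocalCochain A k c ∧ ∀ r ∈ A, ∀ s, GermEq (totalD c r s) 0

/-- The cochains `c` and `c'` of degree `k + 1` differ by the coboundary of a local cochain of
degree `k`. -/
def LocallyCohomologous (A : Set ℕ) (k : ℕ) (c c' : BGCochain E G) : Prop :=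
  ∃ b : BGCochain E G, IsLocalCochain A k b ∧
    ∀ r ∈ A, ∀ s, GermEq (totalD b r s) (fun g => c r s g - c' r s g)

/-- The form degrees of `F^p Ω`. -/
def hodgeDegrees (p : ℕ) : Set ℕ := {r | p ≤ r}

/-- The form degrees of `σ_{<p} Ω`. -/
def truncDegrees (p : ℕ) : Set ℕ := {r | r < p}

/-- The connecting homomorphism `H^k_loc(σ_{<p} Ω) → H^{k+1}_loc(F^p Ω)` of
`0 → F^p Ω → Ω → σ_{<p} Ω → 0` sends the class of the cocycle `η` to the class of the cocycle `c`:
for some lift `e` of `η` to the full complex, `D e` is a cocycle of `F^p Ω` in the class of `c`. -/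
def BoundaryMapsTo (p k : ℕ) (η c : BGCochain E G) : Prop :=
  ∃ e e' : BGCochain E G, IsLocalCochain univ k e ∧
    (∀ r ∈ truncDegrees p, ∀ s, GermEq (e r s) (η r s)) ∧
    IsLocalCocycle (hodgeDegrees p) (k + 1) e' ∧
    (∀ r s, GermEq (totalD e r s) (e' r s)) ∧
    LocallyCohomologous (hodgeDegrees p) k e' c

end BG

/-! ## Bott–Shulman–Stasheff forms -/

section BSS

variable {E : Type*} [NormedAddCommGroup E] [NormedSpace ℂ E]
  {G : Type*} [TopologicalSpace G] [ChartedSpace E G] [Group G]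

variable (E) in
/-- The right invariant Maurer–Cartan form `dg g⁻¹`, with values in the Lie algebra `T_1 G = E`. -/
noncomputable def maurerCartan (g : G) : E →L[ℂ] E :=
  tangentDeriv 𝓘(ℂ, E) 𝓘(ℂ, E) (fun h : G => h * g⁻¹) g

variable (E) in
/-- The adjoint action of `g` on the Lie algebra `T_1 G = E`. -/
noncomputable def adjointAction (g : G) : E →L[ℂ] E :=
  tangentDeriv 𝓘(ℂ, E) 𝓘(ℂ, E) (fun h : G => g * h * g⁻¹) (1 : G)

variable (G) in
/-- An invariant polynomial of degree `2` on the Lie algebra of `G`, in polarized form: a symmetric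
bilinear form which is invariant under the adjoint action of `G`. -/
structure IsInvariantQuadratic (P : E →L[ℂ] E →L[ℂ] ℂ) : Prop where
  symm : ∀ X Y, P X Y = P Y X
  invariant : ∀ (g : G) (X Y : E), P (adjointAction E g X) (adjointAction E g Y) = P X Y

/-- `(v_1, …, v_{k+l}) ↦ B (a (v_1, …, v_k), b (v_{k+1}, …, v_{k+l}))` for a bilinear map `B`. -/
noncomputable def bilinMul {F E V : Type*} [NormedAddCommGroup F] [NormedSpace ℂ F]
    [NormedAddCommGroup E] [NormedSpace ℂ E] [NormedAddCommGroup V] [NormedSpace ℂ V]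
    (B : E →L[ℂ] E →L[ℂ] V) {k l : ℕ} (a : F [⋀^Fin k]→L[ℂ] E) (b : F [⋀^Fin l]→L[ℂ] E) :
    ContinuousMultilinearMap ℂ (fun _ : Fin (k + l) => F) V where
  toFun v := B (a fun i => v (Fin.castAdd l i)) (b fun i => v (Fin.natAdd k i))
  map_update_add' v i x y := by
    classical
    induction i using Fin.addCases with
    | left i =>
      have h₁ : ∀ z, (fun j => Function.update v (Fin.castAdd l i) z (Fin.castAdd l j)) =
          Function.update (fun j => v (Fin.castAdd l j)) i z := fun z => by
        ext1 j; simp [Function.update_apply]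
      have h₂ : ∀ z, (fun j => Function.update v (Fin.castAdd l i) z (Fin.natAdd k j)) =
          fun j => v (Fin.natAdd k j) := fun z => by
        ext1 j; simp [Function.update_apply, Fin.ext_iff]; omega
      simp [h₁, h₂]
    | right i =>
      have h₁ : ∀ z, (fun j => Function.update v (Fin.natAdd k i) z (Fin.castAdd l j)) =
          fun j => v (Fin.castAdd l j) := fun z => by
        ext1 j; simp [Function.update_apply, Fin.ext_iff]; omega
      have h₂ : ∀ z, (fun j => Function.update v (Fin.natAdd k i) z (Fin.natAdd k j)) =
          Function.update (fun j => v (Fin.natAdd k j)) i z := fun z => by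
        ext1 j; simp [Function.update_apply]
      simp [h₁, h₂]
  map_update_smul' v i c x := by
    classical
    induction i using Fin.addCases with
    | left i =>
      have h₁ : ∀ z, (fun j => Function.update v (Fin.castAdd l i) z (Fin.castAdd l j)) =
          Function.update (fun j => v (Fin.castAdd l j)) i z := fun z => by
        ext1 j; simp [Function.update_apply]
      have h₂ : ∀ z, (fun j => Function.update v (Fin.castAdd l i) z (Fin.natAdd k j)) =
          fun j => v (Fin.natAdd k j) := fun z => by
        ext1 j; simp [Function.update_apply, Fin.ext_iff]; omega
      simp [h₁, h₂]
    | right i =>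
      have h₁ : ∀ z, (fun j => Function.update v (Fin.natAdd k i) z (Fin.castAdd l j)) =
          fun j => v (Fin.castAdd l j) := fun z => by
        ext1 j; simp [Function.update_apply, Fin.ext_iff]; omega
      have h₂ : ∀ z, (fun j => Function.update v (Fin.natAdd k i) z (Fin.natAdd k j)) =
          Function.update (fun j => v (Fin.natAdd k j)) i z := fun z => by
        ext1 j; simp [Function.update_apply]
      simp [h₁, h₂]
  cont := by
    have h₁ : Continuous fun v : Fin (k + l) → F => a fun i => v (Fin.castAdd l i) :=
      a.cont.comp (by fun_prop)
    have h₂ : Continuous fun v : Fin (k + l) → F => b fun i => v (Fin.natAdd k i) :=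
      b.cont.comp (by fun_prop)
    exact (B.continuous.comp h₁).clm_apply h₂

/-- The wedge product `B(a ∧ b)` of alternating maps, with the values multiplied by the bilinear map
`B`: `B(a ∧ b)(v) = (1 / k! l!) ∑_τ sgn(τ) B (a (v_{τ1}, …, v_{τk}), b (v_{τ(k+1)}, …))`. -/
noncomputable def bilinWedge {F E V : Type*} [NormedAddCommGroup F] [NormedSpace ℂ F]
    [NormedAddCommGroup E] [NormedSpace ℂ E] [NormedAddCommGroup V] [NormedSpace ℂ V]
    (B : E →L[ℂ] E →L[ℂ] V) {k l : ℕ} (a : F [⋀^Fin k]→L[ℂ] E) (b : F [⋀^Fin l]→L[ℂ] E) :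
    F [⋀^Fin (k + l)]→L[ℂ] V :=
  ((k.factorial * l.factorial : ℕ) : ℂ)⁻¹ •
    ContinuousMultilinearMap.alternatization (bilinMul B a b)

section Connection

variable [FiniteDimensional ℂ E] [LieGroup 𝓘(ℂ, E) ∞ G]

variable (E G) in
/-- The Lie bracket of the Lie algebra `T_1 G = E` (defined by Mathlib through left invariant vector
fields), as a continuous bilinear map. -/
noncomputable def lieBracket : E →L[ℂ] E →L[ℂ] E :=
  haveI : CompleteSpace E := FiniteDimensional.complete ℂ E
  haveI : LieGroup 𝓘(ℂ, E) (minSmoothness ℂ 3) G :=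
    LieGroup.of_le (n := ∞) (by
      rw [minSmoothness_of_isRCLikeNormedField]; exact WithTop.coe_le_coe.2 le_top)
  let B : GroupLieAlgebra 𝓘(ℂ, E) G →ₗ[ℂ] GroupLieAlgebra 𝓘(ℂ, E) G →ₗ[ℂ]
      GroupLieAlgebra 𝓘(ℂ, E) G :=
    LinearMap.mk₂ ℂ (fun X Y => ⁅X, Y⁆) add_lie smul_lie lie_add lie_smul
  LinearMap.toContinuousBilinearMap (show E →ₗ[ℂ] E →ₗ[ℂ] E from B)

variable (E G) in
/-- The connection form of the connection `∑_i t_i D_i` on the pull-back of the left principal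
`G`-bundle `G^{n+1} → G^n` to `G^n × Δ_n`. Here `D_i` is the flat connection for which the section
with `g_i = 1` is horizontal; its connection form is `dg_i g_i⁻¹`. The barycentric coordinates
are allowed to be complex, so that the form lives on the complex manifold `G^{n+1} × ℂ^n`. -/
noncomputable def connectionForm (n : ℕ) :
    MForm ((Fin (n + 1) → E) × (Fin n → ℂ)) ((Fin (n + 1) → G) × (Fin n → ℂ)) E 1 :=
  fun x => ContinuousAlternatingMap.ofSubsingleton ℂ _ E (0 : Fin 1)
    (∑ i : Fin (n + 1), bary x.2 i •
      (maurerCartan E (x.1 i)).comp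
        ((ContinuousLinearMap.proj i).comp (ContinuousLinearMap.fst ℂ (Fin (n + 1) → E)
          (Fin n → ℂ))))

variable (E G) in
/-- The curvature `R = dθ - ½ [θ ∧ θ]` of the connection form `θ` (the sign is the one for left
principal bundles). -/
noncomputable def curvatureForm (n : ℕ) :
    MForm ((Fin (n + 1) → E) × (Fin n → ℂ)) ((Fin (n + 1) → G) × (Fin n → ℂ)) E 2 :=
  fun x => MForm.d (powProdModel E (n + 1) n) (connectionForm E G n) x -
    (2⁻¹ : ℂ) • bilinWedge (lieBracket E G) (connectionForm E G n x) (connectionForm E G n x)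

/-- The Chern–Weil form `P(R)`. -/
noncomputable def chernWeilForm (P : E →L[ℂ] E →L[ℂ] ℂ) (n : ℕ) :
    MForm ((Fin (n + 1) → E) × (Fin n → ℂ)) ((Fin (n + 1) → G) × (Fin n → ℂ)) ℂ 4 :=
  fun x => bilinWedge P (curvatureForm E G n x) (curvatureForm E G n x)

variable (E G) in
/-- The section `(g_1, …, g_n) ↦ (1, g_1, g_1 g_2, …)` of `G^{n+1} → G^n`, times the inclusion of
`Δ_n` in `ℂ^n`. -/
def bssSection (n : ℕ) (g : Fin n → G) (t : Fin n → ℝ) : (Fin (n + 1) → G) × (Fin n → ℂ) :=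
  (Fin.partialProd g, fun i => (t i : ℂ))

/-- The Bott–Shulman–Stasheff `3`-form `ω` on `G`, namely the secondary class
`∫_{Δ_1} P(R)` of the connections `D_0, D_1`. The form `P(R)` on `G^2 × Δ_1` is basic; it is
descended to `G × Δ_1` by pulling it back by a section. -/
noncomputable def bssForm₁ (P : E →L[ℂ] E →L[ℂ] ℂ) : BGForm E G 3 1 :=
  fiberIntegralLast (powModel E 1) (powProdModel E 2 1) 3 1 (bssSection G 1) (chernWeilForm P 1)

/-- The Bott–Shulman–Stasheff `2`-form `ω_2` on `G^2`, namely the secondary class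
`∫_{Δ_2} P(R)` of the connections `D_0, D_1, D_2`. -/
noncomputable def bssForm₂ (P : E →L[ℂ] E →L[ℂ] ℂ) : BGForm E G 2 2 :=
  fiberIntegralLast (powModel E 2) (powProdModel E 3 2) 2 2 (bssSection G 2) (chernWeilForm P 2)

end Connection

end BSS

/-! ## The simplices and the forms `β_{m,q}` -/

section Simplices

variable (E : Type*) [NormedAddCommGroup E] [NormedSpace ℂ E]
  (G : Type*) [TopologicalSpace G] [ChartedSpace E G] [Group G]

/-- A compatible system of simplices `σ_{g_1, …, g_l} : Δ_l → U` in an open neighbourhood `U` of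
`1`. Since products of elements of `U` need not lie in `U`, the simplex `σ_{g_1, …, g_l}` is defined
for `(g_1, …, g_l)` in an open neighbourhood `W_l ⊆ U^l` of `(1, …, 1)`, where the `W_l` are stable
under the face maps of `BG`. The map `W_l × Δ_l → U` is smooth, and it is holomorphic in
`(g_1, …, g_l)`. -/
structure SimplexSystem where
  U : Set G
  isOpen_U : IsOpen U
  one_mem_U : (1 : G) ∈ U
  W : ∀ l : ℕ, Set (Fin l → G)
  isOpen_W : ∀ l, IsOpen (W l)
  one_mem_W : ∀ l, (1 : Fin l → G) ∈ W l
  mem_U_of_mem_W : ∀ l, ∀ g ∈ W l, ∀ i, g i ∈ U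
  face_mem : ∀ l, ∀ g ∈ W (l + 1), ∀ j, bgFace j g ∈ W l
  σ : ∀ l : ℕ, (Fin l → G) → (Fin l → ℝ) → G
  σ_mem : ∀ l, ∀ g ∈ W l, ∀ t ∈ stdSimp l, σ l g t ∈ U
  σ_zero : ∀ g t, σ 0 g t = 1
  σ_face_zero : ∀ l, ∀ g ∈ W (l + 1), ∀ t ∈ stdSimp l,
    σ (l + 1) g (simpFace 0 t) = g 0 * σ l (Fin.tail g) t
  σ_face_succ : ∀ l, ∀ g ∈ W (l + 1), ∀ t ∈ stdSimp l, ∀ j : Fin (l + 1),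
    σ (l + 1) g (simpFace j.succ t) = σ l (bgFace j.succ g) t
  σ_smooth : ∀ l, ContMDiffOn ((powModelReal E l).prod 𝓘(ℝ, Fin l → ℝ)) 𝓘(ℝ, E) ∞
    (fun x : (Fin l → G) × (Fin l → ℝ) => σ l x.1 x.2) (W l ×ˢ stdSimp l)
  σ_holomorphic : ∀ l, ∀ t ∈ stdSimp l,
    MDifferentiableOn (powModel E l) 𝓘(ℂ, E) (fun g : Fin l → G => σ l g t) (W l)

variable {E G}

/-- The map `f_{m+1,q} : W_{m+q} × Δ_q → G^{m+1}`,
`(g_1, …, g_{m+q}; t) ↦ (g_1, …, g_m, σ_{g_{m+1}, …, g_{m+q}}(t))`. -/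
def SimplexSystem.f (S : SimplexSystem E G) (m q : ℕ) (g : Fin (m + q) → G) (t : Fin q → ℝ) :
    Fin (m + 1) → G :=
  Fin.snoc (α := fun _ => G) (fun i : Fin m => g (Fin.castAdd q i))
    (S.σ q (fun i => g (Fin.natAdd m i)) t)

/-- The `r`-form `∫_{Δ_q} f_{m+1,q}^* α` on `W_{m+q}`, for an `(r+q)`-form `α` on `G^{m+1}`. -/
noncomputable def SimplexSystem.beta (S : SimplexSystem E G) (m q r : ℕ)
    (α : BGForm E G (r + q) (m + 1)) : BGForm E G r (m + q) :=
  fiberIntegral (powModel E (m + q)) (powModel E (m + 1)) r q (S.f m q) α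

variable [FiniteDimensional ℂ E] [LieGroup 𝓘(ℂ, E) ∞ G]

/-- `η_0 = β_{1,3} = ∫_{Δ_3} f_{1,3}^* ω`. -/
noncomputable def SimplexSystem.eta₀ (S : SimplexSystem E G) (P : E →L[ℂ] E →L[ℂ] ℂ) :
    BGForm E G 0 3 :=
  S.beta 0 3 0 (bssForm₁ P)

/-- `η_1 = β_{1,2} + β_{2,1} = ∫_{Δ_2} f_{1,2}^* ω + ∫_{Δ_1} f_{2,1}^* ω_2`. -/
noncomputable def SimplexSystem.eta₁ (S : SimplexSystem E G) (P : E →L[ℂ] E →L[ℂ] ℂ) :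
    BGForm E G 1 2 :=
  fun g => S.beta 0 2 1 (bssForm₁ P) g + S.beta 1 1 1 (bssForm₂ P) g

/-- The cochain `(η_0, η_1)` of total degree `3`. -/
noncomputable def SimplexSystem.etaCochain (S : SimplexSystem E G) (P : E →L[ℂ] E →L[ℂ] ℂ) :
    BGCochain E G
  | 0, 3 => S.eta₀ P
  | 1, 2 => S.eta₁ P
  | _, _ => 0

/-- The cochain `(0, dη_1)` of total degree `4`. -/
noncomputable def SimplexSystem.dEtaCochain (S : SimplexSystem E G) (P : E →L[ℂ] E →L[ℂ] ℂ) :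
    BGCochain E G
  | 2, 2 => bgD (S.eta₁ P)
  | _, _ => 0

/-- The Bott–Shulman–Stasheff cochain `(ω, ω_2)` of total degree `4`. -/
noncomputable def bssCochain (P : E →L[ℂ] E →L[ℂ] ℂ) : BGCochain E G
  | 3, 1 => bssForm₁ P
  | 2, 2 => bssForm₂ P
  | _, _ => 0

end Simplices

/-! ## Integration over the standard simplex -/

section Simplex

open MeasureTheory

/-! All the forms are handled in one calculus: families F : Ω × Δ_q → G over an open subset Ω of a
complex vector space, real-smooth in all variables and holomorphic in the first (`HolFamily`),
together with the pull-back Θ = `dlog` F of the right invariant Maurer–Cartan form θ. The bracket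
comes from left invariant fields, so the Maurer–Cartan equation reads dΘ(u, v) = [Θu, Θv]
(`SmoothIntoWithinAt.fderivWithin_dlog_antisymm`), and dlog(hF) = dlog h + Ad_h dlog F (`dlog_mul`).

Evaluating the curvature along the section (1, g₁, g₁g₂) gives ω = −P(θ, [θ, θ]) and ω₂ = −P(θ_{g₁}
∧ θ_{g₁g₂}) (`bssForm₁_apply`, `bssForm₂_apply`). Fibre integrals of ω then become integrals of κ(Θ)
= P(Θ, [Θ, Θ]), and those of ω₂ become integrals of P(B ∧ C) with B = dlog h and C = dlog(hF). Two
differential identities carry the proof. First, κ(Θ) is closed, by Jacobi and the invariance of P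
(`cartanForm_dlog_closed`). Second, dP(B ∧ C) = κ(C − B) − κ(C) + κ(B) (`fderivWithin_dlog_wedge`).
Here C − B = Ad_h dlog F, and B kills the simplex directions. Hence translating F by h changes κ by
an exact form as soon as one argument is a simplex direction.

Stokes on Δ_q turns both identities into relations between the integrals over a simplex and over its
faces. The faces j ≥ 1 of σ_g are σ at d_j g, while face 0 is the g₁-translate of σ at d_0 g. The
boundary sum is therefore the simplicial differential up to translation terms, and those are exactly
what the ω₂-integrals absorb. With β_{1,1} = ∫_{Δ_1} f_{1,1}^* ω the result is four identities on
the W_l: dη₀ = δη₁, δη₀ = 0, dβ_{1,1} = ω, and δβ_{1,1} = ω₂ − dη₁. The third is the Poincaré lemma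
along the paths σ_g from 1 to g.

The rest is formal. In the full complex D(η₀, η₁) = (0, dη₁), and Dβ_{1,1} = (ω, ω₂) − (0, dη₁). The
holomorphy of ω and ω₂ near 1 and their cocycle relations are also read off from the four
identities, without Chern–Weil theory.

Holomorphy of the integrals rests on `PartHolOn.contDiffOn_setIntegral`: integrating over Δ_q a
function that is real-smooth and holomorphic in the parameter gives a holomorphic function. To
descend to G^s, forms are pulled back along maps ρ : Ω → W_l, namely inverse charts followed by face
maps, where they are explicit integrals. -/

lemma isClosed_stdSimp (q : ℕ) : IsClosed (stdSimp q) := by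
  have h : stdSimp q = (⋂ i, {t | 0 ≤ t i}) ∩ {t | ∑ i, t i ≤ 1} := by
    ext t; simp [stdSimp]
  rw [h]
  exact (isClosed_iInter fun i => isClosed_le continuous_const (continuous_apply i)).inter
    (isClosed_le (by fun_prop) continuous_const)

lemma stdSimp_subset_Icc (q : ℕ) : stdSimp q ⊆ Icc 0 1 := fun _ ht =>
  ⟨ht.1, fun i => (Finset.single_le_sum (fun j _ => ht.1 j) (Finset.mem_univ i)).trans ht.2⟩

lemma isCompact_stdSimp (q : ℕ) : IsCompact (stdSimp q) :=
  isCompact_Icc.of_isClosed_subset (isClosed_stdSimp q) (stdSimp_subset_Icc q)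

lemma measurableSet_stdSimp (q : ℕ) : MeasurableSet (stdSimp q) :=
  (isClosed_stdSimp q).measurableSet

lemma convex_stdSimp (q : ℕ) : Convex ℝ (stdSimp q) := by
  intro s hs t ht a b ha hb hab
  refine ⟨fun i => ?_, ?_⟩
  · have := hs.1 i; have := ht.1 i
    simp only [Pi.add_apply, Pi.smul_apply, smul_eq_mul]; positivity
  · simp only [Pi.add_apply, Pi.smul_apply, smul_eq_mul, Finset.sum_add_distrib, ← Finset.mul_sum]
    nlinarith [hs.2, ht.2]

lemma interior_stdSimp_nonempty (q : ℕ) : (interior (stdSimp q)).Nonempty := by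
  have ho : IsOpen {t : Fin q → ℝ | (∀ i, 0 < t i) ∧ ∑ i, t i < 1} := by
    have h : {t : Fin q → ℝ | (∀ i, 0 < t i) ∧ ∑ i, t i < 1} =
        (⋂ i, {t | 0 < t i}) ∩ {t | ∑ i, t i < 1} := by ext t; simp
    rw [h]
    exact (isOpen_iInter_of_finite fun i => isOpen_lt continuous_const (continuous_apply i)).inter
      (isOpen_lt (by fun_prop) continuous_const)
  have hs : {t : Fin q → ℝ | (∀ i, 0 < t i) ∧ ∑ i, t i < 1} ⊆ stdSimp q :=
    fun t ht => ⟨fun i => (ht.1 i).le, ht.2.le⟩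
  refine ⟨fun _ => 1 / (q + 1 : ℝ), interior_maximal hs ho ⟨fun i => by positivity, ?_⟩⟩
  rw [Finset.sum_const, Finset.card_univ, Fintype.card_fin, nsmul_eq_mul, mul_one_div,
    div_lt_one (by positivity)]
  linarith

lemma uniqueDiffOn_stdSimp (q : ℕ) : UniqueDiffOn ℝ (stdSimp q) :=
  uniqueDiffOn_convex (convex_stdSimp q) (interior_stdSimp_nonempty q)

lemma stdSimp_subset_closure_interior (q : ℕ) : stdSimp q ⊆ closure (interior (stdSimp q)) := by
  rw [(convex_stdSimp q).closure_interior_eq_closure_of_nonempty_interior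
    (interior_stdSimp_nonempty q)]
  exact subset_closure

/-- Fibres Δ_{q+1} over Δ_q by forgetting the i-th coordinate. The fibre is an interval running from
face i+1 (where x = 0) to face 0. -/
lemma insertNth_mem_stdSimp {q : ℕ} (i : Fin (q + 1)) (x : ℝ) (s : Fin q → ℝ) :
    Fin.insertNth (α := fun _ => ℝ) i x s ∈ stdSimp (q + 1) ↔
      s ∈ stdSimp q ∧ x ∈ Icc 0 (1 - ∑ k, s k) := by
  simp only [stdSimp, mem_ofPred_eq, Fin.sum_univ_succAbove _ i, Fin.insertNth_apply_same,
    Fin.insertNth_apply_succAbove, Fin.forall_iff_succAbove i, mem_Icc]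
  constructor
  · rintro ⟨⟨h1, h2⟩, h3⟩; exact ⟨⟨h2, by linarith⟩, h1, by linarith⟩
  · rintro ⟨⟨h1, h2⟩, h3, h4⟩; exact ⟨⟨h3, h1⟩, by linarith⟩

lemma simpFace_zero {q : ℕ} (t : Fin q → ℝ) :
    simpFace 0 t = Fin.cons (α := fun _ => ℝ) (1 - ∑ i, t i) t := by
  simp [simpFace, bary]

lemma simpFace_succ {q : ℕ} (j : Fin (q + 1)) (t : Fin q → ℝ) :
    simpFace j.succ t = Fin.insertNth (α := fun _ => ℝ) j 0 t := by
  have h : Fin.insertNth (α := fun _ => ℝ) j.succ 0 (bary t) =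
      Fin.cons (1 - ∑ i, t i) (Fin.insertNth (α := fun _ => ℝ) j 0 t) := by
    rw [bary, Fin.insertNth_eq_iff]
    constructor
    · simp
    · funext k
      refine Fin.cases ?_ (fun k => ?_) k <;> simp [Fin.removeNth]
  rw [simpFace, h, Fin.tail_cons]

lemma simpFace_mem {q : ℕ} (j : Fin (q + 2)) {t : Fin q → ℝ} (ht : t ∈ stdSimp q) :
    simpFace j t ∈ stdSimp (q + 1) := by
  refine Fin.cases ?_ (fun j => ?_) j
  · rw [simpFace_zero, ← Fin.insertNth_zero', insertNth_mem_stdSimp]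
    exact ⟨ht, by linarith [ht.2], le_rfl⟩
  · rw [simpFace_succ, insertNth_mem_stdSimp]
    exact ⟨ht, le_rfl, by linarith [ht.2]⟩

variable {W : Type*} [NormedAddCommGroup W] [NormedSpace ℝ W]

lemma continuous_insertNth {q : ℕ} (i : Fin (q + 1)) :
    Continuous fun p : ℝ × (Fin q → ℝ) => Fin.insertNth (α := fun _ => ℝ) i p.1 p.2 := by
  refine continuous_pi fun k => ?_
  refine Fin.succAboveCases i ?_ (fun k => ?_) k
  · simpa using continuous_fst
  · simpa using (by fun_prop : Continuous fun p : ℝ × (Fin q → ℝ) => p.2 k)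

lemma continuous_simpFace {q : ℕ} (j : Fin (q + 2)) :
    Continuous (simpFace j : (Fin q → ℝ) → Fin (q + 1) → ℝ) := by
  refine Fin.cases ?_ (fun j => ?_) j
  · rw [funext fun t => simpFace_zero t]
    refine continuous_pi fun k => Fin.cases ?_ (fun k => ?_) k
    · simp only [Fin.cons_zero]; fun_prop
    · simp only [Fin.cons_succ]; fun_prop
  · rw [funext fun t => simpFace_succ j t]
    exact (continuous_insertNth j).comp (by fun_prop : Continuous fun s : Fin q → ℝ =>
      ((0 : ℝ), s))

/-- Fubini for the fibration above, applied to the extension of g by zero, so that the region of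
integration becomes a product. -/
lemma setIntegral_stdSimp_succ {q : ℕ} (i : Fin (q + 1)) (g : (Fin (q + 1) → ℝ) → W)
    (hg : ContinuousOn g (stdSimp (q + 1))) :
    ∫ t in stdSimp (q + 1), g t =
      ∫ s in stdSimp q, ∫ x in (0 : ℝ)..(1 - ∑ k, s k),
        g (Fin.insertNth (α := fun _ => ℝ) i x s) := by
  have hint : IntegrableOn g (stdSimp (q + 1)) := hg.integrableOn_compact (isCompact_stdSimp _)
  have hint' := (integrable_indicator_iff (measurableSet_stdSimp (q + 1))).2 hint
  set e := (MeasurableEquiv.piFinSuccAbove (fun _ : Fin (q + 1) => ℝ) i).symm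
  have hem : MeasurePreserving e := (volume_preserving_piFinSuccAbove (fun _ => ℝ) i).symm _
  rw [← integral_indicator (measurableSet_stdSimp _), ← hem.integral_comp']
  have hint2 : Integrable (fun p => (stdSimp (q + 1)).indicator g (e p)) volume :=
    (hem.integrable_comp_emb e.measurableEmbedding).2 hint'
  rw [Measure.volume_eq_prod] at hint2 ⊢
  rw [integral_prod_symm _ hint2, ← integral_indicator (measurableSet_stdSimp _)]
  congr 1
  funext s
  have he : ∀ x, e (x, s) = Fin.insertNth (α := fun _ => ℝ) i x s := fun x => rfl
  by_cases hs : s ∈ stdSimp q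
  · rw [indicator_of_mem hs, intervalIntegral.integral_of_le (by linarith [hs.2]),
      ← integral_Icc_eq_integral_Ioc, ← integral_indicator measurableSet_Icc]
    congr 1
    funext x
    rw [he]
    by_cases hx : x ∈ Icc 0 (1 - ∑ k, s k)
    · rw [indicator_of_mem hx, indicator_of_mem ((insertNth_mem_stdSimp i x s).2 ⟨hs, hx⟩)]
    · rw [indicator_of_notMem hx,
        indicator_of_notMem fun h => hx ((insertNth_mem_stdSimp i x s).1 h).2]
  · rw [indicator_of_notMem hs]
    convert! integral_zero ℝ W with x
    rw [he, indicator_of_notMem fun h => hs ((insertNth_mem_stdSimp i x s).1 h).1]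

/-- The faces of a simplex opposite to the vertex `0`, in two systems of coordinates. -/
lemma setIntegral_stdSimp_hypotenuse {q : ℕ} (i : Fin (q + 1)) (f : (Fin (q + 1) → ℝ) → W)
    (hf : ContinuousOn f (stdSimp (q + 1))) :
    ∫ s in stdSimp q, f (Fin.insertNth (α := fun _ => ℝ) i (1 - ∑ k, s k) s) =
      ∫ s in stdSimp q, f (simpFace 0 s) := by
  refine Fin.cases ?_ (fun j => ?_) i
  · simp_rw [simpFace_zero, Fin.insertNth_zero']
  · cases q with
    | zero => exact j.elim0
    | succ q =>
      have hc : ∀ (i : Fin (q + 2)), ContinuousOn (fun s : Fin (q + 1) → ℝ =>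
          f (Fin.insertNth (α := fun _ => ℝ) i (1 - ∑ k, s k) s)) (stdSimp (q + 1)) := by
        intro i
        refine hf.comp ((continuous_insertNth i).comp
          (Continuous.prodMk (f := fun s : Fin (q + 1) → ℝ => 1 - ∑ k, s k) (by fun_prop)
            continuous_id)).continuousOn
          fun s hs => (insertNth_mem_stdSimp _ _ _).2 ⟨hs, by linarith [hs.2], le_rfl⟩
      have hc0 := hc 0
      simp_rw [Fin.insertNth_zero', ← simpFace_zero] at hc0
      rw [setIntegral_stdSimp_succ 0 _ (hc _), setIntegral_stdSimp_succ j _ hc0]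
      congr 1
      funext r
      -- After slicing both sides over the remaining coordinates r, the two parametrisations of the
      -- hypotenuse differ by the reflection x ↦ 1 − Σ r − x of the fibre interval.
      have := intervalIntegral.integral_comp_sub_left
        (a := 0) (b := 1 - ∑ k, r k) (fun x => f (simpFace 0 (Fin.insertNth (α := fun _ => ℝ) j x r)))
        (1 - ∑ k, r k)
      rw [sub_self, sub_zero] at this
      rw [← this]
      congr 1
      funext x
      congr 1
      rw [simpFace_zero, Fin.insertNth_eq_iff]
      have hsum : ∀ (j : Fin (q + 1)) (x : ℝ), ∑ k, Fin.insertNth (α := fun _ => ℝ) j x r k =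
          x + ∑ k, r k := by
        intro j x
        simp [Fin.sum_univ_succAbove _ j]
      constructor
      · rw [hsum]; simp; ring
      · funext k
        refine Fin.cases ?_ (fun k => ?_) k
        · simp only [Fin.removeNth, Fin.succ_succAbove_zero, Fin.cons_zero, hsum]; ring_nf
          simp
        · simp [Fin.removeNth]

/-- The integral of a partial derivative over a simplex. -/
lemma setIntegral_stdSimp_fderivWithin [CompleteSpace W] {q : ℕ} (i : Fin (q + 1))
    (f : (Fin (q + 1) → ℝ) → W) (hf : ContDiffOn ℝ 1 f (stdSimp (q + 1))) :
    ∫ t in stdSimp (q + 1), fderivWithin ℝ f (stdSimp (q + 1)) t (Pi.single i 1) =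
      (∫ s in stdSimp q, f (simpFace 0 s)) - ∫ s in stdSimp q, f (simpFace i.succ s) := by
  have hcf : ContinuousOn (fun t => fderivWithin ℝ f (stdSimp (q + 1)) t (Pi.single i 1))
      (stdSimp (q + 1)) :=
    (hf.continuousOn_fderivWithin (uniqueDiffOn_stdSimp _) le_rfl).clm_apply continuousOn_const
  have hline : ∀ (x : ℝ) (s : Fin q → ℝ), Fin.insertNth (α := fun _ => ℝ) i x s =
      Fin.insertNth (α := fun _ => ℝ) i 0 s + x • Pi.single i (1 : ℝ) := by
    intro x s
    funext k
    refine Fin.succAboveCases i ?_ (fun k => ?_) k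
    · simp
    · simp
  rw [setIntegral_stdSimp_succ i _ hcf, ← setIntegral_stdSimp_hypotenuse i f hf.continuousOn,
    ← integral_sub]
  · refine setIntegral_congr_fun (measurableSet_stdSimp q) fun s hs => ?_
    have hmaps : MapsTo (fun x => Fin.insertNth (α := fun _ => ℝ) i x s)
        (Icc 0 (1 - ∑ k, s k)) (stdSimp (q + 1)) :=
      fun x hx => (insertNth_mem_stdSimp i x s).2 ⟨hs, hx⟩
    have hcl : Continuous fun x : ℝ => Fin.insertNth (α := fun _ => ℝ) i x s :=
      (continuous_insertNth i).comp (by fun_prop : Continuous fun x : ℝ => (x, s))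
    have h01 : (0 : ℝ) ≤ 1 - ∑ k, s k := by linarith [hs.2]
    rw [simpFace_succ]
    -- This form of the fundamental theorem asks for derivatives at interior points only. At the
    -- endpoints f is merely differentiable within the simplex.
    refine intervalIntegral.integral_eq_sub_of_hasDerivAt_of_le
      (f := fun x => f (Fin.insertNth (α := fun _ => ℝ) i x s)) h01
      (hf.continuousOn.comp hcl.continuousOn hmaps) (fun x hx => ?_) ?_
    · have h1 := (hf.differentiableOn one_ne_zero _ (hmaps ⟨hx.1.le, hx.2.le⟩)).hasFDerivWithinAt
      have h2 : HasDerivWithinAt (fun x => Fin.insertNth (α := fun _ => ℝ) i x s)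
          (Pi.single i (1 : ℝ)) (Icc 0 (1 - ∑ k, s k)) x := by
        rw [funext fun x => hline x s]
        simpa using (((hasDerivAt_id x).smul_const (Pi.single i (1 : ℝ))).const_add
          (Fin.insertNth (α := fun _ => ℝ) i 0 s)).hasDerivWithinAt
      exact (h1.comp_hasDerivWithinAt x h2 hmaps).hasDerivAt (Icc_mem_nhds hx.1 hx.2)
    · refine ContinuousOn.intervalIntegrable ?_
      rw [uIcc_of_le h01]
      exact hcf.comp hcl.continuousOn hmaps
  · refine ContinuousOn.integrableOn_compact (isCompact_stdSimp q) ?_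
    refine hf.continuousOn.comp ((continuous_insertNth i).comp
          (Continuous.prodMk (f := fun s : Fin q → ℝ => 1 - ∑ k, s k) (by fun_prop)
            continuous_id)).continuousOn
          fun s hs => (insertNth_mem_stdSimp _ _ _).2 ⟨hs, by linarith [hs.2], le_rfl⟩
  · refine ContinuousOn.integrableOn_compact (isCompact_stdSimp q) ?_
    exact hf.continuousOn.comp (continuous_simpFace _).continuousOn fun s hs => simpFace_mem _ hs

end Simplex

/-! ## Functions that are smooth, and holomorphic in some of the variables -/

section PartiallyHolomorphic

open MeasureTheory

variable {Y : Type*} [NormedAddCommGroup Y] [NormedSpace ℂ Y]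
  {T : Type*} [NormedAddCommGroup T] [NormedSpace ℝ T]
  {W : Type*} [NormedAddCommGroup W] [NormedSpace ℂ W]
  {W' : Type*} [NormedAddCommGroup W'] [NormedSpace ℂ W']
  {W'' : Type*} [NormedAddCommGroup W''] [NormedSpace ℂ W'']

/-- The function `k` is smooth on `X` at `x`, and holomorphic in the first variable near `x`. -/
structure PartHolWithinAt (k : Y × T → W) (X : Set (Y × T)) (x : Y × T) : Prop where
  contDiffWithinAt : ContDiffWithinAt ℝ ∞ k X x
  hol : ∀ᶠ x' in 𝓝[X] x, ∀ w : Y,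
    fderivWithin ℝ k X x' (Complex.I • w, 0) = Complex.I • fderivWithin ℝ k X x' (w, 0)

lemma ContDiffWithinAt.eventually_differentiableWithinAt {V V' : Type*} [NormedAddCommGroup V]
    [NormedSpace ℝ V] [NormedAddCommGroup V'] [NormedSpace ℝ V'] {k : V → V'} {X : Set V} {x : V}
    (h : ContDiffWithinAt ℝ ∞ k X x) (hx : x ∈ X) :
    ∀ᶠ x' in 𝓝[X] x, DifferentiableWithinAt ℝ k X x' := by
  have := (h.of_le (m := 1) (by exact_mod_cast le_top)).eventually (by simp)
  rw [insert_eq_of_mem hx] at this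
  exact this.mono fun x' hx' => hx'.differentiableWithinAt one_ne_zero

namespace PartHolWithinAt

variable {k k' : Y × T → W} {X : Set (Y × T)} {x : Y × T}

lemma congr (h : PartHolWithinAt k X x) (hx : x ∈ X) (hk : k' =ᶠ[𝓝[X] x] k) :
    PartHolWithinAt k' X x := by
  refine ⟨h.1.congr_of_eventuallyEq_of_mem hk hx, ?_⟩
  filter_upwards [h.2, eventually_eventually_nhdsWithin.2 hk, self_mem_nhdsWithin]
    with x' h1 h2 h3 w
  rw [Filter.EventuallyEq.fderivWithin_eq_of_mem h2 h3, h1]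

/-- The derivative of Φ commutes with multiplication by i, so the Cauchy–Riemann equation survives.
Together with `prodMk` this yields all algebraic closure properties of the class. -/
lemma comp {Φ : W → W'} (hΦ : ContDiffAt ℂ ∞ Φ (k x)) (h : PartHolWithinAt k X x)
    (hX : UniqueDiffOn ℝ X) (hx : x ∈ X) : PartHolWithinAt (fun x => Φ (k x)) X x := by
  refine ⟨(hΦ.restrict_scalars ℝ).comp_contDiffWithinAt x h.1, ?_⟩
  have h1 : ∀ᶠ z in 𝓝 (k x), DifferentiableAt ℂ Φ z :=
    ((hΦ.of_le (m := 1) (by exact_mod_cast le_top)).eventually (by simp)).mono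
      fun z hz => hz.differentiableAt one_ne_zero
  filter_upwards [h.2, h.1.eventually_differentiableWithinAt hx, self_mem_nhdsWithin,
    h.1.continuousWithinAt.eventually h1] with x' h2 h3 h4 h5 w
  have := (h5.hasFDerivAt.restrictScalars ℝ).comp_hasFDerivWithinAt x' h3.hasFDerivWithinAt
  have h6 := this.fderivWithin (hX x' h4)
  simp only [Function.comp_def] at h6
  rw [h6]
  simp [h2]

lemma prodMk {l : Y × T → W'} (h : PartHolWithinAt k X x) (h' : PartHolWithinAt l X x)
    (hX : UniqueDiffOn ℝ X) (hx : x ∈ X) : PartHolWithinAt (fun x => (k x, l x)) X x := by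
  refine ⟨h.1.prodMk h'.1, ?_⟩
  filter_upwards [h.2, h.1.eventually_differentiableWithinAt hx, self_mem_nhdsWithin, h'.2,
    h'.1.eventually_differentiableWithinAt hx] with x' h2 h3 h4 h5 h6 w
  rw [h3.fderivWithin_prodMk h6 (hX x' h4)]
  simp [h2, h5]

lemma bilin (B : W →L[ℂ] W' →L[ℂ] W'') {l : Y × T → W'} (h : PartHolWithinAt k X x)
    (h' : PartHolWithinAt l X x) (hX : UniqueDiffOn ℝ X) (hx : x ∈ X) :
    PartHolWithinAt (fun x => B (k x) (l x)) X x :=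
  (h.prodMk h' hX hx).comp (Φ := fun p : W × W' => B p.1 p.2)
    (B.isBoundedBilinearMap.contDiff.contDiffAt) hX hx

/-- The Cauchy–Riemann equation has constant coefficients, so it can be differentiated in the
direction u; symmetry of the second derivative moves u inside. This needs the equation on a
neighbourhood of x, and X in the closure of its interior for symmetry at boundary points. -/
protected lemma fderivWithin (h : PartHolWithinAt k X x) (hX : UniqueDiffOn ℝ X)
    (hX' : X ⊆ closure (interior X)) (hx : x ∈ X) (u : Y × T) :
    PartHolWithinAt (fun x => fderivWithin ℝ k X x u) X x := by
  have hD : ContDiffWithinAt ℝ ∞ (fun x => fderivWithin ℝ k X x) X x :=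
    h.1.fderivWithin_right hX (by simp) hx
  refine ⟨hD.clm_apply contDiffWithinAt_const, ?_⟩
  have h2 : ∀ᶠ x' in 𝓝[X] x, ContDiffWithinAt ℝ 2 k X x' := by
    have := (h.1.of_le (m := 2) ENat.LEInfty.out).eventually (by simp)
    rwa [insert_eq_of_mem hx] at this
  filter_upwards [eventually_eventually_nhdsWithin.2 h.2, h2,
    hD.eventually_differentiableWithinAt hx, self_mem_nhdsWithin] with x' h1 h2 h3 h4 w
  have hs : ∀ a b, fderivWithin ℝ (fun x => fderivWithin ℝ k X x a) X x' b =
      fderivWithin ℝ (fun x => fderivWithin ℝ k X x b) X x' a := by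
    intro a b
    rw [fderivWithin_clm_apply (hX x' h4) h3 (differentiableWithinAt_const _),
      fderivWithin_clm_apply (hX x' h4) h3 (differentiableWithinAt_const _)]
    simp only [fderivWithin_fun_const, Pi.zero_apply, ContinuousLinearMap.comp_zero, zero_add,
      ContinuousLinearMap.flip_apply]
    exact h2.isSymmSndFDerivWithinAt (by simp [minSmoothness_of_isRCLikeNormedField]) hX (hX' h4)
      h4 b a
  rw [hs, hs u, Filter.EventuallyEq.fderivWithin_eq_of_mem
    (f := fun x => Complex.I • fderivWithin ℝ k X x (w, 0)) (h1.mono fun x hx => hx w) h4,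
    fderivWithin_fun_const_smul (hX x' h4)]
  · rfl
  · exact h3.clm_apply (differentiableWithinAt_const _)

end PartHolWithinAt

/-- The function `k` is smooth on `X`, and holomorphic in the first variable. -/
def PartHolOn (k : Y × T → W)
    (X : Set (Y × T)) : Prop := ∀ x ∈ X, PartHolWithinAt k X x

lemma PartHolOn.contDiffOn {k : Y × T → W}
    {X : Set (Y × T)} (h : PartHolOn k X) : ContDiffOn ℝ ∞ k X :=
  fun x hx => (h x hx).contDiffWithinAt

lemma PartHolOn.contDiffOn_one {k : Y × T → W} {X : Set (Y × T)} (h : PartHolOn k X) : ContDiffOn ℝ 1 k X :=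
  h.contDiffOn.of_le (by exact_mod_cast le_top)

section Integral

variable {q : ℕ} {Ω : Set Y} {k : Y × (Fin q → ℝ) → W}

lemma uniqueDiffOn_prod_stdSimp (hΩ : IsOpen Ω) : UniqueDiffOn ℝ (Ω ×ˢ stdSimp q) :=
  hΩ.uniqueDiffOn.prod (uniqueDiffOn_stdSimp q)

omit [NormedSpace ℂ Y] in
lemma prod_stdSimp_subset_closure_interior (hΩ : IsOpen Ω) :
    Ω ×ˢ stdSimp q ⊆ closure (interior (Ω ×ˢ stdSimp q)) := by
  rw [interior_prod_eq, closure_prod_eq, hΩ.interior_eq]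
  exact prod_mono subset_closure (stdSimp_subset_closure_interior q)

omit [NormedSpace ℂ Y] in
lemma continuousOn_prod_slice {Z : Type*} [TopologicalSpace Z] {g : Y × (Fin q → ℝ) → Z}
    (hg : ContinuousOn g (Ω ×ˢ stdSimp q)) {y : Y} (hy : y ∈ Ω) :
    ContinuousOn (fun t => g (y, t)) (stdSimp q) :=
  hg.comp (by fun_prop) fun _ ht => ⟨hy, ht⟩

variable [FiniteDimensional ℂ Y]

/-- Differentiation under the integral sign. On K × Δ_q with K a compact neighbourhood of y the
derivative is bounded, and a constant is integrable over the simplex. -/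
lemma hasFDerivAt_setIntegral_stdSimp (hΩ : IsOpen Ω) (hk : ContDiffOn ℝ 1 k (Ω ×ˢ stdSimp q))
    {y : Y} (hy : y ∈ Ω) :
    HasFDerivAt (fun y => ∫ t in stdSimp q, k (y, t))
      (∫ t in stdSimp q, (fderivWithin ℝ k (Ω ×ˢ stdSimp q) (y, t)).comp
        (ContinuousLinearMap.inl ℝ Y (Fin q → ℝ))) y := by
  have : ProperSpace Y := FiniteDimensional.proper ℂ Y
  obtain ⟨K, hK, hKΩ, hKc⟩ := local_compact_nhds (hΩ.mem_nhds hy)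
  have hD : ContinuousOn (fun x => (fderivWithin ℝ k (Ω ×ˢ stdSimp q) x).comp
      (ContinuousLinearMap.inl ℝ Y (Fin q → ℝ))) (Ω ×ˢ stdSimp q) :=
    (hk.continuousOn_fderivWithin (uniqueDiffOn_prod_stdSimp hΩ) le_rfl).clm_comp
      continuousOn_const
  obtain ⟨C, hC⟩ := (hKc.prod (isCompact_stdSimp q)).exists_bound_of_continuousOn
    (hD.mono (prod_mono hKΩ le_rfl))
  have hint : ∀ {Z : Type _} [NormedAddCommGroup Z] {g : Y × (Fin q → ℝ) → Z},
      ContinuousOn g (Ω ×ˢ stdSimp q) → ∀ y ∈ Ω,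
      Integrable (fun t => g (y, t)) (volume.restrict (stdSimp q)) := fun hg y hy =>
    (continuousOn_prod_slice hg hy).integrableOn_compact (isCompact_stdSimp q)
  have hint' := ((continuousOn_prod_slice hD hy).integrableOn_compact (isCompact_stdSimp q)
    (μ := volume))
  refine hasFDerivAt_integral_of_dominated_of_fderiv_le (bound := fun _ => C)
    (F' := fun y t => (fderivWithin ℝ k (Ω ×ˢ stdSimp q) (y, t)).comp
        (ContinuousLinearMap.inl ℝ Y (Fin q → ℝ))) hK ?_ (hint hk.continuousOn y hy)
    hint'.aestronglyMeasurable ?_ ?_ ?_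
  · filter_upwards [hΩ.mem_nhds hy] with y' hy'
    exact (hint hk.continuousOn y' hy').aestronglyMeasurable
  · exact (ae_restrict_iff' (measurableSet_stdSimp q)).2 (.of_forall fun t ht y' hy' =>
      hC (y', t) ⟨hy', ht⟩)
  · exact integrableOn_const (isCompact_stdSimp q).measure_lt_top.ne
  · refine (ae_restrict_iff' (measurableSet_stdSimp q)).2 (.of_forall fun t ht y' hy' => ?_)
    have h1 := (hk.differentiableOn one_ne_zero (y', t) ⟨hKΩ hy', ht⟩).hasFDerivWithinAt
    have h2 : HasFDerivWithinAt (fun y : Y => (y, t)) (ContinuousLinearMap.inl ℝ Y (Fin q → ℝ))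
      Ω y' := (hasFDerivAt_prodMk_left y' t).hasFDerivWithinAt
    have h3 : MapsTo (fun y : Y => (y, t)) Ω (Ω ×ˢ stdSimp q) := fun z hz => ⟨hz, ht⟩
    exact (h1.comp y' h2 h3).hasFDerivAt (hΩ.mem_nhds (hKΩ hy'))

lemma fderiv_setIntegral_stdSimp [CompleteSpace W] (hΩ : IsOpen Ω)
    (hk : ContDiffOn ℝ 1 k (Ω ×ˢ stdSimp q)) {y : Y} (hy : y ∈ Ω) (v : Y) :
    fderiv ℝ (fun y => ∫ t in stdSimp q, k (y, t)) y v =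
      ∫ t in stdSimp q, fderivWithin ℝ k (Ω ×ˢ stdSimp q) (y, t) (v, 0) := by
  rw [(hasFDerivAt_setIntegral_stdSimp hΩ hk hy).fderiv, ContinuousLinearMap.integral_apply]
  · rfl
  · have hD : ContinuousOn (fun x => (fderivWithin ℝ k (Ω ×ˢ stdSimp q) x).comp
        (ContinuousLinearMap.inl ℝ Y (Fin q → ℝ))) (Ω ×ˢ stdSimp q) :=
      (hk.continuousOn_fderivWithin (uniqueDiffOn_prod_stdSimp hΩ) le_rfl).clm_comp
        continuousOn_const
    exact (continuousOn_prod_slice hD hy).integrableOn_compact (isCompact_stdSimp q)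

/-- The real derivative is the integral of derivatives commuting with i, hence is complex linear. -/
lemma PartHolOn.differentiableAt_setIntegral [CompleteSpace W] (hΩ : IsOpen Ω)
    (hk : PartHolOn k (Ω ×ˢ stdSimp q)) {y : Y} (hy : y ∈ Ω) :
    DifferentiableAt ℂ (fun y => ∫ t in stdSimp q, k (y, t)) y := by
  have h1 := hasFDerivAt_setIntegral_stdSimp hΩ hk.contDiffOn_one hy
  refine (differentiableAt_iff_restrictScalars ℝ h1.differentiableAt).2 ?_
  refine ⟨{ (fderiv ℝ (fun y => ∫ t in stdSimp q, k (y, t)) y) with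
    map_smul' := ?_ }, ?_⟩
  · intro c v
    have hI : fderiv ℝ (fun y => ∫ t in stdSimp q, k (y, t)) y (Complex.I • v) =
        Complex.I • fderiv ℝ (fun y => ∫ t in stdSimp q, k (y, t)) y v := by
      rw [fderiv_setIntegral_stdSimp hΩ hk.contDiffOn_one hy,
        fderiv_setIntegral_stdSimp hΩ hk.contDiffOn_one hy, ← integral_smul]
      refine setIntegral_congr_fun (measurableSet_stdSimp q) fun t ht => ?_
      exact (hk (y, t) ⟨hy, ht⟩).hol.self_of_nhdsWithin ⟨hy, ht⟩ v
    set L := fderiv ℝ (fun y => ∫ t in stdSimp q, k (y, t)) y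
    have hr : ∀ (r : ℝ) (v : Y), L ((r : ℂ) • v) = (r : ℂ) • L v := fun r v => by
      rw [Complex.coe_smul, Complex.coe_smul, map_smul]
    change L (c • v) = c • L v
    rw [← Complex.re_add_im c, add_smul, add_smul, map_add, hr, mul_smul, hr, hI, mul_smul]
  · ext v; rfl

/-- Induction on the order: a directional derivative of the integral is the integral of a function
of the same class, by stability of that class under derivatives. -/
lemma PartHolOn.contDiffOn_setIntegral [CompleteSpace W] (hΩ : IsOpen Ω)
    (hk : PartHolOn k (Ω ×ˢ stdSimp q)) :
    ContDiffOn ℂ ∞ (fun y => ∫ t in stdSimp q, k (y, t)) Ω := by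
  rw [contDiffOn_infty]
  intro n
  induction n generalizing k with
  | zero =>
    exact contDiffOn_zero.2 fun y hy =>
      (hk.differentiableAt_setIntegral hΩ hy).continuousAt.continuousWithinAt
  | succ n ih =>
    push_cast
    refine contDiffOn_succ_of_fderiv_apply
      (fun y hy => (hk.differentiableAt_setIntegral hΩ hy).differentiableWithinAt) (by simp)
      fun v => ?_
    have h1 : PartHolOn (fun x => fderivWithin ℝ k (Ω ×ˢ stdSimp q) x (v, 0))
        (Ω ×ˢ stdSimp q) := fun x hx => (hk x hx).fderivWithin (uniqueDiffOn_prod_stdSimp hΩ)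
          (prod_stdSimp_subset_closure_interior hΩ) hx _
    refine (ih h1).congr fun y hy => ?_
    rw [fderivWithin_of_isOpen hΩ hy, ← fderiv_setIntegral_stdSimp hΩ hk.contDiffOn_one hy,
      (hk.differentiableAt_setIntegral hΩ hy).fderiv_restrictScalars ℝ]
    rfl

end Integral

end PartiallyHolomorphic

/-! ## Powers of a manifold -/

section Pow

variable {𝕜 : Type*} [NontriviallyNormedField 𝕜] {E : Type*} [NormedAddCommGroup E]
  [NormedSpace 𝕜 E] {G : Type*} [TopologicalSpace G] [ChartedSpace E G] {n : ℕ}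
  {F : Type*} [NormedAddCommGroup F] [NormedSpace 𝕜 F] {H : Type*} [TopologicalSpace H]
  {I : ModelWithCorners 𝕜 F H} {M : Type*} [TopologicalSpace M] [ChartedSpace H M]

local notation "𝓘pi" => ModelWithCorners.pi fun _ : Fin n => 𝓘(𝕜, E)

lemma mem_extChartAt_pi_target (g : Fin n → G) (y : Fin n → E) :
    y ∈ (extChartAt (𝓘pi) g).target ↔ ∀ i, y i ∈ (extChartAt 𝓘(𝕜, E) (g i)).target := by
  simp [extChartAt, OpenPartialHomeomorph.extend, ModelWithCorners.pi, OpenPartialHomeomorph.pi,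
    PartialEquiv.pi, Set.mem_pi]

instance : (𝓘pi).Boundaryless where
  range_eq_univ := by
    refine range_eq_univ.2 fun y => ⟨y, rfl⟩

/-- The preferred chart of a power is by definition the product of the preferred charts, so after
unfolding only the vector space statement remains. -/
lemma mdifferentiableAt_pi_iff {f : M → Fin n → G} {x : M} :
    MDifferentiableAt I (𝓘pi) f x ↔ ∀ i, MDifferentiableAt I 𝓘(𝕜, E) (fun y => f y i) x := by
  simp only [mdifferentiableAt_iff, forall_and, continuousAt_pi]
  refine and_congr Iff.rfl ?_
  rw [differentiableWithinAt_pi]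
  rfl

lemma contMDiffWithinAt_pi_iff {f : M → Fin n → G} {x : M} {s : Set M} {r : ℕ∞ω} :
    ContMDiffWithinAt I (𝓘pi) r f s x ↔
      ∀ i, ContMDiffWithinAt I 𝓘(𝕜, E) r (fun y => f y i) s x := by
  simp only [contMDiffWithinAt_iff, forall_and, ContinuousWithinAt, tendsto_pi_nhds]
  refine and_congr Iff.rfl ?_
  rw [contDiffWithinAt_pi]
  rfl

lemma mdifferentiableAt_eval (i : Fin n) (g : Fin n → G) :
    MDifferentiableAt (𝓘pi) 𝓘(𝕜, E) (fun h : Fin n → G => h i) g :=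
  mdifferentiableAt_pi_iff.1 mdifferentiableAt_id i

lemma contMDiffAt_eval {r : ℕ∞ω} (i : Fin n) (g : Fin n → G) :
    ContMDiffAt (𝓘pi) 𝓘(𝕜, E) r (fun h : Fin n → G => h i) g :=
  contMDiffWithinAt_pi_iff.1 contMDiffAt_id i

end Pow

/-! ## Derivatives, with tangent spaces written as the model spaces -/

section TangentDeriv

variable {F : Type*} [NormedAddCommGroup F] [NormedSpace ℂ F]
  {H : Type*} [TopologicalSpace H] {I : ModelWithCorners ℂ F H}
  {M : Type*} [TopologicalSpace M] [ChartedSpace H M]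
  {F' : Type*} [NormedAddCommGroup F'] [NormedSpace ℂ F']
  {H' : Type*} [TopologicalSpace H'] {J : ModelWithCorners ℂ F' H'}
  {N : Type*} [TopologicalSpace N] [ChartedSpace H' N]
  {F'' : Type*} [NormedAddCommGroup F''] [NormedSpace ℂ F'']
  {H'' : Type*} [TopologicalSpace H''] {K : ModelWithCorners ℂ F'' H''}
  {L : Type*} [TopologicalSpace L] [ChartedSpace H'' L]
  {E : Type*} [NormedAddCommGroup E] [NormedSpace ℂ E]
  {G : Type*} [TopologicalSpace G] [ChartedSpace E G] {n : ℕ}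

lemma tangentDeriv_eq_fderivWithin {f : M → N} {x : M} (hf : MDifferentiableAt I J f x) :
    tangentDeriv I J f x = fderivWithin ℂ (writtenInExtChartAt I J x f) (range I)
      (extChartAt I x x) := if_pos hf

lemma tangentDeriv_comp {f : M → N} {g : N → L} {x : M} (hg : MDifferentiableAt J K g (f x))
    (hf : MDifferentiableAt I J f x) :
    tangentDeriv I K (fun y => g (f y)) x = (tangentDeriv J K g (f x)).comp (tangentDeriv I J f x) :=
  mfderiv_comp x hg hf

lemma tangentDeriv_id (x : M) : tangentDeriv I I (fun y : M => y) x = ContinuousLinearMap.id ℂ F :=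
  mfderiv_id

lemma tangentDeriv_const (c : N) (x : M) : tangentDeriv I J (fun _ : M => c) x = 0 :=
  mfderiv_const

lemma tangentDeriv_congr {f g : M → N} {x : M} (h : f =ᶠ[𝓝 x] g) :
    tangentDeriv I J f x = tangentDeriv I J g x :=
  h.mfderiv_eq

lemma tangentDeriv_vectorSpace (f : F → F') (x : F) :
    tangentDeriv 𝓘(ℂ, F) 𝓘(ℂ, F') f x = fderiv ℂ f x :=
  mfderiv_eq_fderiv

lemma tangentDeriv_pi_apply {f : M → Fin n → G} {x : M}
    (hf : MDifferentiableAt I (powModel E n) f x) (v : F) (i : Fin n) :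
    tangentDeriv I (powModel E n) f x v i = tangentDeriv I 𝓘(ℂ, E) (fun y => f y i) x v := by
  rw [tangentDeriv_eq_fderivWithin hf,
    tangentDeriv_eq_fderivWithin (mdifferentiableAt_pi_iff.1 hf i)]
  have h1 := (mdifferentiableAt_iff f x).1 hf
  have h3 := hasFDerivWithinAt_pi'.1 h1.2.hasFDerivWithinAt i
  exact (DFunLike.congr_fun (h3.fderivWithin (I.uniqueDiffOn _ (mem_range_self _))) v).symm

lemma tangentDeriv_eval (i : Fin n) (g : Fin n → G) :
    tangentDeriv (powModel E n) 𝓘(ℂ, E) (fun h : Fin n → G => h i) g =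
      ContinuousLinearMap.proj i := by
  ext v
  have h := tangentDeriv_pi_apply (E := E) (mdifferentiableAt_id (I := powModel E n) (x := g)) v i
  simp only [id] at h
  rw [← h, show tangentDeriv (powModel E n) (powModel E n) id g = ContinuousLinearMap.id ℂ _ from
    mfderiv_id]
  rfl

lemma writtenInExtChartAt_extChartAt_self (x : M) [I.Boundaryless] :
    writtenInExtChartAt I 𝓘(ℂ, F) x (extChartAt I x) =ᶠ[𝓝 (extChartAt I x x)] id := by
  filter_upwards [extChartAt_target_mem_nhds (I := I) x] with y hy
  simp only [writtenInExtChartAt, extChartAt_model_space_eq_id, PartialEquiv.refl_coe,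
    Function.comp, id]
  exact (extChartAt I x).right_inv hy

lemma mdifferentiableAt_extChartAt_self (x : M) [I.Boundaryless] :
    MDifferentiableAt I 𝓘(ℂ, F) (extChartAt I x) x := by
  rw [mdifferentiableAt_iff, I.range_eq_univ, differentiableWithinAt_univ]
  exact ⟨continuousAt_extChartAt x,
    differentiableAt_id.congr_of_eventuallyEq (writtenInExtChartAt_extChartAt_self x)⟩

/-- Tangent spaces are identified with the model space through the preferred chart at the point
itself, so these charts disappear from all computations at their base points. -/
lemma tangentDeriv_extChartAt_self (x : M) [I.Boundaryless] :
    tangentDeriv I 𝓘(ℂ, F) (extChartAt I x) x = ContinuousLinearMap.id ℂ F := by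
  rw [tangentDeriv_eq_fderivWithin (mdifferentiableAt_extChartAt_self x), I.range_eq_univ,
    fderivWithin_univ, (writtenInExtChartAt_extChartAt_self x).fderiv_eq, fderiv_id]

end TangentDeriv

/-! ## The Maurer–Cartan form in charts -/

section Pullback

variable {𝕜 : Type*} [RCLike 𝕜] {V : Type*} [NormedAddCommGroup V] [NormedSpace 𝕜 V]
  {E : Type*} [NormedAddCommGroup E] [NormedSpace 𝕜 E]
  {E' : Type*} [NormedAddCommGroup E'] [NormedSpace 𝕜 E']

/-- The exterior derivative of the pull-back `f^* A` of a `1`-form `A`. -/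
lemma fderivWithin_pullback_antisymm {A : E → E →L[𝕜] E'} {f : V → E} {X : Set V} {x : V}
    (hA : DifferentiableAt 𝕜 A (f x)) (hf : ContDiffWithinAt 𝕜 2 f X x) (hX : UniqueDiffOn 𝕜 X)
    (hx : x ∈ X) (hx' : x ∈ closure (interior X)) (u v : V) :
    fderivWithin 𝕜 (fun y => (A (f y)).comp (fderivWithin 𝕜 f X y)) X x u v -
      fderivWithin 𝕜 (fun y => (A (f y)).comp (fderivWithin 𝕜 f X y)) X x v u =
    fderiv 𝕜 A (f x) (fderivWithin 𝕜 f X x u) (fderivWithin 𝕜 f X x v) -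
      fderiv 𝕜 A (f x) (fderivWithin 𝕜 f X x v) (fderivWithin 𝕜 f X x u) := by
  have hfd := hf.differentiableWithinAt two_ne_zero
  have hD : DifferentiableWithinAt 𝕜 (fderivWithin 𝕜 f X) X x :=
    (hf.fderivWithin_right (m := 1) hX le_rfl hx).differentiableWithinAt one_ne_zero
  have h1 := hA.hasFDerivAt.comp_hasFDerivWithinAt x hfd.hasFDerivWithinAt
  have h2 := (h1.clm_comp hD.hasFDerivWithinAt).fderivWithin (hX x hx)
  -- The term A(f x)(D²f(u, v)) is symmetric in u and v, hence drops out of the difference.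
  have hs := hf.isSymmSndFDerivWithinAt (by simp [minSmoothness_of_isRCLikeNormedField]) hX hx' hx
    u v
  simp only [Function.comp_def] at h2
  rw [h2]
  simp [hs]

end Pullback

/-! ### The division map and the Maurer–Cartan form in coordinates -/

section DivChart

variable {E : Type*} [NormedAddCommGroup E] [NormedSpace ℂ E]
  {G : Type*} [TopologicalSpace G] [ChartedSpace E G] [Group G]

variable (E) in
/-- The map `(g, h) ↦ g h⁻¹`, in the chart at `g₀` on the source and in the chart at `1` on the
target. -/
noncomputable def divChart (g₀ : G) (p : E × E) : E :=
  extChartAt 𝓘(ℂ, E) (1 : G) ((extChartAt 𝓘(ℂ, E) g₀).symm p.1 *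
    ((extChartAt 𝓘(ℂ, E) g₀).symm p.2)⁻¹)

variable (E) in
/-- The right invariant Maurer–Cartan form in the chart at `g₀`. -/
noncomputable def mcChart (g₀ : G) (z : E) : E →L[ℂ] E := fderiv ℂ (fun y => divChart E g₀ (y, z)) z

lemma divChart_self (g₀ : G) (z : E) :
    divChart E g₀ (z, z) = extChartAt 𝓘(ℂ, E) (1 : G) 1 := by
  simp [divChart]

lemma mcChart_one_self : mcChart E (1 : G) (extChartAt 𝓘(ℂ, E) (1 : G) 1) =
    ContinuousLinearMap.id ℂ E := by
  have : (fun y => divChart E (1 : G) (y, extChartAt 𝓘(ℂ, E) (1 : G) 1)) =ᶠ[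
      𝓝 (extChartAt 𝓘(ℂ, E) (1 : G) 1)] id := by
    filter_upwards [extChartAt_target_mem_nhds (I := 𝓘(ℂ, E)) (1 : G)] with y hy
    simp only [divChart, extChartAt_to_inv, inv_one, mul_one, id]
    exact (extChartAt 𝓘(ℂ, E) (1 : G)).right_inv hy
  rw [mcChart, this.fderiv_eq, fderiv_id]

variable [LieGroup 𝓘(ℂ, E) ∞ G]

lemma contDiffAt_divChart {g₀ : G} {z w : E} (hz : z ∈ (extChartAt 𝓘(ℂ, E) g₀).target)
    (hw : w ∈ (extChartAt 𝓘(ℂ, E) g₀).target)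
    (h : (extChartAt 𝓘(ℂ, E) g₀).symm z * ((extChartAt 𝓘(ℂ, E) g₀).symm w)⁻¹ ∈
      (extChartAt 𝓘(ℂ, E) (1 : G)).source) :
    ContDiffAt ℂ ∞ (divChart E g₀) (z, w) := by
  rw [← contMDiffAt_iff_contDiffAt]
  have hs : ∀ z ∈ (extChartAt 𝓘(ℂ, E) g₀).target,
      ContMDiffAt 𝓘(ℂ, E) 𝓘(ℂ, E) ∞ (extChartAt 𝓘(ℂ, E) g₀).symm z := fun z hz =>
    (contMDiffOn_extChartAt_symm g₀).contMDiffAt ((isOpen_extChartAt_target g₀).mem_nhds hz)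
  have h1 : ContMDiffAt 𝓘(ℂ, E × E) 𝓘(ℂ, E) ∞
      (fun p : E × E => (extChartAt 𝓘(ℂ, E) g₀).symm p.1) (z, w) :=
    ContMDiffAt.comp (z, w) (hs z hz) contDiff_fst.contMDiff.contMDiffAt
  have h2 : ContMDiffAt 𝓘(ℂ, E × E) 𝓘(ℂ, E) ∞
      (fun p : E × E => (extChartAt 𝓘(ℂ, E) g₀).symm p.2) (z, w) :=
    ContMDiffAt.comp (z, w) (hs w hw) contDiff_snd.contMDiff.contMDiffAt
  have h3 := h1.mul h2.inv
  exact ContMDiffAt.comp (z, w) (contMDiffAt_extChartAt' (by simpa using h)) h3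

lemma contDiffAt_divChart_self {g₀ : G} {z : E} (hz : z ∈ (extChartAt 𝓘(ℂ, E) g₀).target) :
    ContDiffAt ℂ ∞ (divChart E g₀) (z, z) :=
  contDiffAt_divChart hz hz (by simp)

lemma eventually_div_mem_source {g₀ : G} {z : E} (hz : z ∈ (extChartAt 𝓘(ℂ, E) g₀).target) :
    ∀ᶠ p : E × E in 𝓝 (z, z), (extChartAt 𝓘(ℂ, E) g₀).symm p.1 *
      ((extChartAt 𝓘(ℂ, E) g₀).symm p.2)⁻¹ ∈ (extChartAt 𝓘(ℂ, E) (1 : G)).source := by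
  have : IsTopologicalGroup G := topologicalGroup_of_lieGroup 𝓘(ℂ, E) ∞
  have h1 := continuousAt_extChartAt_symm'' hz
  have h2 : ContinuousAt (fun p : E × E => (extChartAt 𝓘(ℂ, E) g₀).symm p.1 *
      ((extChartAt 𝓘(ℂ, E) g₀).symm p.2)⁻¹) (z, z) :=
    (ContinuousAt.comp (f := Prod.fst) (x := (z, z)) h1 continuousAt_fst).mul
      (ContinuousAt.comp (f := Prod.snd) (x := (z, z)) h1 continuousAt_snd).inv
  refine h2.eventually_mem ?_
  simpa using extChartAt_source_mem_nhds (I := 𝓘(ℂ, E)) (1 : G)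

/-- The group identity g h⁻¹ = (g k⁻¹)(h k⁻¹)⁻¹, valid in coordinates near the diagonal point where
all the quotients stay in the chart at 1. -/
lemma divChart_eq_divChart_one {g₀ : G} {z : E} (hz : z ∈ (extChartAt 𝓘(ℂ, E) g₀).target) :
    ∀ᶠ p : E × E in 𝓝 (z, z), divChart E g₀ p =
      divChart E (1 : G) (divChart E g₀ (p.1, z), divChart E g₀ (p.2, z)) := by
  have h := eventually_div_mem_source hz
  have h1 : ∀ᶠ p : E × E in 𝓝 (z, z), (extChartAt 𝓘(ℂ, E) g₀).symm p.1 *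
      ((extChartAt 𝓘(ℂ, E) g₀).symm z)⁻¹ ∈ (extChartAt 𝓘(ℂ, E) (1 : G)).source :=
    (by fun_prop : ContinuousAt (fun p : E × E => (p.1, z)) (z, z)).eventually h
  have h2 : ∀ᶠ p : E × E in 𝓝 (z, z), (extChartAt 𝓘(ℂ, E) g₀).symm p.2 *
      ((extChartAt 𝓘(ℂ, E) g₀).symm z)⁻¹ ∈ (extChartAt 𝓘(ℂ, E) (1 : G)).source :=
    (by fun_prop : ContinuousAt (fun p : E × E => (p.2, z)) (z, z)).eventually h
  filter_upwards [h1, h2] with p h1 h2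
  simp only [divChart]
  rw [(extChartAt 𝓘(ℂ, E) (1 : G)).left_inv h1, (extChartAt 𝓘(ℂ, E) (1 : G)).left_inv h2]
  congr 1
  group

lemma contDiffAt_mcChart {g₀ : G} {z : E} (hz : z ∈ (extChartAt 𝓘(ℂ, E) g₀).target) :
    ContDiffAt ℂ ∞ (mcChart E g₀) z := by
  have h := contDiffAt_divChart_self hz
  refine ContDiffAt.fderiv (n := ∞) (f := fun w y => divChart E g₀ (y, w)) (g := id) ?_
    contDiffAt_id (by simp)
  exact h.comp (z, z) (contDiff_snd.prodMk contDiff_fst).contDiffAt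

/-- Right invariance: near z the form is the pull-back of its expression at the identity under right
division by z. Obtained by differentiating `divChart_eq_divChart_one` in its first argument. -/
lemma mcChart_eq_comp {g₀ : G} {z : E} (hz : z ∈ (extChartAt 𝓘(ℂ, E) g₀).target) :
    ∀ᶠ w in 𝓝 z, mcChart E g₀ w = (mcChart E (1 : G) (divChart E g₀ (w, z))).comp
      (fderiv ℂ (fun y => divChart E g₀ (y, z)) w) := by
  have h := (divChart_eq_divChart_one hz).eventually_nhds
  have hd : ContDiffAt ℂ ∞ (fun y => divChart E g₀ (y, z)) z :=
    (contDiffAt_divChart_self hz).comp z (f := fun y => (y, z)) (by fun_prop)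
  have hd1 : ∀ᶠ w in 𝓝 z, DifferentiableAt ℂ (fun y => divChart E g₀ (y, z)) w :=
    ((hd.of_le (m := 1) (by exact_mod_cast le_top)).eventually (by simp)).mono
      fun w hw => hw.differentiableAt one_ne_zero
  have hK : ∀ᶠ p in 𝓝 (extChartAt 𝓘(ℂ, E) (1 : G) 1, extChartAt 𝓘(ℂ, E) (1 : G) 1),
      DifferentiableAt ℂ (divChart E (1 : G)) p :=
    (((contDiffAt_divChart_self (mem_extChartAt_target (1 : G))).of_le (m := 1)
      (by exact_mod_cast le_top)).eventually (by simp)).mono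
      fun w hw => hw.differentiableAt one_ne_zero
  have hK' : ∀ᶠ w in 𝓝 z, DifferentiableAt ℂ (divChart E (1 : G))
      (divChart E g₀ (w, z), divChart E g₀ (w, z)) := by
    have hc : ContinuousAt (fun w => (divChart E g₀ (w, z), divChart E g₀ (w, z))) z :=
      hd.continuousAt.prodMk hd.continuousAt
    have := hc.eventually (p := fun p => DifferentiableAt ℂ (divChart E (1 : G)) p)
    simp only [divChart_self] at this
    exact this hK
  have h' : ∀ᶠ w in 𝓝 z, ∀ᶠ p in 𝓝 (w, w), divChart E g₀ p =
      divChart E (1 : G) (divChart E g₀ (p.1, z), divChart E g₀ (p.2, z)) :=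
    (by fun_prop : ContinuousAt (fun w : E => (w, w)) z).eventually h
  filter_upwards [h', hd1, hK'] with w h1 h2 h3
  have h4 : (fun y => divChart E g₀ (y, w)) =ᶠ[𝓝 w]
      fun y => divChart E (1 : G) (divChart E g₀ (y, z), divChart E g₀ (w, z)) :=
    (by fun_prop : ContinuousAt (fun y : E => (y, w)) w).eventually h1
  rw [mcChart, h4.fderiv_eq]
  have h5 : DifferentiableAt ℂ (fun y => divChart E (1 : G) (y, divChart E g₀ (w, z)))
      (divChart E g₀ (w, z)) := h3.comp (divChart E g₀ (w, z)) (f := fun y => (y, divChart E g₀ (w, z)))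
        (by fun_prop)
  exact fderiv_comp w h5 h2

end DivChart

/-! ### The Lie bracket as a second derivative, and the Maurer–Cartan equation -/

section Bracket

variable {E : Type*} [NormedAddCommGroup E] [NormedSpace ℂ E]
  {G : Type*} [TopologicalSpace G] [ChartedSpace E G] [Group G] [LieGroup 𝓘(ℂ, E) ∞ G]

local notation "e₁" => extChartAt 𝓘(ℂ, E) (1 : G) 1
local notation "D₂" => fderiv ℂ (fderiv ℂ (divChart E (1 : G))) (e₁, e₁)

lemma contDiffAt_divChart_one : ContDiffAt ℂ ∞ (divChart E (1 : G)) (e₁, e₁) :=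
  contDiffAt_divChart_self (mem_extChartAt_target (1 : G))

lemma differentiableAt_fderiv_divChart_one :
    DifferentiableAt ℂ (fderiv ℂ (divChart E (1 : G))) (e₁, e₁) :=
  ((contDiffAt_divChart_one (G := G)).fderiv_right (m := 1)
    (by rw [one_add_one_eq_two]; exact ENat.LEInfty.out)).differentiableAt one_ne_zero

lemma fderiv_divChart_one_symm (p q : E × E) : D₂ p q = D₂ q p :=
  (contDiffAt_divChart_one (G := G)).isSymmSndFDerivAt
    (by rw [minSmoothness_of_isRCLikeNormedField]; exact ENat.LEInfty.out) p q

lemma eventually_differentiableAt_divChart_one :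
    ∀ᶠ p in 𝓝 (e₁, e₁), DifferentiableAt ℂ (divChart E (1 : G)) p :=
  (((contDiffAt_divChart_one (G := G)).of_le (m := 1) (by exact_mod_cast le_top)).eventually
    (by simp)).mono fun _ hw => hw.differentiableAt one_ne_zero

lemma fderiv_mcChart_one (a b : E) :
    fderiv ℂ (mcChart E (1 : G)) e₁ a b = D₂ (a, a) (b, 0) := by
  have h1 : mcChart E (1 : G) =ᶠ[𝓝 e₁] fun w => (fderiv ℂ (divChart E (1 : G)) (w, w)).comp
      (ContinuousLinearMap.inl ℂ E E) := by
    have := (by fun_prop : ContinuousAt (fun w : E => (w, w)) e₁).eventually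
      (eventually_differentiableAt_divChart_one (G := G))
    filter_upwards [this] with w hw
    exact (hw.hasFDerivAt.comp w (f := fun y => (y, w)) (hasFDerivAt_prodMk_left w w)).fderiv
  have h2 := (differentiableAt_fderiv_divChart_one (G := G)).hasFDerivAt.comp e₁
    (f := fun w : E => (w, w)) ((hasFDerivAt_id e₁).prodMk (hasFDerivAt_id e₁))
  have h3 := h2.clm_comp (hasFDerivAt_const (ContinuousLinearMap.inl ℂ E E) e₁)
  simp only [Function.comp_def] at h3
  rw [h1.fderiv_eq, h3.fderiv]
  simp

/-- Division is constant on the diagonal, and its derivative in the first slot is the identity. -/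
lemma fderiv_divChart_one_inr (y : E) : fderiv ℂ (divChart E (1 : G)) (e₁, e₁) (0, y) = -y := by
  have hd := (contDiffAt_divChart_one (E := E) (G := G)).differentiableAt (by simp)
  have h1 : fderiv ℂ (divChart E (1 : G)) (e₁, e₁) (y, y) = 0 := by
    have h2 := hd.hasFDerivAt.comp e₁
      (f := fun w : E => (w, w)) ((hasFDerivAt_id e₁).prodMk (hasFDerivAt_id e₁))
    simp only [Function.comp_def, divChart_self] at h2
    have := h2.unique (hasFDerivAt_const _ _)
    simpa using DFunLike.congr_fun this y
  have h3 : fderiv ℂ (divChart E (1 : G)) (e₁, e₁) (y, 0) = y := by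
    have h4 := hd.hasFDerivAt.comp e₁ (f := fun w : E => (w, e₁)) (hasFDerivAt_prodMk_left e₁ e₁)
    have h5 := DFunLike.congr_fun h4.fderiv y
    have h6 := DFunLike.congr_fun (mcChart_one_self (E := E) (G := G)) y
    simp only [mcChart] at h6
    simp only [Function.comp_def] at h5
    rw [h5] at h6
    simpa using h6
  have h7 : ((0 : E), y) = (y, y) - (y, 0) := by simp
  rw [h7, map_sub, h1, h3, zero_sub]

variable (G) in
/-- The left invariant vector field with value `X` at `1`, in the chart at `1`. -/
noncomputable def leftInvariantInChart (X : E) : E → E :=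
  VectorField.mpullbackWithin 𝓘(ℂ, E) 𝓘(ℂ, E) (extChartAt 𝓘(ℂ, E) (1 : G)).symm
    (mulInvariantVectorField (I := 𝓘(ℂ, E)) (G := G) X) (range 𝓘(ℂ, E))

/-- Left translation is expressed by division alone, w y = w (1 y⁻¹)⁻¹, and the inner inversion has
derivative −1 at the identity. This puts invariant fields and the Maurer–Cartan form in terms of the
same map. -/
lemma leftInvariantInChart_eventuallyEq (X : E) :
    leftInvariantInChart G X =ᶠ[𝓝 e₁]
      fun w => -(fderiv ℂ (divChart E (1 : G)) (w, e₁) (0, X)) := by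
  have hev := (by fun_prop : ContinuousAt (fun w : E => (w, e₁)) e₁).eventually
    (eventually_differentiableAt_divChart_one (G := G))
  filter_upwards [extChartAt_target_mem_nhds (I := 𝓘(ℂ, E)) (1 : G), hev] with w hw hdw
  set c := extChartAt 𝓘(ℂ, E) (1 : G) with hc
  have hws : c.symm w ∈ c.source := c.map_target hw
  have hinv : (mfderivWithin 𝓘(ℂ, E) 𝓘(ℂ, E) c.symm (range 𝓘(ℂ, E)) w).inverse =
      mfderiv 𝓘(ℂ, E) 𝓘(ℂ, E) c (c.symm w) :=
    have : IsManifold 𝓘(ℂ, E) 1 G := .of_le (n := ∞) (by exact_mod_cast le_top)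
    ContinuousLinearMap.inverse_eq (mfderivWithin_extChartAt_symm_comp_mfderiv_extChartAt hw)
      (mfderiv_extChartAt_comp_mfderivWithin_extChartAt_symm hw)
  have hm : MDifferentiableAt 𝓘(ℂ, E) 𝓘(ℂ, E) (fun h : G => c.symm w * h) 1 :=
    (contMDiff_mul_left (I := 𝓘(ℂ, E)) (n := ∞)).mdifferentiableAt (by simp)
  have hcd : MDifferentiableAt 𝓘(ℂ, E) 𝓘(ℂ, E) c (c.symm w * 1) := by
    rw [mul_one]
    exact (contMDiffAt_extChartAt' (n := ∞) (by simpa [hc] using hws)).mdifferentiableAt (by simp)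
  have h1 := DFunLike.congr_fun (tangentDeriv_comp hcd hm) X
  have h2 : tangentDeriv 𝓘(ℂ, E) 𝓘(ℂ, E) c (c.symm w * 1) =
    tangentDeriv 𝓘(ℂ, E) 𝓘(ℂ, E) c (c.symm w) := by rw [mul_one]
  rw [h2] at h1
  refine (DFunLike.congr_fun hinv _).trans (h1.symm.trans ?_)
  have hcm : MDifferentiableAt 𝓘(ℂ, E) 𝓘(ℂ, E) (fun y => c (c.symm w * y)) 1 := hcd.comp 1 hm
  rw [tangentDeriv_eq_fderivWithin hcm]
  have h3 : writtenInExtChartAt 𝓘(ℂ, E) 𝓘(ℂ, E) 1 (fun y => c (c.symm w * y)) =ᶠ[𝓝 e₁]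
      fun y => divChart E (1 : G) (w, divChart E (1 : G) (e₁, y)) := by
    have h4 := (by fun_prop : ContinuousAt (fun y : E => (e₁, y)) e₁).eventually
      (eventually_div_mem_source (mem_extChartAt_target (I := 𝓘(ℂ, E)) (1 : G)))
    filter_upwards [h4] with y hy
    simp only [writtenInExtChartAt, extChartAt_model_space_eq_id, PartialEquiv.refl_coe,
      Function.comp, id, divChart]
    rw [(extChartAt 𝓘(ℂ, E) (1 : G)).left_inv hy]
    simp [hc]
  simp only [ModelWithCorners.range_eq_univ, fderivWithin_univ]
  rw [h3.fderiv_eq]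
  have hin : HasFDerivAt (fun y => divChart E (1 : G) (e₁, y)) (-ContinuousLinearMap.id ℂ E) e₁ := by
    have hd := (contDiffAt_divChart_one (E := E) (G := G)).differentiableAt (by simp)
    convert! hd.hasFDerivAt.comp e₁ (f := fun w : E => (e₁, w)) (hasFDerivAt_prodMk_right e₁ e₁)
    ext y
    exact (fderiv_divChart_one_inr (G := G) y).symm
  have hout := (show DifferentiableAt ℂ (divChart E (1 : G)) (w, divChart E (1 : G) (e₁, e₁)) by
    rwa [divChart_self]).hasFDerivAt.comp e₁ (f := fun y => (w, divChart E (1 : G) (e₁, y)))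
      ((hasFDerivAt_const w e₁).prodMk hin)
  simp only [Function.comp_def] at hout
  rw [hout.fderiv]
  simp only [divChart_self]
  rw [ContinuousLinearMap.comp_apply, ← map_neg]
  congr 1
  simp

variable [FiniteDimensional ℂ E]

/-- Both sides are second derivatives of the division map at the identity. The pure second
derivative in the first variable is symmetric and cancels on the right, leaving the antisymmetrised
mixed derivative that the bracket of left invariant fields gives. This fixes the sign + in dΘ = [Θ,
Θ]. -/
lemma lieBracket_eq_fderiv_mcChart (X Y : E) :
    lieBracket E G X Y = fderiv ℂ (mcChart E (1 : G)) e₁ X Y -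
      fderiv ℂ (mcChart E (1 : G)) e₁ Y X := by
  have h0 : lieBracket E G X Y = VectorField.mlieBracket 𝓘(ℂ, E)
    (mulInvariantVectorField (I := 𝓘(ℂ, E)) (G := G) X)
    (mulInvariantVectorField (I := 𝓘(ℂ, E)) (G := G) Y) (1 : G) := rfl
  have hL : ∀ Z : E, HasFDerivAt (fun w => -(fderiv ℂ (divChart E (1 : G)) (w, e₁) (0, Z)))
      (-((D₂).flip (0, Z)).comp (ContinuousLinearMap.inl ℂ E E)) e₁ := by
    intro Z
    have h1 := (differentiableAt_fderiv_divChart_one (G := G)).hasFDerivAt.comp e₁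
      (f := fun w : E => (w, e₁)) (hasFDerivAt_prodMk_left e₁ e₁)
    have h2 := (h1.clm_apply (hasFDerivAt_const ((0 : E), Z) e₁)).neg
    convert! h2 using 1
    ext a
    simp
  have hX := leftInvariantInChart_eventuallyEq (G := G) X
  have hY := leftInvariantInChart_eventuallyEq (G := G) Y
  rw [h0, VectorField.mlieBracket, VectorField.mlieBracketWithin_apply, mfderiv_extChartAt_self]
  have hid : ((ContinuousLinearMap.id ℂ (TangentSpace 𝓘(ℂ, E) (1 : G))).inverse :
      E →L[ℂ] E) = ContinuousLinearMap.id ℂ E := ContinuousLinearMap.inverse_id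
  refine (DFunLike.congr_fun hid _).trans ?_
  have hset : (extChartAt 𝓘(ℂ, E) (1 : G)).symm ⁻¹' univ ∩ range 𝓘(ℂ, E) = univ := by simp
  change VectorField.lieBracketWithin ℂ (leftInvariantInChart G X) (leftInvariantInChart G Y) _ e₁ = _
  rw [hset, VectorField.lieBracketWithin_univ, VectorField.lieBracket, hX.fderiv_eq, hY.fderiv_eq,
    hX.eq_of_nhds, hY.eq_of_nhds, (hL X).fderiv, (hL Y).fderiv, fderiv_mcChart_one,
    fderiv_mcChart_one, fderiv_divChart_one_inr, fderiv_divChart_one_inr]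
  simp only [neg_apply, ContinuousLinearMap.comp_apply,
    ContinuousLinearMap.flip_apply, ContinuousLinearMap.inl_apply, neg_neg]
  have h1 : ∀ a b : E, D₂ (a, a) (b, 0) = D₂ (a, 0) (b, 0) + D₂ (0, a) (b, 0) := fun a b => by
    rw [← add_apply, ← map_add]; simp
  rw [h1, h1, fderiv_divChart_one_symm (Y, 0) (X, 0), fderiv_divChart_one_symm (Y, 0) (0, X),
    fderiv_divChart_one_symm (X, 0) (0, Y)]
  abel

/-- The Maurer–Cartan equation in a chart. -/
lemma fderiv_mcChart_antisymm {g₀ : G} {z : E} (hz : z ∈ (extChartAt 𝓘(ℂ, E) g₀).target)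
    (a b : E) :
    fderiv ℂ (mcChart E g₀) z a b - fderiv ℂ (mcChart E g₀) z b a =
      lieBracket E G (mcChart E g₀ z a) (mcChart E g₀ z b) := by
  have hd : ContDiffAt ℂ ∞ (fun y => divChart E g₀ (y, z)) z :=
    (contDiffAt_divChart_self hz).comp z (f := fun y => (y, z)) (by fun_prop)
  have hA := (contDiffAt_mcChart (E := E)
    (mem_extChartAt_target (I := 𝓘(ℂ, E)) (1 : G))).differentiableAt (by simp)
  -- By right invariance the form is a pull-back of its expression at 1, so the equation at z
  -- follows from the one at the identity.
  have h := fderivWithin_pullback_antisymm (𝕜 := ℂ) (A := mcChart E (1 : G))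
    (f := fun y => divChart E g₀ (y, z)) (X := univ) (x := z) (by rwa [divChart_self])
    (hd.of_le ENat.LEInfty.out).contDiffWithinAt uniqueDiffOn_univ (mem_univ _) (by simp) a b
  simp only [fderivWithin_univ, divChart_self] at h
  have hc : mcChart E g₀ =ᶠ[𝓝 z] _ := mcChart_eq_comp hz
  rw [hc.fderiv_eq, h, ← lieBracket_eq_fderiv_mcChart]
  rfl

end Bracket

/-! ## Logarithmic derivatives of maps from vector spaces to a Lie group -/

section Dlog

variable {E : Type*} [NormedAddCommGroup E] [NormedSpace ℂ E]
  {G : Type*} [TopologicalSpace G] [ChartedSpace E G] [Group G]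
  {V : Type*} [NormedAddCommGroup V] [NormedSpace ℝ V]
  {V' : Type*} [NormedAddCommGroup V'] [NormedSpace ℝ V']

variable (E) in
/-- The pull-back of the right invariant Maurer–Cartan form under `F : X → G`. -/
noncomputable def dlog (F : V → G) (X : Set V) (x : V) : V →L[ℝ] E :=
  fderivWithin ℝ (fun x' => extChartAt 𝓘(ℂ, E) (1 : G) (F x' * (F x)⁻¹)) X x

variable (E) in
/-- The map `F : X → G` is smooth at `x`, in the real sense. -/
def SmoothIntoWithinAt (F : V → G) (X : Set V) (x : V) : Prop :=
  ContinuousWithinAt F X x ∧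
    ContDiffWithinAt ℝ ∞ (fun x' => extChartAt 𝓘(ℂ, E) (F x) (F x')) X x

lemma dlog_congr {F F' : V → G} {X : Set V} (h : EqOn F F' X) {x : V} (hx : x ∈ X) :
    dlog E F X x = dlog E F' X x := by
  unfold dlog
  rw [h hx]
  refine fderivWithin_congr (fun y hy => ?_) ?_
  · simp only [h hy]
  · simp only [h hx]

omit [Group G] in
lemma smoothIntoWithinAt_const (c : G) (X : Set V) (x : V) :
    SmoothIntoWithinAt E (fun _ => c) X x :=
  ⟨continuousWithinAt_const, contDiffWithinAt_const⟩

lemma dlog_const (c : G) (X : Set V) (x : V) : dlog E (fun _ => c) X x = 0 := by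
  simp [dlog]

omit [Group G] in
lemma SmoothIntoWithinAt.comp {F : V → G} {X : Set V} {φ : V' → V} {X' : Set V'} {x : V'}
    (h : SmoothIntoWithinAt E F X (φ x)) (hφ : ContDiffWithinAt ℝ ∞ φ X' x)
    (hm : MapsTo φ X' X) : SmoothIntoWithinAt E (fun y => F (φ y)) X' x :=
  ⟨h.1.comp hφ.continuousWithinAt hm, h.2.comp x hφ hm⟩

variable [LieGroup 𝓘(ℂ, E) ∞ G]

/-- The definition of `dlog` divides by F at a moving base point and so cannot be differentiated
directly. Near x it agrees with a pull-back through the fixed chart at F x, which can. -/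
lemma SmoothIntoWithinAt.eventually_dlog_eq {F : V → G} {X : Set V} {x : V}
    (h : SmoothIntoWithinAt E F X x) (hX : UniqueDiffOn ℝ X) (hx : x ∈ X) :
    ∀ᶠ x' in 𝓝[X] x, HasFDerivWithinAt
      (fun x'' => extChartAt 𝓘(ℂ, E) (1 : G) (F x'' * (F x')⁻¹)) (dlog E F X x') X x' ∧
      dlog E F X x' =
      ((mcChart E (F x) (extChartAt 𝓘(ℂ, E) (F x) (F x'))).restrictScalars ℝ).comp
        (fderivWithin ℝ (fun x' => extChartAt 𝓘(ℂ, E) (F x) (F x')) X x') := by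
  have h1 : ∀ᶠ x' in 𝓝[X] x, F x' ∈ (extChartAt 𝓘(ℂ, E) (F x)).source :=
    h.1.eventually_mem (extChartAt_source_mem_nhds (F x))
  filter_upwards [eventually_eventually_nhdsWithin.2 h1, self_mem_nhdsWithin,
    h.2.eventually_differentiableWithinAt hx] with x' h2 hx' h4
  have h3 := h2.self_of_nhdsWithin hx'
  have h5 : (fun x'' => extChartAt 𝓘(ℂ, E) (1 : G) (F x'' * (F x')⁻¹)) =ᶠ[𝓝[X] x']
      fun x'' => divChart E (F x) (extChartAt 𝓘(ℂ, E) (F x) (F x''),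
        extChartAt 𝓘(ℂ, E) (F x) (F x')) := by
    filter_upwards [h2] with x'' h6
    simp only [divChart, (extChartAt 𝓘(ℂ, E) (F x)).left_inv h6,
      (extChartAt 𝓘(ℂ, E) (F x)).left_inv h3]
  have h6 : DifferentiableAt ℂ (fun y => divChart E (F x) (y, extChartAt 𝓘(ℂ, E) (F x) (F x')))
      (extChartAt 𝓘(ℂ, E) (F x) (F x')) :=
    ((contDiffAt_divChart_self ((extChartAt 𝓘(ℂ, E) (F x)).map_source h3)).differentiableAt
      (by simp)).comp _ (f := fun y => (y, extChartAt 𝓘(ℂ, E) (F x) (F x'))) (by fun_prop)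
  have h7 := ((h6.hasFDerivAt.restrictScalars ℝ).comp_hasFDerivWithinAt x'
    h4.hasFDerivWithinAt).congr_of_eventuallyEq h5
    (h5.eq_of_nhdsWithin hx')
  have h8 := h7.fderivWithin (hX x' hx')
  exact ⟨h7.differentiableWithinAt.hasFDerivWithinAt, h8⟩

lemma SmoothIntoWithinAt.hasFDerivWithinAt {F : V → G} {X : Set V} {x : V}
    (h : SmoothIntoWithinAt E F X x) (hX : UniqueDiffOn ℝ X) (hx : x ∈ X) :
    HasFDerivWithinAt (fun x' => extChartAt 𝓘(ℂ, E) (1 : G) (F x' * (F x)⁻¹))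
      (dlog E F X x) X x :=
  ((h.eventually_dlog_eq hX hx).self_of_nhdsWithin hx).1

lemma dlog_comp {F : V → G} {X : Set V} {φ : V' → V} {X' : Set V'} {x : V'} {φ' : V' →L[ℝ] V}
    (h : SmoothIntoWithinAt E F X (φ x)) (hX : UniqueDiffOn ℝ X) (hX' : UniqueDiffOn ℝ X')
    (hφ : HasFDerivWithinAt φ φ' X' x) (hm : MapsTo φ X' X) (hx : x ∈ X') :
    dlog E (fun y => F (φ y)) X' x = (dlog E F X (φ x)).comp φ' :=
  ((h.hasFDerivWithinAt hX (hm hx)).comp x hφ hm).fderivWithin (hX' x hx)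

lemma restrictScalars_mcChart_hasFDerivAt {g₀ : G} {z : E}
    (hz : z ∈ (extChartAt 𝓘(ℂ, E) g₀).target) :
    HasFDerivAt (fun z => (mcChart E g₀ z).restrictScalars ℝ)
      ((ContinuousLinearMap.restrictScalarsL ℂ E E ℝ ℝ).comp
        ((fderiv ℂ (mcChart E g₀) z).restrictScalars ℝ)) z :=
  (ContinuousLinearMap.restrictScalarsL ℂ E E ℝ ℝ).hasFDerivAt.comp z
    (((contDiffAt_mcChart hz).differentiableAt (by simp)).hasFDerivAt.restrictScalars ℝ)

lemma SmoothIntoWithinAt.differentiableWithinAt_dlog {F : V → G} {X : Set V} {x : V}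
    (h : SmoothIntoWithinAt E F X x) (hX : UniqueDiffOn ℝ X) (hx : x ∈ X) :
    DifferentiableWithinAt ℝ (dlog E F X) X x := by
  have h1 : dlog E F X =ᶠ[𝓝[X] x] _ := (h.eventually_dlog_eq hX hx).mono fun _ h => h.2
  refine DifferentiableWithinAt.congr_of_eventuallyEq_of_mem ?_ h1 hx
  refine DifferentiableWithinAt.clm_comp ?_ ?_
  · exact (restrictScalars_mcChart_hasFDerivAt
      (mem_extChartAt_target (F x))).comp_hasFDerivWithinAt x
        (h.2.differentiableWithinAt (by simp)).hasFDerivWithinAt |>.differentiableWithinAt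
  · exact (h.2.fderivWithin_right (m := 1) hX
      (by rw [one_add_one_eq_two]; exact ENat.LEInfty.out) hx).differentiableWithinAt one_ne_zero

/-- The Maurer–Cartan equation. -/
lemma SmoothIntoWithinAt.fderivWithin_dlog_antisymm [FiniteDimensional ℂ E] {F : V → G} {X : Set V}
    {x : V} (h : SmoothIntoWithinAt E F X x) (hX : UniqueDiffOn ℝ X)
    (hX' : X ⊆ closure (interior X)) (hx : x ∈ X) (u v : V) :
    fderivWithin ℝ (dlog E F X) X x u v - fderivWithin ℝ (dlog E F X) X x v u =
      lieBracket E G (dlog E F X x u) (dlog E F X x v) := by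
  have h1 : dlog E F X =ᶠ[𝓝[X] x] _ := (h.eventually_dlog_eq hX hx).mono fun _ h => h.2
  have hA := restrictScalars_mcChart_hasFDerivAt (E := E) (mem_extChartAt_target (F x))
  rw [h1.fderivWithin_eq_of_mem hx, fderivWithin_pullback_antisymm
    (A := fun z => (mcChart E (F x) z).restrictScalars ℝ)
    (f := fun x' => extChartAt 𝓘(ℂ, E) (F x) (F x')) hA.differentiableAt
    (h.2.of_le ENat.LEInfty.out) hX hx (hX' hx), hA.fderiv]
  have h2 := h1.self_of_nhdsWithin hx
  rw [h2]
  exact fderiv_mcChart_antisymm (mem_extChartAt_target (F x)) _ _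

lemma fderiv_divChart_one (a b : E) :
    fderiv ℂ (divChart E (1 : G)) (extChartAt 𝓘(ℂ, E) (1 : G) 1, extChartAt 𝓘(ℂ, E) (1 : G) 1)
      (a, b) = a - b := by
  have h3 : fderiv ℂ (divChart E (1 : G)) (extChartAt 𝓘(ℂ, E) (1 : G) 1,
      extChartAt 𝓘(ℂ, E) (1 : G) 1) (a, 0) = a := by
    have hd := (contDiffAt_divChart_one (E := E) (G := G)).differentiableAt (by simp)
    have h4 := hd.hasFDerivAt.comp (extChartAt 𝓘(ℂ, E) (1 : G) 1)
      (f := fun w : E => (w, extChartAt 𝓘(ℂ, E) (1 : G) 1)) (hasFDerivAt_prodMk_left _ _)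
    have h5 := DFunLike.congr_fun h4.fderiv a
    have h6 := DFunLike.congr_fun (mcChart_one_self (E := E) (G := G)) a
    simp only [mcChart] at h6
    simp only [Function.comp_def] at h5
    rw [h5] at h6
    simpa using h6
  have : (a, b) = (a, 0) + (0, b) := by simp
  rw [this, map_add, h3, fderiv_divChart_one_inr, sub_eq_add_neg]

lemma adjointAction_hasFDerivAt (g : G) :
    HasFDerivAt (fun y => extChartAt 𝓘(ℂ, E) (1 : G)
      (g * (extChartAt 𝓘(ℂ, E) (1 : G)).symm y * g⁻¹)) (adjointAction E g)
      (extChartAt 𝓘(ℂ, E) (1 : G) 1) := by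
  have hm : MDifferentiableAt 𝓘(ℂ, E) 𝓘(ℂ, E) (fun h : G => g * h * g⁻¹) 1 :=
    ((contMDiff_mul_right (I := 𝓘(ℂ, E)) (n := ∞)).comp
      (contMDiff_mul_left (I := 𝓘(ℂ, E)) (n := ∞))).mdifferentiableAt (by simp)
  rw [adjointAction, tangentDeriv_eq_fderivWithin hm]
  have h := ((mdifferentiableAt_iff _ _).1 hm).2.hasFDerivWithinAt
  simp only [ModelWithCorners.range_eq_univ, hasFDerivWithinAt_univ] at h ⊢
  convert! h using 2
  simp [writtenInExtChartAt]

/-- The logarithmic derivative of a product. -/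
lemma dlog_mul {F K : V → G} {X : Set V} {x : V} (hF : SmoothIntoWithinAt E F X x)
    (hK : SmoothIntoWithinAt E K X x) (hX : UniqueDiffOn ℝ X) (hx : x ∈ X) :
    dlog E (fun y => F y * K y) X x = dlog E F X x +
      ((adjointAction E (F x)).restrictScalars ℝ).comp (dlog E K X x) := by
  have : IsTopologicalGroup G := topologicalGroup_of_lieGroup 𝓘(ℂ, E) ∞
  set e := extChartAt 𝓘(ℂ, E) (1 : G) 1 with he
  set c := extChartAt 𝓘(ℂ, E) (1 : G) with hc
  have hu := hF.hasFDerivWithinAt hX hx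
  have hw := hK.hasFDerivWithinAt hX hx
  have hu0 : c (F x * (F x)⁻¹) = e := by rw [mul_inv_cancel]
  have hw0 : c (K x * (K x)⁻¹) = e := by rw [mul_inv_cancel]
  have hadj : HasFDerivWithinAt (fun y => c (F x * (K y * (K x)⁻¹) * (F x)⁻¹))
      (((adjointAction E (F x)).restrictScalars ℝ).comp (dlog E K X x)) X x := by
    have h1 := (adjointAction_hasFDerivAt (E := E) (F x)).restrictScalars ℝ
    rw [← he, ← hw0] at h1
    have hcont : ContinuousWithinAt (fun y => K y * (K x)⁻¹) X x :=
      hK.1.mul continuousWithinAt_const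
    have := hcont.eventually_mem (s := c.source) (by
      change _ ∈ 𝓝 (K x * (K x)⁻¹)
      rw [mul_inv_cancel]; exact extChartAt_source_mem_nhds (I := 𝓘(ℂ, E)) (1 : G))
    have heq : (fun y => c (F x * (K y * (K x)⁻¹) * (F x)⁻¹)) =ᶠ[𝓝[X] x]
        (fun y => c (F x * c.symm y * (F x)⁻¹)) ∘ fun y => c (K y * (K x)⁻¹) := by
      filter_upwards [this] with y hy
      simp only [Function.comp]
      rw [c.left_inv hy]
    exact (h1.comp_hasFDerivWithinAt x hw).congr_of_eventuallyEq heq (heq.eq_of_nhdsWithin hx)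
  have hd := (contDiffAt_divChart_one (E := E) (G := G)).differentiableAt (by simp)
  have hd1 := hd.hasFDerivAt.restrictScalars ℝ
  have hd2 := hd1
  have hz0 : c (F x * (K x * (K x)⁻¹) * (F x)⁻¹) = e := by simp [he]
  have hs0 : divChart E (1 : G) (e, e) = e := divChart_self _ _
  rw [← he] at hd1 hd2
  -- The product a b is written a (1 b⁻¹)⁻¹, so that the derivative (a, b) ↦ a − b of division at
  -- the identity serves twice.
  have h1 : HasFDerivWithinAt (fun y => divChart E (1 : G)
      (e, c (F x * (K y * (K x)⁻¹) * (F x)⁻¹)))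
      (-((adjointAction E (F x)).restrictScalars ℝ).comp (dlog E K X x)) X x := by
    have h2 := HasFDerivAt.comp_hasFDerivWithinAt x (by rw [hz0]; exact hd1)
      ((hasFDerivWithinAt_const e x X).prodMk hadj)
    convert! h2 using 1
    ext v
    exact ((fderiv_divChart_one _ _).trans (zero_sub _)).symm
  have h3 : HasFDerivWithinAt (fun y => divChart E (1 : G) (c (F y * (F x)⁻¹),
      divChart E (1 : G) (e, c (F x * (K y * (K x)⁻¹) * (F x)⁻¹))))
      (dlog E F X x + ((adjointAction E (F x)).restrictScalars ℝ).comp (dlog E K X x)) X x := by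
    have h2 := HasFDerivAt.comp_hasFDerivWithinAt x (by rw [hu0, hz0, hs0]; exact hd2)
      (hu.prodMk h1)
    convert! h2 using 1
    ext v
    exact ((fderiv_divChart_one _ _).trans (sub_neg_eq_add _ _)).symm
  have hFc : ContinuousWithinAt (fun y => F y * (F x)⁻¹) X x := hF.1.mul continuousWithinAt_const
  have hKc : ContinuousWithinAt (fun y => F x * (K y * (K x)⁻¹) * (F x)⁻¹) X x :=
    (continuousWithinAt_const.mul (hK.1.mul continuousWithinAt_const)).mul continuousWithinAt_const
  have hs : c.source ∈ 𝓝 (1 : G) := extChartAt_source_mem_nhds (I := 𝓘(ℂ, E)) (1 : G)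
  have e1 := hFc.eventually_mem (s := c.source) (by simpa using hs)
  have e2 := hKc.eventually_mem (s := c.source) (by simpa using hs)
  have e3 := hKc.inv.eventually_mem (s := c.source) (by simpa using hs)
  -- F(y)K(y)(F(x)K(x))⁻¹ = (F(y)F(x)⁻¹) · F(x)(K(y)K(x)⁻¹)F(x)⁻¹; the second factor produces the
  -- adjoint action.
  have heq : (fun y => c (F y * K y * (F x * K x)⁻¹)) =ᶠ[𝓝[X] x]
      fun y => divChart E (1 : G) (c (F y * (F x)⁻¹),
        divChart E (1 : G) (e, c (F x * (K y * (K x)⁻¹) * (F x)⁻¹))) := by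
    filter_upwards [e1, e2, e3] with y h1 h2 h3
    simp only [divChart]
    rw [← hc, c.left_inv h1, c.left_inv h2, he, c.left_inv (mem_extChartAt_source (1 : G)), one_mul,
      c.left_inv (by simpa using h3)]
    congr 1
    group
  exact (h3.congr_of_eventuallyEq heq (heq.eq_of_nhdsWithin hx)).fderivWithin (hX x hx)

end Dlog

/-! ### The adjoint action, the bracket, and infinitesimal invariance -/

section Invariance

variable {E : Type*} [NormedAddCommGroup E] [NormedSpace ℂ E]
  {G : Type*} [TopologicalSpace G] [ChartedSpace E G] [Group G] [LieGroup 𝓘(ℂ, E) ∞ G]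
  {V : Type*} [NormedAddCommGroup V] [NormedSpace ℝ V]

lemma contDiffAt_mulChart (g h : G) :
    ContDiffAt ℂ ∞ (fun p : E × E => extChartAt 𝓘(ℂ, E) (g * h)
      ((extChartAt 𝓘(ℂ, E) g).symm p.1 * (extChartAt 𝓘(ℂ, E) h).symm p.2))
      (extChartAt 𝓘(ℂ, E) g g, extChartAt 𝓘(ℂ, E) h h) := by
  rw [← contMDiffAt_iff_contDiffAt]
  have hs : ∀ g : G, ContMDiffAt 𝓘(ℂ, E) 𝓘(ℂ, E) ∞ (extChartAt 𝓘(ℂ, E) g).symm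
      (extChartAt 𝓘(ℂ, E) g g) := fun g =>
    (contMDiffOn_extChartAt_symm g).contMDiffAt (extChartAt_target_mem_nhds g)
  have h1 : ContMDiffAt 𝓘(ℂ, E × E) 𝓘(ℂ, E) ∞
      (fun p : E × E => (extChartAt 𝓘(ℂ, E) g).symm p.1)
      (extChartAt 𝓘(ℂ, E) g g, extChartAt 𝓘(ℂ, E) h h) :=
    ContMDiffAt.comp _ (hs g) contDiff_fst.contMDiff.contMDiffAt
  have h2 : ContMDiffAt 𝓘(ℂ, E × E) 𝓘(ℂ, E) ∞
      (fun p : E × E => (extChartAt 𝓘(ℂ, E) h).symm p.2)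
      (extChartAt 𝓘(ℂ, E) g g, extChartAt 𝓘(ℂ, E) h h) :=
    ContMDiffAt.comp _ (hs h) contDiff_snd.contMDiff.contMDiffAt
  exact ContMDiffAt.comp _ (contMDiffAt_extChartAt' (by simp)) (h1.mul h2)

omit [LieGroup 𝓘(ℂ, E) ∞ G] [NormedSpace ℝ V] in
lemma SmoothIntoWithinAt.eventuallyEq_mulChart {F K : V → G} {X : Set V} {x : V}
    (hF : ContinuousWithinAt F X x) (hK : ContinuousWithinAt K X x) :
    (fun y => extChartAt 𝓘(ℂ, E) (F x * K x) (F y * K y)) =ᶠ[𝓝[X] x]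
      fun y => extChartAt 𝓘(ℂ, E) (F x * K x) ((extChartAt 𝓘(ℂ, E) (F x)).symm
        (extChartAt 𝓘(ℂ, E) (F x) (F y)) * (extChartAt 𝓘(ℂ, E) (K x)).symm
        (extChartAt 𝓘(ℂ, E) (K x) (K y))) := by
  filter_upwards [hF.eventually_mem (extChartAt_source_mem_nhds (I := 𝓘(ℂ, E)) (F x)),
    hK.eventually_mem (extChartAt_source_mem_nhds (I := 𝓘(ℂ, E)) (K x))] with y h1 h2
  rw [(extChartAt 𝓘(ℂ, E) (F x)).left_inv h1, (extChartAt 𝓘(ℂ, E) (K x)).left_inv h2]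

lemma SmoothIntoWithinAt.mul {F K : V → G} {X : Set V} {x : V} (hx : x ∈ X)
    (hF : SmoothIntoWithinAt E F X x) (hK : SmoothIntoWithinAt E K X x) :
    SmoothIntoWithinAt E (fun y => F y * K y) X x := by
  have : IsTopologicalGroup G := topologicalGroup_of_lieGroup 𝓘(ℂ, E) ∞
  refine ⟨hF.1.mul hK.1, ContDiffWithinAt.congr_of_eventuallyEq_of_mem ?_
    (SmoothIntoWithinAt.eventuallyEq_mulChart hF.1 hK.1) hx⟩
  exact ((contDiffAt_mulChart (F x) (K x)).restrict_scalars ℝ).comp_contDiffWithinAt x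
    (f := fun y => (extChartAt 𝓘(ℂ, E) (F x) (F y), extChartAt 𝓘(ℂ, E) (K x) (K y)))
    (hF.2.prodMk hK.2)

lemma smoothIntoWithinAt_chart_symm (g : G) :
    ∀ᶠ z in 𝓝 (extChartAt 𝓘(ℂ, E) g g),
      SmoothIntoWithinAt E (extChartAt 𝓘(ℂ, E) g).symm univ z := by
  filter_upwards [extChartAt_target_mem_nhds (I := 𝓘(ℂ, E)) g] with z hz
  refine ⟨(continuousAt_extChartAt_symm'' hz).continuousWithinAt, ?_⟩
  have h1 : ContMDiffAt 𝓘(ℂ, E) 𝓘(ℂ, E) ∞ (extChartAt 𝓘(ℂ, E) g).symm z :=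
    (contMDiffOn_extChartAt_symm g).contMDiffAt ((isOpen_extChartAt_target g).mem_nhds hz)
  have h2 := contMDiffAt_extChartAt (I := 𝓘(ℂ, E)) (n := ∞) (x := (extChartAt 𝓘(ℂ, E) g).symm z)
  exact (contMDiffAt_iff_contDiffAt.1 (ContMDiffAt.comp z h2 h1)).restrict_scalars ℝ

lemma dlog_chart_symm {g : G} {z : E} (hz : z ∈ (extChartAt 𝓘(ℂ, E) g).target) :
    dlog E (extChartAt 𝓘(ℂ, E) g).symm univ z = (mcChart E g z).restrictScalars ℝ := by
  have h6 : DifferentiableAt ℂ (fun y => divChart E g (y, z)) z :=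
    ((contDiffAt_divChart_self hz).differentiableAt
      (by simp)).comp _ (f := fun y => (y, z)) (by fun_prop)
  rw [dlog, fderivWithin_univ]
  exact (h6.hasFDerivAt.restrictScalars ℝ).fderiv

variable [FiniteDimensional ℂ E]

/-- The derivative of the adjoint action. -/
lemma hasDerivAdjoint (a b : E) :
    DifferentiableAt ℝ (fun z => adjointAction E ((extChartAt 𝓘(ℂ, E) (1 : G)).symm z) b)
      (extChartAt 𝓘(ℂ, E) (1 : G) 1) ∧
    fderiv ℝ (fun z => adjointAction E ((extChartAt 𝓘(ℂ, E) (1 : G)).symm z) b)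
      (extChartAt 𝓘(ℂ, E) (1 : G) 1) a = lieBracket E G a b := by
  set c := extChartAt 𝓘(ℂ, E) (1 : G) with hc
  set e := c 1 with he
  have hce : c.symm e = 1 := c.left_inv (mem_extChartAt_source (1 : G))
  have he' : e ∈ c.target := mem_extChartAt_target (1 : G)
  have hev : ∀ᶠ z in 𝓝 e, SmoothIntoWithinAt E c.symm univ z := smoothIntoWithinAt_chart_symm 1
  have hF : ∀ᶠ p : E × E in 𝓝 (e, e), SmoothIntoWithinAt E (fun p : E × E => c.symm p.1) univ p := by
    filter_upwards [(continuousAt_fst (p := (e, e))).eventually hev] with p hp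
    exact hp.comp contDiff_fst.contDiffWithinAt (mapsTo_univ _ _)
  have hK : ∀ᶠ p : E × E in 𝓝 (e, e), SmoothIntoWithinAt E (fun p : E × E => c.symm p.2) univ p := by
    filter_upwards [(continuousAt_snd (p := (e, e))).eventually hev] with p hp
    exact hp.comp contDiff_snd.contDiffWithinAt (mapsTo_univ _ _)
  -- The Maurer–Cartan equation for the multiplication map, on the vectors (a, 0) and (0, b), gives
  -- the claim: Θ(z, e)(0, b) is Ad_z b, while Θ(e, z)(a, 0) = a does not depend on z.
  set Θ := dlog E (fun p : E × E => c.symm p.1 * c.symm p.2) univ with hΘ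
  have hform : ∀ᶠ p : E × E in 𝓝 (e, e), ∀ v, Θ p v = mcChart E (1 : G) p.1 v.1 +
      adjointAction E (c.symm p.1) (mcChart E (1 : G) p.2 v.2) := by
    have ht : ∀ᶠ z in 𝓝 e, z ∈ c.target := extChartAt_target_mem_nhds (I := 𝓘(ℂ, E)) (1 : G)
    filter_upwards [hF, hK, (continuousAt_fst (p := (e, e))).eventually ht,
      (continuousAt_snd (p := (e, e))).eventually ht,
      (continuousAt_fst (p := (e, e))).eventually hev,
      (continuousAt_snd (p := (e, e))).eventually hev] with p h1 h2 h3 h4 h5 h6 v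
    rw [hΘ, dlog_mul h1 h2 uniqueDiffOn_univ (mem_univ _),
      dlog_comp (φ := Prod.fst) (X := univ) h5 uniqueDiffOn_univ uniqueDiffOn_univ
        hasFDerivWithinAt_fst (mapsTo_univ _ _) (mem_univ _),
      dlog_comp (φ := Prod.snd) (X := univ) h6 uniqueDiffOn_univ uniqueDiffOn_univ
        hasFDerivWithinAt_snd (mapsTo_univ _ _) (mem_univ _), dlog_chart_symm h3,
      dlog_chart_symm h4]
    rfl
  have hS := SmoothIntoWithinAt.mul (mem_univ _) hF.self_of_nhds hK.self_of_nhds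
  have hd := (hS.differentiableWithinAt_dlog uniqueDiffOn_univ (mem_univ _)).differentiableAt
    univ_mem
  rw [← hΘ] at hd
  have hMC := hS.fderivWithin_dlog_antisymm uniqueDiffOn_univ (by simp) (mem_univ _) (a, 0) (0, b)
  rw [← hΘ, fderivWithin_univ] at hMC
  have hone := mcChart_one_self (E := E) (G := G)
  rw [← hc, ← he] at hone
  have hone' : adjointAction E (1 : G) = ContinuousLinearMap.id ℂ E := by
    simp [adjointAction, tangentDeriv_id]
  have hΘ1 : ∀ v, Θ (e, e) v = v.1 + v.2 := fun v => by
    rw [hform.self_of_nhds, hone, hce, hone']; rfl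
  have hcurve1 : HasFDerivAt (fun z : E => (z, e)) (ContinuousLinearMap.inl ℝ E E) e :=
    hasFDerivAt_prodMk_left e e
  have hcurve2 : HasFDerivAt (fun z : E => (e, z)) (ContinuousLinearMap.inr ℝ E E) e :=
    hasFDerivAt_prodMk_right e e
  have hAd : (fun z => adjointAction E (c.symm z) b) =ᶠ[𝓝 e] fun z => Θ (z, e) (0, b) := by
    filter_upwards [hcurve1.continuousAt.eventually hform] with z hz
    rw [hz]
    simp [hone]
  have h1 := (HasFDerivAt.comp (g := Θ) (f := fun z : E => (z, e)) e hd.hasFDerivAt hcurve1).clm_apply (hasFDerivAt_const ((0 : E), b) e)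
  have h2 := (HasFDerivAt.comp (g := Θ) (f := fun z : E => (e, z)) e hd.hasFDerivAt hcurve2).clm_apply (hasFDerivAt_const (a, (0 : E)) e)
  have h3 : (fun z => Θ (e, z) (a, 0)) =ᶠ[𝓝 e] fun _ => a := by
    filter_upwards [hcurve2.continuousAt.eventually hform] with z hz
    rw [hz]
    simp [hone]
  have h4 := h2.unique ((hasFDerivAt_const a e).congr_of_eventuallyEq h3)
  have h4' := DFunLike.congr_fun h4 b
  have h1' := h1.congr_of_eventuallyEq hAd
  refine ⟨h1'.differentiableAt, ?_⟩
  rw [h1'.fderiv]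
  simp only [hΘ1, add_zero, zero_add] at hMC
  rw [← hMC]
  simp at h4' ⊢
  rw [h4', sub_zero]

variable {P : E →L[ℂ] E →L[ℂ] ℂ}

/-- The infinitesimal form of the invariance of `P`. -/
lemma IsInvariantQuadratic.lieBracket_add (hP : IsInvariantQuadratic G P) (a b d : E) :
    P (lieBracket E G a b) d + P b (lieBracket E G a d) = 0 := by
  obtain ⟨h1, h2⟩ := hasDerivAdjoint (G := G) a b
  obtain ⟨h3, h4⟩ := hasDerivAdjoint (G := G) a d
  have hone' : adjointAction E (1 : G) = ContinuousLinearMap.id ℂ E := by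
    simp [adjointAction, tangentDeriv_id]
  -- Invariance makes z ↦ P(Ad_z b, Ad_z d) constant; its derivative at the identity is the asserted
  -- sum.
  have h5 := HasFDerivAt.comp (f := fun z =>
      (adjointAction E ((extChartAt 𝓘(ℂ, E) (1 : G)).symm z) b,
      adjointAction E ((extChartAt 𝓘(ℂ, E) (1 : G)).symm z) d)) _
    ((P.bilinearRestrictScalars ℝ).isBoundedBilinearMap.hasFDerivAt _)
    (h1.hasFDerivAt.prodMk h3.hasFDerivAt)
  have h6 : ((fun p : E × E => (P.bilinearRestrictScalars ℝ) p.1 p.2) ∘ fun z =>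
      (adjointAction E ((extChartAt 𝓘(ℂ, E) (1 : G)).symm z) b,
      adjointAction E ((extChartAt 𝓘(ℂ, E) (1 : G)).symm z) d)) = fun _ => P b d := by
    funext z
    simp [hP.invariant]
  rw [h6] at h5
  have h7 := DFunLike.congr_fun (h5.unique (hasFDerivAt_const _ _)) a
  simp only [extChartAt_to_inv, hone'] at h7
  simp [IsBoundedBilinearMap.deriv] at h2 h4 h7
  rw [h2, h4] at h7
  rw [add_comm]
  exact h7

lemma lieBracket_skew (a b : E) : lieBracket E G a b = -lieBracket E G b a := by
  rw [lieBracket_eq_fderiv_mcChart, lieBracket_eq_fderiv_mcChart, neg_sub]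

lemma lieBracket_jacobi (a b d : E) :
    lieBracket E G a (lieBracket E G b d) = lieBracket E G (lieBracket E G a b) d +
      lieBracket E G b (lieBracket E G a d) := by
  have : CompleteSpace E := FiniteDimensional.complete ℂ E
  have : LieGroup 𝓘(ℂ, E) (minSmoothness ℂ 3) G :=
    LieGroup.of_le (n := ∞) (by
      rw [minSmoothness_of_isRCLikeNormedField]; exact WithTop.coe_le_coe.2 le_top)
  exact leibniz_lie (L₁ := GroupLieAlgebra 𝓘(ℂ, E) G) (L₂ := GroupLieAlgebra 𝓘(ℂ, E) G)
    (M := GroupLieAlgebra 𝓘(ℂ, E) G) a b d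

lemma IsInvariantQuadratic.lieBracket_swap_right (a b d : E) :
    P a (lieBracket E G b d) = -P a (lieBracket E G d b) := by
  rw [lieBracket_skew b d, map_neg]

lemma IsInvariantQuadratic.lieBracket_swap_outer (hP : IsInvariantQuadratic G P) (a b d : E) :
    P a (lieBracket E G b d) = -P d (lieBracket E G b a) := by
  rw [hP.symm a, ← add_eq_zero_iff_eq_neg]
  exact hP.lieBracket_add b d a

end Invariance

/-! ### Leibniz rules for complex bilinear maps and real derivatives -/

section Bilinear

variable {V : Type*} [NormedAddCommGroup V] [NormedSpace ℝ V]
  {W : Type*} [NormedAddCommGroup W] [NormedSpace ℂ W]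
  {W' : Type*} [NormedAddCommGroup W'] [NormedSpace ℂ W']
  {W'' : Type*} [NormedAddCommGroup W''] [NormedSpace ℂ W'']

lemma HasFDerivWithinAt.complexBilinear (B : W →L[ℂ] W' →L[ℂ] W'') {f : V → W} {g : V → W'}
    {f' : V →L[ℝ] W} {g' : V →L[ℝ] W'} {X : Set V} {x : V}
    (hf : HasFDerivWithinAt f f' X x) (hg : HasFDerivWithinAt g g' X x) :
    HasFDerivWithinAt (fun y => B (f y) (g y))
      ((B.bilinearRestrictScalars ℝ).precompR V (f x) g' +
        (B.bilinearRestrictScalars ℝ).precompL V f' (g x)) X x :=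
  (B.bilinearRestrictScalars ℝ).hasFDerivWithinAt_of_bilinear hf hg

lemma fderivWithin_complexBilinear (B : W →L[ℂ] W' →L[ℂ] W'') {f : V → W} {g : V → W'}
    {X : Set V} {x : V} (hf : DifferentiableWithinAt ℝ f X x) (hg : DifferentiableWithinAt ℝ g X x)
    (hX : UniqueDiffWithinAt ℝ X x) (u : V) :
    fderivWithin ℝ (fun y => B (f y) (g y)) X x u =
      B (f x) (fderivWithin ℝ g X x u) + B (fderivWithin ℝ f X x u) (g x) := by
  rw [(HasFDerivWithinAt.complexBilinear B hf.hasFDerivWithinAt hg.hasFDerivWithinAt).fderivWithin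
    hX]
  simp

lemma fderivWithin_evalConst {Θ : V → V →L[ℝ] W} {X : Set V} {x : V}
    (h : DifferentiableWithinAt ℝ Θ X x) (hX : UniqueDiffWithinAt ℝ X x) (u v : V) :
    fderivWithin ℝ (fun y => Θ y v) X x u = fderivWithin ℝ Θ X x u v := by
  rw [(h.hasFDerivWithinAt.clm_apply (hasFDerivWithinAt_const v x X)).fderivWithin hX]
  simp

end Bilinear

/-! ### The trilinear form P(a, [b, c]) and its closedness -/

section Cartan

variable {E : Type*} [NormedAddCommGroup E] [NormedSpace ℂ E] [FiniteDimensional ℂ E]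
  {G : Type*} [TopologicalSpace G] [ChartedSpace E G] [Group G] [LieGroup 𝓘(ℂ, E) ∞ G]
  {V : Type*} [NormedAddCommGroup V] [NormedSpace ℝ V]
  {P : E →L[ℂ] E →L[ℂ] ℂ}

variable (G) in
/-- The trilinear form `P(a, [b, c])`. -/
noncomputable def cartanForm (P : E →L[ℂ] E →L[ℂ] ℂ) (a b c : E) : ℂ := P a (lieBracket E G b c)

/-- Left translation by g multiplies the logarithmic derivative by Ad_g. Comparing the Maurer–Cartan
equations before and after translation gives the compatibility. -/
lemma adjointAction_lieBracket (g : G) (a b : E) :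
    adjointAction E g (lieBracket E G a b) =
      lieBracket E G (adjointAction E g a) (adjointAction E g b) := by
  set c := extChartAt 𝓘(ℂ, E) (1 : G) with hc
  set e := c 1 with he
  have he' : e ∈ c.target := mem_extChartAt_target (1 : G)
  have hev : ∀ᶠ z in 𝓝 e, SmoothIntoWithinAt E c.symm univ z := smoothIntoWithinAt_chart_symm 1
  have hS := hev.self_of_nhds
  have hform : dlog E (fun z => g * c.symm z) univ =ᶠ[𝓝 e] fun z =>
      ((adjointAction E g).restrictScalars ℝ).comp (dlog E c.symm univ z) := by
    filter_upwards [hev] with z hz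
    rw [dlog_mul (smoothIntoWithinAt_const g _ _) hz uniqueDiffOn_univ (mem_univ _), dlog_const,
      zero_add]
  have hd := hS.differentiableWithinAt_dlog uniqueDiffOn_univ (mem_univ _)
  have hone : ∀ v, dlog E c.symm univ e v = v := fun v => by
    rw [dlog_chart_symm he', he, hc, mcChart_one_self]; rfl
  have h1 := hS.fderivWithin_dlog_antisymm uniqueDiffOn_univ (by simp) (mem_univ _) a b
  have h2 := (SmoothIntoWithinAt.mul (mem_univ _) (smoothIntoWithinAt_const g _ _)
    hS).fderivWithin_dlog_antisymm uniqueDiffOn_univ (by simp) (mem_univ _) a b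
  have h3 : HasFDerivAt (fun z => ((adjointAction E g).restrictScalars ℝ).comp
      (dlog E c.symm univ z)) ((ContinuousLinearMap.compL ℝ E E E
        ((adjointAction E g).restrictScalars ℝ)).comp (fderivWithin ℝ (dlog E c.symm univ) univ e))
      e := by
    rw [fderivWithin_univ]
    exact ((ContinuousLinearMap.compL ℝ E E E
        ((adjointAction E g).restrictScalars ℝ)).hasFDerivAt).comp e
        (hd.differentiableAt univ_mem).hasFDerivAt
  rw [fderivWithin_univ, (h3.congr_of_eventuallyEq hform).fderiv, hform.self_of_nhds] at h2
  simp only [ContinuousLinearMap.comp_apply, ContinuousLinearMap.compL_apply, hone,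
    ContinuousLinearMap.coe_restrictScalars'] at h1 h2
  rw [← map_sub, h1] at h2
  exact h2

namespace IsInvariantQuadratic

lemma cartanForm_swap_right (a b c : E) : cartanForm G P a b c = -cartanForm G P a c b :=
  lieBracket_swap_right a b c

lemma cartanForm_swap_left (hP : IsInvariantQuadratic G P) (a b c : E) :
    cartanForm G P a b c = -cartanForm G P b a c := by
  rw [cartanForm_swap_right, cartanForm_swap_right b]
  simp only [cartanForm]
  rw [hP.lieBracket_swap_outer, neg_neg, lieBracket_swap_right]

lemma cartanForm_adjointAction (hP : IsInvariantQuadratic G P) (g : G) (a b c : E) :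
    cartanForm G P (adjointAction E g a) (adjointAction E g b) (adjointAction E g c) =
      cartanForm G P a b c := by
  rw [cartanForm, ← adjointAction_lieBracket, hP.invariant, cartanForm]

/-- Invariance moves a out of each bracket, P([a, x], z) = P(a, [x, z]), and the sum becomes P(a, ·)
of the Jacobi identity for b, c, d. -/
lemma lieBracket_jacobi_apply (hP : IsInvariantQuadratic G P) (a b c d : E) :
    P (lieBracket E G a b) (lieBracket E G c d) - P (lieBracket E G a c) (lieBracket E G b d) +
      P (lieBracket E G a d) (lieBracket E G b c) = 0 := by
  have h : ∀ x y z : E, P (lieBracket E G a x) z = - P x (lieBracket E G a z) := fun x y z => by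
    linear_combination hP.lieBracket_add a x z
  have hJ := congr_arg (P a) (lieBracket_jacobi (G := G) b c d)
  have h' : ∀ x z : E, P (lieBracket E G a x) z = P a (lieBracket E G x z) := fun x z => by
    rw [lieBracket_skew a x]
    have := hP.lieBracket_add x a z
    simp only [map_neg, neg_apply]
    linear_combination -this
  rw [h', h', h', hJ, lieBracket_skew (lieBracket E G b c) d]
  simp only [map_add, map_neg]
  ring

variable {F : V → G} {X : Set V} {x : V}

lemma fderivWithin_cartanForm {f₁ f₂ f₃ : V → E} (h₁ : DifferentiableWithinAt ℝ f₁ X x)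
    (h₂ : DifferentiableWithinAt ℝ f₂ X x) (h₃ : DifferentiableWithinAt ℝ f₃ X x)
    (hX : UniqueDiffWithinAt ℝ X x) (u : V) :
    fderivWithin ℝ (fun y => cartanForm G P (f₁ y) (f₂ y) (f₃ y)) X x u =
      cartanForm G P (fderivWithin ℝ f₁ X x u) (f₂ x) (f₃ x) +
      cartanForm G P (f₁ x) (fderivWithin ℝ f₂ X x u) (f₃ x) +
      cartanForm G P (f₁ x) (f₂ x) (fderivWithin ℝ f₃ X x u) := by
  have hd : DifferentiableWithinAt ℝ (fun y => lieBracket E G (f₂ y) (f₃ y)) X x :=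
    (HasFDerivWithinAt.complexBilinear _ h₂.hasFDerivWithinAt
      h₃.hasFDerivWithinAt).differentiableWithinAt
  simp only [cartanForm]
  rw [fderivWithin_complexBilinear P h₁ hd hX, fderivWithin_complexBilinear _ h₂ h₃ hX, map_add]
  ring

/-- The `3`-form `P(Θ, [Θ, Θ])` is closed. -/
lemma cartanForm_dlog_closed (hP : IsInvariantQuadratic G P) (h : SmoothIntoWithinAt E F X x)
    (hX : UniqueDiffOn ℝ X) (hX' : X ⊆ closure (interior X)) (hx : x ∈ X) (u : Fin 4 → V) :
    let k := fun (a b c : Fin 4) (y : V) => cartanForm G P (dlog E F X y (u a)) (dlog E F X y (u b))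
      (dlog E F X y (u c))
    fderivWithin ℝ (k 1 2 3) X x (u 0) - fderivWithin ℝ (k 0 2 3) X x (u 1) +
      fderivWithin ℝ (k 0 1 3) X x (u 2) - fderivWithin ℝ (k 0 1 2) X x (u 3) = 0 := by
  intro k
  have hd := h.differentiableWithinAt_dlog hX hx
  have hdv : ∀ v, DifferentiableWithinAt ℝ (fun y => dlog E F X y v) X x := fun v =>
    hd.clm_apply (differentiableWithinAt_const v)
  have hMC := fun a b => h.fderivWithin_dlog_antisymm hX hX' hx (u a) (u b)
  simp only [k, fderivWithin_cartanForm (hdv _) (hdv _) (hdv _) (hX x hx),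
    fderivWithin_evalConst hd (hX x hx)]
  set D := fun a b => fderivWithin ℝ (dlog E F X) X x (u a) (u b) with hD
  set θ := fun a => dlog E F X x (u a) with hθ
  -- Used below for a < b only. The twelve derivative terms then cancel in pairs and leave six
  -- bracket terms, equal in pairs by symmetry of P; hence twice the Jacobi sum.
  have hMC' : ∀ a b, D a b = D b a + lieBracket E G (θ a) (θ b) := fun a b =>
    eq_add_of_sub_eq' (hMC a b)
  have hJ := hP.lieBracket_jacobi_apply (θ 0) (θ 1) (θ 2) (θ 3)
  have r : ∀ a b c, cartanForm G P a b c = -cartanForm G P a c b := cartanForm_swap_right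
  have l : ∀ a b c, cartanForm G P a b c = -cartanForm G P b a c := hP.cartanForm_swap_left
  have hadd : ∀ a b c d, cartanForm G P (a + b) c d = cartanForm G P a c d + cartanForm G P b c d :=
    fun a b c d => by simp [cartanForm]
  have hm : ∀ (w : E) (b c : Fin 4), cartanForm G P (θ b) w (θ c) = -cartanForm G P w (θ b) (θ c) :=
    fun w b c => l _ _ _
  have hr : ∀ (w : E) (b c : Fin 4), cartanForm G P (θ b) (θ c) w = cartanForm G P w (θ b) (θ c) :=
    fun w b c => by rw [r, l, neg_neg]
  change cartanForm G P (D 0 1) (θ 2) (θ 3) + cartanForm G P (θ 1) (D 0 2) (θ 3) +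
    cartanForm G P (θ 1) (θ 2) (D 0 3) - (cartanForm G P (D 1 0) (θ 2) (θ 3) +
    cartanForm G P (θ 0) (D 1 2) (θ 3) + cartanForm G P (θ 0) (θ 2) (D 1 3)) +
    (cartanForm G P (D 2 0) (θ 1) (θ 3) + cartanForm G P (θ 0) (D 2 1) (θ 3) +
    cartanForm G P (θ 0) (θ 1) (D 2 3)) - (cartanForm G P (D 3 0) (θ 1) (θ 2) +
    cartanForm G P (θ 0) (D 3 1) (θ 2) + cartanForm G P (θ 0) (θ 1) (D 3 2)) = 0
  rw [hm, hm, hm, hm, hr, hr, hr, hr, hMC' 0 1, hMC' 0 2, hMC' 0 3, hMC' 1 2, hMC' 1 3, hMC' 2 3]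
  simp only [hadd]
  have hb : ∀ a b c d, cartanForm G P (lieBracket E G (θ a) (θ b)) (θ c) (θ d) =
    P (lieBracket E G (θ a) (θ b)) (lieBracket E G (θ c) (θ d)) := fun _ _ _ _ => rfl
  simp only [hb]
  have s := hP.symm
  rw [s (lieBracket E G (θ 1) (θ 2)), s (lieBracket E G (θ 1) (θ 3)),
    s (lieBracket E G (θ 2) (θ 3))]
  linear_combination 2 * hJ

/-- The exterior derivative of `P(B ∧ C)` for two logarithmic derivatives `B` and `C`. -/
lemma fderivWithin_dlog_wedge (hP : IsInvariantQuadratic G P) {F' : V → G}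
    (h : SmoothIntoWithinAt E F X x) (h' : SmoothIntoWithinAt E F' X x)
    (hX : UniqueDiffOn ℝ X) (hX' : X ⊆ closure (interior X)) (hx : x ∈ X) (u v w : V) :
    let k := fun (a b : V) (y : V) => P (dlog E F X y a) (dlog E F' X y b) -
      P (dlog E F X y b) (dlog E F' X y a)
    let κ := fun Θ : V →L[ℝ] E => cartanForm G P (Θ u) (Θ v) (Θ w)
    fderivWithin ℝ (k v w) X x u - fderivWithin ℝ (k u w) X x v +
      fderivWithin ℝ (k u v) X x w =
      κ (dlog E F' X x - dlog E F X x) - κ (dlog E F' X x) + κ (dlog E F X x) := by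
  intro k κ
  have hd := h.differentiableWithinAt_dlog hX hx
  have hdv : ∀ v, DifferentiableWithinAt ℝ (fun y => dlog E F X y v) X x := fun v =>
    hd.clm_apply (differentiableWithinAt_const v)
  have hd' := h'.differentiableWithinAt_dlog hX hx
  have hdv' : ∀ v, DifferentiableWithinAt ℝ (fun y => dlog E F' X y v) X x := fun v =>
    hd'.clm_apply (differentiableWithinAt_const v)
  have hMC := fun a b => h.fderivWithin_dlog_antisymm hX hX' hx a b
  have hMC' := fun a b => h'.fderivWithin_dlog_antisymm hX hX' hx a b
  have hdP : ∀ a b, DifferentiableWithinAt ℝ (fun y => P (dlog E F X y a) (dlog E F' X y b)) X x :=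
    fun a b => (HasFDerivWithinAt.complexBilinear P (hdv a).hasFDerivWithinAt
      (hdv' b).hasFDerivWithinAt).differentiableWithinAt
  have hk : ∀ a b c, fderivWithin ℝ (k a b) X x c =
      P (dlog E F X x a) (fderivWithin ℝ (dlog E F' X) X x c b) +
      P (fderivWithin ℝ (dlog E F X) X x c a) (dlog E F' X x b) -
      (P (dlog E F X x b) (fderivWithin ℝ (dlog E F' X) X x c a) +
      P (fderivWithin ℝ (dlog E F X) X x c b) (dlog E F' X x a)) := fun a b c => by
    simp only [k]
    rw [fderivWithin_fun_sub (hX x hx) (hdP _ _) (hdP _ _), sub_apply,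
      fderivWithin_complexBilinear P (hdv _) (hdv' _) (hX x hx),
      fderivWithin_complexBilinear P (hdv _) (hdv' _) (hX x hx),
      fderivWithin_evalConst hd (hX x hx), fderivWithin_evalConst hd' (hX x hx),
      fderivWithin_evalConst hd (hX x hx), fderivWithin_evalConst hd' (hX x hx)]
  -- Substituting both Maurer–Cartan equations makes the derivatives of the two logarithmic
  -- derivatives cancel. What remains is pointwise and follows from the alternation of P(a, [b, c]).
  rw [hk, hk, hk, eq_add_of_sub_eq' (hMC u v), eq_add_of_sub_eq' (hMC u w),
    eq_add_of_sub_eq' (hMC v w), eq_add_of_sub_eq' (hMC' u v), eq_add_of_sub_eq' (hMC' u w),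
    eq_add_of_sub_eq' (hMC' v w)]
  simp only [κ, cartanForm, sub_apply, map_sub, map_add,
    add_apply]
  generalize dlog E F X x u = b₁
  generalize dlog E F X x v = b₂
  generalize dlog E F X x w = b₃
  generalize dlog E F' X x u = c₁
  generalize dlog E F' X x v = c₂
  generalize dlog E F' X x w = c₃
  have s : ∀ a b c : E, P (lieBracket E G a b) c = P c (lieBracket E G a b) := fun a b c =>
    hP.symm _ _
  have l : ∀ a b c : E, P a (lieBracket E G b c) = -P b (lieBracket E G a c) :=
    hP.cartanForm_swap_left
  have r : ∀ a b c : E, P a (lieBracket E G b c) = -P a (lieBracket E G c b) :=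
    lieBracket_swap_right
  simp only [s]
  have cyc : ∀ a b c : E, P a (lieBracket E G b c) = P c (lieBracket E G a b) := fun a b c => by
    rw [r, l, neg_neg]
  linear_combination cyc c₁ c₂ b₃ + l c₁ b₂ c₃ - l b₁ c₂ b₃ - cyc b₁ b₂ c₃

end IsInvariantQuadratic

end Cartan

/-! ### Families of simplices that are holomorphic in the parameter -/

section Families

variable {E : Type*} [NormedAddCommGroup E] [NormedSpace ℂ E]
  {G : Type*} [TopologicalSpace G] [ChartedSpace E G]
  {Y : Type*} [NormedAddCommGroup Y] [NormedSpace ℂ Y]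
  {W : Type*} [NormedAddCommGroup W] [NormedSpace ℂ W] {q : ℕ}

lemma hasFDerivAt_prod_slice {f : Y × (Fin q → ℝ) → W} {Ω : Set Y} (hΩ : IsOpen Ω) {y : Y}
    {t : Fin q → ℝ} (hf : DifferentiableWithinAt ℝ f (Ω ×ˢ stdSimp q) (y, t)) (hy : y ∈ Ω)
    (ht : t ∈ stdSimp q) :
    HasFDerivAt (fun y => f (y, t)) ((fderivWithin ℝ f (Ω ×ˢ stdSimp q) (y, t)).comp
      (ContinuousLinearMap.inl ℝ Y (Fin q → ℝ))) y :=
  (HasFDerivWithinAt.comp (g := f) (f := fun y => (y, t)) y hf.hasFDerivWithinAt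
    (hasFDerivAt_prodMk_left y t).hasFDerivWithinAt fun _ h => ⟨h, ht⟩).hasFDerivAt
    (hΩ.mem_nhds hy)

lemma hasFDerivWithinAt_prod_slice {f : Y × (Fin q → ℝ) → W} {Ω : Set Y} {y : Y}
    {t : Fin q → ℝ} (hf : DifferentiableWithinAt ℝ f (Ω ×ˢ stdSimp q) (y, t)) (hy : y ∈ Ω) :
    HasFDerivWithinAt (fun t => f (y, t)) ((fderivWithin ℝ f (Ω ×ˢ stdSimp q) (y, t)).comp
      (ContinuousLinearMap.inr ℝ Y (Fin q → ℝ))) (stdSimp q) t :=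
  HasFDerivWithinAt.comp (g := f) (f := fun t => (y, t)) t hf.hasFDerivWithinAt
    (hasFDerivAt_prodMk_right y t).hasFDerivWithinAt fun _ h => ⟨hy, h⟩

variable (E) in
/-- The family `F : Ω × Δ_q → G` is smooth in the real sense, and holomorphic in the first
variable. -/
structure HolFamily (F : Y × (Fin q → ℝ) → G) (Ω : Set Y) : Prop where
  continuousOn : ContinuousOn F (Ω ×ˢ stdSimp q)
  partHol : ∀ x ∈ Ω ×ˢ stdSimp q, PartHolWithinAt
    (fun x' => extChartAt 𝓘(ℂ, E) (F x) (F x')) (Ω ×ˢ stdSimp q) x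

namespace HolFamily

variable {F K : Y × (Fin q → ℝ) → G} {Ω : Set Y}

lemma smooth (h : HolFamily E F Ω) {x : Y × (Fin q → ℝ)} (hx : x ∈ Ω ×ˢ stdSimp q) :
    SmoothIntoWithinAt E F (Ω ×ˢ stdSimp q) x :=
  ⟨h.continuousOn x hx, (h.partHol x hx).contDiffWithinAt⟩

lemma differentiableWithinAt_chart (h : HolFamily E F Ω) {x : Y × (Fin q → ℝ)}
    (hx : x ∈ Ω ×ˢ stdSimp q) : DifferentiableWithinAt ℝ
      (fun x' => extChartAt 𝓘(ℂ, E) (F x) (F x')) (Ω ×ˢ stdSimp q) x :=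
  (h.partHol x hx).contDiffWithinAt.differentiableWithinAt (by simp)

lemma of_contMDiffOn (hΩ : IsOpen Ω) {h : Y → G} (hh : ContMDiffOn 𝓘(ℂ, Y) 𝓘(ℂ, E) ∞ h Ω) :
    HolFamily E (fun x : Y × (Fin q → ℝ) => h x.1) Ω := by
  have hU := uniqueDiffOn_prod_stdSimp (q := q) hΩ
  refine ⟨hh.continuousOn.comp continuousOn_fst fun x hx => hx.1, fun x hx => ?_⟩
  have h1 : PartHolWithinAt (Prod.fst : Y × (Fin q → ℝ) → Y) (Ω ×ˢ stdSimp q) x := by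
    refine ⟨contDiff_fst.contDiffWithinAt, ?_⟩
    filter_upwards [self_mem_nhdsWithin] with x' hx' w
    rw [hasFDerivWithinAt_fst.fderivWithin (hU x' hx')]
    rfl
  refine h1.comp (Φ := fun y => extChartAt 𝓘(ℂ, E) (h x.1) (h y)) ?_ hU hx
  rw [← contMDiffAt_iff_contDiffAt]
  exact ContMDiffAt.comp _ contMDiffAt_extChartAt (hh.contMDiffAt (hΩ.mem_nhds hx.1))

/-- For fixed t the real derivative in y commutes with i and so is the complex manifold derivative.
This links derivatives within Ω × Δ_q to `tangentDeriv`. -/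
lemma hasMFDerivAt_slice (h : HolFamily E F Ω) (hΩ : IsOpen Ω) {y : Y} {t : Fin q → ℝ}
    (hy : y ∈ Ω) (ht : t ∈ stdSimp q) :
    MDifferentiableAt 𝓘(ℂ, Y) 𝓘(ℂ, E) (fun y => F (y, t)) y ∧
    ∀ v, tangentDeriv 𝓘(ℂ, Y) 𝓘(ℂ, E) (fun y => F (y, t)) y v =
      fderivWithin ℝ (fun x' => extChartAt 𝓘(ℂ, E) (F (y, t)) (F x')) (Ω ×ˢ stdSimp q) (y, t)
        (v, 0) := by
  have hx : (y, t) ∈ Ω ×ˢ stdSimp q := ⟨hy, ht⟩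
  have h1 := hasFDerivAt_prod_slice hΩ (h.differentiableWithinAt_chart hx) hy ht
  set D := (fderivWithin ℝ (fun x' => extChartAt 𝓘(ℂ, E) (F (y, t)) (F x')) (Ω ×ˢ stdSimp q)
    (y, t)).comp (ContinuousLinearMap.inl ℝ Y (Fin q → ℝ)) with hD
  have hI : ∀ w, D (Complex.I • w) = Complex.I • D w := fun w =>
    (h.partHol _ hx).hol.self_of_nhdsWithin hx w
  let D' : Y →L[ℂ] E :=
    { D with
      map_smul' := fun c v => by
        have hc : c • v = c.re • v + c.im • (Complex.I • v) := by
          conv_lhs => rw [← Complex.re_add_im c]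
          rw [add_smul, mul_smul, Complex.coe_smul, Complex.coe_smul]
        have hc' : c • D v = c.re • D v + c.im • (Complex.I • D v) := by
          conv_lhs => rw [← Complex.re_add_im c]
          rw [add_smul, mul_smul, Complex.coe_smul, Complex.coe_smul]
        change D (c • v) = c • D v
        rw [hc, hc', map_add, map_smul, map_smul, hI] }
  have h2 : HasFDerivAt (fun y' => extChartAt 𝓘(ℂ, E) (F (y, t)) (F (y', t))) D' y :=
    hasFDerivAt_of_restrictScalars ℝ h1 rfl
  have h3 : ContinuousAt (fun y => F (y, t)) y :=
    (ContinuousOn.comp h.continuousOn (f := fun y => (y, t)) (by fun_prop)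
      fun _ h => ⟨h, ht⟩).continuousAt (hΩ.mem_nhds hy)
  have h4 : MDifferentiableAt 𝓘(ℂ, Y) 𝓘(ℂ, E) (fun y => F (y, t)) y := by
    rw [mdifferentiableAt_iff]
    exact ⟨h3, h2.differentiableAt.differentiableWithinAt⟩
  refine ⟨h4, fun v => ?_⟩
  rw [tangentDeriv_eq_fderivWithin h4]
  have h5 : fderivWithin ℂ (writtenInExtChartAt 𝓘(ℂ, Y) 𝓘(ℂ, E) y fun y => F (y, t))
      (range 𝓘(ℂ, Y)) (extChartAt 𝓘(ℂ, Y) y y) = D' := by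
    simp only [modelWithCornersSelf_coe, range_id, fderivWithin_univ]
    exact h2.fderiv
  rw [h5]
  rfl

variable [Group G] [LieGroup 𝓘(ℂ, E) ∞ G]

lemma mul (h : HolFamily E F Ω) (hK : HolFamily E K Ω) (hΩ : IsOpen Ω) :
    HolFamily E (fun x => F x * K x) Ω := by
  have : IsTopologicalGroup G := topologicalGroup_of_lieGroup 𝓘(ℂ, E) ∞
  have hU := uniqueDiffOn_prod_stdSimp (q := q) hΩ
  refine ⟨h.continuousOn.mul hK.continuousOn, fun x hx => ?_⟩
  refine PartHolWithinAt.congr ?_ hx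
    (SmoothIntoWithinAt.eventuallyEq_mulChart (h.continuousOn x hx) (hK.continuousOn x hx))
  exact ((h.partHol x hx).prodMk (hK.partHol x hx) hU hx).comp
    (Φ := fun p : E × E => extChartAt 𝓘(ℂ, E) (F x * K x)
      ((extChartAt 𝓘(ℂ, E) (F x)).symm p.1 * (extChartAt 𝓘(ℂ, E) (K x)).symm p.2))
    (contDiffAt_mulChart (F x) (K x)) hU hx

/-- In a fixed chart `dlog` is the holomorphic Maurer–Cartan coefficient applied to a directional
derivative of F, and both constituents belong to the class. Every integrand below is polynomial in
such functions. -/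
lemma partHolOn_dlog (h : HolFamily E F Ω) (hΩ : IsOpen Ω) (u : Y × (Fin q → ℝ)) :
    PartHolOn (fun x => dlog E F (Ω ×ˢ stdSimp q) x u) (Ω ×ˢ stdSimp q) := by
  intro x hx
  have hU := uniqueDiffOn_prod_stdSimp (q := q) hΩ
  have h1 := (h.partHol x hx).prodMk ((h.partHol x hx).fderivWithin hU
    (prod_stdSimp_subset_closure_interior hΩ) hx u) hU hx
  refine PartHolWithinAt.congr (h1.comp (Φ := fun p : E × E => mcChart E (F x) p.1 p.2) ?_ hU hx)
    hx ?_
  · exact ContDiffAt.clm_apply (ContDiffAt.comp (g := mcChart E (F x)) (f := Prod.fst) _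
      (contDiffAt_mcChart (mem_extChartAt_target (F x))) contDiffAt_fst) contDiffAt_snd
  · filter_upwards [(h.smooth hx).eventually_dlog_eq hU hx] with x' hx'
    rw [hx'.2]
    rfl

lemma dlog_eq (h : HolFamily E F Ω) (hΩ : IsOpen Ω) {x : Y × (Fin q → ℝ)}
    (hx : x ∈ Ω ×ˢ stdSimp q) (u : Y × (Fin q → ℝ)) :
    dlog E F (Ω ×ˢ stdSimp q) x u = mcChart E (F x) (extChartAt 𝓘(ℂ, E) (F x) (F x))
      (fderivWithin ℝ (fun x' => extChartAt 𝓘(ℂ, E) (F x) (F x')) (Ω ×ˢ stdSimp q) x u) := by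
  rw [((h.smooth hx).eventually_dlog_eq (uniqueDiffOn_prod_stdSimp hΩ) hx).self_of_nhdsWithin hx
    |>.2]
  rfl

end HolFamily

variable [Group G] [LieGroup 𝓘(ℂ, E) ∞ G]

lemma maurerCartan_eq_mcChart (g : G) :
    maurerCartan E g = mcChart E g (extChartAt 𝓘(ℂ, E) g g) := by
  have h : MDifferentiableAt 𝓘(ℂ, E) 𝓘(ℂ, E) (fun h : G => h * g⁻¹) g :=
    (contMDiff_mul_right (I := 𝓘(ℂ, E)) (n := ∞) (a := g⁻¹)).mdifferentiable (by simp) g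
  rw [maurerCartan, tangentDeriv_eq_fderivWithin h, mcChart]
  simp only [modelWithCornersSelf_coe, range_id, fderivWithin_univ]
  congr 1
  funext y
  simp only [writtenInExtChartAt, divChart, Function.comp_apply, mul_inv_cancel,
    extChartAt_to_inv]

namespace HolFamily

variable {F K : Y × (Fin q → ℝ) → G} {Ω : Set Y}

/-- With the next lemma, the dictionary between the integrands of fibre integrals and `dlog`:
parameter directions here, simplex directions there. -/
lemma maurerCartan_tangentDeriv (h : HolFamily E F Ω) (hΩ : IsOpen Ω) {y : Y} {t : Fin q → ℝ}
    (hy : y ∈ Ω) (ht : t ∈ stdSimp q) (v : Y) :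
    maurerCartan E (F (y, t)) (tangentDeriv 𝓘(ℂ, Y) 𝓘(ℂ, E) (fun y => F (y, t)) y v) =
      dlog E F (Ω ×ˢ stdSimp q) (y, t) (v, 0) := by
  rw [(h.hasMFDerivAt_slice hΩ hy ht).2, maurerCartan_eq_mcChart, h.dlog_eq hΩ ⟨hy, ht⟩]

lemma maurerCartan_simpVelocity (h : HolFamily E F Ω) (hΩ : IsOpen Ω) {y : Y} {t : Fin q → ℝ}
    (hy : y ∈ Ω) (ht : t ∈ stdSimp q) (i : Fin q) :
    maurerCartan E (F (y, t)) (simpVelocity 𝓘(ℂ, E) (fun t => F (y, t)) t i) =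
      dlog E F (Ω ×ˢ stdSimp q) (y, t) (0, Pi.single i 1) := by
  have h1 := hasFDerivWithinAt_prod_slice (h.differentiableWithinAt_chart ⟨hy, ht⟩) hy
  rw [maurerCartan_eq_mcChart, h.dlog_eq hΩ ⟨hy, ht⟩, simpVelocity,
    h1.fderivWithin (uniqueDiffOn_stdSimp q t ht)]
  rfl

end HolFamily

end Families

/-! ### The simplices σ as holomorphic families -/

section Simplices

variable {E : Type*} [NormedAddCommGroup E] [NormedSpace ℂ E]
  {G : Type*} [TopologicalSpace G] [ChartedSpace E G]
  {Y : Type*} [NormedAddCommGroup Y] [NormedSpace ℂ Y] {V : Type*} [NormedAddCommGroup V]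
  [NormedSpace ℝ V]

lemma ContMDiffWithinAt.restrictScalars_real {h : Y → G} {s : Set Y} {y : Y}
    (hh : ContMDiffWithinAt 𝓘(ℂ, Y) 𝓘(ℂ, E) ∞ h s y) :
    ContMDiffWithinAt 𝓘(ℝ, Y) 𝓘(ℝ, E) ∞ h s y := by
  rw [contMDiffWithinAt_iff] at hh ⊢
  exact ⟨hh.1, hh.2.restrict_scalars ℝ⟩

variable [Group G] (S : SimplexSystem E G)

/-- Joint real smoothness of σ gives regularity up to the boundary of the simplex. The
Cauchy–Riemann equation comes from holomorphy at each fixed t and uniqueness of the real derivative.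
-/
lemma SimplexSystem.holFamily {k : ℕ} {Ω : Set Y} (hΩ : IsOpen Ω) {d : Y → Fin k → G}
    (hd : ContMDiffOn 𝓘(ℂ, Y) (powModel E k) ∞ d Ω) (hdW : MapsTo d Ω (S.W k))
    [IsManifold 𝓘(ℂ, E) ∞ G] :
    HolFamily E (fun x : Y × (Fin k → ℝ) => S.σ k (d x.1) x.2) Ω := by
  have h1 : ContMDiffOn 𝓘(ℝ, Y × (Fin k → ℝ)) (powModelReal E k) ∞
      (fun x : Y × (Fin k → ℝ) => d x.1) (Ω ×ˢ stdSimp k) := by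
    intro x hx
    rw [contMDiffWithinAt_pi_iff]
    intro i
    have := (contMDiffWithinAt_pi_iff.1 (hd x.1 hx.1) i).restrictScalars_real
    exact ContMDiffWithinAt.comp (g := fun y => d y i) (f := Prod.fst) x this
      contDiff_fst.contMDiff.contMDiffAt.contMDiffWithinAt (fun y hy => hy.1)
  have h2 : ContMDiffOn 𝓘(ℝ, Y × (Fin k → ℝ)) 𝓘(ℝ, E) ∞
      (fun x : Y × (Fin k → ℝ) => S.σ k (d x.1) x.2) (Ω ×ˢ stdSimp k) :=
    ContMDiffOn.comp (S.σ_smooth k) (f := fun x : Y × (Fin k → ℝ) => (d x.1, x.2))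
      (h1.prodMk contDiff_snd.contMDiff.contMDiffOn) fun x hx => ⟨hdW hx.1, hx.2⟩
  refine ⟨h2.continuousOn, fun x hx => ?_⟩
  have h3 : ContDiffWithinAt ℝ ∞ (fun x' : Y × (Fin k → ℝ) =>
      extChartAt 𝓘(ℂ, E) (S.σ k (d x.1) x.2) (S.σ k (d x'.1) x'.2)) (Ω ×ˢ stdSimp k) x := by
    have := (contMDiffWithinAt_iff.1 (h2 x hx)).2
    simp only [mfld_simps] at this ⊢
    exact this
  refine ⟨h3, ?_⟩
  filter_upwards [h3.eventually_differentiableWithinAt hx, self_mem_nhdsWithin,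
    (h2.continuousOn x hx).eventually_mem (extChartAt_source_mem_nhds (I := 𝓘(ℂ, E)) _)]
    with x' h4 h5 h6 w
  have h7 : DifferentiableAt ℂ (fun y => extChartAt 𝓘(ℂ, E) (S.σ k (d x.1) x.2)
      (S.σ k (d y) x'.2)) x'.1 := by
    rw [← mdifferentiableAt_iff_differentiableAt]
    have h8 := (S.σ_holomorphic k x'.2 h5.2).mdifferentiableAt
      ((S.isOpen_W k).mem_nhds (hdW h5.1))
    have h9 := (hd.contMDiffAt (hΩ.mem_nhds h5.1)).mdifferentiableAt (by simp)
    have h10 : MDifferentiableAt 𝓘(ℂ, E) 𝓘(ℂ, E) (extChartAt 𝓘(ℂ, E) (S.σ k (d x.1) x.2))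
        (S.σ k (d x'.1) x'.2) := mdifferentiableAt_extChartAt (by simpa using h6)
    exact MDifferentiableAt.comp (g := extChartAt 𝓘(ℂ, E) (S.σ k (d x.1) x.2))
      (f := fun y => S.σ k (d y) x'.2) x'.1 h10
      (MDifferentiableAt.comp (g := fun g => S.σ k g x'.2) (f := d) x'.1 h8 h9)
  have h11 := (h7.hasFDerivAt.restrictScalars ℝ).unique (hasFDerivAt_prod_slice hΩ h4 h5.1 h5.2)
  have h12 := fun w => DFunLike.congr_fun h11 w
  simp only [ContinuousLinearMap.comp_apply, ContinuousLinearMap.inl_apply,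
    ContinuousLinearMap.coe_restrictScalars'] at h12
  rw [← h12, ← h12, map_smul]

end Simplices

/-! ### Logarithmic derivatives along the faces of a family -/

section Faces

lemma hasFDerivAt_simpFace_zero {q : ℕ} (t : Fin q → ℝ) :
    HasFDerivAt (simpFace (0 : Fin (q + 2))) (ContinuousLinearMap.pi
      (Fin.cons (-∑ i, ContinuousLinearMap.proj i) fun i => ContinuousLinearMap.proj i :
        Fin (q + 1) → (Fin q → ℝ) →L[ℝ] ℝ)) t := by
  have h : simpFace (0 : Fin (q + 2)) = fun t : Fin q → ℝ =>
      (Fin.cons (1 - ∑ i, t i) t : Fin (q + 1) → ℝ) := funext fun t => simpFace_zero t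
  rw [h, hasFDerivAt_pi]
  intro i
  cases i using Fin.cases with
  | zero =>
    simp only [Fin.cons_zero]
    exact (HasFDerivAt.fun_sum fun i _ => hasFDerivAt_apply i t).const_sub 1
  | succ i => simpa using hasFDerivAt_apply i t

lemma hasFDerivAt_simpFace_succ {q : ℕ} (j : Fin (q + 1)) (t : Fin q → ℝ) :
    HasFDerivAt (simpFace j.succ) (ContinuousLinearMap.pi
      (j.insertNth 0 fun i => ContinuousLinearMap.proj i :
        Fin (q + 1) → (Fin q → ℝ) →L[ℝ] ℝ)) t := by
  have h : simpFace j.succ = fun t : Fin q → ℝ =>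
      (j.insertNth 0 t : Fin (q + 1) → ℝ) := funext fun t => simpFace_succ j t
  rw [h, hasFDerivAt_pi]
  intro i
  rcases j.eq_self_or_eq_succAbove i with rfl | ⟨i, rfl⟩
  · simpa using hasFDerivAt_const (0 : ℝ) t
  · simpa using hasFDerivAt_apply i t

variable {E : Type*} [NormedAddCommGroup E] [NormedSpace ℂ E]
  {G : Type*} [TopologicalSpace G] [ChartedSpace E G] [Group G] [LieGroup 𝓘(ℂ, E) ∞ G]
  {Y : Type*} [NormedAddCommGroup Y] [NormedSpace ℂ Y] {q : ℕ}

/-- The `j`-th face of a family of simplices. -/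
def familyFace (j : Fin (q + 2)) (F : Y × (Fin (q + 1) → ℝ) → G) : Y × (Fin q → ℝ) → G :=
  fun x => F (x.1, simpFace j x.2)

variable {F : Y × (Fin (q + 1) → ℝ) → G} {Ω : Set Y}

namespace HolFamily

lemma dlog_familyFace (h : HolFamily E F Ω) (hΩ : IsOpen Ω) {y : Y} {t : Fin q → ℝ} (hy : y ∈ Ω)
    (ht : t ∈ stdSimp q) (j : Fin (q + 2)) {φ : (Fin q → ℝ) →L[ℝ] (Fin (q + 1) → ℝ)}
    (hφ : HasFDerivAt (simpFace j) φ t) (v : Y) (w : Fin q → ℝ) :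
    dlog E (familyFace j F) (Ω ×ˢ stdSimp q) (y, t) (v, w) =
      dlog E F (Ω ×ˢ stdSimp (q + 1)) (y, simpFace j t) (v, φ w) := by
  rw [show familyFace j F = fun x => F (x.1, simpFace j x.2) from rfl,
    dlog_comp (h.smooth (x := (y, simpFace j t)) ⟨hy, simpFace_mem j ht⟩)
    (φ := fun x => (x.1, simpFace j x.2)) (X' := Ω ×ˢ stdSimp q)
    (φ' := (ContinuousLinearMap.fst ℝ Y (Fin q → ℝ)).prod
      (φ.comp (ContinuousLinearMap.snd ℝ Y (Fin q → ℝ))))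
    (uniqueDiffOn_prod_stdSimp hΩ) (uniqueDiffOn_prod_stdSimp hΩ) ?_
    (fun x hx => ⟨hx.1, simpFace_mem j hx.2⟩) ⟨hy, ht⟩]
  · rfl
  · exact hasFDerivWithinAt_fst.prodMk (HasFDerivAt.comp_hasFDerivWithinAt (g := simpFace j)
      (f := Prod.snd) _ hφ hasFDerivWithinAt_snd)

lemma exists_hasFDerivAt_simpFace (j : Fin (q + 2)) (t : Fin q → ℝ) :
    ∃ φ : (Fin q → ℝ) →L[ℝ] (Fin (q + 1) → ℝ), HasFDerivAt (simpFace j) φ t := by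
  cases j using Fin.cases with
  | zero => exact ⟨_, hasFDerivAt_simpFace_zero t⟩
  | succ j => exact ⟨_, hasFDerivAt_simpFace_succ j t⟩

lemma dlog_familyFace_left (h : HolFamily E F Ω) (hΩ : IsOpen Ω) {y : Y} {t : Fin q → ℝ}
    (hy : y ∈ Ω) (ht : t ∈ stdSimp q) (j : Fin (q + 2)) (v : Y) :
    dlog E (familyFace j F) (Ω ×ˢ stdSimp q) (y, t) (v, 0) =
      dlog E F (Ω ×ˢ stdSimp (q + 1)) (y, simpFace j t) (v, 0) := by
  obtain ⟨φ, hφ⟩ := exists_hasFDerivAt_simpFace j t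
  rw [h.dlog_familyFace hΩ hy ht j hφ, map_zero]

/-- On face 0 the first coordinate is 1 − Σ t, so ∂_{t_i} is pushed forward to the difference of two
coordinate fields. On the other faces it is pushed to a single one. -/
lemma dlog_familyFace_zero (h : HolFamily E F Ω) (hΩ : IsOpen Ω) {y : Y} {t : Fin q → ℝ}
    (hy : y ∈ Ω) (ht : t ∈ stdSimp q) (i : Fin q) :
    dlog E (familyFace 0 F) (Ω ×ˢ stdSimp q) (y, t) (0, Pi.single i 1) =
      dlog E F (Ω ×ˢ stdSimp (q + 1)) (y, simpFace 0 t) (0, Pi.single i.succ 1) -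
      dlog E F (Ω ×ˢ stdSimp (q + 1)) (y, simpFace 0 t) (0, Pi.single 0 1) := by
  rw [h.dlog_familyFace hΩ hy ht 0 (hasFDerivAt_simpFace_zero t), ← map_sub]
  congr 1
  refine Prod.ext (by simp) (funext fun k => ?_)
  cases k using Fin.cases with
  | zero => simp
  | succ k => simp [Pi.single_apply]

lemma dlog_familyFace_succ (h : HolFamily E F Ω) (hΩ : IsOpen Ω) {y : Y} {t : Fin q → ℝ}
    (hy : y ∈ Ω) (ht : t ∈ stdSimp q) (j : Fin (q + 1)) (i : Fin q) :
    dlog E (familyFace j.succ F) (Ω ×ˢ stdSimp q) (y, t) (0, Pi.single i 1) =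
      dlog E F (Ω ×ˢ stdSimp (q + 1)) (y, simpFace j.succ t) (0, Pi.single (j.succAbove i) 1) := by
  rw [h.dlog_familyFace hΩ hy ht _ (hasFDerivAt_simpFace_succ j t)]
  congr 1
  refine Prod.ext rfl (funext fun k => ?_)
  rcases j.eq_self_or_eq_succAbove k with rfl | ⟨k, rfl⟩
  · simp
  · simp [Pi.single_apply]

lemma dlog_mul {n : ℕ} {F K : Y × (Fin n → ℝ) → G} (h : HolFamily E F Ω) (hK : HolFamily E K Ω)
    (hΩ : IsOpen Ω) {x : Y × (Fin n → ℝ)} (hx : x ∈ Ω ×ˢ stdSimp n) (u : Y × (Fin n → ℝ)) :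
    dlog E (fun x => F x * K x) (Ω ×ˢ stdSimp n) x u = dlog E F (Ω ×ˢ stdSimp n) x u +
      adjointAction E (F x) (dlog E K (Ω ×ˢ stdSimp n) x u) := by
  rw [_root_.dlog_mul (h.smooth hx) (hK.smooth hx) (uniqueDiffOn_prod_stdSimp hΩ) hx]
  rfl

end HolFamily

lemma dlog_fst {h : Y → G} (hΩ : IsOpen Ω) (hh : ContMDiffOn 𝓘(ℂ, Y) 𝓘(ℂ, E) ∞ h Ω)
    {x : Y × (Fin q → ℝ)} (hx : x ∈ Ω ×ˢ stdSimp q) (u : Y × (Fin q → ℝ)) :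
    dlog E (fun x : Y × (Fin q → ℝ) => h x.1) (Ω ×ˢ stdSimp q) x u = dlog E h Ω x.1 u.1 := by
  have hs : SmoothIntoWithinAt E h Ω x.1 := by
    refine ⟨hh.continuousOn _ hx.1, ContDiffAt.contDiffWithinAt ?_⟩
    refine ContDiffAt.restrict_scalars ℝ (𝕜' := ℂ) ?_
    rw [← contMDiffAt_iff_contDiffAt]
    exact ContMDiffAt.comp _ contMDiffAt_extChartAt (hh.contMDiffAt (hΩ.mem_nhds hx.1))
  rw [dlog_comp hs (φ := Prod.fst) hΩ.uniqueDiffOn (uniqueDiffOn_prod_stdSimp hΩ)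
    hasFDerivWithinAt_fst (fun y hy => hy.1) hx]
  rfl

end Faces

/-! ### Stokes along the simplex directions -/

section Stokes

variable {Y : Type*} [NormedAddCommGroup Y] [NormedSpace ℂ Y] {q : ℕ}
  {W : Type*} [NormedAddCommGroup W] [NormedSpace ℂ W] {Ω : Set Y}

protected lemma PartHolOn.fderivWithin {k : Y × (Fin q → ℝ) → W} (hk : PartHolOn k (Ω ×ˢ stdSimp q))
    (hΩ : IsOpen Ω) (u : Y × (Fin q → ℝ)) :
    PartHolOn (fun x => fderivWithin ℝ k (Ω ×ˢ stdSimp q) x u) (Ω ×ˢ stdSimp q) := fun x hx =>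
  (hk x hx).fderivWithin (uniqueDiffOn_prod_stdSimp hΩ) (prod_stdSimp_subset_closure_interior hΩ)
    hx u

lemma PartHolOn.integrableOn {k : Y × (Fin q → ℝ) → W} (hk : PartHolOn k (Ω ×ˢ stdSimp q))
    {y : Y} (hy : y ∈ Ω) : MeasureTheory.IntegrableOn (fun t => k (y, t)) (stdSimp q) :=
  (continuousOn_prod_slice hk.contDiffOn.continuousOn hy).integrableOn_compact (isCompact_stdSimp q)

lemma PartHolOn.integrableOn_face {k : Y × (Fin (q + 1) → ℝ) → W}
    (hk : PartHolOn k (Ω ×ˢ stdSimp (q + 1))) {y : Y} (hy : y ∈ Ω) (j : Fin (q + 2)) :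
    MeasureTheory.IntegrableOn (fun t => k (y, simpFace j t)) (stdSimp q) :=
  ((continuousOn_prod_slice hk.contDiffOn.continuousOn hy).comp
    (continuous_simpFace j).continuousOn fun _ ht => simpFace_mem j ht).integrableOn_compact
    (isCompact_stdSimp q)

lemma PartHolOn.setIntegral_fderivWithin_basis [CompleteSpace W] {k : Y × (Fin (q + 1) → ℝ) → W}
    (hk : PartHolOn k (Ω ×ˢ stdSimp (q + 1))) {y : Y} (hy : y ∈ Ω) (i : Fin (q + 1)) :
    ∫ t in stdSimp (q + 1), fderivWithin ℝ k (Ω ×ˢ stdSimp (q + 1)) (y, t) (0, Pi.single i 1) =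
      (∫ t in stdSimp q, k (y, simpFace 0 t)) - ∫ t in stdSimp q, k (y, simpFace i.succ t) := by
  have h1 : ContDiffOn ℝ 1 (fun t => k (y, t)) (stdSimp (q + 1)) :=
    hk.contDiffOn_one.comp (contDiff_prodMk_right y).contDiffOn fun t ht => ⟨hy, ht⟩
  rw [← setIntegral_stdSimp_fderivWithin i _ h1]
  refine MeasureTheory.setIntegral_congr_fun (measurableSet_stdSimp _) fun t ht => ?_
  have h2 := hasFDerivWithinAt_prod_slice
    ((hk.contDiffOn_one.differentiableOn one_ne_zero) (y, t) ⟨hy, ht⟩) hy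
  rw [h2.fderivWithin (uniqueDiffOn_stdSimp _ t ht)]
  rfl

end Stokes

/-! ### Fibre integrals of the Cartan form -/

section FibreIntegrals

lemma setIntegral_alternating_three {T : Type*} [MeasurableSpace T] {μ : MeasureTheory.Measure T}
    {s : Set T} {f g h : T → ℂ} (hf : MeasureTheory.IntegrableOn f s μ)
    (hg : MeasureTheory.IntegrableOn g s μ) (hh : MeasureTheory.IntegrableOn h s μ) :
    (∫ t in s, f t ∂μ) - (∫ t in s, g t ∂μ) + (∫ t in s, h t ∂μ) =
      ∫ t in s, (f t - g t + h t) ∂μ := by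
  rw [MeasureTheory.integral_add (f := fun t => f t - g t) (hf.sub hg) hh,
    MeasureTheory.integral_sub hf hg]

lemma setIntegral_alternating_four {T : Type*} [MeasurableSpace T] {μ : MeasureTheory.Measure T}
    {s : Set T} {f g h k : T → ℂ} (hf : MeasureTheory.IntegrableOn f s μ)
    (hg : MeasureTheory.IntegrableOn g s μ) (hh : MeasureTheory.IntegrableOn h s μ)
    (hk : MeasureTheory.IntegrableOn k s μ) :
    (∫ t in s, f t ∂μ) - (∫ t in s, g t ∂μ) + (∫ t in s, h t ∂μ) - (∫ t in s, k t ∂μ) =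
      ∫ t in s, (f t - g t + h t - k t) ∂μ := by
  rw [setIntegral_alternating_three hf hg hh, MeasureTheory.integral_sub
    (f := fun t => f t - g t + h t) ((hf.sub hg).add hh) hk]

variable {E : Type*} [NormedAddCommGroup E] [NormedSpace ℂ E] [FiniteDimensional ℂ E]
  {G : Type*} [TopologicalSpace G] [ChartedSpace E G] [Group G] [LieGroup 𝓘(ℂ, E) ∞ G]
  {Y : Type*} [NormedAddCommGroup Y] [NormedSpace ℂ Y]
  {P : E →L[ℂ] E →L[ℂ] ℂ} {q : ℕ}

/-- The function `P(Θ u, [Θ v, Θ w])` for the logarithmic derivative `Θ` of a family `F`. -/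
noncomputable def dlogCubic (P : E →L[ℂ] E →L[ℂ] ℂ) (F : Y × (Fin q → ℝ) → G) (Ω : Set Y)
    (u v w : Y × (Fin q → ℝ)) (x : Y × (Fin q → ℝ)) : ℂ :=
  cartanForm G P (dlog E F (Ω ×ˢ stdSimp q) x u) (dlog E F (Ω ×ˢ stdSimp q) x v)
    (dlog E F (Ω ×ˢ stdSimp q) x w)

/-- The coordinate vector field `∂_{t_i}`. -/
def simpDir (Y : Type*) [Zero Y] {q : ℕ} (i : Fin q) : Y × (Fin q → ℝ) := (0, Pi.single i 1)

/-- `∫_{Δ_3} P(a_1, [a_2, a_3])`. -/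
noncomputable def cartanIntegral₃ (P : E →L[ℂ] E →L[ℂ] ℂ) (F : Y × (Fin 3 → ℝ) → G) (Ω : Set Y)
    (y : Y) : ℂ :=
  ∫ t in stdSimp 3, dlogCubic P F Ω (simpDir Y 0) (simpDir Y 1) (simpDir Y 2) (y, t)

/-- `∫_{Δ_2} P(a_1, [a_2, A_v])`. -/
noncomputable def cartanIntegral₂ (P : E →L[ℂ] E →L[ℂ] ℂ) (F : Y × (Fin 2 → ℝ) → G) (Ω : Set Y)
    (v : Y) (y : Y) : ℂ :=
  ∫ t in stdSimp 2, dlogCubic P F Ω (simpDir Y 0) (simpDir Y 1) (v, 0) (y, t)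

/-- `∫_{Δ_1} P(a_1, [A_v, A_w])`. -/
noncomputable def cartanIntegral₁ (P : E →L[ℂ] E →L[ℂ] ℂ) (F : Y × (Fin 1 → ℝ) → G) (Ω : Set Y)
    (v w : Y) (y : Y) : ℂ :=
  ∫ t in stdSimp 1, dlogCubic P F Ω (simpDir Y 0) (v, 0) (w, 0) (y, t)

/-- `∫_{Δ_0} P(A_u, [A_v, A_w])`. -/
noncomputable def cartanIntegral₀ (P : E →L[ℂ] E →L[ℂ] ℂ) (F : Y × (Fin 0 → ℝ) → G) (Ω : Set Y)
    (u v w : Y) (y : Y) : ℂ :=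
  ∫ t in stdSimp 0, dlogCubic P F Ω (u, 0) (v, 0) (w, 0) (y, t)

variable {F : Y × (Fin q → ℝ) → G} {Ω : Set Y}

lemma HolFamily.partHolOn_dlogCubic (h : HolFamily E F Ω) (hΩ : IsOpen Ω)
    (u v w : Y × (Fin q → ℝ)) : PartHolOn (dlogCubic P F Ω u v w) (Ω ×ˢ stdSimp q) := fun x hx =>
  have hU := uniqueDiffOn_prod_stdSimp (q := q) hΩ
  (h.partHolOn_dlog hΩ u x hx).bilin P ((h.partHolOn_dlog hΩ v x hx).bilin (lieBracket E G)
    (h.partHolOn_dlog hΩ w x hx) hU hx) hU hx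

lemma dlogCubic_congr {F' : Y × (Fin q → ℝ) → G} (h : EqOn F F' (Ω ×ˢ stdSimp q)) {x : Y × (Fin q → ℝ)}
    (hx : x ∈ Ω ×ˢ stdSimp q) (u v w : Y × (Fin q → ℝ)) :
    dlogCubic P F Ω u v w x = dlogCubic P F' Ω u v w x := by
  rw [dlogCubic, dlogCubic, dlog_congr h hx]

variable [FiniteDimensional ℂ Y]

omit [FiniteDimensional ℂ Y] in
-- Closedness, integrated over the fibre. With some of the four vectors chosen as simplex
-- directions, `PartHolOn.setIntegral_fderivWithin_basis` turns the corresponding terms into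
-- boundary integrals.
lemma IsInvariantQuadratic.setIntegral_dlogCubic_closed (hP : IsInvariantQuadratic G P)
    (h : HolFamily E F Ω) (hΩ : IsOpen Ω) {y : Y} (hy : y ∈ Ω) (u₀ u₁ u₂ u₃ : Y × (Fin q → ℝ)) :
    (∫ t in stdSimp q, fderivWithin ℝ (dlogCubic P F Ω u₁ u₂ u₃) (Ω ×ˢ stdSimp q) (y, t) u₀) -
    (∫ t in stdSimp q, fderivWithin ℝ (dlogCubic P F Ω u₀ u₂ u₃) (Ω ×ˢ stdSimp q) (y, t) u₁) +
    (∫ t in stdSimp q, fderivWithin ℝ (dlogCubic P F Ω u₀ u₁ u₃) (Ω ×ˢ stdSimp q) (y, t) u₂) -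
    (∫ t in stdSimp q, fderivWithin ℝ (dlogCubic P F Ω u₀ u₁ u₂) (Ω ×ˢ stdSimp q) (y, t) u₃) =
      0 := by
  have hi := fun a b c d => ((h.partHolOn_dlogCubic (P := P) hΩ a b c).fderivWithin hΩ
    d).integrableOn hy
  rw [setIntegral_alternating_four (hi _ _ _ _) (hi _ _ _ _) (hi _ _ _ _) (hi _ _ _ _),
    ← MeasureTheory.integral_zero (Fin q → ℝ) ℂ]
  refine MeasureTheory.setIntegral_congr_fun (measurableSet_stdSimp _) fun t ht => ?_
  exact hP.cartanForm_dlog_closed (h.smooth (x := (y, t)) ⟨hy, ht⟩) (uniqueDiffOn_prod_stdSimp hΩ)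
    (prod_stdSimp_subset_closure_interior hΩ) ⟨hy, ht⟩ ![u₀, u₁, u₂, u₃]

end FibreIntegrals

/-! ### Derivatives of the Cartan integrals as boundary sums -/

section Transgression

variable {E : Type*} [NormedAddCommGroup E] [NormedSpace ℂ E] [FiniteDimensional ℂ E]
  {G : Type*} [TopologicalSpace G] [ChartedSpace E G] [Group G] [LieGroup 𝓘(ℂ, E) ∞ G]
  {Y : Type*} [NormedAddCommGroup Y] [NormedSpace ℂ Y] [FiniteDimensional ℂ Y]
  {P : E →L[ℂ] E →L[ℂ] ℂ} {Ω : Set Y}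

lemma cartanForm_sub_left (a a' b c : E) :
    cartanForm G P (a - a') b c = cartanForm G P a b c - cartanForm G P a' b c := by
  simp [cartanForm]

lemma cartanForm_sub_mid (a b b' c : E) :
    cartanForm G P a (b - b') c = cartanForm G P a b c - cartanForm G P a b' c := by
  simp [cartanForm]

lemma cartanForm_sub_right (a b c c' : E) :
    cartanForm G P a b (c - c') = cartanForm G P a b c - cartanForm G P a b c' := by
  simp [cartanForm]

namespace IsInvariantQuadratic

lemma cartanForm_cyclic (hP : IsInvariantQuadratic G P) (a b c : E) :
    cartanForm G P a b c = cartanForm G P b c a := by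
  rw [hP.cartanForm_swap_left, cartanForm_swap_right, neg_neg]

lemma cartanForm_self_right (a b : E) : cartanForm G P a b b = 0 := by
  have := cartanForm_swap_right (G := G) (P := P) a b b
  linear_combination this / 2

lemma cartanForm_self_left (hP : IsInvariantQuadratic G P) (a b : E) :
    cartanForm G P a a b = 0 := by
  rw [hP.cartanForm_cyclic, hP.cartanForm_cyclic, cartanForm_self_right]

lemma cartanForm_self_outer (hP : IsInvariantQuadratic G P) (a b : E) :
    cartanForm G P a b a = 0 := by
  rw [hP.cartanForm_cyclic, cartanForm_self_right]

/-- Made for face 0, whose tangent vectors are differences with the common term ∂_{t_1}; alternation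
kills the terms containing it twice. It assembles the face-0 contributions of all Stokes terms into
one integral. -/
lemma cartanForm_sub_sub (hP : IsInvariantQuadratic G P) (a b c v : E) :
    cartanForm G P (b - a) (c - a) v =
      cartanForm G P v b c - cartanForm G P v a c + cartanForm G P v a b := by
  simp only [cartanForm_sub_left, cartanForm_sub_mid, hP.cartanForm_self_left]
  linear_combination hP.cartanForm_cyclic v a c - hP.cartanForm_cyclic v b c -
    hP.cartanForm_cyclic v a b - hP.cartanForm_swap_left b a v

lemma cartanForm_sub_sub_sub (hP : IsInvariantQuadratic G P) (a b c d : E) :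
    cartanForm G P (b - a) (c - a) (d - a) =
      cartanForm G P b c d - cartanForm G P a c d + cartanForm G P a b d -
        cartanForm G P a b c := by
  simp only [cartanForm_sub_left, cartanForm_sub_mid, cartanForm_sub_right,
    hP.cartanForm_self_left, cartanForm_self_right, hP.cartanForm_self_outer]
  linear_combination -hP.cartanForm_swap_left b a d + hP.cartanForm_cyclic a b c

/-- Closedness on (v, ∂₁, ∂₂, ∂₃). The first term is the wanted derivative. Each of the others is
face 0 minus one further face, and the three face-0 terms combine by `cartanForm_sub_sub`. -/
lemma fderiv_cartanIntegral₃ (hP : IsInvariantQuadratic G P) {F : Y × (Fin 3 → ℝ) → G}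
    (h : HolFamily E F Ω) (hΩ : IsOpen Ω) {y : Y} (hy : y ∈ Ω) (v : Y) :
    fderiv ℝ (cartanIntegral₃ P F Ω) y v =
      cartanIntegral₂ P (familyFace 0 F) Ω v y - cartanIntegral₂ P (familyFace 1 F) Ω v y +
      cartanIntegral₂ P (familyFace 2 F) Ω v y - cartanIntegral₂ P (familyFace 3 F) Ω v y := by
  have hp := h.partHolOn_dlogCubic (P := P) hΩ
  have h1 := hP.setIntegral_dlogCubic_closed h hΩ hy (v, 0) (simpDir Y 0) (simpDir Y 1)
    (simpDir Y 2)
  have h2 : ∀ i : Fin 3, ∀ a b c, ∫ t in stdSimp 3, fderivWithin ℝ (dlogCubic P F Ω a b c)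
      (Ω ×ˢ stdSimp 3) (y, t) (simpDir Y i) = _ := fun i a b c =>
    (hp a b c).setIntegral_fderivWithin_basis hy i
  rw [h2, h2, h2] at h1
  have hi := fun (j : Fin 4) a b c => (hp a b c).integrableOn_face hy j
  have h3 : cartanIntegral₂ P (familyFace 0 F) Ω v y =
      (∫ t in stdSimp 2, dlogCubic P F Ω (v, 0) (simpDir Y 1) (simpDir Y 2) (y, simpFace 0 t)) -
      (∫ t in stdSimp 2, dlogCubic P F Ω (v, 0) (simpDir Y 0) (simpDir Y 2) (y, simpFace 0 t)) +
      ∫ t in stdSimp 2, dlogCubic P F Ω (v, 0) (simpDir Y 0) (simpDir Y 1) (y, simpFace 0 t) := by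
    rw [setIntegral_alternating_three (hi _ _ _ _) (hi _ _ _ _) (hi _ _ _ _)]
    refine MeasureTheory.setIntegral_congr_fun (measurableSet_stdSimp _) fun t ht => ?_
    simp only [dlogCubic, simpDir]
    rw [h.dlog_familyFace_left hΩ hy ht, h.dlog_familyFace_zero hΩ hy ht,
      h.dlog_familyFace_zero hΩ hy ht]
    exact hP.cartanForm_sub_sub _ _ _ _
  have h4 : ∀ j : Fin 3, cartanIntegral₂ P (familyFace j.succ F) Ω v y =
      ∫ t in stdSimp 2, dlogCubic P F Ω (v, 0) (simpDir Y (j.succAbove 0))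
        (simpDir Y (j.succAbove 1)) (y, simpFace j.succ t) := fun j => by
    refine MeasureTheory.setIntegral_congr_fun (measurableSet_stdSimp _) fun t ht => ?_
    simp only [dlogCubic, simpDir]
    rw [h.dlog_familyFace_left hΩ hy ht, h.dlog_familyFace_succ hΩ hy ht,
      h.dlog_familyFace_succ hΩ hy ht, ← hP.cartanForm_cyclic]
  have e0 : cartanIntegral₂ P (familyFace 1 F) Ω v y = ∫ t in stdSimp 2,
      dlogCubic P F Ω (v, 0) (simpDir Y 1) (simpDir Y 2) (y, simpFace (Fin.succ 0) t) := h4 0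
  have e1 : cartanIntegral₂ P (familyFace 2 F) Ω v y = ∫ t in stdSimp 2,
      dlogCubic P F Ω (v, 0) (simpDir Y 0) (simpDir Y 2) (y, simpFace (Fin.succ 1) t) := h4 1
  have e2 : cartanIntegral₂ P (familyFace 3 F) Ω v y = ∫ t in stdSimp 2,
      dlogCubic P F Ω (v, 0) (simpDir Y 0) (simpDir Y 1) (y, simpFace (Fin.succ 2) t) := h4 2
  have h5 : fderiv ℝ (cartanIntegral₃ P F Ω) y v = _ :=
    fderiv_setIntegral_stdSimp hΩ (hp _ _ _).contDiffOn_one hy v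
  rw [h5, h3, e0, e1, e2]
  linear_combination h1

omit [FiniteDimensional ℂ Y] in
/-- The alternating sum of the integrals over the faces of a family of `4`-simplices vanishes. -/
lemma cartanIntegral₃_face_sum (hP : IsInvariantQuadratic G P) {F : Y × (Fin 4 → ℝ) → G}
    (h : HolFamily E F Ω) (hΩ : IsOpen Ω) {y : Y} (hy : y ∈ Ω) :
    cartanIntegral₃ P (familyFace 0 F) Ω y - cartanIntegral₃ P (familyFace 1 F) Ω y +
      cartanIntegral₃ P (familyFace 2 F) Ω y - cartanIntegral₃ P (familyFace 3 F) Ω y +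
      cartanIntegral₃ P (familyFace 4 F) Ω y = 0 := by
  have hp := h.partHolOn_dlogCubic (P := P) hΩ
  have h1 := hP.setIntegral_dlogCubic_closed h hΩ hy (simpDir Y 0) (simpDir Y 1) (simpDir Y 2)
    (simpDir Y 3)
  have h2 : ∀ i : Fin 4, ∀ a b c, ∫ t in stdSimp 4, fderivWithin ℝ (dlogCubic P F Ω a b c)
      (Ω ×ˢ stdSimp 4) (y, t) (simpDir Y i) = _ := fun i a b c =>
    (hp a b c).setIntegral_fderivWithin_basis hy i
  rw [h2, h2, h2, h2] at h1
  have hi := fun (j : Fin 5) a b c => (hp a b c).integrableOn_face hy j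
  have h3 : cartanIntegral₃ P (familyFace 0 F) Ω y =
      (∫ t in stdSimp 3, dlogCubic P F Ω (simpDir Y 1) (simpDir Y 2) (simpDir Y 3)
        (y, simpFace 0 t)) -
      (∫ t in stdSimp 3, dlogCubic P F Ω (simpDir Y 0) (simpDir Y 2) (simpDir Y 3)
        (y, simpFace 0 t)) +
      (∫ t in stdSimp 3, dlogCubic P F Ω (simpDir Y 0) (simpDir Y 1) (simpDir Y 3)
        (y, simpFace 0 t)) -
      ∫ t in stdSimp 3, dlogCubic P F Ω (simpDir Y 0) (simpDir Y 1) (simpDir Y 2)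
        (y, simpFace 0 t) := by
    rw [setIntegral_alternating_four (hi _ _ _ _) (hi _ _ _ _) (hi _ _ _ _) (hi _ _ _ _)]
    refine MeasureTheory.setIntegral_congr_fun (measurableSet_stdSimp _) fun t ht => ?_
    simp only [dlogCubic, simpDir]
    rw [h.dlog_familyFace_zero hΩ hy ht, h.dlog_familyFace_zero hΩ hy ht,
      h.dlog_familyFace_zero hΩ hy ht]
    exact hP.cartanForm_sub_sub_sub _ _ _ _
  have h4 : ∀ j : Fin 4, cartanIntegral₃ P (familyFace j.succ F) Ω y =
      ∫ t in stdSimp 3, dlogCubic P F Ω (simpDir Y (j.succAbove 0)) (simpDir Y (j.succAbove 1))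
        (simpDir Y (j.succAbove 2)) (y, simpFace j.succ t) := fun j => by
    refine MeasureTheory.setIntegral_congr_fun (measurableSet_stdSimp _) fun t ht => ?_
    simp only [dlogCubic, simpDir]
    rw [h.dlog_familyFace_succ hΩ hy ht, h.dlog_familyFace_succ hΩ hy ht,
      h.dlog_familyFace_succ hΩ hy ht]
  have e0 : cartanIntegral₃ P (familyFace 1 F) Ω y = ∫ t in stdSimp 3,
    dlogCubic P F Ω (simpDir Y 1) (simpDir Y 2) (simpDir Y 3) (y, simpFace (Fin.succ 0) t) := h4 0
  have e1 : cartanIntegral₃ P (familyFace 2 F) Ω y = ∫ t in stdSimp 3,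
    dlogCubic P F Ω (simpDir Y 0) (simpDir Y 2) (simpDir Y 3) (y, simpFace (Fin.succ 1) t) := h4 1
  have e2 : cartanIntegral₃ P (familyFace 3 F) Ω y = ∫ t in stdSimp 3,
    dlogCubic P F Ω (simpDir Y 0) (simpDir Y 1) (simpDir Y 3) (y, simpFace (Fin.succ 2) t) := h4 2
  have e3 : cartanIntegral₃ P (familyFace 4 F) Ω y = ∫ t in stdSimp 3,
    dlogCubic P F Ω (simpDir Y 0) (simpDir Y 1) (simpDir Y 2) (y, simpFace (Fin.succ 3) t) := h4 3
  rw [h3, e0, e1, e2, e3]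
  linear_combination h1

/-- Closedness on (v, w, ∂₁, ∂₂). The simplex directions now start in the third slot instead of the
second, which flips the sign relative to `fderiv_cartanIntegral₃`. -/
lemma fderiv_cartanIntegral₂ (hP : IsInvariantQuadratic G P) {F : Y × (Fin 2 → ℝ) → G}
    (h : HolFamily E F Ω) (hΩ : IsOpen Ω) {y : Y} (hy : y ∈ Ω) (v w : Y) :
    fderiv ℝ (cartanIntegral₂ P F Ω w) y v - fderiv ℝ (cartanIntegral₂ P F Ω v) y w =
      -(cartanIntegral₁ P (familyFace 0 F) Ω v w y - cartanIntegral₁ P (familyFace 1 F) Ω v w y +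
      cartanIntegral₁ P (familyFace 2 F) Ω v w y) := by
  have hp := h.partHolOn_dlogCubic (P := P) hΩ
  have h1 := hP.setIntegral_dlogCubic_closed h hΩ hy (v, 0) (w, 0) (simpDir Y 0) (simpDir Y 1)
  have h2 : ∀ i : Fin 2, ∀ a b c, ∫ t in stdSimp 2, fderivWithin ℝ (dlogCubic P F Ω a b c)
      (Ω ×ˢ stdSimp 2) (y, t) (simpDir Y i) = _ := fun i a b c =>
    (hp a b c).setIntegral_fderivWithin_basis hy i
  rw [h2, h2] at h1
  have hi := fun (j : Fin 3) a b c => (hp a b c).integrableOn_face hy j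
  have h3 : cartanIntegral₁ P (familyFace 0 F) Ω v w y =
      (∫ t in stdSimp 1, dlogCubic P F Ω (v, 0) (w, 0) (simpDir Y 1) (y, simpFace 0 t)) -
      (∫ t in stdSimp 1, dlogCubic P F Ω (v, 0) (w, 0) (simpDir Y 0) (y, simpFace 0 t)) := by
    rw [← MeasureTheory.integral_sub (hi _ _ _ _) (hi _ _ _ _)]
    refine MeasureTheory.setIntegral_congr_fun (measurableSet_stdSimp _) fun t ht => ?_
    simp only [dlogCubic, simpDir]
    rw [h.dlog_familyFace_left hΩ hy ht, h.dlog_familyFace_left hΩ hy ht,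
      h.dlog_familyFace_zero hΩ hy ht, hP.cartanForm_cyclic]
    exact cartanForm_sub_right _ _ _ _
  have h4 : ∀ j : Fin 2, cartanIntegral₁ P (familyFace j.succ F) Ω v w y =
      ∫ t in stdSimp 1, dlogCubic P F Ω (v, 0) (w, 0) (simpDir Y (j.succAbove 0))
        (y, simpFace j.succ t) := fun j => by
    refine MeasureTheory.setIntegral_congr_fun (measurableSet_stdSimp _) fun t ht => ?_
    simp only [dlogCubic, simpDir]
    rw [h.dlog_familyFace_left hΩ hy ht, h.dlog_familyFace_left hΩ hy ht,
      h.dlog_familyFace_succ hΩ hy ht, hP.cartanForm_cyclic]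
  have e0 : cartanIntegral₁ P (familyFace 1 F) Ω v w y = ∫ t in stdSimp 1,
    dlogCubic P F Ω (v, 0) (w, 0) (simpDir Y 1) (y, simpFace (Fin.succ 0) t) := h4 0
  have e1 : cartanIntegral₁ P (familyFace 2 F) Ω v w y = ∫ t in stdSimp 1,
    dlogCubic P F Ω (v, 0) (w, 0) (simpDir Y 0) (y, simpFace (Fin.succ 1) t) := h4 1
  have h5 : ∀ u, cartanIntegral₂ P F Ω u = fun y => ∫ t in stdSimp 2,
      dlogCubic P F Ω (u, 0) (simpDir Y 0) (simpDir Y 1) (y, t) := fun u => by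
    funext y
    simp only [cartanIntegral₂, dlogCubic, ← hP.cartanForm_cyclic (dlog E F _ _ (u, 0))]
  rw [h5, h5, fderiv_setIntegral_stdSimp hΩ (hp _ _ _).contDiffOn_one hy v,
    fderiv_setIntegral_stdSimp hΩ (hp _ _ _).contDiffOn_one hy w, h3, e0, e1]
  linear_combination h1

lemma fderiv_cartanIntegral₁ (hP : IsInvariantQuadratic G P) {F : Y × (Fin 1 → ℝ) → G}
    (h : HolFamily E F Ω) (hΩ : IsOpen Ω) {y : Y} (hy : y ∈ Ω) (u v w : Y) :
    fderiv ℝ (cartanIntegral₁ P F Ω v w) y u - fderiv ℝ (cartanIntegral₁ P F Ω u w) y v +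
      fderiv ℝ (cartanIntegral₁ P F Ω u v) y w =
      cartanIntegral₀ P (familyFace 0 F) Ω u v w y -
        cartanIntegral₀ P (familyFace 1 F) Ω u v w y := by
  have hp := h.partHolOn_dlogCubic (P := P) hΩ
  have h1 := hP.setIntegral_dlogCubic_closed h hΩ hy (u, 0) (v, 0) (w, 0) (simpDir Y 0)
  have h2 : ∀ i : Fin 1, ∀ a b c, ∫ t in stdSimp 1, fderivWithin ℝ (dlogCubic P F Ω a b c)
      (Ω ×ˢ stdSimp 1) (y, t) (simpDir Y i) = _ := fun i a b c =>
    (hp a b c).setIntegral_fderivWithin_basis hy i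
  rw [h2] at h1
  have h4 : ∀ j : Fin 2, cartanIntegral₀ P (familyFace j F) Ω u v w y =
      ∫ t in stdSimp 0, dlogCubic P F Ω (u, 0) (v, 0) (w, 0) (y, simpFace j t) := fun j => by
    refine MeasureTheory.setIntegral_congr_fun (measurableSet_stdSimp _) fun t ht => ?_
    simp only [dlogCubic]
    rw [h.dlog_familyFace_left hΩ hy ht, h.dlog_familyFace_left hΩ hy ht,
      h.dlog_familyFace_left hΩ hy ht]
  have e0 : cartanIntegral₀ P (familyFace 1 F) Ω u v w y = ∫ t in stdSimp 0,
    dlogCubic P F Ω (u, 0) (v, 0) (w, 0) (y, simpFace (Fin.succ 0) t) := h4 1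
  have h5 : ∀ a b, cartanIntegral₁ P F Ω a b = fun y => ∫ t in stdSimp 1,
      dlogCubic P F Ω (a, 0) (b, 0) (simpDir Y 0) (y, t) := fun a b => by
    funext y
    simp only [cartanIntegral₁, dlogCubic, hP.cartanForm_cyclic (dlog E F _ _ (simpDir Y 0))]
  rw [h5, h5, h5, fderiv_setIntegral_stdSimp hΩ (hp _ _ _).contDiffOn_one hy u,
    fderiv_setIntegral_stdSimp hΩ (hp _ _ _).contDiffOn_one hy v,
    fderiv_setIntegral_stdSimp hΩ (hp _ _ _).contDiffOn_one hy w, h4 0, e0]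
  linear_combination h1

end IsInvariantQuadratic

end Transgression

/-! ### The effect of left translation on the integrals -/

section LeftTranslation

variable {E : Type*} [NormedAddCommGroup E] [NormedSpace ℂ E]
  {G : Type*} [TopologicalSpace G] [ChartedSpace E G] [Group G] [LieGroup 𝓘(ℂ, E) ∞ G]
  {Y : Type*} [NormedAddCommGroup Y] [NormedSpace ℂ Y]
  {P : E →L[ℂ] E →L[ℂ] ℂ} {Ω : Set Y} {q : ℕ}

/-- The family `(y, t) ↦ h(y) F(y, t)`. -/
def leftTranslate (h : Y → G) (F : Y × (Fin q → ℝ) → G) : Y × (Fin q → ℝ) → G :=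
  fun x => h x.1 * F x

/-- `P(B_u, C_v) - P(B_v, C_u)` for the logarithmic derivatives `B` of `h` and `C` of `h F`. -/
noncomputable def dlogWedge (P : E →L[ℂ] E →L[ℂ] ℂ) (h : Y → G) (F : Y × (Fin q → ℝ) → G)
    (Ω : Set Y) (u v : Y × (Fin q → ℝ)) (x : Y × (Fin q → ℝ)) : ℂ :=
  P (dlog E h Ω x.1 u.1) (dlog E (leftTranslate h F) (Ω ×ˢ stdSimp q) x v) -
    P (dlog E h Ω x.1 v.1) (dlog E (leftTranslate h F) (Ω ×ˢ stdSimp q) x u)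

/-- `∫_{Δ_1} P(B_v, C_1)`. -/
noncomputable def wedgeIntegral₁ (P : E →L[ℂ] E →L[ℂ] ℂ) (h : Y → G) (F : Y × (Fin 1 → ℝ) → G)
    (Ω : Set Y) (v : Y) (y : Y) : ℂ :=
  ∫ t in stdSimp 1, dlogWedge P h F Ω (v, 0) (simpDir Y 0) (y, t)

/-- `∫_{Δ_0} (P(B_v, C_w) - P(B_w, C_v))`. -/
noncomputable def wedgeIntegral₀ (P : E →L[ℂ] E →L[ℂ] ℂ) (h : Y → G) (F : Y × (Fin 0 → ℝ) → G)
    (Ω : Set Y) (v w : Y) (y : Y) : ℂ :=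
  ∫ t in stdSimp 0, dlogWedge P h F Ω (v, 0) (w, 0) (y, t)

lemma HolFamily.leftTranslate {h : Y → G} {F : Y × (Fin q → ℝ) → G} (hF : HolFamily E F Ω)
    (hh : ContMDiffOn 𝓘(ℂ, Y) 𝓘(ℂ, E) ∞ h Ω) (hΩ : IsOpen Ω) :
    HolFamily E (leftTranslate h F) Ω :=
  (HolFamily.of_contMDiffOn hΩ hh).mul hF hΩ

lemma HolFamily.dlog_leftTranslate {h : Y → G} {F : Y × (Fin q → ℝ) → G} (hF : HolFamily E F Ω)
    (hh : ContMDiffOn 𝓘(ℂ, Y) 𝓘(ℂ, E) ∞ h Ω) (hΩ : IsOpen Ω) {x : Y × (Fin q → ℝ)}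
    (hx : x ∈ Ω ×ˢ stdSimp q) (u : Y × (Fin q → ℝ)) :
    dlog E (_root_.leftTranslate h F) (Ω ×ˢ stdSimp q) x u =
      dlog E h Ω x.1 u.1 + adjointAction E (h x.1) (dlog E F (Ω ×ˢ stdSimp q) x u) := by
  rw [← dlog_fst hΩ hh hx]
  exact (HolFamily.of_contMDiffOn hΩ hh).dlog_mul hF hΩ hx u

lemma PartHolWithinAt.sub {T W : Type*} [NormedAddCommGroup T] [NormedSpace ℝ T]
    [NormedAddCommGroup W] [NormedSpace ℂ W] {k l : Y × T → W} {X : Set (Y × T)} {x : Y × T}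
    (h : PartHolWithinAt k X x) (h' : PartHolWithinAt l X x) (hX : UniqueDiffOn ℝ X) (hx : x ∈ X) :
    PartHolWithinAt (fun x => k x - l x) X x :=
  (h.prodMk h' hX hx).comp (Φ := fun p : W × W => p.1 - p.2) (by fun_prop) hX hx

variable {h : Y → G} {F : Y × (Fin q → ℝ) → G}

lemma HolFamily.partHolOn_dlogWedge (hF : HolFamily E F Ω)
    (hh : ContMDiffOn 𝓘(ℂ, Y) 𝓘(ℂ, E) ∞ h Ω) (hΩ : IsOpen Ω) (u v : Y × (Fin q → ℝ)) :
    PartHolOn (dlogWedge P h F Ω u v) (Ω ×ˢ stdSimp q) := fun x hx => by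
  have hU := uniqueDiffOn_prod_stdSimp (q := q) hΩ
  have hH := (HolFamily.of_contMDiffOn (q := q) hΩ hh)
  have hK := hF.leftTranslate hh hΩ
  have h1 := (((hH.partHolOn_dlog hΩ u x hx).bilin P (hK.partHolOn_dlog hΩ v x hx) hU hx).sub
    ((hH.partHolOn_dlog hΩ v x hx).bilin P (hK.partHolOn_dlog hΩ u x hx) hU hx) hU hx)
  refine h1.congr hx ?_
  filter_upwards [self_mem_nhdsWithin] with x' hx'
  rw [dlogWedge, ← dlog_fst hΩ hh hx', ← dlog_fst hΩ hh hx']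

variable [FiniteDimensional ℂ E] [FiniteDimensional ℂ Y]

omit [FiniteDimensional ℂ Y] in
-- Integrated form of `fderivWithin_dlog_wedge` for B = dlog h and C = dlog(hF). As C − B = Ad_h
-- dlog F, invariance turns its cubic term into that of F. The term of B vanishes because h does not
-- depend on t and one of the three vectors has no parameter component.
lemma IsInvariantQuadratic.setIntegral_dlogWedge (hP : IsInvariantQuadratic G P)
    (hF : HolFamily E F Ω) (hh : ContMDiffOn 𝓘(ℂ, Y) 𝓘(ℂ, E) ∞ h Ω) (hΩ : IsOpen Ω) {y : Y}
    (hy : y ∈ Ω) (u v w : Y × (Fin q → ℝ)) (huvw : u.1 = 0 ∨ v.1 = 0 ∨ w.1 = 0) :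
    (∫ t in stdSimp q, fderivWithin ℝ (dlogWedge P h F Ω v w) (Ω ×ˢ stdSimp q) (y, t) u) -
    (∫ t in stdSimp q, fderivWithin ℝ (dlogWedge P h F Ω u w) (Ω ×ˢ stdSimp q) (y, t) v) +
    (∫ t in stdSimp q, fderivWithin ℝ (dlogWedge P h F Ω u v) (Ω ×ˢ stdSimp q) (y, t) w) =
    (∫ t in stdSimp q, dlogCubic P F Ω u v w (y, t)) -
      ∫ t in stdSimp q, dlogCubic P (leftTranslate h F) Ω u v w (y, t) := by
  have hH := (HolFamily.of_contMDiffOn (q := q) hΩ hh)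
  have hK := hF.leftTranslate hh hΩ
  have hU := uniqueDiffOn_prod_stdSimp (q := q) hΩ
  have hi := fun a b c => ((hF.partHolOn_dlogWedge (P := P) hh hΩ a b).fderivWithin hΩ
    c).integrableOn hy
  rw [setIntegral_alternating_three (hi _ _ _) (hi _ _ _) (hi _ _ _),
    ← MeasureTheory.integral_sub ((hF.partHolOn_dlogCubic hΩ _ _ _).integrableOn hy)
    ((hK.partHolOn_dlogCubic hΩ _ _ _).integrableOn hy)]
  refine MeasureTheory.setIntegral_congr_fun (measurableSet_stdSimp _) fun t ht => ?_
  have hx : (y, t) ∈ Ω ×ˢ stdSimp q := ⟨hy, ht⟩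
  have h1 := hP.fderivWithin_dlog_wedge (hH.smooth hx) (hK.smooth hx) hU
    (prod_stdSimp_subset_closure_interior hΩ) hx u v w
  have h2 : ∀ a b c, fderivWithin ℝ (dlogWedge P h F Ω a b) (Ω ×ˢ stdSimp q) (y, t) c =
      fderivWithin ℝ (fun x => P (dlog E (fun x => h x.1) (Ω ×ˢ stdSimp q) x a)
        (dlog E (leftTranslate h F) (Ω ×ˢ stdSimp q) x b) -
        P (dlog E (fun x => h x.1) (Ω ×ˢ stdSimp q) x b)
        (dlog E (leftTranslate h F) (Ω ×ˢ stdSimp q) x a)) (Ω ×ˢ stdSimp q) (y, t) c :=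
    fun a b c => by
      rw [fderivWithin_congr' (fun x' hx' => ?_) hx]
      rw [dlogWedge, ← dlog_fst hΩ hh hx', ← dlog_fst hΩ hh hx']
  simp only [h2]
  refine h1.trans ?_
  have h3 : ∀ a, (dlog E (leftTranslate h F) (Ω ×ˢ stdSimp q) (y, t) -
      dlog E (fun x : Y × (Fin q → ℝ) => h x.1) (Ω ×ˢ stdSimp q) (y, t)) a =
      adjointAction E (h y) (dlog E F (Ω ×ˢ stdSimp q) (y, t) a) := fun a => by
    rw [sub_apply, hF.dlog_leftTranslate hh hΩ hx, dlog_fst hΩ hh hx, add_sub_cancel_left]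
  have h4 : cartanForm G P (dlog E (fun x : Y × (Fin q → ℝ) => h x.1) (Ω ×ˢ stdSimp q) (y, t) u)
      (dlog E (fun x : Y × (Fin q → ℝ) => h x.1) (Ω ×ˢ stdSimp q) (y, t) v)
      (dlog E (fun x : Y × (Fin q → ℝ) => h x.1) (Ω ×ˢ stdSimp q) (y, t) w) = 0 := by
    rw [dlog_fst hΩ hh hx, dlog_fst hΩ hh hx, dlog_fst hΩ hh hx]
    rcases huvw with h0 | h0 | h0 <;> simp [h0, cartanForm]
  simp only [h3, h4, hP.cartanForm_adjointAction, add_zero]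
  rfl

namespace IsInvariantQuadratic

omit [FiniteDimensional ℂ Y] in
-- All three arguments are simplex directions, on which translation acts through Ad_h only.
lemma cartanIntegral₃_leftTranslate (hP : IsInvariantQuadratic G P) {F : Y × (Fin 3 → ℝ) → G}
    (hF : HolFamily E F Ω) (hh : ContMDiffOn 𝓘(ℂ, Y) 𝓘(ℂ, E) ∞ h Ω) (hΩ : IsOpen Ω) {y : Y}
    (hy : y ∈ Ω) :
    cartanIntegral₃ P (leftTranslate h F) Ω y = cartanIntegral₃ P F Ω y := by
  refine MeasureTheory.setIntegral_congr_fun (measurableSet_stdSimp _) fun t ht => ?_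
  have hx : (y, t) ∈ Ω ×ˢ stdSimp 3 := ⟨hy, ht⟩
  simp only [dlogCubic, simpDir]
  rw [hF.dlog_leftTranslate hh hΩ hx, hF.dlog_leftTranslate hh hΩ hx,
    hF.dlog_leftTranslate hh hΩ hx]
  simp only [map_zero, zero_add, hP.cartanForm_adjointAction]

omit [FiniteDimensional ℂ E] [FiniteDimensional ℂ Y] in
lemma dlogWedge_familyFace_left (j : Fin (q + 2)) {F : Y × (Fin (q + 1) → ℝ) → G}
    (hF : HolFamily E F Ω) (hh : ContMDiffOn 𝓘(ℂ, Y) 𝓘(ℂ, E) ∞ h Ω) (hΩ : IsOpen Ω) {y : Y}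
    {t : Fin q → ℝ} (hy : y ∈ Ω) (ht : t ∈ stdSimp q) (v w : Y) :
    dlogWedge P h (familyFace j F) Ω (v, 0) (w, 0) (y, t) =
      dlogWedge P h F Ω (v, 0) (w, 0) (y, simpFace j t) := by
  have := (hF.leftTranslate hh hΩ).dlog_familyFace_left hΩ hy ht j
  rw [dlogWedge, dlogWedge, ← this, ← this]
  rfl

omit [FiniteDimensional ℂ Y] in
-- The exact correction is purely a boundary term: the wedge of two simplex directions vanishes, so
-- no derivative in v survives, and Stokes turns the others into the three edges.
lemma cartanIntegral₂_leftTranslate (hP : IsInvariantQuadratic G P) {F : Y × (Fin 2 → ℝ) → G}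
    (hF : HolFamily E F Ω) (hh : ContMDiffOn 𝓘(ℂ, Y) 𝓘(ℂ, E) ∞ h Ω) (hΩ : IsOpen Ω) {y : Y}
    (hy : y ∈ Ω) (v : Y) :
    cartanIntegral₂ P (leftTranslate h F) Ω v y = cartanIntegral₂ P F Ω v y +
      (wedgeIntegral₁ P h (familyFace 0 F) Ω v y - wedgeIntegral₁ P h (familyFace 1 F) Ω v y +
      wedgeIntegral₁ P h (familyFace 2 F) Ω v y) := by
  have hK := hF.leftTranslate hh hΩ
  have hp := hF.partHolOn_dlogWedge (P := P) hh hΩ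
  have h1 := hP.setIntegral_dlogWedge hF hh hΩ hy (v, 0) (simpDir Y 0) (simpDir Y 1)
    (Or.inr (Or.inl rfl))
  have h2 : ∀ i : Fin 2, ∀ a b, ∫ t in stdSimp 2, fderivWithin ℝ (dlogWedge P h F Ω a b)
      (Ω ×ˢ stdSimp 2) (y, t) (simpDir Y i) = _ := fun i a b =>
    (hp a b).setIntegral_fderivWithin_basis hy i
  have h0 : dlogWedge P h F Ω (simpDir Y 0) (simpDir Y 1) = fun _ => 0 := by
    funext x
    simp [dlogWedge, simpDir]
  rw [h2, h2, h0] at h1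
  simp only [fderivWithin_fun_const, Pi.zero_apply, zero_apply,
    MeasureTheory.integral_zero, zero_sub] at h1
  have hi := fun (j : Fin 3) a b => (hp a b).integrableOn_face hy j
  have hs : ∀ (i : Fin 2) x, dlogWedge P h F Ω (v, 0) (simpDir Y i) x = 
      P (dlog E h Ω x.1 v) (dlog E (leftTranslate h F) (Ω ×ˢ stdSimp 2) x (simpDir Y i)) :=
    fun i x => by simp [dlogWedge, simpDir]
  have hs' : ∀ (F : Y × (Fin 1 → ℝ) → G) x, dlogWedge P h F Ω (v, 0) (simpDir Y 0) x = 
      P (dlog E h Ω x.1 v) (dlog E (leftTranslate h F) (Ω ×ˢ stdSimp 1) x (simpDir Y 0)) :=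
    fun F x => by simp [dlogWedge, simpDir]
  have h3 : wedgeIntegral₁ P h (familyFace 0 F) Ω v y =
      (∫ t in stdSimp 1, dlogWedge P h F Ω (v, 0) (simpDir Y 1) (y, simpFace 0 t)) -
      (∫ t in stdSimp 1, dlogWedge P h F Ω (v, 0) (simpDir Y 0) (y, simpFace 0 t)) := by
    rw [← MeasureTheory.integral_sub (hi _ _ _) (hi _ _ _)]
    refine MeasureTheory.setIntegral_congr_fun (measurableSet_stdSimp _) fun t ht => ?_
    simp only [hs, hs']
    have := hK.dlog_familyFace_zero hΩ hy ht 0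
    rw [← map_sub]
    exact congr_arg _ this
  have h4 : ∀ j : Fin 2, wedgeIntegral₁ P h (familyFace j.succ F) Ω v y =
      ∫ t in stdSimp 1, dlogWedge P h F Ω (v, 0) (simpDir Y (j.succAbove 0))
        (y, simpFace j.succ t) := fun j => by
    refine MeasureTheory.setIntegral_congr_fun (measurableSet_stdSimp _) fun t ht => ?_
    simp only [hs, hs']
    exact congr_arg _ (hK.dlog_familyFace_succ hΩ hy ht j 0)
  have e0 : wedgeIntegral₁ P h (familyFace 1 F) Ω v y = ∫ t in stdSimp 1,
    dlogWedge P h F Ω (v, 0) (simpDir Y 1) (y, simpFace (Fin.succ 0) t) := h4 0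
  have e1 : wedgeIntegral₁ P h (familyFace 2 F) Ω v y = ∫ t in stdSimp 1,
    dlogWedge P h F Ω (v, 0) (simpDir Y 0) (y, simpFace (Fin.succ 1) t) := h4 1
  have h5 : ∀ F : Y × (Fin 2 → ℝ) → G, cartanIntegral₂ P F Ω v y = ∫ t in stdSimp 2,
      dlogCubic P F Ω (v, 0) (simpDir Y 0) (simpDir Y 1) (y, t) := fun F => by
    simp only [cartanIntegral₂, dlogCubic, ← hP.cartanForm_cyclic (dlog E F _ _ (v, 0))]
  rw [h5, h5, h3, e0, e1]
  linear_combination h1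

/-- With two parameter directions the correction has a genuine exterior derivative, besides the
contributions of the two endpoints of the path. -/
lemma fderiv_wedgeIntegral₁ (hP : IsInvariantQuadratic G P) {F : Y × (Fin 1 → ℝ) → G}
    (hF : HolFamily E F Ω) (hh : ContMDiffOn 𝓘(ℂ, Y) 𝓘(ℂ, E) ∞ h Ω) (hΩ : IsOpen Ω) {y : Y}
    (hy : y ∈ Ω) (v w : Y) :
    fderiv ℝ (wedgeIntegral₁ P h F Ω w) y v - fderiv ℝ (wedgeIntegral₁ P h F Ω v) y w =
      cartanIntegral₁ P F Ω v w y - cartanIntegral₁ P (leftTranslate h F) Ω v w y -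
      (wedgeIntegral₀ P h (familyFace 0 F) Ω v w y -
        wedgeIntegral₀ P h (familyFace 1 F) Ω v w y) := by
  have hK := hF.leftTranslate hh hΩ
  have hp := hF.partHolOn_dlogWedge (P := P) hh hΩ
  have h1 := hP.setIntegral_dlogWedge hF hh hΩ hy (v, 0) (w, 0) (simpDir Y 0)
    (Or.inr (Or.inr rfl))
  have h2 : ∀ i : Fin 1, ∀ a b, ∫ t in stdSimp 1, fderivWithin ℝ (dlogWedge P h F Ω a b)
      (Ω ×ˢ stdSimp 1) (y, t) (simpDir Y i) = _ := fun i a b =>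
    (hp a b).setIntegral_fderivWithin_basis hy i
  rw [h2] at h1
  have h4 : ∀ j : Fin 2, wedgeIntegral₀ P h (familyFace j F) Ω v w y =
      ∫ t in stdSimp 0, dlogWedge P h F Ω (v, 0) (w, 0) (y, simpFace j t) := fun j =>
    MeasureTheory.setIntegral_congr_fun (measurableSet_stdSimp _) fun t ht =>
      dlogWedge_familyFace_left j hF hh hΩ hy ht v w
  have e0 : wedgeIntegral₀ P h (familyFace 1 F) Ω v w y = ∫ t in stdSimp 0,
    dlogWedge P h F Ω (v, 0) (w, 0) (y, simpFace (Fin.succ 0) t) := h4 1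
  have h5 : ∀ F : Y × (Fin 1 → ℝ) → G, cartanIntegral₁ P F Ω v w y = ∫ t in stdSimp 1,
      dlogCubic P F Ω (v, 0) (w, 0) (simpDir Y 0) (y, t) := fun F => by
    simp only [cartanIntegral₁, dlogCubic, hP.cartanForm_cyclic (dlog E F _ _ (simpDir Y 0))]
  have h6 : ∀ u, fderiv ℝ (wedgeIntegral₁ P h F Ω u) y = fderiv ℝ (fun y => ∫ t in stdSimp 1,
    dlogWedge P h F Ω (u, 0) (simpDir Y 0) (y, t)) y := fun u => rfl
  rw [h6, h6, fderiv_setIntegral_stdSimp hΩ (hp _ _).contDiffOn_one hy v,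
    fderiv_setIntegral_stdSimp hΩ (hp _ _).contDiffOn_one hy w, h4 0, e0, h5, h5]
  linear_combination h1

omit [FiniteDimensional ℂ E] [FiniteDimensional ℂ Y] in
-- Cocycle property in the translating element: dlog(h h') = dlog h + Ad_h dlog h', and Ad_h also
-- multiplies the simplex derivative of h'F, so invariance removes it from the second term.
lemma wedgeIntegral₁_mul (hP : IsInvariantQuadratic G P) {F : Y × (Fin 1 → ℝ) → G}
    (hF : HolFamily E F Ω) {h' : Y → G} (hh : ContMDiffOn 𝓘(ℂ, Y) 𝓘(ℂ, E) ∞ h Ω)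
    (hh' : ContMDiffOn 𝓘(ℂ, Y) 𝓘(ℂ, E) ∞ h' Ω) (hΩ : IsOpen Ω) {y : Y} (hy : y ∈ Ω) (v : Y) :
    wedgeIntegral₁ P (fun y => h y * h' y) F Ω v y =
      wedgeIntegral₁ P h (leftTranslate h' F) Ω v y + wedgeIntegral₁ P h' F Ω v y := by
  have hp := hF.partHolOn_dlogWedge (P := P) hh' hΩ
  have hp' := (hF.leftTranslate hh' hΩ).partHolOn_dlogWedge (P := P) hh hΩ
  rw [wedgeIntegral₁, wedgeIntegral₁, wedgeIntegral₁, ← MeasureTheory.integral_add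
    ((hp' _ _).integrableOn hy) ((hp _ _).integrableOn hy)]
  refine MeasureTheory.setIntegral_congr_fun (measurableSet_stdSimp _) fun t ht => ?_
  have hx : (y, t) ∈ Ω ×ˢ stdSimp 1 := ⟨hy, ht⟩
  have h1 : leftTranslate (fun y => h y * h' y) F = leftTranslate h (leftTranslate h' F) := by
    funext x
    simp [leftTranslate, mul_assoc]
  have h2 : dlog E (fun y => h y * h' y) Ω y v =
      dlog E h Ω y v + adjointAction E (h y) (dlog E h' Ω y v) := by
    have h3 := (HolFamily.of_contMDiffOn (q := 1) hΩ hh').dlog_leftTranslate hh hΩ hx (v, 0)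
    rw [← dlog_fst (q := 1) hΩ hh' hx (v, 0), ← h3]
    refine (dlog_fst (q := 1) hΩ (hh.mul hh') hx (v, 0)).symm
  simp only [dlogWedge, simpDir, h1, map_zero, zero_apply, sub_zero, h2, map_add, add_apply]
  rw [(hF.leftTranslate hh' hΩ).dlog_leftTranslate hh hΩ hx]
  simp only [map_zero, zero_add, hP.invariant]

end IsInvariantQuadratic

end LeftTranslation

/-! ### Powers of a manifold are manifolds -/

section PowManifold

variable {𝕜 : Type*} [NontriviallyNormedField 𝕜] {E : Type*} [NormedAddCommGroup E]
  [NormedSpace 𝕜 E] {G : Type*} [TopologicalSpace G] [ChartedSpace E G] {n : ℕ}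

instance {r : ℕ∞ω} [IsManifold 𝓘(𝕜, E) r G] :
    IsManifold (ModelWithCorners.pi fun _ : Fin n => 𝓘(𝕜, E)) r (Fin n → G) := by
  refine isManifold_of_contDiffOn _ _ _ ?_
  rintro _ _ ⟨e, he, rfl⟩ ⟨e', he', rfl⟩
  rw [contDiffOn_pi]
  intro i
  have h1 := (contDiffGroupoid r 𝓘(𝕜, E)).compatible (he i (mem_univ i)) (he' i (mem_univ i))
  have h2 : ContDiffOn 𝕜 r (𝓘(𝕜, E) ∘ ((e i).symm ≫ₕ e' i) ∘ 𝓘(𝕜, E).symm)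
      (𝓘(𝕜, E).symm ⁻¹' ((e i).symm ≫ₕ e' i).source ∩ range 𝓘(𝕜, E)) :=
    (mem_groupoid_of_pregroupoid.1 h1).1
  refine h2.comp (f := fun y : Fin n → E => y i) (contDiff_apply 𝕜 E i).contDiffOn ?_
  rintro y ⟨⟨hy1, hy2⟩, -⟩
  exact ⟨⟨hy1 i (mem_univ i), hy2 i (mem_univ i)⟩, by simp⟩

end PowManifold

/-! ### Regularity and integration of form-valued functions, tested on vectors -/

section AlternatingTools

variable {F : Type*} [NormedAddCommGroup F] [NormedSpace ℂ F] [FiniteDimensional ℂ F]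
  {V : Type*} [NormedAddCommGroup V] [NormedSpace ℂ V] [FiniteDimensional ℂ V]

/-- In finite dimension a form is a fixed linear function of its values on basis tuples. So
smoothness, continuity and integrals of form-valued functions can be checked after evaluation. -/
lemma ContinuousAlternatingMap.exists_leftInverse_eval (F V : Type*) [NormedAddCommGroup F]
    [NormedSpace ℂ F] [FiniteDimensional ℂ F] [NormedAddCommGroup V] [NormedSpace ℂ V]
    [FiniteDimensional ℂ V] (r : ℕ) :
    ∃ (e : (Fin r → Fin (Module.finrank ℂ F)) → Fin r → F)
      (L : ((Fin r → Fin (Module.finrank ℂ F)) → V) →L[ℂ] F [⋀^Fin r]→L[ℂ] V),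
      ∀ a, L (fun s => a (e s)) = a := by
  let b := Module.finBasis ℂ F
  let ev : (F [⋀^Fin r]→L[ℂ] V) →ₗ[ℂ] ((Fin r → Fin (Module.finrank ℂ F)) → V) :=
    { toFun := fun a s => a fun i => b (s i)
      map_add' := fun _ _ => rfl
      map_smul' := fun _ _ => rfl }
  have hev : LinearMap.ker ev = ⊥ := by
    rw [LinearMap.ker_eq_bot]
    intro a a' h
    have h1 : a.toAlternatingMap.toMultilinearMap = a'.toAlternatingMap.toMultilinearMap :=
      Module.Basis.ext_multilinear (fun _ => b) fun s => congr_fun h s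
    ext v
    exact DFunLike.congr_fun h1 v
  obtain ⟨L, hL⟩ := LinearMap.exists_leftInverse_of_injective ev hev
  exact ⟨fun s i => b (s i), LinearMap.toContinuousLinearMap L, fun a => LinearMap.congr_fun hL a⟩

lemma contDiffAt_of_forall_apply {X : Type*} [NormedAddCommGroup X] [NormedSpace ℂ X] {r : ℕ}
    {n : ℕ∞ω} {k : X → F [⋀^Fin r]→L[ℂ] V} {x : X} (h : ∀ v, ContDiffAt ℂ n (fun y => k y v) x) :
    ContDiffAt ℂ n k x := by
  obtain ⟨e, L, hL⟩ := ContinuousAlternatingMap.exists_leftInverse_eval F V r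
  have h1 : k = fun y => L fun s => k y (e s) := funext fun y => (hL (k y)).symm
  rw [h1]
  exact L.contDiff.contDiffAt.comp x (contDiffAt_pi.2 fun s => h (e s))

lemma continuousOn_of_forall_apply {X : Type*} [TopologicalSpace X] {r : ℕ}
    {k : X → F [⋀^Fin r]→L[ℂ] V} {s : Set X} (h : ∀ v, ContinuousOn (fun y => k y v) s) :
    ContinuousOn k s := by
  obtain ⟨e, L, hL⟩ := ContinuousAlternatingMap.exists_leftInverse_eval F V r
  have h1 : k = fun y => L fun s => k y (e s) := funext fun y => (hL (k y)).symm
  rw [h1]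
  exact L.continuous.comp_continuousOn (continuousOn_pi.2 fun s => h (e s))

lemma setIntegral_stdSimp_alternating_apply {r q : ℕ} {k : (Fin q → ℝ) → F [⋀^Fin r]→L[ℂ] V}
    (h : ∀ v, ContinuousOn (fun t => k t v) (stdSimp q)) (v : Fin r → F) :
    (∫ t in stdSimp q, k t) v = ∫ t in stdSimp q, k t v := by
  have : FiniteDimensional ℂ (F [⋀^Fin r]→L[ℂ] V) := by
    obtain ⟨e, L, hL⟩ := ContinuousAlternatingMap.exists_leftInverse_eval F V r
    exact Module.Finite.of_surjective L.toLinearMap fun a => ⟨_, hL a⟩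
  have : CompleteSpace (F [⋀^Fin r]→L[ℂ] V) := FiniteDimensional.complete ℂ _
  have : CompleteSpace V := FiniteDimensional.complete ℂ _
  exact ((ContinuousAlternatingMap.apply ℂ F V v).integral_comp_comm
    ((continuousOn_of_forall_apply h).integrableOn_compact (isCompact_stdSimp q))).symm

lemma ContDiffAt.alternating_compContinuousLinearMap {X F' : Type*} [NormedAddCommGroup X]
    [NormedSpace ℂ X] [NormedAddCommGroup F'] [NormedSpace ℂ F'] {r : ℕ} {n : ℕ∞ω}
    {a : X → F' [⋀^Fin r]→L[ℂ] V} {A : X → F →L[ℂ] F'} {x : X} (ha : ContDiffAt ℂ n a x)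
    (hA : ContDiffAt ℂ n A x) :
    ContDiffAt ℂ n (fun y => (a y).compContinuousLinearMap (A y)) x := by
  refine contDiffAt_of_forall_apply fun v => ?_
  have h1 : ContDiffAt ℂ n (fun y =>
      ContinuousMultilinearMap.compContinuousLinearMapContinuousMultilinear ℂ
      (fun _ : Fin r => F) (fun _ => F') V (fun _ => A y)) x :=
    (ContinuousMultilinearMap.contDiff _).contDiffAt.comp x (contDiffAt_pi.2 fun _ => hA)
  have h2 : ContDiffAt ℂ n (fun y =>
      ContinuousAlternatingMap.toContinuousMultilinearMapCLM ℂ (a y)) x :=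
    (ContinuousLinearMap.contDiff _).contDiffAt.comp x ha
  exact (ContinuousMultilinearMap.apply ℂ (fun _ : Fin r => F) V v).contDiff.contDiffAt.comp x
    (h1.clm_apply h2)

end AlternatingTools

/-! ### Naturality of pull-back and exterior derivative on manifolds -/

section Naturality

variable {F : Type*} [NormedAddCommGroup F] [NormedSpace ℂ F]
  {H : Type*} [TopologicalSpace H] {I : ModelWithCorners ℂ F H} [I.Boundaryless]
  {M : Type*} [TopologicalSpace M] [ChartedSpace H M] [IsManifold I ∞ M]
  {F' : Type*} [NormedAddCommGroup F'] [NormedSpace ℂ F']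
  {H' : Type*} [TopologicalSpace H'] {J : ModelWithCorners ℂ F' H'} [J.Boundaryless]
  {N : Type*} [TopologicalSpace N] [ChartedSpace H' N] [IsManifold J ∞ N]
  {F'' : Type*} [NormedAddCommGroup F''] [NormedSpace ℂ F'']
  {H'' : Type*} [TopologicalSpace H''] {K : ModelWithCorners ℂ F'' H''}
  {L : Type*} [TopologicalSpace L] [ChartedSpace H'' L]
  {V : Type*} [NormedAddCommGroup V] [NormedSpace ℂ V] {k : ℕ}

namespace MForm

omit [I.Boundaryless] [IsManifold I ∞ M] [J.Boundaryless] [IsManifold J ∞ N] in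
lemma pullback_pullback {f : M → N} {g : N → L} (α : MForm F'' L V k) {x : M}
    (hg : MDifferentiableAt J K g (f x)) (hf : MDifferentiableAt I J f x) :
    pullback I J f (pullback J K g α) x = pullback I K (fun y => g (f y)) α x := by
  simp only [pullback, tangentDeriv_comp hg hf]
  rfl

lemma mdifferentiableAt_chart_symm {x : M} {z : F} (hz : z ∈ (extChartAt I x).target) :
    MDifferentiableAt 𝓘(ℂ, F) I (extChartAt I x).symm z :=
  ((contMDiffOn_extChartAt_symm (I := I) (n := ∞) x).contMDiffAt
    ((isOpen_extChartAt_target x).mem_nhds hz)).mdifferentiableAt (by simp)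

/-- With the charts at x and f x fixed, manifold pull-back becomes vector space pull-back by the
coordinate expression of f. Naturality of d and holomorphy of pull-backs are then statements about
vector spaces. -/
lemma inChart_pullback {f : M → N} {x : M} (hf : ∀ᶠ y in 𝓝 x, MDifferentiableAt I J f y)
    (α : MForm F' N V k) :
    inChart I (pullback I J f α) x =ᶠ[𝓝 (extChartAt I x x)] fun y =>
      (inChart J α (f x) (writtenInExtChartAt I J x f y)).compContinuousLinearMap
        (fderiv ℂ (writtenInExtChartAt I J x f) y) := by
  have ht : ∀ᶠ z in 𝓝 (extChartAt I x x), z ∈ (extChartAt I x).target :=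
    extChartAt_target_mem_nhds x
  have hc : ContinuousAt (extChartAt I x).symm (extChartAt I x x) := continuousAt_extChartAt_symm x
  have hc' : Tendsto (extChartAt I x).symm (𝓝 (extChartAt I x x)) (𝓝 x) := by
    have := hc.tendsto
    rwa [extChartAt_to_inv] at this
  have hs : ∀ᶠ y in 𝓝 x, f y ∈ (extChartAt J (f x)).source :=
    hf.self_of_nhds.continuousAt.eventually (extChartAt_source_mem_nhds (f x))
  filter_upwards [ht, hc'.eventually hf, (hc'.eventually hs).eventually_nhds] with z h1 h2 h3
  have h4 := mdifferentiableAt_chart_symm h1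
  have h5 : MDifferentiableAt J 𝓘(ℂ, F') (extChartAt J (f x)) (f ((extChartAt I x).symm z)) :=
    mdifferentiableAt_extChartAt (by simpa using h3.self_of_nhds)
  have h6 : MDifferentiableAt 𝓘(ℂ, F) 𝓘(ℂ, F') (writtenInExtChartAt I J x f) z :=
    h5.comp z (h2.comp z h4)
  have h7 : MDifferentiableAt 𝓘(ℂ, F') J (extChartAt J (f x)).symm
      (writtenInExtChartAt I J x f z) :=
    mdifferentiableAt_chart_symm ((extChartAt J (f x)).map_source h3.self_of_nhds)
  simp only [inChart]
  rw [pullback_pullback α h2 h4, ← tangentDeriv_vectorSpace]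
  have h8 := pullback_pullback α h7 h6
  refine Eq.trans ?_ h8.symm
  have h9 : (fun y => f ((extChartAt I x).symm y)) =ᶠ[𝓝 z] fun y =>
      (extChartAt J (f x)).symm (writtenInExtChartAt I J x f y) := by
    filter_upwards [h3] with y hy
    exact ((extChartAt J (f x)).left_inv hy).symm
  simp only [pullback, tangentDeriv_congr h9]
  rw [show f ((extChartAt I x).symm z) = _ from h9.self_of_nhds]

omit [J.Boundaryless] [IsManifold J ∞ N] in
omit [IsManifold I ∞ M] in
lemma contDiffAt_written {f : M → N} {x : M} (hf : ContMDiffAt I J ∞ f x) :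
    ContDiffAt ℂ ∞ (writtenInExtChartAt I J x f) (extChartAt I x x) := by
  have := (contMDiffAt_iff.1 hf).2
  rwa [I.range_eq_univ, contDiffWithinAt_univ] at this

lemma HolomorphicAt.pullback [FiniteDimensional ℂ F] [FiniteDimensional ℂ V] {f : M → N} {x : M} {α : MForm F' N V k}
    (hα : HolomorphicAt J α (f x)) (hf : ContMDiffAt I J ∞ f x)
    (hf' : ∀ᶠ y in 𝓝 x, MDifferentiableAt I J f y) :
    HolomorphicAt I (MForm.pullback I J f α) x := by
  refine ContDiffAt.congr_of_eventuallyEq ?_ (inChart_pullback hf' α)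
  have h1 := contDiffAt_written hf
  have h2 : writtenInExtChartAt I J x f (extChartAt I x x) = extChartAt J (f x) (f x) := by
    simp [writtenInExtChartAt]
  have h3 : ContDiffAt ℂ ∞ (fderiv ℂ (writtenInExtChartAt I J x f)) (extChartAt I x x) :=
    h1.fderiv_right (by simp)
  unfold HolomorphicAt at hα
  rw [← h2] at hα
  exact ContDiffAt.alternating_compContinuousLinearMap (hα.comp _ h1) h3

lemma d_pullback {f : M → N} {x : M} {α : MForm F' N V k}
    (hα : HolomorphicAt J α (f x)) (hf : ContMDiffAt I J ∞ f x)
    (hf' : ∀ᶠ y in 𝓝 x, MDifferentiableAt I J f y) :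
    d I (MForm.pullback I J f α) x = MForm.pullback I J f (d J α) x := by
  have h1 := contDiffAt_written hf
  have h2 : writtenInExtChartAt I J x f (extChartAt I x x) = extChartAt J (f x) (f x) := by
    simp [writtenInExtChartAt]
  unfold HolomorphicAt at hα
  rw [← h2] at hα
  rw [d, (inChart_pullback hf' α).extDeriv_eq, extDeriv_pullback (hα.differentiableAt (by simp)) h1
    (by simpa using ENat.LEInfty.out), MForm.pullback, d, h2, tangentDeriv_extChartAt_self,
    tangentDeriv_extChartAt_self, tangentDeriv_eq_fderivWithin hf'.self_of_nhds, I.range_eq_univ,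
    fderivWithin_univ]
  rfl

lemma inChart_vectorSpace (α : MForm F F V k) (x : F) : inChart 𝓘(ℂ, F) α x = α := by
  funext y
  have : tangentDeriv 𝓘(ℂ, F) 𝓘(ℂ, F) (fun y : F => y) y = ContinuousLinearMap.id ℂ F :=
    tangentDeriv_id y
  have h : ((extChartAt 𝓘(ℂ, F) x).symm : F → F) = fun y => y := by
    funext z
    simp only [mfld_simps]
    rfl
  simp only [inChart, pullback, h, this]
  rfl

lemma d_vectorSpace (α : MForm F F V k) (x : F) : d 𝓘(ℂ, F) α x = extDeriv α x := by
  rw [d, inChart_vectorSpace, tangentDeriv_extChartAt_self]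
  rfl

/-- The exterior derivative in a chart. -/
lemma inChart_d {α : MForm F M V k} {x : M} (hα : ∀ᶠ y in 𝓝 x, HolomorphicAt I α y) :
    inChart I (d I α) x =ᶠ[𝓝 (extChartAt I x x)] extDeriv (inChart I α x) := by
  have ht : ∀ᶠ z in 𝓝 (extChartAt I x x), z ∈ (extChartAt I x).target :=
    extChartAt_target_mem_nhds x
  have hc' : Tendsto (extChartAt I x).symm (𝓝 (extChartAt I x x)) (𝓝 x) := by
    have := (continuousAt_extChartAt_symm (I := I) x).tendsto
    rwa [extChartAt_to_inv] at this
  filter_upwards [ht.eventually_nhds, hc'.eventually hα] with z h1 h2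
  rw [← d_vectorSpace, inChart, ← d_pullback h2
    ((contMDiffOn_extChartAt_symm (I := I) (n := ∞) x).contMDiffAt
    ((isOpen_extChartAt_target x).mem_nhds h1.self_of_nhds))
    (h1.mono fun _ => mdifferentiableAt_chart_symm)]
  rfl

lemma HolomorphicAt.d {α : MForm F M V k} {x : M} (hα : ∀ᶠ y in 𝓝 x, HolomorphicAt I α y) :
    HolomorphicAt I (MForm.d I α) x := by
  refine ContDiffAt.congr_of_eventuallyEq ?_ (inChart_d hα)
  have h : ContDiffAt ℂ ∞ (inChart I α x) (extChartAt I x x) := hα.self_of_nhds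
  exact (ContinuousAlternatingMap.alternatizeUncurryFinCLM ℂ F V).contDiff.contDiffAt.comp _
    (h.fderiv_right (m := ∞) (by simp))

lemma d_d {α : MForm F M V k} {x : M} (hα : ∀ᶠ y in 𝓝 x, HolomorphicAt I α y) :
    MForm.d I (MForm.d I α) x = 0 := by
  have h : ContDiffAt ℂ ∞ (inChart I α x) (extChartAt I x x) := hα.self_of_nhds
  rw [MForm.d, (inChart_d hα).extDeriv_eq, extDeriv_extDeriv_apply h
    (by simpa using ENat.LEInfty.out)]
  rfl

end MForm

end Naturality

/-! ### Sums over permutations of two and four letters -/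

section Permutations

lemma sum_perm_fin_succ {M : Type*} [AddCommMonoid M] {n : ℕ}
    (f : Equiv.Perm (Fin (n + 1)) → M) :
    ∑ τ, f τ = ∑ p, ∑ e : Equiv.Perm (Fin n), f (Equiv.Perm.decomposeFin.symm (p, e)) := by
  rw [← Equiv.Perm.decomposeFin.symm.sum_comp, Fintype.sum_prod_type]

lemma sum_perm_fin_two {M : Type*} [AddCommMonoid M] (f : Equiv.Perm (Fin 2) → M) :
    ∑ τ, f τ = f 1 + f (Equiv.swap 0 1) := by
  have : (Finset.univ : Finset (Equiv.Perm (Fin 2))) = {1, Equiv.swap 0 1} := by decide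
  rw [this, Finset.sum_pair (by decide)]

/-- The symmetries generate a group of order 8, so the 24 terms collapse to one for each splitting
of four letters into two pairs. -/
lemma sum_perm_fin_four_of_symm (g : Fin 4 → Fin 4 → Fin 4 → Fin 4 → ℂ)
    (h₁ : ∀ a b c d, g a b c d = -g b a c d) (h₂ : ∀ a b c d, g a b c d = -g a b d c)
    (h₃ : ∀ a b c d, g a b c d = g c d a b) :
    ∑ τ : Equiv.Perm (Fin 4), Equiv.Perm.sign τ • g (τ 0) (τ 1) (τ 2) (τ 3) =
      8 * (g 0 1 2 3 - g 0 2 1 3 + g 0 3 1 2) := by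
  have e : ∀ τ : Equiv.Perm (Fin 4), g (τ 0) (τ 1) (τ 2) (τ 3) = g (τ 0) (τ (Fin.succ 0))
    (τ (Fin.succ (Fin.succ 0))) (τ (Fin.succ (Fin.succ (Fin.succ 0)))) := fun _ => rfl
  simp only [e, sum_perm_fin_succ, Fin.sum_univ_succ, Equiv.Perm.decomposeFin_symm_apply_succ,
    Equiv.Perm.decomposeFin_symm_apply_zero, Equiv.Perm.decomposeFin.symm_sign,
    Finset.univ_unique, Finset.sum_singleton]
  simp [Equiv.swap_apply_def, Fin.ext_iff]
  simp only [h₁ 1 0, h₁ 2 0, h₁ 3 0, h₁ 2 1, h₁ 3 1, h₁ 3 2, h₂ _ _ 1 0, h₂ _ _ 2 0, h₂ _ _ 3 0,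
    h₂ _ _ 2 1, h₂ _ _ 3 1, h₂ _ _ 3 2, h₃ 2 3 0 1, h₃ 1 3 0 2, h₃ 1 2 0 3]
  ring

end Permutations

/-! ### Explicit wedge products in low degree -/

section Wedge

variable {F E V : Type*} [NormedAddCommGroup F] [NormedSpace ℂ F]
  [NormedAddCommGroup E] [NormedSpace ℂ E] [NormedAddCommGroup V] [NormedSpace ℂ V]

lemma bilinMul_apply (B : E →L[ℂ] E →L[ℂ] V) {k l : ℕ} (a : F [⋀^Fin k]→L[ℂ] E)
    (b : F [⋀^Fin l]→L[ℂ] E) (v : Fin (k + l) → F) :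
    bilinMul B a b v = B (a fun i => v (Fin.castAdd l i)) (b fun i => v (Fin.natAdd k i)) := rfl

lemma bilinWedge_one_one_apply (B : E →L[ℂ] E →L[ℂ] V) (a b : F [⋀^Fin 1]→L[ℂ] E)
    (v : Fin 2 → F) :
    bilinWedge B a b v = B (a ![v 0]) (b ![v 1]) - B (a ![v 1]) (b ![v 0]) := by
  have h1 : ∀ u : Fin 2 → F, bilinMul B a b u = B (a ![u 0]) (b ![u 1]) := fun u => by
    rw [bilinMul_apply]
    congr 2 <;> (congr 1; funext i; fin_cases i; rfl)
  have h2 : ContinuousMultilinearMap.alternatization (bilinMul B a b) v =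
      bilinMul B a b v - bilinMul B a b (v ∘ Equiv.swap (0 : Fin 2) 1) := by
    rw [ContinuousMultilinearMap.alternatization_apply_apply]
    refine (sum_perm_fin_two _).trans ?_
    rw [Equiv.Perm.sign_one, Equiv.Perm.sign_swap (by decide), one_smul, Units.neg_smul, one_smul,
      sub_eq_add_neg]
    rfl
  rw [bilinWedge, ContinuousAlternatingMap.smul_apply, h2, h1, h1]
  simp

/-- The factor 2 is the 8 of `sum_perm_fin_four_of_symm` divided by 2! · 2!. -/
lemma bilinWedge_two_two_apply {P : E →L[ℂ] E →L[ℂ] ℂ} (hP : ∀ X Y, P X Y = P Y X)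
    (a : F [⋀^Fin 2]→L[ℂ] E) (v : Fin 4 → F) :
    bilinWedge P a a v = 2 * (P (a ![v 0, v 1]) (a ![v 2, v 3]) -
      P (a ![v 0, v 2]) (a ![v 1, v 3]) + P (a ![v 0, v 3]) (a ![v 1, v 2])) := by
  have h1 : ∀ x y, a ![x, y] = -a ![y, x] := fun x y => by
    have := a.toAlternatingMap.map_swap ![y, x] (i := 0) (j := 1) (by decide)
    rw [← show ![y, x] ∘ Equiv.swap (0 : Fin 2) 1 = ![x, y] from by
      funext i; fin_cases i <;> rfl]
    exact this
  have h2 := sum_perm_fin_four_of_symm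
    (fun i j k l => P (a ![v i, v j]) (a ![v k, v l]))
    (fun i j k l => by rw [h1 (v i), map_neg, neg_apply])
    (fun i j k l => by rw [h1 (v k), map_neg]) (fun i j k l => hP _ _)
  have h3 : ∀ u : Fin 4 → F, bilinMul P a a u = P (a ![u 0, u 1]) (a ![u 2, u 3]) := fun u => by
    rw [bilinMul_apply]
    congr 2 <;> (congr 1; funext i; fin_cases i <;> rfl)
  have h4 : ContinuousMultilinearMap.alternatization (bilinMul P a a) v =
      ∑ τ : Equiv.Perm (Fin 4), Equiv.Perm.sign τ •
        P (a ![v (τ 0), v (τ 1)]) (a ![v (τ 2), v (τ 3)]) := by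
    rw [ContinuousMultilinearMap.alternatization_apply_apply]
    exact Finset.sum_congr rfl fun τ _ => congr_arg _ (h3 _)
  rw [bilinWedge, ContinuousAlternatingMap.smul_apply, h4, h2]
  simp only [Nat.factorial, smul_eq_mul]
  push_cast
  ring

end Wedge

/-! ### The curvature of the connection Σ t_i D_i -/

section Curvature

variable {E : Type*} [NormedAddCommGroup E] [NormedSpace ℂ E]
  {G : Type*} [TopologicalSpace G] [ChartedSpace E G] [Group G] [LieGroup 𝓘(ℂ, E) ∞ G]

lemma maurerCartan_comp_tangentDeriv_chart_symm {g : G} {z : E}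
    (hz : z ∈ (extChartAt 𝓘(ℂ, E) g).target) :
    (maurerCartan E ((extChartAt 𝓘(ℂ, E) g).symm z)).comp
      (tangentDeriv 𝓘(ℂ, E) 𝓘(ℂ, E) (extChartAt 𝓘(ℂ, E) g).symm z) = mcChart E g z := by
  set k := (extChartAt 𝓘(ℂ, E) g).symm z with hk
  have h1 : MDifferentiableAt 𝓘(ℂ, E) 𝓘(ℂ, E) (extChartAt 𝓘(ℂ, E) g).symm z :=
    MForm.mdifferentiableAt_chart_symm hz
  have h2 : MDifferentiableAt 𝓘(ℂ, E) 𝓘(ℂ, E) (fun h : G => h * k⁻¹) k :=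
    (contMDiff_mul_right (I := 𝓘(ℂ, E)) (n := ∞) (a := k⁻¹)).mdifferentiable (by simp) k
  have h3 : MDifferentiableAt 𝓘(ℂ, E) 𝓘(ℂ, E) (extChartAt 𝓘(ℂ, E) (1 : G)) (k * k⁻¹) := by
    rw [mul_inv_cancel]
    exact mdifferentiableAt_extChartAt_self 1
  have h4 : tangentDeriv 𝓘(ℂ, E) 𝓘(ℂ, E) (extChartAt 𝓘(ℂ, E) (1 : G)) (k * k⁻¹) =
      ContinuousLinearMap.id ℂ E := by
    rw [mul_inv_cancel, tangentDeriv_extChartAt_self]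
  rw [maurerCartan, ← tangentDeriv_comp (f := (extChartAt 𝓘(ℂ, E) g).symm) h2 h1, mcChart, ← tangentDeriv_vectorSpace]
  have h5 := tangentDeriv_comp (f := fun y => (extChartAt 𝓘(ℂ, E) g).symm y * k⁻¹)
    (g := extChartAt 𝓘(ℂ, E) (1 : G)) (x := z) h3 (h2.comp z h1)
  rw [h4] at h5
  exact h5.symm

/-- The derivatives of the barycentric coordinates. -/
def baryDeriv {n : ℕ} (s : Fin n → ℂ) : Fin (n + 1) → ℂ := Fin.cons (-∑ i, s i) s

lemma hasFDerivAt_bary {n : ℕ} (s : Fin n → ℂ) (i : Fin (n + 1)) :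
    ∃ φ : (Fin n → ℂ) →L[ℂ] ℂ, HasFDerivAt (fun s => bary s i) φ s ∧ ∀ u, φ u = baryDeriv u i := by
  cases i using Fin.cases with
  | zero =>
    refine ⟨-∑ i, ContinuousLinearMap.proj i, ?_, fun u => by simp [baryDeriv]⟩
    simp only [bary, Fin.cons_zero]
    exact (HasFDerivAt.fun_sum fun i _ => hasFDerivAt_apply i s).const_sub 1
  | succ i =>
    refine ⟨ContinuousLinearMap.proj i, ?_, fun u => by simp [baryDeriv]⟩
    simpa [bary] using hasFDerivAt_apply i s

omit [LieGroup 𝓘(ℂ, E) ∞ G] in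
lemma connectionForm_apply {n : ℕ} (x : (Fin (n + 1) → G) × (Fin n → ℂ))
    (v : Fin 1 → (Fin (n + 1) → E) × (Fin n → ℂ)) :
    connectionForm E G n x v =
      ∑ i, bary x.2 i • maurerCartan E (x.1 i) ((v 0).1 i) := by
  change (∑ i : Fin (n + 1), bary x.2 i • (maurerCartan E (x.1 i)).comp
    ((ContinuousLinearMap.proj i).comp (ContinuousLinearMap.fst ℂ (Fin (n + 1) → E)
    (Fin n → ℂ)))) (v 0) = _
  rw [sum_apply]
  rfl

/-- Pulling back by the inverse chart acts factor by factor and replaces each Maurer–Cartan form by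
its coordinate expression `mcChart`; only then can the connection form be differentiated. -/
lemma inChart_connectionForm {n : ℕ} (x : (Fin (n + 1) → G) × (Fin n → ℂ)) :
    ∀ᶠ z in 𝓝 (extChartAt (powProdModel E (n + 1) n) x x), ∀ v,
      MForm.inChart (powProdModel E (n + 1) n) (connectionForm E G n) x z v =
        ∑ i, bary z.2 i • mcChart E (x.1 i) (z.1 i) ((v 0).1 i) := by
  filter_upwards [extChartAt_target_mem_nhds (I := powProdModel E (n + 1) n) x] with z hz v
  have h1 : z.1 ∈ (extChartAt (powModel E (n + 1)) x.1).target := by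
    rw [extChartAt_prod] at hz
    exact hz.1
  have h2 := (mem_extChartAt_pi_target _ _).1 h1
  set ψ := (extChartAt (powProdModel E (n + 1) n) x).symm with hψ
  have h3 : MDifferentiableAt 𝓘(ℂ, (Fin (n + 1) → E) × (Fin n → ℂ)) (powProdModel E (n + 1) n) ψ z :=
    MForm.mdifferentiableAt_chart_symm hz
  have h4 : ∀ (i : Fin (n + 1)) w, (tangentDeriv 𝓘(ℂ, (Fin (n + 1) → E) × (Fin n → ℂ))
      (powProdModel E (n + 1) n) ψ z w).1 i =
      tangentDeriv 𝓘(ℂ, E) 𝓘(ℂ, E) (extChartAt 𝓘(ℂ, E) (x.1 i)).symm (z.1 i) (w.1 i) := by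
    intro i w
    have e1 : tangentDeriv (powProdModel E (n + 1) n) 𝓘(ℂ, E)
        (fun p : (Fin (n + 1) → G) × (Fin n → ℂ) => p.1 i) (ψ z) =
        (ContinuousLinearMap.proj i).comp (ContinuousLinearMap.fst ℂ _ _) := by
      rw [tangentDeriv_comp (f := Prod.fst) (g := fun h : Fin (n + 1) → G => h i)
        (mdifferentiableAt_eval i _) mdifferentiableAt_fst, tangentDeriv_eval]
      congr 1
      exact mfderiv_fst
    have e2 := tangentDeriv_comp (f := ψ) (x := z)
      (g := fun p : (Fin (n + 1) → G) × (Fin n → ℂ) => p.1 i)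
      ((mdifferentiableAt_eval i _).comp _ mdifferentiableAt_fst) h3
    rw [e1] at e2
    have e3 := tangentDeriv_comp (I := 𝓘(ℂ, (Fin (n + 1) → E) × (Fin n → ℂ)))
      (f := fun p : (Fin (n + 1) → E) × (Fin n → ℂ) => p.1 i) (x := z)
      (g := (extChartAt 𝓘(ℂ, E) (x.1 i)).symm) (MForm.mdifferentiableAt_chart_symm (h2 i))
      (DifferentiableAt.mdifferentiableAt (by fun_prop))
    have e4 : fderiv ℂ (fun p : (Fin (n + 1) → E) × (Fin n → ℂ) => p.1 i) z =
      (ContinuousLinearMap.proj i).comp (ContinuousLinearMap.fst ℂ _ _) :=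
      ((ContinuousLinearMap.proj (R := ℂ) (φ := fun _ : Fin (n + 1) => E) i).comp
        (ContinuousLinearMap.fst ℂ (Fin (n + 1) → E) (Fin n → ℂ))).fderiv
    rw [tangentDeriv_vectorSpace, e4] at e3
    have e5 := DFunLike.congr_fun (e2.symm.trans e3) w
    exact e5
  have h5 : MForm.inChart (powProdModel E (n + 1) n) (connectionForm E G n) x z v =
      ∑ i, bary (ψ z).2 i • maurerCartan E ((ψ z).1 i)
        ((tangentDeriv 𝓘(ℂ, (Fin (n + 1) → E) × (Fin n → ℂ))
          (powProdModel E (n + 1) n) ψ z (v 0)).1 i) := by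
    exact connectionForm_apply (E := E) (G := G) (ψ z) (tangentDeriv _ _ ψ z ∘ v)
  rw [h5]
  refine Finset.sum_congr rfl fun i _ => ?_
  rw [h4, ← maurerCartan_comp_tangentDeriv_chart_symm (h2 i)]
  rfl

variable [FiniteDimensional ℂ E]

lemma d_connectionForm_apply {n : ℕ} (x : (Fin (n + 1) → G) × (Fin n → ℂ))
    (p r : (Fin (n + 1) → E) × (Fin n → ℂ)) :
    MForm.d (powProdModel E (n + 1) n) (connectionForm E G n) x ![p, r] =
      ∑ i, (baryDeriv p.2 i • maurerCartan E (x.1 i) (r.1 i) -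
        baryDeriv r.2 i • maurerCartan E (x.1 i) (p.1 i) +
        bary x.2 i • lieBracket E G (maurerCartan E (x.1 i) (p.1 i))
          (maurerCartan E (x.1 i) (r.1 i))) := by
  set z := extChartAt (powProdModel E (n + 1) n) x x with hz
  have hz1 : ∀ i, z.1 i = extChartAt 𝓘(ℂ, E) (x.1 i) (x.1 i) := fun i => rfl
  have hz2 : z.2 = x.2 := rfl
  have hA : ∀ i, ContDiffAt ℂ ∞ (mcChart E (x.1 i)) (z.1 i) := fun i =>
    contDiffAt_mcChart (mem_extChartAt_target (x.1 i))
  have hev := inChart_connectionForm (E := E) x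
  rw [← hz] at hev
  have hbary : ∀ i, DifferentiableAt ℂ (fun z : (Fin (n + 1) → E) × (Fin n → ℂ) => bary z.2 i) z ∧
      ∀ w, fderiv ℂ (fun z : (Fin (n + 1) → E) × (Fin n → ℂ) => bary z.2 i) z w =
        baryDeriv w.2 i := fun i => by
    obtain ⟨φ, h1, h2⟩ := hasFDerivAt_bary z.2 i
    have h3 := h1.comp z (f := Prod.snd) hasFDerivAt_snd
    exact ⟨h3.differentiableAt, fun w => (DFunLike.congr_fun h3.fderiv w).trans (h2 _)⟩
  have hmc : ∀ i (u : E), DifferentiableAt ℂ (fun z : (Fin (n + 1) → E) × (Fin n → ℂ) =>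
      mcChart E (x.1 i) (z.1 i) u) z ∧
      ∀ w, fderiv ℂ (fun z : (Fin (n + 1) → E) × (Fin n → ℂ) => mcChart E (x.1 i) (z.1 i) u) z w =
        fderiv ℂ (mcChart E (x.1 i)) (z.1 i) (w.1 i) u := fun i u => by
    have h1 := ((hA i).differentiableAt (by simp)).hasFDerivAt
    have h2 := h1.comp z (f := fun z : (Fin (n + 1) → E) × (Fin n → ℂ) => z.1 i)
      ((ContinuousLinearMap.proj (R := ℂ) (φ := fun _ : Fin (n + 1) => E) i).comp
        (ContinuousLinearMap.fst ℂ (Fin (n + 1) → E) (Fin n → ℂ))).hasFDerivAt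
    have h3 := h2.clm_apply (hasFDerivAt_const u z)
    refine ⟨h3.differentiableAt, fun w => ?_⟩
    exact (DFunLike.congr_fun h3.fderiv w).trans (by simp)
  have hdiff : DifferentiableAt ℂ (MForm.inChart (powProdModel E (n + 1) n)
      (connectionForm E G n) x) z := by
    refine ContDiffAt.differentiableAt (n := 1) (contDiffAt_of_forall_apply fun v => ?_) one_ne_zero
    refine ContDiffAt.congr_of_eventuallyEq ?_ (hev.mono fun z h => h v)
    refine ContDiffAt.sum fun i _ => ContDiffAt.smul ?_ (ContDiffAt.clm_apply ?_ contDiffAt_const)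
    · have : ContDiff ℂ 1 (fun s : Fin n → ℂ => bary s i) := by
        cases i using Fin.cases with
        | zero => simp only [bary, Fin.cons_zero]; fun_prop
        | succ i => simp only [bary, Fin.cons_succ]; fun_prop
      exact this.contDiffAt.comp z contDiffAt_snd
    · exact ((hA i).of_le (by exact_mod_cast le_top)).comp z
        (f := fun z : (Fin (n + 1) → E) × (Fin n → ℂ) => z.1 i) (by fun_prop)
  have hfd : ∀ u w, fderiv ℂ (fun z => MForm.inChart (powProdModel E (n + 1) n)
      (connectionForm E G n) x z u) z w = ∑ i, (bary x.2 i •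
        fderiv ℂ (mcChart E (x.1 i)) (z.1 i) (w.1 i) ((u 0).1 i) +
        baryDeriv w.2 i • mcChart E (x.1 i) (z.1 i) ((u 0).1 i)) := fun u w => by
    have h1 : (fun z => MForm.inChart (powProdModel E (n + 1) n) (connectionForm E G n) x z u)
      =ᶠ[𝓝 z] fun z => ∑ i, bary z.2 i • mcChart E (x.1 i) (z.1 i) ((u 0).1 i) :=
      hev.mono fun z h => h u
    have h2 : ∀ i, DifferentiableAt ℂ (fun z : (Fin (n + 1) → E) × (Fin n → ℂ) =>
        bary z.2 i • mcChart E (x.1 i) (z.1 i) ((u 0).1 i)) z :=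
      fun i => (hbary i).1.smul (hmc i _).1
    rw [h1.fderiv_eq, fderiv_fun_sum fun i _ => h2 i, sum_apply]
    refine Finset.sum_congr rfl fun i _ => ?_
    rw [fderiv_fun_smul (hbary i).1 (hmc i _).1]
    simp [(hbary i).2, (hmc i _).2, hz2]
  rw [MForm.d, tangentDeriv_extChartAt_self, ContinuousAlternatingMap.compContinuousLinearMap_apply,
    ← hz, extDeriv_apply hdiff]
  refine (Fin.sum_univ_two _).trans ?_
  rw [hfd, hfd, Fin.val_zero, Fin.val_one, pow_zero, pow_one, one_smul, neg_one_smul,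
    ← sub_eq_add_neg, ← Finset.sum_sub_distrib]
  refine Finset.sum_congr rfl fun i _ => ?_
  rw [maurerCartan_eq_mcChart, ← hz1]
  rw [← fderiv_mcChart_antisymm (by rw [hz1]; exact mem_extChartAt_target (x.1 i)), smul_sub]
  change bary x.2 i • fderiv ℂ (mcChart E (x.1 i)) (z.1 i) (p.1 i) (r.1 i) +
    baryDeriv p.2 i • mcChart E (x.1 i) (z.1 i) (r.1 i) -
    (bary x.2 i • fderiv ℂ (mcChart E (x.1 i)) (z.1 i) (r.1 i) (p.1 i) +
    baryDeriv r.2 i • mcChart E (x.1 i) (z.1 i) (p.1 i)) = _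
  abel

/-- The factor ½ disappears because [θ ∧ θ](p, r) = [θp, θr] − [θr, θp] = 2[θp, θr]. -/
lemma curvatureForm_apply {n : ℕ} (x : (Fin (n + 1) → G) × (Fin n → ℂ))
    (p r : (Fin (n + 1) → E) × (Fin n → ℂ)) :
    curvatureForm E G n x ![p, r] =
      (∑ i, (baryDeriv p.2 i • maurerCartan E (x.1 i) (r.1 i) -
        baryDeriv r.2 i • maurerCartan E (x.1 i) (p.1 i) +
        bary x.2 i • lieBracket E G (maurerCartan E (x.1 i) (p.1 i))
          (maurerCartan E (x.1 i) (r.1 i)))) -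
      lieBracket E G (∑ i, bary x.2 i • maurerCartan E (x.1 i) (p.1 i))
        (∑ i, bary x.2 i • maurerCartan E (x.1 i) (r.1 i)) := by
  rw [curvatureForm, ContinuousAlternatingMap.sub_apply, d_connectionForm_apply,
    ContinuousAlternatingMap.smul_apply, bilinWedge_one_one_apply, connectionForm_apply,
    connectionForm_apply]
  simp only [Matrix.cons_val_zero, Matrix.cons_val_one]
  rw [lieBracket_skew (∑ i, bary x.2 i • maurerCartan E (x.1 i) (r.1 i)), sub_neg_eq_add,
    ← two_smul ℂ, smul_smul]
  norm_num

end Curvature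

/-! ### Evaluating fibre integrals on vectors -/

section FiberIntegral

variable {F : Type*} [NormedAddCommGroup F] [NormedSpace ℂ F]
  {H : Type*} [TopologicalSpace H] {I : ModelWithCorners ℂ F H}
  {M : Type*} [TopologicalSpace M] [ChartedSpace H M]
  {F' : Type*} [NormedAddCommGroup F'] [NormedSpace ℂ F']
  {H' : Type*} [TopologicalSpace H'] {J : ModelWithCorners ℂ F' H'}
  {N : Type*} [TopologicalSpace N] [ChartedSpace H' N]

lemma contractFirst_one_apply {r : ℕ} (u : Fin 1 → F) (a : F [⋀^Fin (r + 1)]→L[ℂ] ℂ)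
    (v : Fin r → F) : contractFirst 1 u a v = a (Fin.cons (u 0) v) := rfl

lemma contractFirst_two_apply {r : ℕ} (u : Fin 2 → F) (a : F [⋀^Fin (r + 2)]→L[ℂ] ℂ)
    (v : Fin r → F) : contractFirst 2 u a v = a (Fin.cons (u 0) (Fin.cons (u 1) v)) := rfl

lemma contractFirst_three_apply {r : ℕ} (u : Fin 3 → F) (a : F [⋀^Fin (r + 3)]→L[ℂ] ℂ)
    (v : Fin r → F) :
    contractFirst 3 u a v = a (Fin.cons (u 0) (Fin.cons (u 1) (Fin.cons (u 2) v))) := rfl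

lemma fiberIntegral_apply [FiniteDimensional ℂ F] {r q : ℕ} {f : M → (Fin q → ℝ) → N}
    {α : MForm F' N ℂ (r + q)} {x : M} {k : (Fin q → ℝ) → (Fin r → F) → ℂ}
    (hk : ∀ t ∈ stdSimp q, ∀ v, contractFirst q (simpVelocity J (f x) t) (α (f x t))
      (fun i => tangentDeriv I J (fun y => f y t) x (v i)) = k t v)
    (hc : ∀ v, ContinuousOn (fun t => k t v) (stdSimp q)) (v : Fin r → F) :
    fiberIntegral I J r q f α x v = ∫ t in stdSimp q, k t v := by
  rw [fiberIntegral, setIntegral_stdSimp_alternating_apply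
    fun v => (hc v).congr fun t ht => hk t ht v]
  exact MeasureTheory.setIntegral_congr_fun (measurableSet_stdSimp q) fun t ht => hk t ht v

end FiberIntegral

/-! ### The section of the universal bundle and the curvature along it -/

section BSSForms

variable {E : Type*} [NormedAddCommGroup E] [NormedSpace ℂ E] [FiniteDimensional ℂ E]
  {G : Type*} [TopologicalSpace G] [ChartedSpace E G] [Group G] [LieGroup 𝓘(ℂ, E) ∞ G]

omit [FiniteDimensional ℂ E] [LieGroup 𝓘(ℂ, E) ∞ G] in
lemma simpVelocity_bssSection {n : ℕ} (g : Fin n → G) (t : Fin n → ℝ) (ht : t ∈ stdSimp n)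
    (i : Fin n) :
    simpVelocity (powProdModel E (n + 1) n) (bssSection G n g) t i = (0, Pi.single i 1) := by
  have h1 : HasFDerivWithinAt (fun s : Fin n → ℝ => fun j => ((s j : ℝ) : ℂ))
      (ContinuousLinearMap.pi fun j => Complex.ofRealCLM.comp (ContinuousLinearMap.proj j))
      (stdSimp n) t :=
    (ContinuousLinearMap.pi fun j => Complex.ofRealCLM.comp
      (ContinuousLinearMap.proj (R := ℝ) (φ := fun _ : Fin n => ℝ) j)).hasFDerivWithinAt
  have h2 := (hasFDerivWithinAt_const (𝕜 := ℝ)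
    (extChartAt (powModel E (n + 1)) (Fin.partialProd g) (Fin.partialProd g)) t
    (stdSimp n)).prodMk h1
  have h3 : simpVelocity (powProdModel E (n + 1) n) (bssSection G n g) t i = _ :=
    DFunLike.congr_fun (h2.fderivWithin (uniqueDiffOn_stdSimp n t ht)) (Pi.single i 1)
  rw [h3]
  refine Prod.ext rfl (funext fun j => ?_)
  by_cases hj : j = i
  · subst hj; simp
  · simp [hj]

omit [FiniteDimensional ℂ E] in
lemma tangentDeriv_bssSection {n : ℕ} (g : Fin n → G) (t : Fin n → ℝ) (v : Fin n → E) :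
    (∀ i, (tangentDeriv (powModel E n) (powProdModel E (n + 1) n)
      (fun y => bssSection G n y t) g v).1 i =
      tangentDeriv (powModel E n) 𝓘(ℂ, E) (fun y : Fin n → G => Fin.partialProd y i) g v) ∧
    (tangentDeriv (powModel E n) (powProdModel E (n + 1) n)
      (fun y => bssSection G n y t) g v).2 = 0 := by
  have h0 : ∀ i : Fin (n + 1), ContMDiff (powModel E n) 𝓘(ℂ, E) ∞
      (fun y : Fin n → G => Fin.partialProd y i) := fun i => by
    induction i using Fin.induction with
    | zero => simpa using contMDiff_const
    | succ i ih =>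
      simp only [Fin.partialProd_succ]
      exact ih.mul fun x => contMDiffAt_eval i x
  have h1 : MDifferentiableAt (powModel E n) (powModel E (n + 1))
      (fun y : Fin n → G => Fin.partialProd y) g :=
    mdifferentiableAt_pi_iff.2 fun i => (h0 i).mdifferentiable (by simp) g
  have h2 : tangentDeriv (powModel E n) (powProdModel E (n + 1) n)
      (fun y => bssSection G n y t) g =
      (tangentDeriv (powModel E n) (powModel E (n + 1)) (fun y => Fin.partialProd y) g).prod 0 := by
    have h3 := mfderiv_prodMk h1 (mdifferentiableAt_const (I := powModel E n)
      (I' := 𝓘(ℂ, Fin n → ℂ)) (c := fun i => (t i : ℂ)) (x := g))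
    refine h3.trans ?_
    rw [mfderiv_const]
    rfl
  rw [h2]
  refine ⟨fun i => ?_, rfl⟩
  exact tangentDeriv_pi_apply h1 v i

/-- A simplex direction has no group component, so only the terms differentiating the weights t_k
remain: +1 at i+1 and −1 at 0. The latter is killed by `hr0`, which holds along the section since
its 0-th entry is constantly 1. -/
lemma curvatureForm_simplex_left {n : ℕ} (x : (Fin (n + 1) → G) × (Fin n → ℂ)) (i : Fin n)
    (r : (Fin (n + 1) → E) × (Fin n → ℂ)) (hr0 : r.1 0 = 0) :
    curvatureForm E G n x ![(0, Pi.single i 1), r] =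
      maurerCartan E (x.1 i.succ) (r.1 i.succ) := by
  rw [curvatureForm_apply]
  simp [Fin.sum_univ_succ, baryDeriv, hr0, Pi.single_apply]

lemma curvatureForm_simplex_simplex {n : ℕ} (x : (Fin (n + 1) → G) × (Fin n → ℂ)) (i j : Fin n) :
    curvatureForm E G n x ![(0, Pi.single i 1), (0, Pi.single j 1)] = 0 := by
  rw [curvatureForm_apply]
  simp

lemma integral_stdSimp_one (f : ℝ → ℂ) :
    ∫ t in stdSimp 1, f (t 0) = ∫ s in (0 : ℝ)..1, f s := by
  rw [intervalIntegral.integral_of_le zero_le_one, ← MeasureTheory.integral_Icc_eq_integral_Ioc]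
  have h := (MeasureTheory.volume_preserving_funUnique (Fin 1) ℝ).setIntegral_preimage_emb
    (MeasurableEquiv.measurableEmbedding _) f (Set.Icc 0 1)
  refine Eq.trans ?_ h
  congr 2
  ext t
  simp [stdSimp, MeasurableEquiv.funUnique]

end BSSForms

/-! ### Explicit formulas for ω and ω₂ -/

section BSSForms

variable {E : Type*} [NormedAddCommGroup E] [NormedSpace ℂ E] [FiniteDimensional ℂ E]
  {G : Type*} [TopologicalSpace G] [ChartedSpace E G] [Group G] [LieGroup 𝓘(ℂ, E) ∞ G]

omit [FiniteDimensional ℂ E] in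
lemma tangentDeriv_bssSection_zero {n : ℕ} (g : Fin n → G) (t : Fin n → ℝ) (v : Fin n → E) :
    (tangentDeriv (powModel E n) (powProdModel E (n + 1) n)
      (fun y => bssSection G n y t) g v).1 0 = 0 := by
  rw [(tangentDeriv_bssSection g t v).1 0]
  have h : (fun y : Fin n → G => Fin.partialProd y 0) = fun _ => 1 := by
    funext y
    exact Fin.partialProd_zero y
  rw [h, tangentDeriv_const]
  rfl

omit [FiniteDimensional ℂ E] in
lemma tangentDeriv_bssSection_one {n : ℕ} (g : Fin (n + 1) → G) (t : Fin (n + 1) → ℝ)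
    (v : Fin (n + 1) → E) :
    (tangentDeriv (powModel E (n + 1)) (powProdModel E (n + 2) (n + 1))
      (fun y => bssSection G (n + 1) y t) g v).1 1 = v 0 := by
  rw [(tangentDeriv_bssSection g t v).1 1]
  have h : (fun y : Fin (n + 1) → G => Fin.partialProd y 1) = fun y => y 0 := by
    funext y
    exact (Fin.partialProd_succ y 0).trans (by simp)
  rw [h, tangentDeriv_eval]
  rfl

omit [FiniteDimensional ℂ E] in
lemma tangentDeriv_bssSection_two (g : Fin 2 → G) (t : Fin 2 → ℝ) (v : Fin 2 → E) :
    (tangentDeriv (powModel E 2) (powProdModel E 3 2) (fun y => bssSection G 2 y t) g v).1 2 =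
      tangentDeriv (powModel E 2) 𝓘(ℂ, E) (fun y : Fin 2 → G => y 0 * y 1) g v := by
  rw [(tangentDeriv_bssSection g t v).1 2]
  have h : (fun y : Fin 2 → G => Fin.partialProd y 2) = fun y => y 0 * y 1 := by
    funext y
    refine (Fin.partialProd_succ y 1).trans ?_
    exact congr_arg (· * y 1) ((Fin.partialProd_succ y 0).trans (by simp))
  rw [h]

/-- Along the section R(u, w) = (t − t²)[θu, θw] and R(∂_t, u) = θu. The wedge square has three
equal terms with factor 2, so the integrand is 6(t − t²)P(θ, [θ, θ]), whose coefficient integrates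
to 6(1/2 − 1/3) = 1. Moving ∂_t past three vectors to the last slot gives the sign. -/
theorem bssForm₁_apply {P : E →L[ℂ] E →L[ℂ] ℂ} (hP : IsInvariantQuadratic G P) (g : Fin 1 → G)
    (v : Fin 3 → Fin 1 → E) :
    bssForm₁ P g v = -cartanForm G P (maurerCartan E (g 0) (v 0 0))
      (maurerCartan E (g 0) (v 1 0)) (maurerCartan E (g 0) (v 2 0)) := by
  have hg : Fin.partialProd g 1 = g 0 := (Fin.partialProd_succ g 0).trans (by simp)
  have h1 : ∀ (t : Fin 1 → ℝ) (u w : Fin 1 → E), curvatureForm E G 1 (bssSection G 1 g t)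
      ![tangentDeriv (powModel E 1) (powProdModel E 2 1) (fun y => bssSection G 1 y t) g u,
        tangentDeriv (powModel E 1) (powProdModel E 2 1) (fun y => bssSection G 1 y t) g w] =
      ((t 0 : ℂ) - (t 0 : ℂ) ^ 2) • lieBracket E G (maurerCartan E (g 0) (u 0))
        (maurerCartan E (g 0) (w 0)) := fun t u w => by
    rw [curvatureForm_apply]
    have e0 : bary (bssSection G 1 g t).2 1 = (t 0 : ℂ) := rfl
    have e1 : (bssSection G 1 g t).1 1 = g 0 := hg
    have e2 : ∀ u : Fin 1 → E, (tangentDeriv (powModel E 1) (powProdModel E 2 1)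
        (fun y => bssSection G 1 y t) g u).1 0 = 0 := tangentDeriv_bssSection_zero g t
    have e3 : ∀ u : Fin 1 → E, (tangentDeriv (powModel E 1) (powProdModel E 2 1)
        (fun y => bssSection G 1 y t) g u).1 1 = u 0 := tangentDeriv_bssSection_one g t
    have e4 : ∀ u : Fin 1 → E, (tangentDeriv (powModel E 1) (powProdModel E 2 1)
        (fun y => bssSection G 1 y t) g u).2 = 0 := fun u => (tangentDeriv_bssSection g t u).2
    simp only [Fin.sum_univ_two (M := E), e0, e1, e2, e3, e4, baryDeriv, map_zero,
      smul_zero, zero_add, map_smul, smul_apply, smul_smul, sub_smul, pow_two]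
    simp
  have h2 : ∀ (t : Fin 1 → ℝ) (u : Fin 1 → E), curvatureForm E G 1 (bssSection G 1 g t)
      ![(0, Pi.single 0 1),
        tangentDeriv (powModel E 1) (powProdModel E 2 1) (fun y => bssSection G 1 y t) g u] =
        maurerCartan E (g 0) (u 0) := fun t u => by
    rw [curvatureForm_simplex_left _ _ _ (tangentDeriv_bssSection_zero g t u)]
    exact congr_arg₂ (fun a b => maurerCartan E a b) hg (tangentDeriv_bssSection_one g t u)
  set κ := cartanForm G P (maurerCartan E (g 0) (v 0 0))
      (maurerCartan E (g 0) (v 1 0)) (maurerCartan E (g 0) (v 2 0)) with hκ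
  have h3 : fiberIntegral (powModel E 1) (powProdModel E 2 1) 3 1 (bssSection G 1)
      (chernWeilForm P 1) g v = ∫ t in stdSimp 1, 6 * ((t 0 : ℂ) - (t 0 : ℂ) ^ 2) *
        κ := by
    refine fiberIntegral_apply (k := fun t (v : Fin 3 → Fin 1 → E) => 6 * ((t 0 : ℂ) - (t 0 : ℂ) ^ 2) *
      cartanForm G P (maurerCartan E (g 0) (v 0 0))
      (maurerCartan E (g 0) (v 1 0)) (maurerCartan E (g 0) (v 2 0))) (fun t ht v => ?_)
      (fun v => by fun_prop) v
    rw [contractFirst_one_apply, simpVelocity_bssSection g t ht, chernWeilForm,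
      bilinWedge_two_two_apply hP.symm]
    simp only [show (1 : Fin 4) = Fin.succ 0 from rfl, show (2 : Fin 4) = Fin.succ 1 from rfl,
      show (3 : Fin 4) = Fin.succ 2 from rfl, Fin.cons_zero, Fin.cons_succ, h1, h2, map_smul,
      smul_eq_mul]
    have e1 := hP.cartanForm_cyclic (maurerCartan E (g 0) (v 0 0))
      (maurerCartan E (g 0) (v 1 0)) (maurerCartan E (g 0) (v 2 0))
    have e2 := hP.cartanForm_cyclic (maurerCartan E (g 0) (v 1 0))
      (maurerCartan E (g 0) (v 2 0)) (maurerCartan E (g 0) (v 0 0))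
    have e3 := IsInvariantQuadratic.cartanForm_swap_right (G := G) (P := P) (maurerCartan E (g 0) (v 1 0))
      (maurerCartan E (g 0) (v 2 0)) (maurerCartan E (g 0) (v 0 0))
    simp only [cartanForm] at e1 e2 e3 ⊢
    linear_combination (2 * ((t 0 : ℂ) - (t 0 : ℂ) ^ 2)) * (-2 * e1 - e2 - e3)
  rw [bssForm₁, fiberIntegralLast, ContinuousAlternatingMap.smul_apply, h3,
    integral_stdSimp_one (fun s => 6 * ((s : ℂ) - (s : ℂ) ^ 2) * κ)]
  have h4 : ∫ s in (0 : ℝ)..1, 6 * ((s : ℂ) - (s : ℂ) ^ 2) * κ = κ := by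
    rw [intervalIntegral.integral_mul_const, intervalIntegral.integral_const_mul,
      intervalIntegral.integral_sub (Continuous.intervalIntegrable (by fun_prop) _ _)
        (Continuous.intervalIntegrable (by fun_prop) _ _)]
    have a1 : ∫ s in (0 : ℝ)..1, (s : ℂ) = 1 / 2 := by
      rw [intervalIntegral.integral_ofReal, integral_id]; norm_num
    have a2 : ∫ s in (0 : ℝ)..1, (s : ℂ) ^ 2 = 1 / 3 := by
      simp only [← Complex.ofReal_pow]
      rw [intervalIntegral.integral_ofReal, integral_pow]; norm_num
    rw [a1, a2]
    norm_num
  rw [h4]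
  norm_num

lemma integral_stdSimp_two_const (c : ℂ) : ∫ _ in stdSimp 2, c = c / 2 := by
  rw [setIntegral_stdSimp_succ (0 : Fin 2) _ continuousOn_const]
  simp only [intervalIntegral.integral_const, Fin.sum_univ_one, sub_zero, Complex.real_smul]
  rw [integral_stdSimp_one fun s => ((1 - s : ℝ) : ℂ) * c, intervalIntegral.integral_mul_const,
    intervalIntegral.integral_ofReal, intervalIntegral.integral_sub (by simp) (by simp),
    integral_id]
  norm_num
  ring

/-- Since R(∂₁, ∂₂) = 0, only products R(∂₁, ·)R(∂₂, ·) contribute. The integrand is constant in t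
with factor −2, Δ₂ has area 1/2, and the reordering sign (−1)^{2·2} is trivial. -/
theorem bssForm₂_apply {P : E →L[ℂ] E →L[ℂ] ℂ} (hP : IsInvariantQuadratic G P) (g : Fin 2 → G)
    (v : Fin 2 → Fin 2 → E) :
    bssForm₂ P g v = -(P (maurerCartan E (g 0) (v 0 0)) (maurerCartan E (g 0 * g 1)
        (tangentDeriv (powModel E 2) 𝓘(ℂ, E) (fun y : Fin 2 → G => y 0 * y 1) g (v 1))) -
      P (maurerCartan E (g 0) (v 1 0)) (maurerCartan E (g 0 * g 1)
        (tangentDeriv (powModel E 2) 𝓘(ℂ, E) (fun y : Fin 2 → G => y 0 * y 1) g (v 0)))) := by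
  have hg1 : Fin.partialProd g 1 = g 0 := (Fin.partialProd_succ g 0).trans (by simp)
  have hg2 : Fin.partialProd g 2 = g 0 * g 1 := (Fin.partialProd_succ g 1).trans
    (congr_arg (· * g 1) hg1)
  have h1 : ∀ (t : Fin 2 → ℝ) (u : Fin 2 → E), curvatureForm E G 2 (bssSection G 2 g t)
      ![(0, Pi.single 0 1),
        tangentDeriv (powModel E 2) (powProdModel E 3 2) (fun y => bssSection G 2 y t) g u] =
        maurerCartan E (g 0) (u 0) := fun t u => by
    rw [curvatureForm_simplex_left _ _ _ (tangentDeriv_bssSection_zero g t u)]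
    exact congr_arg₂ (fun a b => maurerCartan E a b) hg1 (tangentDeriv_bssSection_one g t u)
  have h2 : ∀ (t : Fin 2 → ℝ) (u : Fin 2 → E), curvatureForm E G 2 (bssSection G 2 g t)
      ![(0, Pi.single 1 1),
        tangentDeriv (powModel E 2) (powProdModel E 3 2) (fun y => bssSection G 2 y t) g u] =
        maurerCartan E (g 0 * g 1)
        (tangentDeriv (powModel E 2) 𝓘(ℂ, E) (fun y : Fin 2 → G => y 0 * y 1) g u) := fun t u => by
    rw [curvatureForm_simplex_left _ _ _ (tangentDeriv_bssSection_zero g t u)]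
    exact congr_arg₂ (fun a b => maurerCartan E a b) hg2 (tangentDeriv_bssSection_two g t u)
  set κ := P (maurerCartan E (g 0) (v 0 0)) (maurerCartan E (g 0 * g 1)
        (tangentDeriv (powModel E 2) 𝓘(ℂ, E) (fun y : Fin 2 → G => y 0 * y 1) g (v 1))) -
      P (maurerCartan E (g 0) (v 1 0)) (maurerCartan E (g 0 * g 1)
        (tangentDeriv (powModel E 2) 𝓘(ℂ, E) (fun y : Fin 2 → G => y 0 * y 1) g (v 0))) with hκ
  have h3 : fiberIntegral (powModel E 2) (powProdModel E 3 2) 2 2 (bssSection G 2)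
      (chernWeilForm P 2) g v = ∫ t in stdSimp 2, -2 * κ := by
    refine fiberIntegral_apply (k := fun _ (v : Fin 2 → Fin 2 → E) => -2 * (P (maurerCartan E (g 0) (v 0 0))
      (maurerCartan E (g 0 * g 1)
        (tangentDeriv (powModel E 2) 𝓘(ℂ, E) (fun y : Fin 2 → G => y 0 * y 1) g (v 1))) -
      P (maurerCartan E (g 0) (v 1 0)) (maurerCartan E (g 0 * g 1)
        (tangentDeriv (powModel E 2) 𝓘(ℂ, E) (fun y : Fin 2 → G => y 0 * y 1) g (v 0)))))
      (fun t ht v => ?_) (fun v => by fun_prop) v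
    rw [contractFirst_two_apply, simpVelocity_bssSection g t ht, simpVelocity_bssSection g t ht,
      chernWeilForm, bilinWedge_two_two_apply hP.symm]
    simp only [show (1 : Fin 4) = Fin.succ 0 from rfl, show (2 : Fin 4) = Fin.succ (Fin.succ 0)
      from rfl, show (3 : Fin 4) = Fin.succ (Fin.succ 1) from rfl, Fin.cons_zero, Fin.cons_succ,
      h1, h2, curvatureForm_simplex_simplex, map_zero, zero_apply]
    ring
  rw [bssForm₂, fiberIntegralLast, ContinuousAlternatingMap.smul_apply, h3,
    integral_stdSimp_two_const]
  norm_num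
  ring

end BSSForms

/-! ### Velocities of simplices under holomorphic maps -/

section Velocity

variable {F : Type*} [NormedAddCommGroup F] [NormedSpace ℂ F]
  {H : Type*} [TopologicalSpace H] {I : ModelWithCorners ℂ F H}
  {M : Type*} [TopologicalSpace M] [ChartedSpace H M]
  {F' : Type*} [NormedAddCommGroup F'] [NormedSpace ℂ F']
  {H' : Type*} [TopologicalSpace H'] {J : ModelWithCorners ℂ F' H'}
  {N : Type*} [TopologicalSpace N] [ChartedSpace H' N]
  {E : Type*} [NormedAddCommGroup E] [NormedSpace ℂ E]
  {G : Type*} [TopologicalSpace G] [ChartedSpace E G] {n q : ℕ}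

lemma tangentDeriv_extChartAt_symm_self [I.Boundaryless] [IsManifold I ∞ M] (x : M) :
    tangentDeriv 𝓘(ℂ, F) I (extChartAt I x).symm (extChartAt I x x) =
      ContinuousLinearMap.id ℂ F := by
  have h1 : MDifferentiableAt I 𝓘(ℂ, F) (extChartAt I x)
      ((extChartAt I x).symm (extChartAt I x x)) := by
    rw [extChartAt_to_inv]
    exact mdifferentiableAt_extChartAt_self x
  have h2 := tangentDeriv_comp (f := (extChartAt I x).symm) (g := extChartAt I x)
    (x := extChartAt I x x) h1 (MForm.mdifferentiableAt_chart_symm (mem_extChartAt_target x))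
  have h3 : (fun y => extChartAt I x ((extChartAt I x).symm y)) =ᶠ[𝓝 (extChartAt I x x)]
      fun y => y := by
    filter_upwards [extChartAt_target_mem_nhds (I := I) x] with y hy
    exact (extChartAt I x).right_inv hy
  rw [tangentDeriv_congr h3, tangentDeriv_id, extChartAt_to_inv,
    tangentDeriv_extChartAt_self, ContinuousLinearMap.id_comp] at h2
  exact h2.symm

/-- A chain rule mixing a complex derivative with a real derivative within the simplex. It is needed
for the product g₁g₂ occurring in ω₂. -/
lemma tangentDeriv_simpVelocity [I.Boundaryless] {f : (Fin q → ℝ) → M} {g : M → N}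
    {t : Fin q → ℝ} (hg : MDifferentiableAt I J g (f t))
    (hf : ContinuousWithinAt f (stdSimp q) t)
    (hd : DifferentiableWithinAt ℝ (fun s => extChartAt I (f t) (f s)) (stdSimp q) t)
    (ht : t ∈ stdSimp q) (i : Fin q) :
    tangentDeriv I J g (f t) (simpVelocity I f t i) = simpVelocity J (fun s => g (f s)) t i := by
  have h1 := ((mdifferentiableAt_iff g (f t)).1 hg).2
  rw [I.range_eq_univ, differentiableWithinAt_univ] at h1
  have h2 := (h1.hasFDerivAt.restrictScalars ℝ).comp_hasFDerivWithinAt (g := _) t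
    (f := fun s => extChartAt I (f t) (f s)) hd.hasFDerivWithinAt
  have h3 : (fun s => extChartAt J (g (f t)) (g (f s))) =ᶠ[𝓝[stdSimp q] t]
      writtenInExtChartAt I J (f t) g ∘ fun s => extChartAt I (f t) (f s) := by
    filter_upwards [hf.eventually_mem (extChartAt_source_mem_nhds (I := I) (f t))] with s hs
    simp only [writtenInExtChartAt, Function.comp_apply, (extChartAt I (f t)).left_inv hs]
  have h4 := (h2.congr_of_eventuallyEq h3 (h3.self_of_nhdsWithin ht)).fderivWithin (uniqueDiffOn_stdSimp q t ht)
  rw [simpVelocity, simpVelocity, h4, tangentDeriv_eq_fderivWithin hg, I.range_eq_univ,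
    fderivWithin_univ]
  rfl

lemma simpVelocity_pi_apply {f : (Fin q → ℝ) → Fin n → G} {t : Fin q → ℝ}
    (hd : ∀ j, DifferentiableWithinAt ℝ (fun s => extChartAt 𝓘(ℂ, E) (f t j) (f s j))
      (stdSimp q) t) (ht : t ∈ stdSimp q) (i : Fin q) (j : Fin n) :
    simpVelocity (powModel E n) f t i j = simpVelocity 𝓘(ℂ, E) (fun s => f s j) t i := by
  have h1 := (hasFDerivWithinAt_pi.2 fun j => (hd j).hasFDerivWithinAt).fderivWithin
    (uniqueDiffOn_stdSimp q t ht)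
  have h2 : simpVelocity (powModel E n) f t i = _ := DFunLike.congr_fun h1 (Pi.single i 1)
  rw [h2]
  rfl

end Velocity

/-! ### The dictionary with `dlog` for maps into powers of G -/

section PiFamilies

variable {E : Type*} [NormedAddCommGroup E] [NormedSpace ℂ E]
  {G : Type*} [TopologicalSpace G] [ChartedSpace E G]
  {Y : Type*} [NormedAddCommGroup Y] [NormedSpace ℂ Y] {n q : ℕ}
  {f : Y → (Fin q → ℝ) → Fin n → G} {Ω : Set Y}

lemma HolFamily.differentiableWithinAt_slice {F : Y × (Fin q → ℝ) → G} (h : HolFamily E F Ω)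
    {y : Y} {t : Fin q → ℝ} (hy : y ∈ Ω) (ht : t ∈ stdSimp q) :
    DifferentiableWithinAt ℝ (fun s => extChartAt 𝓘(ℂ, E) (F (y, t)) (F (y, s)))
      (stdSimp q) t :=
  (hasFDerivWithinAt_prod_slice (h.differentiableWithinAt_chart
    (x := (y, t)) ⟨hy, ht⟩) hy).differentiableWithinAt

lemma HolFamily.mdifferentiableAt_pi (hf : ∀ j, HolFamily E (fun x => f x.1 x.2 j) Ω)
    (hΩ : IsOpen Ω) {y : Y} {t : Fin q → ℝ} (hy : y ∈ Ω) (ht : t ∈ stdSimp q) :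
    MDifferentiableAt 𝓘(ℂ, Y) (powModel E n) (fun y => f y t) y :=
  mdifferentiableAt_pi_iff.2 fun j => ((hf j).hasMFDerivAt_slice hΩ hy ht).1

variable [Group G] [LieGroup 𝓘(ℂ, E) ∞ G]

lemma HolFamily.maurerCartan_tangentDeriv_pi (hf : ∀ j, HolFamily E (fun x => f x.1 x.2 j) Ω)
    (hΩ : IsOpen Ω) {y : Y} {t : Fin q → ℝ} (hy : y ∈ Ω) (ht : t ∈ stdSimp q) (v : Y)
    (j : Fin n) :
    maurerCartan E (f y t j) (tangentDeriv 𝓘(ℂ, Y) (powModel E n) (fun y => f y t) y v j) =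
      dlog E (fun x : Y × (Fin q → ℝ) => f x.1 x.2 j) (Ω ×ˢ stdSimp q) (y, t) (v, 0) := by
  rw [tangentDeriv_pi_apply (HolFamily.mdifferentiableAt_pi hf hΩ hy ht)]
  exact (hf j).maurerCartan_tangentDeriv hΩ hy ht v

lemma HolFamily.maurerCartan_simpVelocity_pi (hf : ∀ j, HolFamily E (fun x => f x.1 x.2 j) Ω)
    (hΩ : IsOpen Ω) {y : Y} {t : Fin q → ℝ} (hy : y ∈ Ω) (ht : t ∈ stdSimp q) (i : Fin q)
    (j : Fin n) :
    maurerCartan E (f y t j) (simpVelocity (powModel E n) (f y) t i j) =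
      dlog E (fun x : Y × (Fin q → ℝ) => f x.1 x.2 j) (Ω ×ˢ stdSimp q) (y, t)
        (simpDir Y i) := by
  rw [simpVelocity_pi_apply (fun j => (hf j).differentiableWithinAt_slice hy ht) ht]
  exact (hf j).maurerCartan_simpVelocity hΩ hy ht i

lemma mdifferentiableAt_mul_pi (g : Fin 2 → G) :
    MDifferentiableAt (powModel E 2) 𝓘(ℂ, E) (fun y : Fin 2 → G => y 0 * y 1) g :=
  ((contMDiffAt_eval (r := ∞) 0 g).mul (contMDiffAt_eval (r := ∞) 1 g)).mdifferentiableAt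
    (by simp)

lemma HolFamily.maurerCartan_mul_tangentDeriv {f : Y → (Fin q → ℝ) → Fin 2 → G}
    (hf : ∀ j, HolFamily E (fun x => f x.1 x.2 j) Ω)
    (hΩ : IsOpen Ω) {y : Y} {t : Fin q → ℝ} (hy : y ∈ Ω) (ht : t ∈ stdSimp q) (v : Y) :
    maurerCartan E (f y t 0 * f y t 1) (tangentDeriv (powModel E 2) 𝓘(ℂ, E)
      (fun y : Fin 2 → G => y 0 * y 1) (f y t)
      (tangentDeriv 𝓘(ℂ, Y) (powModel E 2) (fun y => f y t) y v)) =
      dlog E (fun x : Y × (Fin q → ℝ) => f x.1 x.2 0 * f x.1 x.2 1) (Ω ×ˢ stdSimp q) (y, t)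
        (v, 0) := by
  rw [← ((hf 0).mul (hf 1) hΩ).maurerCartan_tangentDeriv hΩ hy ht]
  have h := tangentDeriv_comp (f := fun y => f y t) (x := y)
    (g := fun y : Fin 2 → G => y 0 * y 1) (mdifferentiableAt_mul_pi (E := E) _)
    (HolFamily.mdifferentiableAt_pi hf hΩ hy ht)
  exact congr_arg (maurerCartan E (f y t 0 * f y t 1)) (DFunLike.congr_fun h v).symm

lemma HolFamily.maurerCartan_mul_simpVelocity {f : Y → (Fin q → ℝ) → Fin 2 → G}
    (hf : ∀ j, HolFamily E (fun x => f x.1 x.2 j) Ω)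
    (hΩ : IsOpen Ω) {y : Y} {t : Fin q → ℝ} (hy : y ∈ Ω) (ht : t ∈ stdSimp q) (i : Fin q) :
    maurerCartan E (f y t 0 * f y t 1) (tangentDeriv (powModel E 2) 𝓘(ℂ, E)
      (fun y : Fin 2 → G => y 0 * y 1) (f y t) (simpVelocity (powModel E 2) (f y) t i)) =
      dlog E (fun x : Y × (Fin q → ℝ) => f x.1 x.2 0 * f x.1 x.2 1) (Ω ×ˢ stdSimp q) (y, t)
        (simpDir Y i) := by
  have h1 : ContinuousWithinAt (f y) (stdSimp q) t := continuousWithinAt_pi.2 fun j =>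
    continuousOn_prod_slice (hf j).continuousOn hy t ht
  have h2 : DifferentiableWithinAt ℝ (fun s => extChartAt (powModel E 2) (f y t) (f y s))
      (stdSimp q) t :=
    differentiableWithinAt_pi.2 fun j => (hf j).differentiableWithinAt_slice hy ht
  rw [tangentDeriv_simpVelocity (mdifferentiableAt_mul_pi (E := E) _) h1 h2 ht]
  exact ((hf 0).mul (hf 1) hΩ).maurerCartan_simpVelocity hΩ hy ht i

end PiFamilies

/-! ### Pulling fibre integrals back to vector spaces -/

section PullbackIntegral

variable {F : Type*} [NormedAddCommGroup F] [NormedSpace ℂ F]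
  {H : Type*} [TopologicalSpace H] {I : ModelWithCorners ℂ F H}
  {M : Type*} [TopologicalSpace M] [ChartedSpace H M]
  {F' : Type*} [NormedAddCommGroup F'] [NormedSpace ℂ F']
  {H' : Type*} [TopologicalSpace H'] {J : ModelWithCorners ℂ F' H'}
  {N : Type*} [TopologicalSpace N] [ChartedSpace H' N]
  {Y : Type*} [NormedAddCommGroup Y] [NormedSpace ℂ Y] {r q : ℕ}
  {f : M → (Fin q → ℝ) → N} {α : MForm F' N ℂ (r + q)}

variable (I J) in
/-- The integrand of `fiberIntegral`. -/
noncomputable def fiberIntegrand (f : M → (Fin q → ℝ) → N) (α : MForm F' N ℂ (r + q)) (x : M)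
    (v : Fin r → F) (t : Fin q → ℝ) : ℂ :=
  contractFirst q (simpVelocity J (f x) t) (α (f x t))
    (fun i => tangentDeriv I J (fun y => f y t) x (v i))

lemma fiberIntegrand_comp {ρ : Y → M} {y : Y} {t : Fin q → ℝ}
    (hf : MDifferentiableAt I J (fun x => f x t) (ρ y))
    (hρ : MDifferentiableAt 𝓘(ℂ, Y) I ρ y) (v : Fin r → Y) :
    fiberIntegrand 𝓘(ℂ, Y) J (fun y => f (ρ y)) α y v t =
      fiberIntegrand I J f α (ρ y) (fun i => tangentDeriv 𝓘(ℂ, Y) I ρ y (v i)) t := by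
  have h := tangentDeriv_comp (f := ρ) (g := fun x => f x t) hf hρ
  simp only [fiberIntegrand, h]
  rfl

/-- Continuity in t is known only for families over vector spaces. The inverse chart at x has
identity derivative at its base point, so it does not change the integrand there. -/
lemma continuousOn_fiberIntegrand_of_chart [I.Boundaryless] [IsManifold I ∞ M] {x : M}
    (hf : ∀ t ∈ stdSimp q, MDifferentiableAt I J (fun x => f x t) x)
    (hc : ∀ v, ContinuousOn (fiberIntegrand 𝓘(ℂ, F) J (fun y => f ((extChartAt I x).symm y)) α
      (extChartAt I x x) v) (stdSimp q)) (v : Fin r → F) :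
    ContinuousOn (fiberIntegrand I J f α x v) (stdSimp q) := by
  refine (hc v).congr fun t ht => ?_
  rw [fiberIntegrand_comp (by rw [extChartAt_to_inv]; exact hf t ht)
    (MForm.mdifferentiableAt_chart_symm (mem_extChartAt_target x)),
    tangentDeriv_extChartAt_symm_self, extChartAt_to_inv]
  rfl

/-- Base change for fibre integration. Continuity of the integrand is required in order to evaluate
the form-valued integral on vectors. -/
lemma pullback_fiberIntegral_apply [FiniteDimensional ℂ F] {ρ : Y → M} {y : Y}
    (hf : ∀ t ∈ stdSimp q, MDifferentiableAt I J (fun x => f x t) (ρ y))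
    (hρ : MDifferentiableAt 𝓘(ℂ, Y) I ρ y)
    (hc : ∀ v, ContinuousOn (fiberIntegrand I J f α (ρ y) v) (stdSimp q)) (v : Fin r → Y) :
    MForm.pullback 𝓘(ℂ, Y) I ρ (fiberIntegral I J r q f α) y v =
      ∫ t in stdSimp q, fiberIntegrand 𝓘(ℂ, Y) J (fun y => f (ρ y)) α y v t := by
  refine (fiberIntegral_apply (k := fun t v => fiberIntegrand I J f α (ρ y) v t)
    (fun t _ v => rfl) hc _).trans ?_
  refine MeasureTheory.setIntegral_congr_fun (measurableSet_stdSimp _) fun t ht => ?_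
  exact (fiberIntegrand_comp (hf t ht) hρ v).symm

end PullbackIntegral

/-! ### Integrands of ω and ω₂ in terms of logarithmic derivatives -/

section BSSFamilies

variable {E : Type*} [NormedAddCommGroup E] [NormedSpace ℂ E] [FiniteDimensional ℂ E]
  {G : Type*} [TopologicalSpace G] [ChartedSpace E G] [Group G] [LieGroup 𝓘(ℂ, E) ∞ G]
  {Y : Type*} [NormedAddCommGroup Y] [NormedSpace ℂ Y] {q : ℕ} {Ω : Set Y} {y : Y}
  {P : E →L[ℂ] E →L[ℂ] ℂ}

lemma IsInvariantQuadratic.fiberIntegrand_bssForm₁_three (hP : IsInvariantQuadratic G P)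
    {f : Y → (Fin 3 → ℝ) → Fin 1 → G} (hf : ∀ j, HolFamily E (fun x => f x.1 x.2 j) Ω)
    (hΩ : IsOpen Ω) (hy : y ∈ Ω) {t : Fin 3 → ℝ} (ht : t ∈ stdSimp 3) (v : Fin 0 → Y) :
    fiberIntegrand (r := 0) 𝓘(ℂ, Y) (powModel E 1) f (bssForm₁ P) y v t =
      -dlogCubic P (fun x => f x.1 x.2 0) Ω (simpDir Y 0) (simpDir Y 1) (simpDir Y 2) (y, t) := by
  rw [fiberIntegrand, contractFirst_three_apply]
  refine (bssForm₁_apply hP _ _).trans (congr_arg Neg.neg ?_)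
  rw [dlogCubic, ← HolFamily.maurerCartan_simpVelocity_pi hf hΩ hy ht,
    ← HolFamily.maurerCartan_simpVelocity_pi hf hΩ hy ht,
    ← HolFamily.maurerCartan_simpVelocity_pi hf hΩ hy ht]
  rfl

lemma IsInvariantQuadratic.fiberIntegrand_bssForm₁_two (hP : IsInvariantQuadratic G P)
    {f : Y → (Fin 2 → ℝ) → Fin 1 → G} (hf : ∀ j, HolFamily E (fun x => f x.1 x.2 j) Ω)
    (hΩ : IsOpen Ω) (hy : y ∈ Ω) {t : Fin 2 → ℝ} (ht : t ∈ stdSimp 2) (v : Fin 1 → Y) :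
    fiberIntegrand (r := 1) 𝓘(ℂ, Y) (powModel E 1) f (bssForm₁ P) y v t =
      -dlogCubic P (fun x => f x.1 x.2 0) Ω (simpDir Y 0) (simpDir Y 1) (v 0, 0) (y, t) := by
  rw [fiberIntegrand, contractFirst_two_apply]
  refine (bssForm₁_apply hP _ _).trans (congr_arg Neg.neg ?_)
  rw [dlogCubic, ← HolFamily.maurerCartan_simpVelocity_pi hf hΩ hy ht,
    ← HolFamily.maurerCartan_simpVelocity_pi hf hΩ hy ht,
    ← HolFamily.maurerCartan_tangentDeriv_pi hf hΩ hy ht]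
  rfl

lemma IsInvariantQuadratic.fiberIntegrand_bssForm₁_one (hP : IsInvariantQuadratic G P)
    {f : Y → (Fin 1 → ℝ) → Fin 1 → G} (hf : ∀ j, HolFamily E (fun x => f x.1 x.2 j) Ω)
    (hΩ : IsOpen Ω) (hy : y ∈ Ω) {t : Fin 1 → ℝ} (ht : t ∈ stdSimp 1) (v : Fin 2 → Y) :
    fiberIntegrand (r := 2) 𝓘(ℂ, Y) (powModel E 1) f (bssForm₁ P) y v t =
      -dlogCubic P (fun x => f x.1 x.2 0) Ω (simpDir Y 0) (v 0, 0) (v 1, 0) (y, t) := by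
  rw [fiberIntegrand, contractFirst_one_apply]
  refine (bssForm₁_apply hP _ _).trans (congr_arg Neg.neg ?_)
  rw [dlogCubic, ← HolFamily.maurerCartan_simpVelocity_pi hf hΩ hy ht,
    ← HolFamily.maurerCartan_tangentDeriv_pi hf hΩ hy ht,
    ← HolFamily.maurerCartan_tangentDeriv_pi hf hΩ hy ht]
  rfl

/-- The simplex direction is inserted first while `dlogWedge` is written with it last. This
transposition absorbs the minus sign of `bssForm₂_apply`. -/
lemma IsInvariantQuadratic.fiberIntegrand_bssForm₂_one (hP : IsInvariantQuadratic G P)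
    {f : Y → (Fin 1 → ℝ) → Fin 2 → G} {h : Y → G} (hh : ContMDiffOn 𝓘(ℂ, Y) 𝓘(ℂ, E) ∞ h Ω)
    (hfh : ∀ y t, f y t 0 = h y) (hf : HolFamily E (fun x => f x.1 x.2 1) Ω)
    (hΩ : IsOpen Ω) (hy : y ∈ Ω) {t : Fin 1 → ℝ} (ht : t ∈ stdSimp 1) (v : Fin 1 → Y) :
    fiberIntegrand (r := 1) 𝓘(ℂ, Y) (powModel E 2) f (bssForm₂ P) y v t =
      dlogWedge P h (fun x => f x.1 x.2 1) Ω (v 0, 0) (simpDir Y 0) (y, t) := by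
  have hf0 : (fun x : Y × (Fin 1 → ℝ) => f x.1 x.2 0) = fun x => h x.1 :=
    funext fun x => hfh _ _
  have hf' : ∀ j, HolFamily E (fun x => f x.1 x.2 j) Ω := by
    intro j
    fin_cases j
    · change HolFamily E (fun x : Y × (Fin 1 → ℝ) => f x.1 x.2 0) Ω
      rw [hf0]
      exact HolFamily.of_contMDiffOn hΩ hh
    · exact hf
  have hx : (y, t) ∈ Ω ×ˢ stdSimp 1 := ⟨hy, ht⟩
  have e1 : leftTranslate h (fun x : Y × (Fin 1 → ℝ) => f x.1 x.2 1) =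
      fun x => f x.1 x.2 0 * f x.1 x.2 1 := funext fun x => by rw [hfh]; rfl
  rw [fiberIntegrand, contractFirst_one_apply]
  refine (bssForm₂_apply hP _ _).trans ?_
  rw [dlogWedge, ← dlog_fst hΩ hh hx, ← dlog_fst hΩ hh hx, e1, ← hf0,
    ← HolFamily.maurerCartan_simpVelocity_pi hf' hΩ hy ht,
    ← HolFamily.maurerCartan_tangentDeriv_pi hf' hΩ hy ht,
    ← HolFamily.maurerCartan_mul_simpVelocity hf' hΩ hy ht,
    ← HolFamily.maurerCartan_mul_tangentDeriv hf' hΩ hy ht, neg_sub]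
  rfl

lemma integral_stdSimp_zero (k : (Fin 0 → ℝ) → ℂ) : ∫ t in stdSimp 0, k t = k 0 := by
  have h : stdSimp 0 = univ := by ext t; simp [stdSimp]
  rw [h, MeasureTheory.setIntegral_univ, MeasureTheory.integral_unique]
  simp only [MeasureTheory.volume_pi, MeasureTheory.Measure.pi_empty_univ,
    MeasureTheory.Measure.real, ENNReal.toReal_one, one_smul]
  exact congr_arg k (Subsingleton.elim _ _)

lemma zero_mem_stdSimp (q : ℕ) : (0 : Fin q → ℝ) ∈ stdSimp q := by simp [stdSimp]

/-- Writes ω itself as an integral over Δ_0, the shape in which it occurs as a boundary term in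
Stokes. -/
lemma IsInvariantQuadratic.pullback_bssForm₁_apply (hP : IsInvariantQuadratic G P)
    {ρ : Y → Fin 1 → G} (hρ : ContMDiffOn 𝓘(ℂ, Y) (powModel E 1) ∞ ρ Ω) (hΩ : IsOpen Ω)
    (hy : y ∈ Ω) (v : Fin 3 → Y) :
    MForm.pullback 𝓘(ℂ, Y) (powModel E 1) ρ (bssForm₁ P) y v =
      -cartanIntegral₀ P (fun x => ρ x.1 0) Ω (v 0) (v 1) (v 2) y := by
  have hf : ∀ j, HolFamily E (fun x : Y × (Fin 0 → ℝ) => ρ x.1 j) Ω := fun j =>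
    HolFamily.of_contMDiffOn hΩ fun y hy => contMDiffWithinAt_pi_iff.1 (hρ y hy) j
  have h := fun v => HolFamily.maurerCartan_tangentDeriv_pi (f := fun y _ => ρ y) hf hΩ hy
    (zero_mem_stdSimp 0) v 0
  refine (bssForm₁_apply hP _ _).trans ?_
  rw [cartanIntegral₀, integral_stdSimp_zero, dlogCubic, ← h, ← h, ← h]
  rfl

lemma IsInvariantQuadratic.pullback_bssForm₂_apply (hP : IsInvariantQuadratic G P)
    {ρ : Y → Fin 2 → G} (hρ : ContMDiffOn 𝓘(ℂ, Y) (powModel E 2) ∞ ρ Ω) (hΩ : IsOpen Ω)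
    (hy : y ∈ Ω) (v : Fin 2 → Y) :
    MForm.pullback 𝓘(ℂ, Y) (powModel E 2) ρ (bssForm₂ P) y v =
      -wedgeIntegral₀ P (fun y => ρ y 0) (fun x => ρ x.1 1) Ω (v 0) (v 1) y := by
  have hρ' := fun j y hy => contMDiffWithinAt_pi_iff.1 (hρ y hy) j
  have hf : ∀ j, HolFamily E (fun x : Y × (Fin 0 → ℝ) => ρ x.1 j) Ω := fun j =>
    HolFamily.of_contMDiffOn hΩ (hρ' j)
  have hx : (y, (0 : Fin 0 → ℝ)) ∈ Ω ×ˢ stdSimp 0 := ⟨hy, zero_mem_stdSimp 0⟩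
  have h := fun v => HolFamily.maurerCartan_tangentDeriv_pi (f := fun y _ => ρ y) hf hΩ hy
    (zero_mem_stdSimp 0) v 0
  have h' := fun v => HolFamily.maurerCartan_mul_tangentDeriv (f := fun y _ => ρ y) hf hΩ hy
    (zero_mem_stdSimp 0) v
  have e1 : leftTranslate (fun y => ρ y 0) (fun x : Y × (Fin 0 → ℝ) => ρ x.1 1) =
      fun x => ρ x.1 0 * ρ x.1 1 := rfl
  refine (bssForm₂_apply hP _ _).trans ?_
  rw [wedgeIntegral₀, integral_stdSimp_zero, dlogWedge, ← dlog_fst hΩ (hρ' 0) hx,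
    ← dlog_fst hΩ (hρ' 0) hx, e1, ← h, ← h, ← h', ← h']
  rfl

end BSSFamilies

/-! ### Open sets read in a chart -/

section ChartDomain

variable {F : Type*} [NormedAddCommGroup F] [NormedSpace ℂ F]
  {H : Type*} [TopologicalSpace H] {I : ModelWithCorners ℂ F H}
  {M : Type*} [TopologicalSpace M] [ChartedSpace H M]

variable (I) in
/-- The set `W`, read in the preferred chart at `x`. -/
def chartDomain (W : Set M) (x : M) : Set F :=
  (extChartAt I x).target ∩ (extChartAt I x).symm ⁻¹' W

lemma isOpen_chartDomain [I.Boundaryless] {W : Set M} (hW : IsOpen W) (x : M) :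
    IsOpen (chartDomain I W x) :=
  (continuousOn_extChartAt_symm x).isOpen_inter_preimage (isOpen_extChartAt_target x) hW

lemma mem_chartDomain_self {W : Set M} {x : M} (hx : x ∈ W) :
    extChartAt I x x ∈ chartDomain I W x :=
  ⟨mem_extChartAt_target x, by rwa [mem_preimage, extChartAt_to_inv]⟩

lemma mapsTo_chartDomain (W : Set M) (x : M) :
    MapsTo (extChartAt I x).symm (chartDomain I W x) W := fun _ h => h.2

lemma contMDiffOn_chartDomain [IsManifold I ∞ M] (W : Set M) (x : M) :
    ContMDiffOn 𝓘(ℂ, F) I ∞ (extChartAt I x).symm (chartDomain I W x) :=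
  (contMDiffOn_extChartAt_symm x).mono inter_subset_left

end ChartDomain

/-! ### The forms β_{m,q} along maps into W_l -/

namespace SimplexSystem

variable {E : Type*} [NormedAddCommGroup E] [NormedSpace ℂ E]
  {G : Type*} [TopologicalSpace G] [ChartedSpace E G] [Group G] (S : SimplexSystem E G)
  {Y : Type*} [NormedAddCommGroup Y] [NormedSpace ℂ Y] {Ω : Set Y} {y : Y}

/-- The family `(y, t) ↦ σ_{ρ(y)}(t)`. -/
def family {l : ℕ} (ρ : Y → Fin l → G) : Y × (Fin l → ℝ) → G := fun x => S.σ l (ρ x.1) x.2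

lemma f_zero (q : ℕ) (g : Fin (0 + q) → G) (t : Fin q → ℝ) (j : Fin 1) :
    S.f 0 q g t j = S.σ q (fun i => g (Fin.natAdd 0 i)) t := by
  rw [Subsingleton.elim j 0]
  rfl

/-- Indices in 0 + 3 and 3 agree by reduction, but `Fin.natAdd 0` is the identity only through 0 + n
= n; hence the explicit argument. -/
lemma f_zero_three (g : Fin 3 → G) (t : Fin 3 → ℝ) (j : Fin 1) : S.f 0 3 g t j = S.σ 3 g t :=
  (S.f_zero 3 g t j).trans (congr_arg (S.σ 3 · t) (funext fun _ => congr_arg g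
    (Fin.ext (Nat.zero_add _))))

lemma f_zero_two (g : Fin 2 → G) (t : Fin 2 → ℝ) (j : Fin 1) : S.f 0 2 g t j = S.σ 2 g t :=
  (S.f_zero 2 g t j).trans (congr_arg (S.σ 2 · t) (funext fun _ => congr_arg g
    (Fin.ext (Nat.zero_add _))))

lemma f_zero_one (g : Fin 1 → G) (t : Fin 1 → ℝ) (j : Fin 1) : S.f 0 1 g t j = S.σ 1 g t :=
  (S.f_zero 1 g t j).trans (congr_arg (S.σ 1 · t) (funext fun _ => congr_arg g
    (Fin.ext (Nat.zero_add _))))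

lemma f_one_one_zero (g : Fin 2 → G) (t : Fin 1 → ℝ) : S.f 1 1 g t 0 = g 0 := rfl

lemma f_one_one_one (g : Fin 2 → G) (t : Fin 1 → ℝ) :
    S.f 1 1 g t 1 = S.σ 1 (bgFace 0 g) t := by
  refine congr_arg (S.σ 1 · t) (funext fun i => ?_)
  rw [Subsingleton.elim i 0]
  rfl

variable [LieGroup 𝓘(ℂ, E) ∞ G]

lemma contMDiff_bgFace {s : ℕ} (j : Fin (s + 2)) :
    ContMDiff (powModel E (s + 1)) (powModel E s) ∞ (bgFace (G := G) j) := by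
  intro g
  refine contMDiffWithinAt_pi_iff.2 fun i => ?_
  cases j using Fin.cases with
  | zero => exact contMDiffAt_eval i.succ g
  | succ j =>
    simp only [bgFace, Fin.cases_succ, Fin.contractNth]
    split_ifs
    · exact contMDiffAt_eval _ g
    · exact (contMDiffAt_eval _ g).mul (contMDiffAt_eval _ g)
    · exact contMDiffAt_eval _ g

lemma holFamily_family {l : ℕ} (hΩ : IsOpen Ω) {ρ : Y → Fin l → G}
    (hρ : ContMDiffOn 𝓘(ℂ, Y) (powModel E l) ∞ ρ Ω) (hW : MapsTo ρ Ω (S.W l)) :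
    HolFamily E (S.family ρ) Ω :=
  S.holFamily hΩ hρ hW

omit [NormedAddCommGroup Y] [NormedSpace ℂ Y] [LieGroup 𝓘(ℂ, E) ∞ G] in
-- The only face that is not again a simplex of the system; every correction by ω₂ in the argument
-- originates here.
lemma familyFace_zero_family {l : ℕ} {ρ : Y → Fin (l + 1) → G} (hW : MapsTo ρ Ω (S.W (l + 1))) :
    EqOn (familyFace 0 (S.family ρ)) (leftTranslate (fun y => ρ y 0)
      (S.family fun y => bgFace 0 (ρ y))) (Ω ×ˢ stdSimp l) := fun _ hx =>
  S.σ_face_zero l _ (hW hx.1) _ hx.2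

omit [NormedAddCommGroup Y] [NormedSpace ℂ Y] [LieGroup 𝓘(ℂ, E) ∞ G] in
lemma familyFace_succ_family {l : ℕ} {ρ : Y → Fin (l + 1) → G} (hW : MapsTo ρ Ω (S.W (l + 1)))
    (j : Fin (l + 1)) :
    EqOn (familyFace j.succ (S.family ρ)) (S.family fun y => bgFace j.succ (ρ y))
      (Ω ×ˢ stdSimp l) := fun _ hx =>
  S.σ_face_succ l _ (hW hx.1) _ hx.2 j

omit [NormedAddCommGroup Y] [NormedSpace ℂ Y] [LieGroup 𝓘(ℂ, E) ∞ G] in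
lemma mapsTo_bgFace {l : ℕ} {ρ : Y → Fin (l + 1) → G} (hW : MapsTo ρ Ω (S.W (l + 1)))
    (j : Fin (l + 2)) : MapsTo (fun y => bgFace j (ρ y)) Ω (S.W l) := fun _ h =>
  S.face_mem l _ (hW h) j

omit [LieGroup 𝓘(ℂ, E) ∞ G] in
lemma mdifferentiableAt_σ {l : ℕ} {g : Fin l → G} (hg : g ∈ S.W l) {t : Fin l → ℝ}
    (ht : t ∈ stdSimp l) : MDifferentiableAt (powModel E l) 𝓘(ℂ, E) (fun g => S.σ l g t) g :=
  (S.σ_holomorphic l t ht).mdifferentiableAt ((S.isOpen_W l).mem_nhds hg)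

variable [FiniteDimensional ℂ E] {P : E →L[ℂ] E →L[ℂ] ℂ}

/-- The `2`-form `β_{1,1}`. -/
noncomputable def betaOne (P : E →L[ℂ] E →L[ℂ] ℂ) : BGForm E G 2 1 := S.beta 0 1 2 (bssForm₁ P)

lemma fiberIntegrand_f_zero_three (hP : IsInvariantQuadratic G P) (hΩ : IsOpen Ω)
    {ρ : Y → Fin 3 → G} (hρ : ContMDiffOn 𝓘(ℂ, Y) (powModel E 3) ∞ ρ Ω)
    (hW : MapsTo ρ Ω (S.W 3)) (hy : y ∈ Ω) (v : Fin 0 → Y) {t : Fin 3 → ℝ} (ht : t ∈ stdSimp 3) :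
    fiberIntegrand (r := 0) 𝓘(ℂ, Y) (powModel E 1) (fun y => S.f 0 3 (ρ y)) (bssForm₁ P) y v t =
      -dlogCubic P (S.family ρ) Ω (simpDir Y 0) (simpDir Y 1) (simpDir Y 2) (y, t) := by
  have h : ∀ j, (fun x : Y × (Fin 3 → ℝ) => S.f 0 3 (ρ x.1) x.2 j) = S.family ρ :=
    fun j => funext fun x => S.f_zero_three _ _ j
  rw [← h 0]
  refine hP.fiberIntegrand_bssForm₁_three (f := fun y => S.f 0 3 (ρ y)) (fun j => ?_) hΩ hy ht v
  rw [h]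
  exact S.holFamily_family hΩ hρ hW

/-- Stated for arbitrary holomorphic ρ because the simplicial differential needs ρ = face map ∘
inverse chart. The continuity required for base change is checked in the chart at ρ y. -/
lemma pullback_eta₀_apply (hP : IsInvariantQuadratic G P) (hΩ : IsOpen Ω) {ρ : Y → Fin 3 → G}
    (hρ : ContMDiffOn 𝓘(ℂ, Y) (powModel E 3) ∞ ρ Ω) (hW : MapsTo ρ Ω (S.W 3)) (hy : y ∈ Ω)
    (v : Fin 0 → Y) :
    MForm.pullback 𝓘(ℂ, Y) (powModel E 3) ρ (S.eta₀ P) y v =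
      -cartanIntegral₃ P (S.family ρ) Ω y := by
  have hf : ∀ t ∈ stdSimp 3, MDifferentiableAt (powModel E 3) (powModel E 1)
      (fun g => S.f 0 3 g t) (ρ y) := fun t ht => mdifferentiableAt_pi_iff.2 fun j => by
    simp only [f_zero_three]
    exact S.mdifferentiableAt_σ (hW hy) ht
  have hΩ' := isOpen_chartDomain (I := powModel E 3) (S.isOpen_W 3) (ρ y)
  have hρ' := contMDiffOn_chartDomain (I := powModel E 3) (S.W 3) (ρ y)
  have hW' := mapsTo_chartDomain (I := powModel E 3) (S.W 3) (ρ y)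
  have hy' := mem_chartDomain_self (I := powModel E 3) (hW hy)
  refine (pullback_fiberIntegral_apply hf ((hρ.contMDiffAt (hΩ.mem_nhds hy)).mdifferentiableAt
    (by simp)) (continuousOn_fiberIntegrand_of_chart hf fun v => ?_) v).trans ?_
  · exact (continuousOn_prod_slice ((S.holFamily_family hΩ' hρ' hW').partHolOn_dlogCubic hΩ' _ _
      _).contDiffOn.continuousOn hy').neg.congr fun t ht =>
      S.fiberIntegrand_f_zero_three hP hΩ' hρ' hW' hy' v ht
  · rw [cartanIntegral₃, ← MeasureTheory.integral_neg]
    exact MeasureTheory.setIntegral_congr_fun (measurableSet_stdSimp _) fun t ht =>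
      S.fiberIntegrand_f_zero_three hP hΩ hρ hW hy v ht

lemma fiberIntegrand_f_zero_two (hP : IsInvariantQuadratic G P) (hΩ : IsOpen Ω)
    {ρ : Y → Fin 2 → G} (hρ : ContMDiffOn 𝓘(ℂ, Y) (powModel E 2) ∞ ρ Ω)
    (hW : MapsTo ρ Ω (S.W 2)) (hy : y ∈ Ω) (v : Fin 1 → Y) {t : Fin 2 → ℝ} (ht : t ∈ stdSimp 2) :
    fiberIntegrand (r := 1) 𝓘(ℂ, Y) (powModel E 1) (fun y => S.f 0 2 (ρ y)) (bssForm₁ P) y v t =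
      -dlogCubic P (S.family ρ) Ω (simpDir Y 0) (simpDir Y 1) (v 0, 0) (y, t) := by
  have h : ∀ j, (fun x : Y × (Fin 2 → ℝ) => S.f 0 2 (ρ x.1) x.2 j) = S.family ρ :=
    fun j => funext fun x => S.f_zero_two _ _ j
  rw [← h 0]
  refine hP.fiberIntegrand_bssForm₁_two (f := fun y => S.f 0 2 (ρ y)) (fun j => ?_) hΩ hy ht v
  rw [h]
  exact S.holFamily_family hΩ hρ hW

lemma pullback_beta_two_apply (hP : IsInvariantQuadratic G P) (hΩ : IsOpen Ω) {ρ : Y → Fin 2 → G}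
    (hρ : ContMDiffOn 𝓘(ℂ, Y) (powModel E 2) ∞ ρ Ω) (hW : MapsTo ρ Ω (S.W 2)) (hy : y ∈ Ω)
    (v : Fin 1 → Y) :
    MForm.pullback 𝓘(ℂ, Y) (powModel E 2) ρ (S.beta 0 2 1 (bssForm₁ P)) y v =
      -cartanIntegral₂ P (S.family ρ) Ω (v 0) y := by
  have hf : ∀ t ∈ stdSimp 2, MDifferentiableAt (powModel E 2) (powModel E 1)
      (fun g => S.f 0 2 g t) (ρ y) := fun t ht => mdifferentiableAt_pi_iff.2 fun j => by
    simp only [f_zero_two]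
    exact S.mdifferentiableAt_σ (hW hy) ht
  have hΩ' := isOpen_chartDomain (I := powModel E 2) (S.isOpen_W 2) (ρ y)
  have hρ' := contMDiffOn_chartDomain (I := powModel E 2) (S.W 2) (ρ y)
  have hW' := mapsTo_chartDomain (I := powModel E 2) (S.W 2) (ρ y)
  have hy' := mem_chartDomain_self (I := powModel E 2) (hW hy)
  refine (pullback_fiberIntegral_apply hf ((hρ.contMDiffAt (hΩ.mem_nhds hy)).mdifferentiableAt
    (by simp)) (continuousOn_fiberIntegrand_of_chart hf fun v => ?_) v).trans ?_
  · exact (continuousOn_prod_slice ((S.holFamily_family hΩ' hρ' hW').partHolOn_dlogCubic hΩ' _ _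
      _).contDiffOn.continuousOn hy').neg.congr fun t ht =>
      S.fiberIntegrand_f_zero_two hP hΩ' hρ' hW' hy' v ht
  · rw [cartanIntegral₂, ← MeasureTheory.integral_neg]
    exact MeasureTheory.setIntegral_congr_fun (measurableSet_stdSimp _) fun t ht =>
      S.fiberIntegrand_f_zero_two hP hΩ hρ hW hy v ht

lemma fiberIntegrand_f_zero_one (hP : IsInvariantQuadratic G P) (hΩ : IsOpen Ω)
    {ρ : Y → Fin 1 → G} (hρ : ContMDiffOn 𝓘(ℂ, Y) (powModel E 1) ∞ ρ Ω)
    (hW : MapsTo ρ Ω (S.W 1)) (hy : y ∈ Ω) (v : Fin 2 → Y) {t : Fin 1 → ℝ} (ht : t ∈ stdSimp 1) :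
    fiberIntegrand (r := 2) 𝓘(ℂ, Y) (powModel E 1) (fun y => S.f 0 1 (ρ y)) (bssForm₁ P) y v t =
      -dlogCubic P (S.family ρ) Ω (simpDir Y 0) (v 0, 0) (v 1, 0) (y, t) := by
  have h : ∀ j, (fun x : Y × (Fin 1 → ℝ) => S.f 0 1 (ρ x.1) x.2 j) = S.family ρ :=
    fun j => funext fun x => S.f_zero_one _ _ j
  rw [← h 0]
  refine hP.fiberIntegrand_bssForm₁_one (f := fun y => S.f 0 1 (ρ y)) (fun j => ?_) hΩ hy ht v
  rw [h]
  exact S.holFamily_family hΩ hρ hW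

lemma pullback_betaOne_apply (hP : IsInvariantQuadratic G P) (hΩ : IsOpen Ω) {ρ : Y → Fin 1 → G}
    (hρ : ContMDiffOn 𝓘(ℂ, Y) (powModel E 1) ∞ ρ Ω) (hW : MapsTo ρ Ω (S.W 1)) (hy : y ∈ Ω)
    (v : Fin 2 → Y) :
    MForm.pullback 𝓘(ℂ, Y) (powModel E 1) ρ (S.betaOne P) y v =
      -cartanIntegral₁ P (S.family ρ) Ω (v 0) (v 1) y := by
  have hf : ∀ t ∈ stdSimp 1, MDifferentiableAt (powModel E 1) (powModel E 1)
      (fun g => S.f 0 1 g t) (ρ y) := fun t ht => mdifferentiableAt_pi_iff.2 fun j => by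
    simp only [f_zero_one]
    exact S.mdifferentiableAt_σ (hW hy) ht
  have hΩ' := isOpen_chartDomain (I := powModel E 1) (S.isOpen_W 1) (ρ y)
  have hρ' := contMDiffOn_chartDomain (I := powModel E 1) (S.W 1) (ρ y)
  have hW' := mapsTo_chartDomain (I := powModel E 1) (S.W 1) (ρ y)
  have hy' := mem_chartDomain_self (I := powModel E 1) (hW hy)
  refine (pullback_fiberIntegral_apply hf ((hρ.contMDiffAt (hΩ.mem_nhds hy)).mdifferentiableAt
    (by simp)) (continuousOn_fiberIntegrand_of_chart hf fun v => ?_) v).trans ?_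
  · exact (continuousOn_prod_slice ((S.holFamily_family hΩ' hρ' hW').partHolOn_dlogCubic hΩ' _ _
      _).contDiffOn.continuousOn hy').neg.congr fun t ht =>
      S.fiberIntegrand_f_zero_one hP hΩ' hρ' hW' hy' v ht
  · rw [cartanIntegral₁, ← MeasureTheory.integral_neg]
    exact MeasureTheory.setIntegral_congr_fun (measurableSet_stdSimp _) fun t ht =>
      S.fiberIntegrand_f_zero_one hP hΩ hρ hW hy v ht

lemma fiberIntegrand_f_one_one (hP : IsInvariantQuadratic G P) (hΩ : IsOpen Ω)
    {ρ : Y → Fin 2 → G} (hρ : ContMDiffOn 𝓘(ℂ, Y) (powModel E 2) ∞ ρ Ω)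
    (hW : MapsTo ρ Ω (S.W 2)) (hy : y ∈ Ω) (v : Fin 1 → Y) {t : Fin 1 → ℝ} (ht : t ∈ stdSimp 1) :
    fiberIntegrand (r := 1) 𝓘(ℂ, Y) (powModel E 2) (fun y => S.f 1 1 (ρ y)) (bssForm₂ P) y v t =
      dlogWedge P (fun y => ρ y 0) (S.family fun y => bgFace 0 (ρ y)) Ω (v 0, 0) (simpDir Y 0)
        (y, t) := by
  have h : (fun x : Y × (Fin 1 → ℝ) => S.f 1 1 (ρ x.1) x.2 1) =
    S.family fun y => bgFace 0 (ρ y) := funext fun x => S.f_one_one_one _ _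
  rw [← h]
  refine hP.fiberIntegrand_bssForm₂_one (f := fun y => S.f 1 1 (ρ y))
    (fun y hy => contMDiffWithinAt_pi_iff.1 (hρ y hy) 0) (fun y t => S.f_one_one_zero _ _) ?_ hΩ hy
    ht v
  rw [h]
  exact S.holFamily_family hΩ ((contMDiff_bgFace 0).comp_contMDiffOn hρ) (S.mapsTo_bgFace hW 0)

lemma pullback_beta_one_one_apply (hP : IsInvariantQuadratic G P) (hΩ : IsOpen Ω)
    {ρ : Y → Fin 2 → G} (hρ : ContMDiffOn 𝓘(ℂ, Y) (powModel E 2) ∞ ρ Ω)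
    (hW : MapsTo ρ Ω (S.W 2)) (hy : y ∈ Ω) (v : Fin 1 → Y) :
    MForm.pullback 𝓘(ℂ, Y) (powModel E 2) ρ (S.beta 1 1 1 (bssForm₂ P)) y v =
      wedgeIntegral₁ P (fun y => ρ y 0) (S.family fun y => bgFace 0 (ρ y)) Ω (v 0) y := by
  have hf : ∀ t ∈ stdSimp 1, MDifferentiableAt (powModel E 2) (powModel E 2)
      (fun g => S.f 1 1 g t) (ρ y) := fun t ht => mdifferentiableAt_pi_iff.2 fun j => by
    fin_cases j
    · exact mdifferentiableAt_eval 0 _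
    · have h1 := S.mdifferentiableAt_σ (E := E) (S.face_mem _ _ (hW hy) 0) ht
      have h2 := MDifferentiableAt.comp (g := fun g => S.σ 1 g t) (f := bgFace (G := G) 0) (ρ y) h1
        ((contMDiff_bgFace (E := E) 0).mdifferentiable (by simp) _)
      exact h2.congr_of_eventuallyEq (Eventually.of_forall fun g => S.f_one_one_one g t)
  have hΩ' := isOpen_chartDomain (I := powModel E 2) (S.isOpen_W 2) (ρ y)
  have hρ' := contMDiffOn_chartDomain (I := powModel E 2) (S.W 2) (ρ y)
  have hW' := mapsTo_chartDomain (I := powModel E 2) (S.W 2) (ρ y)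
  have hy' := mem_chartDomain_self (I := powModel E 2) (hW hy)
  refine (pullback_fiberIntegral_apply hf ((hρ.contMDiffAt (hΩ.mem_nhds hy)).mdifferentiableAt
    (by simp)) (continuousOn_fiberIntegrand_of_chart hf fun v => ?_) v).trans ?_
  · exact (continuousOn_prod_slice ((S.holFamily_family hΩ'
      ((contMDiff_bgFace 0).comp_contMDiffOn hρ') (S.mapsTo_bgFace hW' 0)).partHolOn_dlogWedge
      (fun y hy => contMDiffWithinAt_pi_iff.1 (hρ' y hy) 0) hΩ' _ _).contDiffOn.continuousOn
      hy').congr fun t ht => S.fiberIntegrand_f_one_one hP hΩ' hρ' hW' hy' v ht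
  · exact MeasureTheory.setIntegral_congr_fun (measurableSet_stdSimp _) fun t ht =>
      S.fiberIntegrand_f_one_one hP hΩ hρ hW hy v ht

lemma pullback_eta₁_apply (hP : IsInvariantQuadratic G P) (hΩ : IsOpen Ω)
    {ρ : Y → Fin 2 → G} (hρ : ContMDiffOn 𝓘(ℂ, Y) (powModel E 2) ∞ ρ Ω)
    (hW : MapsTo ρ Ω (S.W 2)) (hy : y ∈ Ω) (v : Fin 1 → Y) :
    MForm.pullback 𝓘(ℂ, Y) (powModel E 2) ρ (S.eta₁ P) y v =
      -cartanIntegral₂ P (S.family ρ) Ω (v 0) y +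
      wedgeIntegral₁ P (fun y => ρ y 0) (S.family fun y => bgFace 0 (ρ y)) Ω (v 0) y := by
  rw [← S.pullback_beta_two_apply hP hΩ hρ hW hy, ← S.pullback_beta_one_one_apply hP hΩ hρ hW hy]
  rfl

end SimplexSystem

/-! ### Testing forms in charts -/

namespace MForm

variable {F : Type*} [NormedAddCommGroup F] [NormedSpace ℂ F]
  {H : Type*} [TopologicalSpace H] {I : ModelWithCorners ℂ F H}
  {M : Type*} [TopologicalSpace M] [ChartedSpace H M]
  {Y : Type*} [NormedAddCommGroup Y] [NormedSpace ℂ Y] {k : ℕ}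

/-- The inverse chart has identity derivative at its base point, so nothing is lost. All identities
on G^s are proved by pulling back this way. -/
lemma eq_of_pullback_chart [I.Boundaryless] [IsManifold I ∞ M] {α β : MForm F M ℂ k} {x : M}
    (h : ∀ v, pullback 𝓘(ℂ, F) I (extChartAt I x).symm α (extChartAt I x x) v =
      pullback 𝓘(ℂ, F) I (extChartAt I x).symm β (extChartAt I x x) v) : α x = β x := by
  ext v
  have h1 := h v
  simp only [pullback, tangentDeriv_extChartAt_symm_self, extChartAt_to_inv] at h1
  exact h1

lemma pullback_d_eq_extDeriv [I.Boundaryless] [IsManifold I ∞ M] {α : MForm F M ℂ k} {Ω : Set Y}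
    {ρ : Y → M} {y : Y}
    (hΩ : IsOpen Ω) (hρ : ContMDiffOn 𝓘(ℂ, Y) I ∞ ρ Ω) (hy : y ∈ Ω) (hα : HolomorphicAt I α (ρ y)) :
    pullback 𝓘(ℂ, Y) I ρ (d I α) y = extDeriv (pullback 𝓘(ℂ, Y) I ρ α) y := by
  rw [← d_vectorSpace, d_pullback hα (hρ.contMDiffAt (hΩ.mem_nhds hy))]
  filter_upwards [hΩ.mem_nhds hy] with z hz
  exact (hρ.contMDiffAt (hΩ.mem_nhds hz)).mdifferentiableAt (by simp)

lemma holomorphicAt_of_chart [FiniteDimensional ℂ F] [I.Boundaryless] {α : MForm F M ℂ k} {W : Set M} (hW : IsOpen W)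
    {x : M} (hx : x ∈ W) {κ : (Fin k → F) → F → ℂ}
    (hκ : ∀ v, ContDiffOn ℂ ∞ (κ v) (chartDomain I W x))
    (h : ∀ z ∈ chartDomain I W x, ∀ v,
      pullback 𝓘(ℂ, F) I (extChartAt I x).symm α z v = κ v z) : HolomorphicAt I α x := by
  have hm := (isOpen_chartDomain hW x).mem_nhds (mem_chartDomain_self (I := I) hx)
  refine contDiffAt_of_forall_apply fun v => ?_
  refine ((hκ v).contDiffAt hm).congr_of_eventuallyEq ?_
  filter_upwards [hm] with z hz
  exact h z hz v

end MForm

/-! ### The exterior derivative of 0-, 1- and 2-forms on a vector space -/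

section ExtDeriv

variable {Y : Type*} [NormedAddCommGroup Y] [NormedSpace ℂ Y] {y : Y}

lemma extDeriv_zero_apply {β : Y → Y [⋀^Fin 0]→L[ℂ] ℂ} (hβ : DifferentiableAt ℂ β y)
    {κ : Y → ℂ} (h : ∀ᶠ z in 𝓝 y, ∀ v, β z v = κ z) (v : Fin 1 → Y) :
    extDeriv β y v = fderiv ℂ κ y (v 0) := by
  have h1 : ∀ u, fderiv ℂ (fun z => β z u) y = fderiv ℂ κ y := fun u =>
    Filter.EventuallyEq.fderiv_eq (h.mono fun z hz => hz u)
  rw [extDeriv_apply hβ]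
  refine (Fin.sum_univ_one _).trans ?_
  rw [h1, Fin.val_zero, pow_zero, one_smul]

lemma extDeriv_one_apply {β : Y → Y [⋀^Fin 1]→L[ℂ] ℂ} (hβ : DifferentiableAt ℂ β y)
    {κ : Y → Y → ℂ} (h : ∀ᶠ z in 𝓝 y, ∀ v, β z v = κ (v 0) z) (v : Fin 2 → Y) :
    extDeriv β y v = fderiv ℂ (κ (v 1)) y (v 0) - fderiv ℂ (κ (v 0)) y (v 1) := by
  have h1 : ∀ u, fderiv ℂ (fun z => β z u) y = fderiv ℂ (κ (u 0)) y := fun u =>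
    Filter.EventuallyEq.fderiv_eq (h.mono fun z hz => hz u)
  rw [extDeriv_apply hβ]
  refine (Fin.sum_univ_two _).trans ?_
  rw [h1, h1, Fin.val_zero, pow_zero, one_smul, Fin.val_one, pow_one, neg_one_smul,
    ← sub_eq_add_neg]
  rfl

lemma extDeriv_two_apply {β : Y → Y [⋀^Fin 2]→L[ℂ] ℂ} (hβ : DifferentiableAt ℂ β y)
    {κ : Y → Y → Y → ℂ} (h : ∀ᶠ z in 𝓝 y, ∀ v, β z v = κ (v 0) (v 1) z) (v : Fin 3 → Y) :
    extDeriv β y v = fderiv ℂ (κ (v 1) (v 2)) y (v 0) - fderiv ℂ (κ (v 0) (v 2)) y (v 1) +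
      fderiv ℂ (κ (v 0) (v 1)) y (v 2) := by
  have h1 : ∀ u, fderiv ℂ (fun z => β z u) y = fderiv ℂ (κ (u 0) (u 1)) y := fun u =>
    Filter.EventuallyEq.fderiv_eq (h.mono fun z hz => hz u)
  rw [extDeriv_apply hβ]
  refine (Fin.sum_univ_three _).trans ?_
  rw [h1, h1, h1, Fin.val_zero, pow_zero, one_smul, Fin.val_one, pow_one, neg_one_smul,
    ← sub_eq_add_neg, Fin.val_two, neg_one_sq, one_smul]
  rfl

end ExtDeriv

/-! ### Congruence, degenerate cases and holomorphy of the integrals -/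

section CartanIntegrals

variable {E : Type*} [NormedAddCommGroup E] [NormedSpace ℂ E] [FiniteDimensional ℂ E]
  {G : Type*} [TopologicalSpace G] [ChartedSpace E G] [Group G] [LieGroup 𝓘(ℂ, E) ∞ G]
  {Y : Type*} [NormedAddCommGroup Y] [NormedSpace ℂ Y] {Ω : Set Y} {y : Y}
  {P : E →L[ℂ] E →L[ℂ] ℂ}

lemma cartanIntegral₃_congr {F F' : Y × (Fin 3 → ℝ) → G} (h : EqOn F F' (Ω ×ˢ stdSimp 3))
    (hy : y ∈ Ω) : cartanIntegral₃ P F Ω y = cartanIntegral₃ P F' Ω y :=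
  MeasureTheory.setIntegral_congr_fun (measurableSet_stdSimp _) fun _ ht =>
    dlogCubic_congr h ⟨hy, ht⟩ _ _ _

lemma cartanIntegral₂_congr {F F' : Y × (Fin 2 → ℝ) → G} (h : EqOn F F' (Ω ×ˢ stdSimp 2))
    (hy : y ∈ Ω) (v : Y) : cartanIntegral₂ P F Ω v y = cartanIntegral₂ P F' Ω v y :=
  MeasureTheory.setIntegral_congr_fun (measurableSet_stdSimp _) fun _ ht =>
    dlogCubic_congr h ⟨hy, ht⟩ _ _ _

lemma cartanIntegral₁_congr {F F' : Y × (Fin 1 → ℝ) → G} (h : EqOn F F' (Ω ×ˢ stdSimp 1))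
    (hy : y ∈ Ω) (v w : Y) : cartanIntegral₁ P F Ω v w y = cartanIntegral₁ P F' Ω v w y :=
  MeasureTheory.setIntegral_congr_fun (measurableSet_stdSimp _) fun _ ht =>
    dlogCubic_congr h ⟨hy, ht⟩ _ _ _

lemma cartanIntegral₀_congr {F F' : Y × (Fin 0 → ℝ) → G} (h : EqOn F F' (Ω ×ˢ stdSimp 0))
    (hy : y ∈ Ω) (u v w : Y) : cartanIntegral₀ P F Ω u v w y = cartanIntegral₀ P F' Ω u v w y :=
  MeasureTheory.setIntegral_congr_fun (measurableSet_stdSimp _) fun _ ht =>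
    dlogCubic_congr h ⟨hy, ht⟩ _ _ _

omit [FiniteDimensional ℂ E] [LieGroup 𝓘(ℂ, E) ∞ G] in
lemma dlogWedge_congr {q : ℕ} {h : Y → G} {F F' : Y × (Fin q → ℝ) → G}
    (hF : EqOn F F' (Ω ×ˢ stdSimp q)) {x : Y × (Fin q → ℝ)} (hx : x ∈ Ω ×ˢ stdSimp q)
    (u v : Y × (Fin q → ℝ)) : dlogWedge P h F Ω u v x = dlogWedge P h F' Ω u v x := by
  have h1 : EqOn (leftTranslate h F) (leftTranslate h F') (Ω ×ˢ stdSimp q) := fun x hx => by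
    rw [leftTranslate, leftTranslate, hF hx]
  rw [dlogWedge, dlogWedge, dlog_congr h1 hx]

omit [FiniteDimensional ℂ E] [LieGroup 𝓘(ℂ, E) ∞ G] in
lemma wedgeIntegral₁_congr {h : Y → G} {F F' : Y × (Fin 1 → ℝ) → G}
    (hF : EqOn F F' (Ω ×ˢ stdSimp 1)) (hy : y ∈ Ω) (v : Y) :
    wedgeIntegral₁ P h F Ω v y = wedgeIntegral₁ P h F' Ω v y :=
  MeasureTheory.setIntegral_congr_fun (measurableSet_stdSimp _) fun _ ht =>
    dlogWedge_congr hF ⟨hy, ht⟩ _ _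

omit [FiniteDimensional ℂ E] [LieGroup 𝓘(ℂ, E) ∞ G] in
lemma wedgeIntegral₀_congr {h : Y → G} {F F' : Y × (Fin 0 → ℝ) → G}
    (hF : EqOn F F' (Ω ×ˢ stdSimp 0)) (hy : y ∈ Ω) (v w : Y) :
    wedgeIntegral₀ P h F Ω v w y = wedgeIntegral₀ P h F' Ω v w y :=
  MeasureTheory.setIntegral_congr_fun (measurableSet_stdSimp _) fun _ ht =>
    dlogWedge_congr hF ⟨hy, ht⟩ _ _

lemma cartanIntegral₀_const (c : G) (u v w : Y) :
    cartanIntegral₀ P (fun _ => c) Ω u v w y = 0 := by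
  rw [cartanIntegral₀]
  simp [dlogCubic, dlog_const, cartanForm]

omit [FiniteDimensional ℂ E] in
-- For the constant family 1 one has C = B, and P(B_v, B_w) is symmetric in v and w.
lemma IsInvariantQuadratic.wedgeIntegral₀_one (hP : IsInvariantQuadratic G P) {h : Y → G}
    (hΩ : IsOpen Ω) (hh : ContMDiffOn 𝓘(ℂ, Y) 𝓘(ℂ, E) ∞ h Ω) (hy : y ∈ Ω) (v w : Y) :
    wedgeIntegral₀ P h (fun _ => 1) Ω v w y = 0 := by
  have h1 : leftTranslate h (fun _ : Y × (Fin 0 → ℝ) => (1 : G)) = fun x => h x.1 :=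
    funext fun x => mul_one _
  have hx : (y, (0 : Fin 0 → ℝ)) ∈ Ω ×ˢ stdSimp 0 := ⟨hy, zero_mem_stdSimp 0⟩
  rw [wedgeIntegral₀, integral_stdSimp_zero, dlogWedge, h1, dlog_fst hΩ hh hx,
    dlog_fst hΩ hh hx, hP.symm, sub_self]

variable [FiniteDimensional ℂ Y]

namespace HolFamily

lemma contDiffOn_cartanIntegral₃ {F : Y × (Fin 3 → ℝ) → G} (h : HolFamily E F Ω)
    (hΩ : IsOpen Ω) : ContDiffOn ℂ ∞ (cartanIntegral₃ P F Ω) Ω :=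
  (h.partHolOn_dlogCubic hΩ _ _ _).contDiffOn_setIntegral hΩ

lemma contDiffOn_cartanIntegral₂ {F : Y × (Fin 2 → ℝ) → G} (h : HolFamily E F Ω)
    (hΩ : IsOpen Ω) (v : Y) : ContDiffOn ℂ ∞ (cartanIntegral₂ P F Ω v) Ω :=
  (h.partHolOn_dlogCubic hΩ _ _ _).contDiffOn_setIntegral hΩ

lemma contDiffOn_cartanIntegral₁ {F : Y × (Fin 1 → ℝ) → G} (h : HolFamily E F Ω)
    (hΩ : IsOpen Ω) (v w : Y) : ContDiffOn ℂ ∞ (cartanIntegral₁ P F Ω v w) Ω :=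
  (h.partHolOn_dlogCubic hΩ _ _ _).contDiffOn_setIntegral hΩ

omit [FiniteDimensional ℂ E] in
lemma contDiffOn_wedgeIntegral₁ {F : Y × (Fin 1 → ℝ) → G} (h : HolFamily E F Ω) {k : Y → G}
    (hk : ContMDiffOn 𝓘(ℂ, Y) 𝓘(ℂ, E) ∞ k Ω) (hΩ : IsOpen Ω) (v : Y) :
    ContDiffOn ℂ ∞ (wedgeIntegral₁ P k F Ω v) Ω :=
  (h.partHolOn_dlogWedge hk hΩ _ _).contDiffOn_setIntegral hΩ

end HolFamily

omit [FiniteDimensional ℂ Y] in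
-- Connects the complex exterior derivative with the real derivatives in which the Stokes identities
-- are stated.
lemma ContDiffOn.fderiv_complex_eq_real {κ : Y → ℂ} (hκ : ContDiffOn ℂ ∞ κ Ω) (hΩ : IsOpen Ω)
    (hy : y ∈ Ω) (v : Y) : fderiv ℂ κ y v = fderiv ℝ κ y v := by
  have h := (hκ.contDiffAt (hΩ.mem_nhds hy)).differentiableAt (by simp)
  rw [h.fderiv_restrictScalars ℝ]
  rfl

end CartanIntegrals

/-! ### The four identities, at the level of integrals -/

namespace SimplexSystem

variable {E : Type*} [NormedAddCommGroup E] [NormedSpace ℂ E]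
  {G : Type*} [TopologicalSpace G] [ChartedSpace E G] [Group G] [LieGroup 𝓘(ℂ, E) ∞ G]
  {Y : Type*} [NormedAddCommGroup Y] [NormedSpace ℂ Y] {Ω : Set Y} {y : Y}

lemma pullback_simplicialD {r s : ℕ} (α : BGForm E G r s) {ρ : Y → Fin (s + 1) → G}
    (hρ : MDifferentiableAt 𝓘(ℂ, Y) (powModel E (s + 1)) ρ y) (v : Fin r → Y) :
    MForm.pullback 𝓘(ℂ, Y) (powModel E (s + 1)) ρ (simplicialD α) y v =
      ∑ j : Fin (s + 2), (-1 : ℂ) ^ (j : ℕ) *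
        MForm.pullback 𝓘(ℂ, Y) (powModel E s) (fun y => bgFace j (ρ y)) α y v := by
  have h : ∀ j : Fin (s + 2), MForm.pullback 𝓘(ℂ, Y) (powModel E s) (fun y => bgFace j (ρ y)) α y =
      MForm.pullback 𝓘(ℂ, Y) (powModel E (s + 1)) ρ
        (MForm.pullback (powModel E (s + 1)) (powModel E s) (bgFace j) α) y := fun j =>
    (MForm.pullback_pullback α ((contMDiff_bgFace j).mdifferentiable (by simp) _) hρ).symm
  simp only [h]
  change (∑ j : Fin (s + 2), (-1 : ℂ) ^ (j : ℕ) • MForm.pullback (powModel E (s + 1))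
    (powModel E s) (bgFace j) α (ρ y)) (fun i => tangentDeriv _ _ ρ y (v i)) = _
  rw [ContinuousAlternatingMap.sum_apply]
  rfl

variable [FiniteDimensional ℂ E] [FiniteDimensional ℂ Y] {P : E →L[ℂ] E →L[ℂ] ℂ}
  (S : SimplexSystem E G)

omit [Group G] [LieGroup 𝓘(ℂ, E) ∞ G] [FiniteDimensional ℂ E] [FiniteDimensional ℂ Y] in
lemma eval_comp {l : ℕ} {ρ : Y → Fin l → G} (hρ : ContMDiffOn 𝓘(ℂ, Y) (powModel E l) ∞ ρ Ω)
    (i : Fin l) : ContMDiffOn 𝓘(ℂ, Y) 𝓘(ℂ, E) ∞ (fun y => ρ y i) Ω := fun y hy =>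
  contMDiffWithinAt_pi_iff.1 (hρ y hy) i

omit [FiniteDimensional ℂ E] [FiniteDimensional ℂ Y] in
lemma bgFace_comp {l : ℕ} {ρ : Y → Fin (l + 1) → G} (j : Fin (l + 2))
    (hρ : ContMDiffOn 𝓘(ℂ, Y) (powModel E (l + 1)) ∞ ρ Ω) :
    ContMDiffOn 𝓘(ℂ, Y) (powModel E l) ∞ (fun y => bgFace j (ρ y)) Ω :=
  (contMDiff_bgFace j).comp_contMDiffOn hρ

/-- The faces 1, 2, 3 give d_1, d_2, d_3 directly; face 0 is the g₁-translate of σ_{g₂,g₃} and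
contributes three edge terms. On the other side the d_1-term, for g₁g₂ acting on σ_{g₃}, splits by
`wedgeIntegral₁_mul`: its g₂-part cancels the d_0-term and its g₁-part is the edge g₂σ_{g₃}, so the
edge terms match. -/
lemma fderiv_cartanIntegral₃_family (hP : IsInvariantQuadratic G P) (hΩ : IsOpen Ω)
    {ρ : Y → Fin 3 → G} (hρ : ContMDiffOn 𝓘(ℂ, Y) (powModel E 3) ∞ ρ Ω)
    (hW : MapsTo ρ Ω (S.W 3)) (hy : y ∈ Ω) (v : Y) :
    -fderiv ℝ (cartanIntegral₃ P (S.family ρ) Ω) y v =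
      ∑ j : Fin 4, (-1 : ℂ) ^ (j : ℕ) *
        (-cartanIntegral₂ P (S.family fun y => bgFace j (ρ y)) Ω v y +
          wedgeIntegral₁ P (fun y => bgFace j (ρ y) 0)
            (S.family fun y => bgFace 0 (bgFace j (ρ y))) Ω v y) := by
  have hρ0 := bgFace_comp 0 hρ
  have hW0 := S.mapsTo_bgFace hW 0
  have e0 := cartanIntegral₂_congr (P := P) (S.familyFace_zero_family hW) hy v
  have e1 : cartanIntegral₂ P (familyFace 1 (S.family ρ)) Ω v y =
      cartanIntegral₂ P (S.family fun y => bgFace 1 (ρ y)) Ω v y :=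
    cartanIntegral₂_congr (S.familyFace_succ_family hW 0) hy v
  have e2 : cartanIntegral₂ P (familyFace 2 (S.family ρ)) Ω v y =
      cartanIntegral₂ P (S.family fun y => bgFace 2 (ρ y)) Ω v y :=
    cartanIntegral₂_congr (S.familyFace_succ_family hW 1) hy v
  have e3 : cartanIntegral₂ P (familyFace 3 (S.family ρ)) Ω v y =
      cartanIntegral₂ P (S.family fun y => bgFace 3 (ρ y)) Ω v y :=
    cartanIntegral₂_congr (S.familyFace_succ_family hW 2) hy v
  have a0 := wedgeIntegral₁_congr (P := P) (h := fun y => ρ y 0) (S.familyFace_zero_family hW0) hy v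
  have a1 : wedgeIntegral₁ P (fun y => ρ y 0) (familyFace 1 (S.family fun y => bgFace 0 (ρ y)))
      Ω v y = wedgeIntegral₁ P (fun y => ρ y 0)
        (S.family fun y => bgFace 1 (bgFace 0 (ρ y))) Ω v y :=
    wedgeIntegral₁_congr (S.familyFace_succ_family hW0 0) hy v
  have a2 : wedgeIntegral₁ P (fun y => ρ y 0) (familyFace 2 (S.family fun y => bgFace 0 (ρ y)))
      Ω v y = wedgeIntegral₁ P (fun y => ρ y 0)
        (S.family fun y => bgFace 2 (bgFace 0 (ρ y))) Ω v y :=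
    wedgeIntegral₁_congr (S.familyFace_succ_family hW0 1) hy v
  have m := hP.wedgeIntegral₁_mul (S.holFamily_family hΩ (bgFace_comp 0 hρ0)
    (S.mapsTo_bgFace hW0 0)) (h := fun y => ρ y 0) (eval_comp hρ 0) (eval_comp hρ0 0) hΩ hy v
  have f1 : ∀ g : Fin 3 → G, bgFace 0 (bgFace 1 g) = bgFace 0 (bgFace 0 g) := fun g => by
    funext i; fin_cases i; rfl
  have f2 : ∀ g : Fin 3 → G, bgFace 0 (bgFace 2 g) = bgFace 1 (bgFace 0 g) := fun g => by
    funext i; fin_cases i; rfl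
  have f3 : ∀ g : Fin 3 → G, bgFace 0 (bgFace 3 g) = bgFace 2 (bgFace 0 g) := fun g => by
    funext i; fin_cases i; rfl
  have h1 : ∀ g : Fin 3 → G, bgFace 1 g 0 = g 0 * bgFace 0 g 0 := fun g => rfl
  have h2 : ∀ g : Fin 3 → G, bgFace 2 g 0 = g 0 := fun g => rfl
  have h3 : ∀ g : Fin 3 → G, bgFace 3 g 0 = g 0 := fun g => rfl
  rw [hP.fderiv_cartanIntegral₃ (S.holFamily_family hΩ hρ hW) hΩ hy, e0,
    hP.cartanIntegral₂_leftTranslate (S.holFamily_family hΩ hρ0 hW0) (eval_comp hρ 0) hΩ hy,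
    a0, a1, a2, e1, e2, e3, Fin.sum_univ_four]
  simp only [f1, f2, f3, h1, h2, h3, m]
  rw [Fin.val_zero, Fin.val_one, Fin.val_two, show ((3 : Fin 4) : ℕ) = 3 from rfl]
  ring

omit [FiniteDimensional ℂ Y] in
-- Stokes on the 4-simplices σ_{g₁,…,g₄}; face 0 needs no correction because `cartanIntegral₃` is
-- invariant under translation.
lemma cartanIntegral₃_family_sum (hP : IsInvariantQuadratic G P) (hΩ : IsOpen Ω)
    {ρ : Y → Fin 4 → G} (hρ : ContMDiffOn 𝓘(ℂ, Y) (powModel E 4) ∞ ρ Ω)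
    (hW : MapsTo ρ Ω (S.W 4)) (hy : y ∈ Ω) :
    ∑ j : Fin 5, (-1 : ℂ) ^ (j : ℕ) *
      -cartanIntegral₃ P (S.family fun y => bgFace j (ρ y)) Ω y = 0 := by
  have h := hP.cartanIntegral₃_face_sum (S.holFamily_family hΩ hρ hW) hΩ hy
  have e0 := cartanIntegral₃_congr (P := P) (S.familyFace_zero_family hW) hy
  rw [hP.cartanIntegral₃_leftTranslate (S.holFamily_family hΩ (bgFace_comp 0 hρ)
    (S.mapsTo_bgFace hW 0)) (eval_comp hρ 0) hΩ hy] at e0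
  have e1 : cartanIntegral₃ P (familyFace 1 (S.family ρ)) Ω y =
      cartanIntegral₃ P (S.family fun y => bgFace 1 (ρ y)) Ω y :=
    cartanIntegral₃_congr (S.familyFace_succ_family hW 0) hy
  have e2 : cartanIntegral₃ P (familyFace 2 (S.family ρ)) Ω y =
      cartanIntegral₃ P (S.family fun y => bgFace 2 (ρ y)) Ω y :=
    cartanIntegral₃_congr (S.familyFace_succ_family hW 1) hy
  have e3 : cartanIntegral₃ P (familyFace 3 (S.family ρ)) Ω y =
      cartanIntegral₃ P (S.family fun y => bgFace 3 (ρ y)) Ω y :=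
    cartanIntegral₃_congr (S.familyFace_succ_family hW 2) hy
  have e4 : cartanIntegral₃ P (familyFace 4 (S.family ρ)) Ω y =
      cartanIntegral₃ P (S.family fun y => bgFace 4 (ρ y)) Ω y :=
    cartanIntegral₃_congr (S.familyFace_succ_family hW 3) hy
  rw [e0, e1, e2, e3, e4] at h
  rw [Fin.sum_univ_five, Fin.val_zero, Fin.val_one, Fin.val_two,
    show ((3 : Fin 5) : ℕ) = 3 from rfl, show ((4 : Fin 5) : ℕ) = 4 from rfl]
  linear_combination -h

/-- Poincaré lemma along the paths σ_g: the end g · σ_0 = g returns the form itself, and the end 1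
is constant and contributes nothing. -/
lemma fderiv_cartanIntegral₁_family (hP : IsInvariantQuadratic G P) (hΩ : IsOpen Ω)
    {ρ : Y → Fin 1 → G} (hρ : ContMDiffOn 𝓘(ℂ, Y) (powModel E 1) ∞ ρ Ω)
    (hW : MapsTo ρ Ω (S.W 1)) (hy : y ∈ Ω) (u v w : Y) :
    fderiv ℝ (cartanIntegral₁ P (S.family ρ) Ω v w) y u -
      fderiv ℝ (cartanIntegral₁ P (S.family ρ) Ω u w) y v +
      fderiv ℝ (cartanIntegral₁ P (S.family ρ) Ω u v) y w =
      cartanIntegral₀ P (fun x => ρ x.1 0) Ω u v w y := by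
  have e0 := cartanIntegral₀_congr (P := P) (S.familyFace_zero_family hW) hy u v w
  have h0 : leftTranslate (fun y => ρ y 0) (S.family fun y => bgFace 0 (ρ y)) =
      fun x => ρ x.1 0 := funext fun x => by
    rw [leftTranslate, family, S.σ_zero, mul_one]
  have e1 : cartanIntegral₀ P (familyFace 1 (S.family ρ)) Ω u v w y =
      cartanIntegral₀ P (S.family fun y => bgFace 1 (ρ y)) Ω u v w y :=
    cartanIntegral₀_congr (S.familyFace_succ_family hW 0) hy u v w
  have h1 : (S.family fun y => bgFace 1 (ρ y)) = fun _ => 1 := funext fun x => S.σ_zero _ _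
  rw [hP.fderiv_cartanIntegral₁ (S.holFamily_family hΩ hρ hW) hΩ hy, e0, e1, h0, h1,
    cartanIntegral₀_const, sub_zero]

/-- Stokes on the triangle σ_{g₁,g₂} together with the translation formula on its face g₁σ_{g₂}.
That path runs from g₁ to g₁g₂: its far end produces ω₂, and its near end vanishes by
`wedgeIntegral₀_one`. -/
lemma cartanIntegral₁_family_sum (hP : IsInvariantQuadratic G P) (hΩ : IsOpen Ω)
    {ρ : Y → Fin 2 → G} (hρ : ContMDiffOn 𝓘(ℂ, Y) (powModel E 2) ∞ ρ Ω)
    (hW : MapsTo ρ Ω (S.W 2)) (hy : y ∈ Ω) (v w : Y) :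
    ∑ j : Fin 3, (-1 : ℂ) ^ (j : ℕ) *
      -cartanIntegral₁ P (S.family fun y => bgFace j (ρ y)) Ω v w y =
    -wedgeIntegral₀ P (fun y => ρ y 0) (fun x => ρ x.1 1) Ω v w y -
      ((-fderiv ℝ (cartanIntegral₂ P (S.family ρ) Ω w) y v +
        fderiv ℝ (wedgeIntegral₁ P (fun y => ρ y 0) (S.family fun y => bgFace 0 (ρ y)) Ω w) y v) -
      (-fderiv ℝ (cartanIntegral₂ P (S.family ρ) Ω v) y w +
        fderiv ℝ (wedgeIntegral₁ P (fun y => ρ y 0) (S.family fun y => bgFace 0 (ρ y)) Ω v) y w))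
    := by
  have hρ0 := bgFace_comp 0 hρ
  have hW0 := S.mapsTo_bgFace hW 0
  have d2 := hP.fderiv_cartanIntegral₂ (S.holFamily_family hΩ hρ hW) hΩ hy v w
  have d1 := hP.fderiv_wedgeIntegral₁ (S.holFamily_family hΩ hρ0 hW0) (eval_comp hρ 0) hΩ hy v w
  have e0 := cartanIntegral₁_congr (P := P) (S.familyFace_zero_family hW) hy v w
  have e1 : cartanIntegral₁ P (familyFace 1 (S.family ρ)) Ω v w y =
      cartanIntegral₁ P (S.family fun y => bgFace 1 (ρ y)) Ω v w y :=
    cartanIntegral₁_congr (S.familyFace_succ_family hW 0) hy v w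
  have e2 : cartanIntegral₁ P (familyFace 2 (S.family ρ)) Ω v w y =
      cartanIntegral₁ P (S.family fun y => bgFace 2 (ρ y)) Ω v w y :=
    cartanIntegral₁_congr (S.familyFace_succ_family hW 1) hy v w
  have a0 := wedgeIntegral₀_congr (P := P) (h := fun y => ρ y 0)
    (S.familyFace_zero_family hW0) hy v w
  have a1 : wedgeIntegral₀ P (fun y => ρ y 0) (familyFace 1 (S.family fun y => bgFace 0 (ρ y)))
      Ω v w y = wedgeIntegral₀ P (fun y => ρ y 0)
        (S.family fun y => bgFace 1 (bgFace 0 (ρ y))) Ω v w y :=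
    wedgeIntegral₀_congr (S.familyFace_succ_family hW0 0) hy v w
  have h0 : leftTranslate (fun y => bgFace 0 (ρ y) 0)
      (S.family fun y => bgFace 0 (bgFace 0 (ρ y))) = fun x => ρ x.1 1 := funext fun x => by
    rw [leftTranslate, family, S.σ_zero, mul_one]
    rfl
  have h1 : (S.family fun y => bgFace 1 (bgFace 0 (ρ y))) = fun _ => 1 :=
    funext fun x => S.σ_zero _ _
  rw [h0] at a0
  rw [h1, hP.wedgeIntegral₀_one hΩ (eval_comp hρ 0) hy] at a1
  rw [e0, e1, e2] at d2
  rw [a0, a1] at d1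
  rw [Fin.sum_univ_three, Fin.val_zero, Fin.val_one, Fin.val_two]
  linear_combination -d2 + d1

end SimplexSystem

/-! ### Linearity and locality of holomorphy and exterior derivative -/

namespace MForm

variable {F : Type*} [NormedAddCommGroup F] [NormedSpace ℂ F]
  {H : Type*} [TopologicalSpace H] {I : ModelWithCorners ℂ F H}
  {M : Type*} [TopologicalSpace M] [ChartedSpace H M] {k : ℕ} {α β : MForm F M ℂ k} {x : M}

lemma inChart_congr (h : α =ᶠ[𝓝 x] β) :
    inChart I α x =ᶠ[𝓝 (extChartAt I x x)] inChart I β x := by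
  have hc := (continuousAt_extChartAt_symm (I := I) x).tendsto
  rw [extChartAt_to_inv] at hc
  filter_upwards [hc.eventually h] with z hz
  simp only [inChart, pullback, hz]

lemma HolomorphicAt.congr (hβ : HolomorphicAt I β x) (h : α =ᶠ[𝓝 x] β) : HolomorphicAt I α x :=
  ContDiffAt.congr_of_eventuallyEq hβ (inChart_congr h)

lemma d_congr (h : α =ᶠ[𝓝 x] β) : d I α x = d I β x := by
  rw [d, d, (inChart_congr h).extDeriv_eq]

lemma inChart_add : inChart I (fun x => α x + β x) x = inChart I α x + inChart I β x := rfl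

lemma inChart_smul (c : ℂ) : inChart I (fun x => c • α x) x = c • inChart I α x := rfl

lemma inChart_sum {ι : Type*} (s : Finset ι) (α : ι → MForm F M ℂ k) :
    inChart I (fun x => ∑ i ∈ s, α i x) x = ∑ i ∈ s, inChart I (α i) x := by
  funext z
  ext v
  simp only [inChart, pullback, ContinuousAlternatingMap.compContinuousLinearMap_apply,
    ContinuousAlternatingMap.sum_apply, Finset.sum_apply]

lemma inChart_zero : inChart I (0 : MForm F M ℂ k) x = 0 := rfl

lemma HolomorphicAt.add (hα : HolomorphicAt I α x) (hβ : HolomorphicAt I β x) :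
    HolomorphicAt I (fun x => α x + β x) x := by
  rw [HolomorphicAt, inChart_add]
  exact ContDiffAt.add hα hβ

lemma HolomorphicAt.smul (hα : HolomorphicAt I α x) (c : ℂ) :
    HolomorphicAt I (fun x => c • α x) x := by
  rw [HolomorphicAt, inChart_smul]
  exact ContDiffAt.const_smul c hα

lemma HolomorphicAt.sum {ι : Type*} {s : Finset ι} {α : ι → MForm F M ℂ k}
    (hα : ∀ i ∈ s, HolomorphicAt I (α i) x) : HolomorphicAt I (fun x => ∑ i ∈ s, α i x) x := by
  rw [HolomorphicAt, inChart_sum]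
  exact (ContDiffAt.sum hα).congr_of_eventuallyEq
    (Eventually.of_forall fun z => Finset.sum_apply z s _)

lemma holomorphicAt_zero : HolomorphicAt I (0 : MForm F M ℂ k) x := by
  rw [HolomorphicAt, inChart_zero]
  exact contDiffAt_const (c := 0)

lemma HolomorphicAt.differentiableAt (hα : HolomorphicAt I α x) :
    DifferentiableAt ℂ (inChart I α x) (extChartAt I x x) :=
  ContDiffAt.differentiableAt hα (by simp)

lemma d_add (hα : HolomorphicAt I α x) (hβ : HolomorphicAt I β x) :
    d I (fun x => α x + β x) x = d I α x + d I β x := by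
  rw [d, inChart_add, extDeriv_add hα.differentiableAt hβ.differentiableAt]
  rfl

lemma d_smul (c : ℂ) : d I (fun x => c • α x) x = c • d I α x := by
  rw [d, inChart_smul, extDeriv_smul]
  rfl

lemma d_zero : d I (0 : MForm F M ℂ k) = 0 := by
  funext x
  rw [d, inChart_zero]
  have : extDeriv (0 : F → F [⋀^Fin k]→L[ℂ] ℂ) (extChartAt I x x) = 0 := by
    rw [extDeriv, fderiv_zero]
    exact (ContinuousAlternatingMap.alternatizeUncurryFinCLM ℂ F ℂ).map_zero
  rw [this]
  rfl

lemma d_sum {ι : Type*} [DecidableEq ι] {s : Finset ι} {α : ι → MForm F M ℂ k}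
    (hα : ∀ i ∈ s, HolomorphicAt I (α i) x) :
    d I (fun x => ∑ i ∈ s, α i x) x = ∑ i ∈ s, d I (α i) x := by
  induction s using Finset.induction_on with
  | empty => exact congr_fun d_zero x
  | insert a s ha ih =>
    simp only [Finset.sum_insert ha]
    rw [d_add (hα a (Finset.mem_insert_self a s)) (HolomorphicAt.sum fun i hi =>
      hα i (Finset.mem_insert_of_mem hi)), ih fun i hi => hα i (Finset.mem_insert_of_mem hi)]

end MForm

/-! ### The simplicial differential: holomorphy, δ² = 0, commutation with d -/

section SimplicialD

variable {E : Type*} [NormedAddCommGroup E] [NormedSpace ℂ E] [FiniteDimensional ℂ E]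
  {G : Type*} [TopologicalSpace G] [ChartedSpace E G] [Group G] [LieGroup 𝓘(ℂ, E) ∞ G]
  {r s : ℕ} {α β : BGForm E G r s}

omit [FiniteDimensional ℂ E] [LieGroup 𝓘(ℂ, E) ∞ G] in
lemma simplicialD_congr {g : Fin (s + 1) → G} (h : ∀ j, α (bgFace j g) = β (bgFace j g)) :
    simplicialD α g = simplicialD β g := by
  simp only [simplicialD, MForm.pullback, h]

omit [FiniteDimensional ℂ E] [LieGroup 𝓘(ℂ, E) ∞ G] in
lemma simplicialD_add (g : Fin (s + 1) → G) :
    simplicialD (fun g => α g + β g) g = simplicialD α g + simplicialD β g := by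
  simp only [simplicialD, ← Finset.sum_add_distrib, ← smul_add]
  rfl

omit [FiniteDimensional ℂ E] [LieGroup 𝓘(ℂ, E) ∞ G] in
lemma simplicialD_zero : simplicialD (0 : BGForm E G r s) = 0 := by
  funext g
  refine Finset.sum_eq_zero fun j _ => ?_
  rw [show MForm.pullback (powModel E (s + 1)) (powModel E s) (bgFace j) (0 : BGForm E G r s) g = 0
    from rfl, smul_zero]

omit [FiniteDimensional ℂ E] in
lemma eventually_mdifferentiableAt_bgFace (j : Fin (s + 2)) (g : Fin (s + 1) → G) :
    ∀ᶠ h in 𝓝 g, MDifferentiableAt (powModel E (s + 1)) (powModel E s) (bgFace (G := G) j) h :=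
  Eventually.of_forall ((SimplexSystem.contMDiff_bgFace j).mdifferentiable (by simp))

lemma bgHolomorphicAt_simplicialD {g : Fin (s + 1) → G}
    (h : ∀ j, bgHolomorphicAt α (bgFace j g)) : bgHolomorphicAt (simplicialD α) g :=
  MForm.HolomorphicAt.sum fun j _ => MForm.HolomorphicAt.smul (MForm.HolomorphicAt.pullback (h j)
    (SimplexSystem.contMDiff_bgFace j g) (eventually_mdifferentiableAt_bgFace j g)) _

lemma bgD_simplicialD {g : Fin (s + 1) → G} (h : ∀ j, bgHolomorphicAt α (bgFace j g)) :
    bgD (simplicialD α) g = simplicialD (bgD α) g := by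
  have h1 := fun j => MForm.HolomorphicAt.pullback (h j)
    (SimplexSystem.contMDiff_bgFace j g) (eventually_mdifferentiableAt_bgFace j g)
  refine (MForm.d_sum fun j _ => MForm.HolomorphicAt.smul (h1 j) _).trans ?_
  refine Finset.sum_congr rfl fun j _ => ?_
  rw [MForm.d_smul, MForm.d_pullback (h j) (SimplexSystem.contMDiff_bgFace j g)
    (eventually_mdifferentiableAt_bgFace j g)]

omit [FiniteDimensional ℂ E] in
-- By the six simplicial identities between G³ and G¹ the twelve terms cancel in pairs.
-- Associativity enters only in the identity for d_1 d_2. The case s = 1 suffices because only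
-- δδβ_{1,1} is needed.
lemma simplicialD_simplicialD_one (α : BGForm E G r 1) (g : Fin 3 → G) :
    simplicialD (simplicialD α) g = 0 := by
  refine MForm.eq_of_pullback_chart (I := powModel E 3) (β := 0) fun v => ?_
  set ψ := (extChartAt (powModel E 3) g).symm
  set z := extChartAt (powModel E 3) g g
  have hψ : MDifferentiableAt 𝓘(ℂ, Fin 3 → E) (powModel E 3) ψ z :=
    MForm.mdifferentiableAt_chart_symm (mem_extChartAt_target g)
  have hψ' : ∀ j : Fin 4, MDifferentiableAt 𝓘(ℂ, Fin 3 → E) (powModel E 2)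
      (fun y => bgFace j (ψ y)) z := fun j =>
    ((SimplexSystem.contMDiff_bgFace j).mdifferentiable (by simp) _).comp z hψ
  have e3 : ∀ j : Fin 4, MForm.pullback 𝓘(ℂ, Fin 3 → E) (powModel E 2) (fun y => bgFace j (ψ y))
      (simplicialD α) z v = ∑ i : Fin 3, (-1 : ℂ) ^ (i : ℕ) * MForm.pullback 𝓘(ℂ, Fin 3 → E)
        (powModel E 1) (fun y => bgFace i (bgFace j (ψ y))) α z v := fun j =>
    SimplexSystem.pullback_simplicialD α (hψ' j) v
  have e4 : MForm.pullback 𝓘(ℂ, Fin 3 → E) (powModel E 3) ψ (simplicialD (simplicialD α)) z v =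
      ∑ j : Fin 4, (-1 : ℂ) ^ (j : ℕ) * MForm.pullback 𝓘(ℂ, Fin 3 → E) (powModel E 2)
        (fun y => bgFace j (ψ y)) (simplicialD α) z v :=
    SimplexSystem.pullback_simplicialD _ hψ v
  have f01 : ∀ g : Fin 3 → G, bgFace 0 (bgFace 1 g) = bgFace 0 (bgFace 0 g) := fun g => by
    funext i; fin_cases i; rfl
  have f02 : ∀ g : Fin 3 → G, bgFace 0 (bgFace 2 g) = bgFace 1 (bgFace 0 g) := fun g => by
    funext i; fin_cases i; rfl
  have f03 : ∀ g : Fin 3 → G, bgFace 0 (bgFace 3 g) = bgFace 2 (bgFace 0 g) := fun g => by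
    funext i; fin_cases i; rfl
  have f12 : ∀ g : Fin 3 → G, bgFace 1 (bgFace 2 g) = bgFace 1 (bgFace 1 g) := fun g => by
    funext i; fin_cases i; exact (mul_assoc (g 0) (g 1) (g 2)).symm
  have f13 : ∀ g : Fin 3 → G, bgFace 1 (bgFace 3 g) = bgFace 2 (bgFace 1 g) := fun g => by
    funext i; fin_cases i; rfl
  have f23 : ∀ g : Fin 3 → G, bgFace 2 (bgFace 3 g) = bgFace 2 (bgFace 2 g) := fun g => by
    funext i; fin_cases i; rfl
  rw [e4]
  simp only [e3, Fin.sum_univ_four, Fin.sum_univ_three, f01, f02, f03, f12, f13, f23]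
  rw [Fin.val_zero, Fin.val_one, Fin.val_two, Fin.val_zero, Fin.val_one, Fin.val_two,
    show ((3 : Fin 4) : ℕ) = 3 from rfl]
  change _ = (0 : ℂ)
  ring

end SimplicialD

/-! ### The four identities as identities of forms on W_l -/

namespace SimplexSystem

variable {E : Type*} [NormedAddCommGroup E] [NormedSpace ℂ E] [FiniteDimensional ℂ E]
  {G : Type*} [TopologicalSpace G] [ChartedSpace E G] [Group G] [LieGroup 𝓘(ℂ, E) ∞ G]
  {P : E →L[ℂ] E →L[ℂ] ℂ} (S : SimplexSystem E G)

theorem holomorphicAt_eta₀ (hP : IsInvariantQuadratic G P) {g : Fin 3 → G} (hg : g ∈ S.W 3) :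
    bgHolomorphicAt (S.eta₀ P) g := by
  have hΩ := isOpen_chartDomain (I := powModel E 3) (S.isOpen_W 3) g
  have hψ := contMDiffOn_chartDomain (I := powModel E 3) (S.W 3) g
  have hW := mapsTo_chartDomain (I := powModel E 3) (S.W 3) g
  exact MForm.holomorphicAt_of_chart (S.isOpen_W 3) hg
    (fun _ => ((S.holFamily_family hΩ hψ hW).contDiffOn_cartanIntegral₃ (P := P) hΩ).neg)
    fun z hz v => S.pullback_eta₀_apply hP hΩ hψ hW hz v

theorem holomorphicAt_eta₁ (hP : IsInvariantQuadratic G P) {g : Fin 2 → G} (hg : g ∈ S.W 2) :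
    bgHolomorphicAt (S.eta₁ P) g := by
  have hΩ := isOpen_chartDomain (I := powModel E 2) (S.isOpen_W 2) g
  have hψ := contMDiffOn_chartDomain (I := powModel E 2) (S.W 2) g
  have hW := mapsTo_chartDomain (I := powModel E 2) (S.W 2) g
  exact MForm.holomorphicAt_of_chart (S.isOpen_W 2) hg
    (fun v => ((S.holFamily_family hΩ hψ hW).contDiffOn_cartanIntegral₂ (P := P) hΩ (v 0)).neg.add
      ((S.holFamily_family hΩ (bgFace_comp 0 hψ)
        (S.mapsTo_bgFace hW 0)).contDiffOn_wedgeIntegral₁ (eval_comp hψ 0) hΩ (v 0)))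
    fun z hz v => S.pullback_eta₁_apply hP hΩ hψ hW hz v

theorem holomorphicAt_betaOne (hP : IsInvariantQuadratic G P) {g : Fin 1 → G} (hg : g ∈ S.W 1) :
    bgHolomorphicAt (S.betaOne P) g := by
  have hΩ := isOpen_chartDomain (I := powModel E 1) (S.isOpen_W 1) g
  have hψ := contMDiffOn_chartDomain (I := powModel E 1) (S.W 1) g
  have hW := mapsTo_chartDomain (I := powModel E 1) (S.W 1) g
  exact MForm.holomorphicAt_of_chart (S.isOpen_W 1) hg
    (fun v => ((S.holFamily_family hΩ hψ hW).contDiffOn_cartanIntegral₁ (P := P) hΩ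
      (v 0) (v 1)).neg)
    fun z hz v => S.pullback_betaOne_apply hP hΩ hψ hW hz v

theorem bgD_eta₀ (hP : IsInvariantQuadratic G P) {g : Fin 3 → G} (hg : g ∈ S.W 3) :
    bgD (S.eta₀ P) g = simplicialD (S.eta₁ P) g := by
  have hΩ := isOpen_chartDomain (I := powModel E 3) (S.isOpen_W 3) g
  have hψ := contMDiffOn_chartDomain (I := powModel E 3) (S.W 3) g
  have hW := mapsTo_chartDomain (I := powModel E 3) (S.W 3) g
  have hz := mem_chartDomain_self (I := powModel E 3) hg
  have hm := hΩ.mem_nhds hz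
  have hα := S.holomorphicAt_eta₀ hP hg
  have hI := (S.holFamily_family hΩ hψ hW).contDiffOn_cartanIntegral₃ (P := P) hΩ
  refine MForm.eq_of_pullback_chart (I := powModel E 3) fun v => ?_
  rw [MForm.pullback_d_eq_extDeriv hΩ hψ hz (by rwa [extChartAt_to_inv]),
    extDeriv_zero_apply (β := MForm.pullback 𝓘(ℂ, Fin 3 → E) (powModel E 3)
      (extChartAt (powModel E 3) g).symm (S.eta₀ P))
      (ContDiffAt.differentiableAt hα (by simp))
      (eventually_of_mem hm fun z hz v => S.pullback_eta₀_apply hP hΩ hψ hW hz v),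
    pullback_simplicialD _ ((hψ.contMDiffAt hm).mdifferentiableAt (by simp)),
    hI.neg.fderiv_complex_eq_real hΩ hz, fderiv_fun_neg, neg_apply,
    S.fderiv_cartanIntegral₃_family hP hΩ hψ hW hz]
  refine Finset.sum_congr rfl fun j _ => ?_
  rw [S.pullback_eta₁_apply hP hΩ (bgFace_comp j hψ) (S.mapsTo_bgFace hW j) hz]

theorem simplicialD_eta₀ (hP : IsInvariantQuadratic G P) {g : Fin 4 → G} (hg : g ∈ S.W 4) :
    simplicialD (S.eta₀ P) g = 0 := by
  have hΩ := isOpen_chartDomain (I := powModel E 4) (S.isOpen_W 4) g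
  have hψ := contMDiffOn_chartDomain (I := powModel E 4) (S.W 4) g
  have hW := mapsTo_chartDomain (I := powModel E 4) (S.W 4) g
  have hz := mem_chartDomain_self (I := powModel E 4) hg
  refine MForm.eq_of_pullback_chart (I := powModel E 4) (β := 0) fun v => ?_
  rw [pullback_simplicialD _ ((hψ.contMDiffAt (hΩ.mem_nhds hz)).mdifferentiableAt (by simp))]
  refine Eq.trans (Finset.sum_congr rfl fun j _ => ?_)
    (S.cartanIntegral₃_family_sum hP hΩ hψ hW hz)
  rw [S.pullback_eta₀_apply hP hΩ (bgFace_comp j hψ) (S.mapsTo_bgFace hW j) hz]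

theorem bgD_betaOne (hP : IsInvariantQuadratic G P) {g : Fin 1 → G} (hg : g ∈ S.W 1) :
    bgD (S.betaOne P) g = bssForm₁ P g := by
  have hΩ := isOpen_chartDomain (I := powModel E 1) (S.isOpen_W 1) g
  have hψ := contMDiffOn_chartDomain (I := powModel E 1) (S.W 1) g
  have hW := mapsTo_chartDomain (I := powModel E 1) (S.W 1) g
  have hz := mem_chartDomain_self (I := powModel E 1) hg
  have hm := hΩ.mem_nhds hz
  have hα := S.holomorphicAt_betaOne hP hg
  have hI := fun v w => (S.holFamily_family hΩ hψ hW).contDiffOn_cartanIntegral₁ (P := P) hΩ v w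
  have hd := fun v w u => ((hI v w).fderiv_complex_eq_real hΩ hz u)
  refine MForm.eq_of_pullback_chart (I := powModel E 1) fun v => ?_
  rw [MForm.pullback_d_eq_extDeriv hΩ hψ hz (by rwa [extChartAt_to_inv]),
    extDeriv_two_apply (β := MForm.pullback 𝓘(ℂ, Fin 1 → E) (powModel E 1)
      (extChartAt (powModel E 1) g).symm (S.betaOne P)) (κ := fun v w y => -cartanIntegral₁ P
      (S.family (extChartAt (powModel E 1) g).symm) (chartDomain (powModel E 1) (S.W 1) g) v w y)
      (ContDiffAt.differentiableAt hα (by simp))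
      (eventually_of_mem hm fun z hz v => S.pullback_betaOne_apply hP hΩ hψ hW hz v),
    hP.pullback_bssForm₁_apply hψ hΩ hz, ← S.fderiv_cartanIntegral₁_family hP hΩ hψ hW hz]
  simp only [hd, fderiv_fun_neg, neg_apply]
  ring

theorem simplicialD_betaOne (hP : IsInvariantQuadratic G P) {g : Fin 2 → G} (hg : g ∈ S.W 2) :
    simplicialD (S.betaOne P) g = bssForm₂ P g - bgD (S.eta₁ P) g := by
  have hΩ := isOpen_chartDomain (I := powModel E 2) (S.isOpen_W 2) g
  have hψ := contMDiffOn_chartDomain (I := powModel E 2) (S.W 2) g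
  have hW := mapsTo_chartDomain (I := powModel E 2) (S.W 2) g
  have hz := mem_chartDomain_self (I := powModel E 2) hg
  have hm := hΩ.mem_nhds hz
  have hα := S.holomorphicAt_eta₁ hP hg
  have hI := fun v => (S.holFamily_family hΩ hψ hW).contDiffOn_cartanIntegral₂ (P := P) hΩ v
  have hJ := fun v => (S.holFamily_family hΩ (bgFace_comp 0 hψ)
    (S.mapsTo_bgFace hW 0)).contDiffOn_wedgeIntegral₁ (P := P) (eval_comp hψ 0) hΩ v
  have hd := fun v u => (((hI v).neg.add (hJ v)).fderiv_complex_eq_real hΩ hz u)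
  have hd' := fun v => (fderiv_fun_add (𝕜 := ℝ)
    (((hI v).neg.contDiffAt hm).restrict_scalars ℝ |>.differentiableAt (by simp))
    (((hJ v).contDiffAt hm).restrict_scalars ℝ |>.differentiableAt (by simp)))
  refine MForm.eq_of_pullback_chart (I := powModel E 2)
    (β := fun g => bssForm₂ P g - bgD (S.eta₁ P) g) fun v => ?_
  have h1 : MForm.pullback 𝓘(ℂ, Fin 2 → E) (powModel E 2) (extChartAt (powModel E 2) g).symm
      (fun g => bssForm₂ P g - bgD (S.eta₁ P) g) (extChartAt (powModel E 2) g g) v =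
      MForm.pullback 𝓘(ℂ, Fin 2 → E) (powModel E 2) (extChartAt (powModel E 2) g).symm
        (bssForm₂ P) (extChartAt (powModel E 2) g g) v -
      MForm.pullback 𝓘(ℂ, Fin 2 → E) (powModel E 2) (extChartAt (powModel E 2) g).symm
        (bgD (S.eta₁ P)) (extChartAt (powModel E 2) g g) v := rfl
  rw [h1, MForm.pullback_d_eq_extDeriv hΩ hψ hz (by rwa [extChartAt_to_inv]),
    extDeriv_one_apply (β := MForm.pullback 𝓘(ℂ, Fin 2 → E) (powModel E 2)
      (extChartAt (powModel E 2) g).symm (S.eta₁ P)) (κ := fun v y => -cartanIntegral₂ P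
      (S.family (extChartAt (powModel E 2) g).symm) (chartDomain (powModel E 2) (S.W 2) g) v y +
      wedgeIntegral₁ P (fun y => (extChartAt (powModel E 2) g).symm y 0) (S.family fun y =>
      bgFace 0 ((extChartAt (powModel E 2) g).symm y)) (chartDomain (powModel E 2) (S.W 2) g) v y)
      (ContDiffAt.differentiableAt hα (by simp))
      (eventually_of_mem hm fun z hz v => S.pullback_eta₁_apply hP hΩ hψ hW hz v),
    hP.pullback_bssForm₂_apply hψ hΩ hz,
    pullback_simplicialD _ ((hψ.contMDiffAt hm).mdifferentiableAt (by simp))]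
  simp only [hd, hd', fderiv_fun_neg, add_apply, neg_apply]
  rw [← S.cartanIntegral₁_family_sum hP hΩ hψ hW hz]
  refine Finset.sum_congr rfl fun j _ => ?_
  rw [S.pullback_betaOne_apply hP hΩ (bgFace_comp j hψ) (S.mapsTo_bgFace hW j) hz]

end SimplexSystem

/-! ### Formal consequences: ω, ω₂ and dη₁ near the identity -/

namespace SimplexSystem

variable {E : Type*} [NormedAddCommGroup E] [NormedSpace ℂ E] [FiniteDimensional ℂ E]
  {G : Type*} [TopologicalSpace G] [ChartedSpace E G] [Group G] [LieGroup 𝓘(ℂ, E) ∞ G]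
  {P : E →L[ℂ] E →L[ℂ] ℂ} (S : SimplexSystem E G)

omit [FiniteDimensional ℂ E] [LieGroup 𝓘(ℂ, E) ∞ G] in
lemma eventually_W {l : ℕ} {g : Fin l → G} (hg : g ∈ S.W l) {p : (Fin l → G) → Prop}
    (hp : ∀ g ∈ S.W l, p g) : ∀ᶠ g in 𝓝 g, p g :=
  eventually_of_mem ((S.isOpen_W l).mem_nhds hg) hp

include S in
-- On W_1 the form is exact, ω = dβ_{1,1} with β_{1,1} holomorphic. The same primitive shows below
-- that it is closed.
theorem holomorphicAt_bssForm₁ (hP : IsInvariantQuadratic G P) {g : Fin 1 → G}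
    (hg : g ∈ S.W 1) : bgHolomorphicAt (bssForm₁ P) g :=
  (MForm.HolomorphicAt.d (S.eventually_W hg fun _ => S.holomorphicAt_betaOne hP)).congr
    (S.eventually_W hg fun _ h => (S.bgD_betaOne hP h).symm)

include S in
theorem bgD_bssForm₁ (hP : IsInvariantQuadratic G P) {g : Fin 1 → G} (hg : g ∈ S.W 1) :
    bgD (bssForm₁ P) g = 0 :=
  (MForm.d_congr (S.eventually_W hg fun _ h => (S.bgD_betaOne hP h).symm)).trans
    (MForm.d_d (S.eventually_W hg fun _ => S.holomorphicAt_betaOne hP))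

theorem holomorphicAt_bgD_eta₁ (hP : IsInvariantQuadratic G P) {g : Fin 2 → G}
    (hg : g ∈ S.W 2) : bgHolomorphicAt (bgD (S.eta₁ P)) g :=
  MForm.HolomorphicAt.d (S.eventually_W hg fun _ => S.holomorphicAt_eta₁ hP)

theorem bgD_bgD_eta₁ (hP : IsInvariantQuadratic G P) {g : Fin 2 → G} (hg : g ∈ S.W 2) :
    bgD (bgD (S.eta₁ P)) g = 0 :=
  MForm.d_d (S.eventually_W hg fun _ => S.holomorphicAt_eta₁ hP)

theorem simplicialD_bgD_eta₁ (hP : IsInvariantQuadratic G P) {g : Fin 3 → G} (hg : g ∈ S.W 3) :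
    simplicialD (bgD (S.eta₁ P)) g = 0 := by
  rw [← bgD_simplicialD fun j => S.holomorphicAt_eta₁ hP (S.face_mem _ _ hg j)]
  exact (MForm.d_congr (S.eventually_W hg fun _ h => (S.bgD_eta₀ hP h).symm)).trans
    (MForm.d_d (S.eventually_W hg fun _ => S.holomorphicAt_eta₀ hP))

theorem bssForm₂_eq (hP : IsInvariantQuadratic G P) {g : Fin 2 → G} (hg : g ∈ S.W 2) :
    bssForm₂ P g = simplicialD (S.betaOne P) g + bgD (S.eta₁ P) g := by
  rw [S.simplicialD_betaOne hP hg, sub_add_cancel]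

theorem holomorphicAt_simplicialD_betaOne (hP : IsInvariantQuadratic G P) {g : Fin 2 → G}
    (hg : g ∈ S.W 2) : bgHolomorphicAt (simplicialD (S.betaOne P)) g :=
  bgHolomorphicAt_simplicialD fun j => S.holomorphicAt_betaOne hP (S.face_mem _ _ hg j)

include S in
theorem holomorphicAt_bssForm₂ (hP : IsInvariantQuadratic G P) {g : Fin 2 → G}
    (hg : g ∈ S.W 2) : bgHolomorphicAt (bssForm₂ P) g :=
  ((S.holomorphicAt_simplicialD_betaOne hP hg).add (S.holomorphicAt_bgD_eta₁ hP hg)).congr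
    (S.eventually_W hg fun _ => S.bssForm₂_eq hP)

include S in
-- Since ω₂ = δβ_{1,1} + dη₁, one gets dω₂ = δdβ_{1,1} = δω.
theorem bgD_bssForm₂ (hP : IsInvariantQuadratic G P) {g : Fin 2 → G} (hg : g ∈ S.W 2) :
    bgD (bssForm₂ P) g = simplicialD (bssForm₁ P) g := by
  have h1 : bgD (bssForm₂ P) g = _ := MForm.d_congr (S.eventually_W hg fun _ => S.bssForm₂_eq hP)
  rw [h1, MForm.d_add (S.holomorphicAt_simplicialD_betaOne hP hg)
    (S.holomorphicAt_bgD_eta₁ hP hg)]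
  refine (congr_arg₂ (· + ·) (bgD_simplicialD fun j => S.holomorphicAt_betaOne hP
    (S.face_mem _ _ hg j)) (S.bgD_bgD_eta₁ hP hg)).trans ?_
  rw [add_zero]
  exact simplicialD_congr fun j => S.bgD_betaOne hP (S.face_mem _ _ hg j)

include S in
-- δω₂ = δδβ_{1,1} + δdη₁, where the first term is zero and δdη₁ = dδη₁ = ddη₀ = 0.
theorem simplicialD_bssForm₂ (hP : IsInvariantQuadratic G P) {g : Fin 3 → G} (hg : g ∈ S.W 3) :
    simplicialD (bssForm₂ P) g = 0 := by
  rw [simplicialD_congr (β := fun g => simplicialD (S.betaOne P) g + bgD (S.eta₁ P) g)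
    fun j => S.bssForm₂_eq hP (S.face_mem _ _ hg j), simplicialD_add,
    simplicialD_simplicialD_one, S.simplicialD_bgD_eta₁ hP hg, add_zero]

end SimplexSystem

/-! ### Cocycles in the local double complex -/

section Cochains

variable {E : Type*} [NormedAddCommGroup E] [NormedSpace ℂ E]
  {G : Type*} [TopologicalSpace G] [ChartedSpace E G] [Group G]

omit [ChartedSpace E G] in
lemma GermEq.of_eq {r s : ℕ} {α β : BGForm E G r s} (h : α = β) : GermEq α β :=
  Eventually.of_forall fun _ => congr_fun h _

omit [Group G] in
lemma totalDR_eq_zero {c : BGCochain E G} {r s : ℕ} (h : ∀ r', r = r' + 1 → c r' s = 0) :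
    totalDR c r s = 0 := by
  cases r with
  | zero => rfl
  | succ r => exact (congr_arg bgD (h r rfl)).trans MForm.d_zero

lemma totalSimp_eq_zero {c : BGCochain E G} {r s : ℕ} (h : ∀ s', s = s' + 1 → c r s' = 0) :
    totalSimp c r s = 0 := by
  cases s with
  | zero => rfl
  | succ s =>
    funext g
    change (-1 : ℂ) ^ r • simplicialD (c r s) g = 0
    rw [h s rfl, simplicialD_zero]
    exact smul_zero _

lemma totalD_eq_zero {c : BGCochain E G} {r s : ℕ} (h : ∀ r', r = r' + 1 → c r' s = 0)
    (h' : ∀ s', s = s' + 1 → c r s' = 0) : totalD c r s = 0 := by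
  funext g
  rw [totalD, totalDR_eq_zero h, totalSimp_eq_zero h']
  exact add_zero 0

lemma simplicialD_neg {r s : ℕ} (α : BGForm E G r s) (g : Fin (s + 1) → G) :
    simplicialD (fun g => -α g) g = -simplicialD α g := by
  have h := simplicialD_add (α := fun g => -α g) (β := α) (g := g)
  have h0 : (fun g => -α g + α g) = (0 : BGForm E G r s) := funext fun g => neg_add_cancel _
  rw [h0, simplicialD_zero] at h
  exact eq_neg_of_add_eq_zero_left h.symm

omit [Group G] in
lemma bgD_neg {r s : ℕ} (α : BGForm E G r s) (g : Fin s → G) :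
    bgD (fun g => -α g) g = -bgD α g := by
  have h : (fun g => -α g) = fun g => (-1 : ℂ) • α g :=
    funext fun g => (neg_one_smul ℂ (α g)).symm
  rw [h]
  exact (MForm.d_smul _).trans (neg_one_smul ℂ _)

lemma totalD_neg (c : BGCochain E G) (r s : ℕ) :
    totalD (fun r s g => -c r s g) r s = fun g => -totalD c r s g := by
  funext g
  have h1 : totalDR (fun r s g => -c r s g) r s g = -totalDR c r s g := by
    cases r with
    | zero => exact neg_zero.symm
    | succ r => exact bgD_neg _ _
  have h2 : totalSimp (fun r s g => -c r s g) r s g = -totalSimp c r s g := by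
    cases s with
    | zero => exact neg_zero.symm
    | succ s => exact (congr_arg _ (simplicialD_neg _ _)).trans (smul_neg _ _)
  exact (congr_arg₂ (· + ·) h1 h2).trans (neg_add _ _).symm

variable [FiniteDimensional ℂ E] [LieGroup 𝓘(ℂ, E) ∞ G] {P : E →L[ℂ] E →L[ℂ] ℂ}
  (S : SimplexSystem E G)

lemma bssCochain_eq_zero {r s : ℕ} (h₁ : ¬(r = 3 ∧ s = 1)) (h₂ : ¬(r = 2 ∧ s = 2)) :
    (bssCochain P : BGCochain E G) r s = 0 := by
  unfold bssCochain
  split <;> simp_all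

namespace SimplexSystem

lemma etaCochain_eq_zero {r s : ℕ} (h₁ : ¬(r = 0 ∧ s = 3)) (h₂ : ¬(r = 1 ∧ s = 2)) :
    S.etaCochain P r s = 0 := by
  unfold etaCochain
  split <;> simp_all

lemma dEtaCochain_eq_zero {r s : ℕ} (h : ¬(r = 2 ∧ s = 2)) : S.dEtaCochain P r s = 0 := by
  unfold dEtaCochain
  split <;> simp_all

/-- The cochain with the single entry `β_{1,1}`. -/
noncomputable def betaCochain (P : E →L[ℂ] E →L[ℂ] ℂ) : BGCochain E G
  | 2, 1 => S.betaOne P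
  | _, _ => 0

lemma betaCochain_eq_zero {r s : ℕ} (h : ¬(r = 2 ∧ s = 1)) : S.betaCochain P r s = 0 := by
  unfold betaCochain
  split <;> simp_all

omit [FiniteDimensional ℂ E] [LieGroup 𝓘(ℂ, E) ∞ G] in
lemma eventually_one {l : ℕ} {p : (Fin l → G) → Prop} (hp : ∀ g ∈ S.W l, p g) :
    ∀ᶠ g in 𝓝 (1 : Fin l → G), p g :=
  S.eventually_W (S.one_mem_W l) hp

/-- The set A is left open so that the same cochain serves in the truncated complex and, as its own
lift, in the full one. -/
lemma isLocalCochain_etaCochain (hP : IsInvariantQuadratic G P) {A : Set ℕ} (h0 : 0 ∈ A)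
    (h1 : 1 ∈ A) : IsLocalCochain A 3 (S.etaCochain P) := by
  refine ⟨fun r s => ?_, fun r s h => GermEq.of_eq (S.etaCochain_eq_zero ?_ ?_)⟩
  · by_cases h₁ : r = 0 ∧ s = 3
    · obtain ⟨rfl, rfl⟩ := h₁
      exact S.eventually_one fun _ => S.holomorphicAt_eta₀ hP
    by_cases h₂ : r = 1 ∧ s = 2
    · obtain ⟨rfl, rfl⟩ := h₂
      exact S.eventually_one fun _ => S.holomorphicAt_eta₁ hP
    rw [S.etaCochain_eq_zero h₁ h₂]
    exact Eventually.of_forall fun _ => MForm.holomorphicAt_zero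
  · rintro ⟨rfl, rfl⟩; exact h ⟨h0, rfl⟩
  · rintro ⟨rfl, rfl⟩; exact h ⟨h1, rfl⟩

/-- In degrees (0, 4) and (1, 3) this is δη₀ = 0 and dη₀ = δη₁. Only dη₁ in degree (2, 2) survives,
and it dies in the truncation. -/
lemma totalD_etaCochain (hP : IsInvariantQuadratic G P) (r s : ℕ) :
    GermEq (totalD (S.etaCochain P) r s) (S.dEtaCochain P r s) := by
  by_cases h₁ : r = 0 ∧ s = 4
  · obtain ⟨rfl, rfl⟩ := h₁
    refine S.eventually_one fun g hg => ?_
    change 0 + (-1 : ℂ) ^ 0 • simplicialD (S.eta₀ P) g = 0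
    rw [S.simplicialD_eta₀ hP hg, smul_zero, add_zero]
  by_cases h₂ : r = 1 ∧ s = 3
  · obtain ⟨rfl, rfl⟩ := h₂
    refine S.eventually_one fun g hg => ?_
    change bgD (S.eta₀ P) g + (-1 : ℂ) ^ 1 • simplicialD (S.eta₁ P) g = 0
    rw [S.bgD_eta₀ hP hg, pow_one, neg_one_smul, add_neg_cancel]
  by_cases h₃ : r = 2 ∧ s = 2
  · obtain ⟨rfl, rfl⟩ := h₃
    refine GermEq.of_eq (funext fun g => ?_)
    change bgD (S.eta₁ P) g + (-1 : ℂ) ^ 2 • simplicialD (0 : BGForm E G 2 1) g =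
      bgD (S.eta₁ P) g
    rw [simplicialD_zero]
    simp
  refine GermEq.of_eq ((totalD_eq_zero (fun r' hr => S.etaCochain_eq_zero ?_ ?_)
    fun s' hs => S.etaCochain_eq_zero ?_ ?_).trans (S.dEtaCochain_eq_zero h₃).symm) <;> omega

lemma isLocalCocycle_etaCochain (hP : IsInvariantQuadratic G P) :
    IsLocalCocycle (truncDegrees 2) 3 (S.etaCochain P) :=
  ⟨S.isLocalCochain_etaCochain hP (by simp [truncDegrees]) (by simp [truncDegrees]),
    fun r hr s => (S.totalD_etaCochain hP r s).trans (GermEq.of_eq (S.dEtaCochain_eq_zero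
      fun h => absurd hr (by simp [truncDegrees, h.1])))⟩

include S in
lemma isLocalCocycle_bssCochain (hP : IsInvariantQuadratic G P) :
    IsLocalCocycle (hodgeDegrees 2) 4 (bssCochain P : BGCochain E G) := by
  refine ⟨⟨fun r s => ?_, fun r s h => GermEq.of_eq (bssCochain_eq_zero ?_ ?_)⟩, fun r hr s => ?_⟩
  · by_cases h₁ : r = 3 ∧ s = 1
    · obtain ⟨rfl, rfl⟩ := h₁
      exact S.eventually_one fun _ => S.holomorphicAt_bssForm₁ hP
    by_cases h₂ : r = 2 ∧ s = 2
    · obtain ⟨rfl, rfl⟩ := h₂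
      exact S.eventually_one fun _ => S.holomorphicAt_bssForm₂ hP
    rw [bssCochain_eq_zero h₁ h₂]
    exact Eventually.of_forall fun _ => MForm.holomorphicAt_zero
  · rintro ⟨rfl, rfl⟩; exact h (by simp [hodgeDegrees])
  · rintro ⟨rfl, rfl⟩; exact h (by simp [hodgeDegrees])
  by_cases h₁ : r = 4 ∧ s = 1
  · obtain ⟨rfl, rfl⟩ := h₁
    refine S.eventually_one fun g hg => ?_
    change bgD (bssForm₁ P) g + (-1 : ℂ) ^ 4 • simplicialD (0 : BGForm E G 4 0) g = 0
    rw [S.bgD_bssForm₁ hP hg, simplicialD_zero]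
    simp
  by_cases h₂ : r = 3 ∧ s = 2
  · obtain ⟨rfl, rfl⟩ := h₂
    refine S.eventually_one fun g hg => ?_
    change bgD (bssForm₂ P) g + (-1 : ℂ) ^ 3 • simplicialD (bssForm₁ P) g = 0
    rw [S.bgD_bssForm₂ hP hg, Odd.neg_one_pow (by decide), neg_one_smul, add_neg_cancel]
  by_cases h₃ : r = 2 ∧ s = 3
  · obtain ⟨rfl, rfl⟩ := h₃
    refine S.eventually_one fun g hg => ?_
    change bgD (0 : BGForm E G 1 3) g + (-1 : ℂ) ^ 2 • simplicialD (bssForm₂ P) g = 0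
    rw [S.simplicialD_bssForm₂ hP hg, smul_zero, add_zero]
    exact congr_fun MForm.d_zero g
  refine GermEq.of_eq (totalD_eq_zero (fun r' hr => bssCochain_eq_zero ?_ ?_)
    fun s' hs => bssCochain_eq_zero ?_ ?_) <;> omega

lemma isLocalCocycle_dEtaCochain (hP : IsInvariantQuadratic G P) :
    IsLocalCocycle (hodgeDegrees 2) 4 (S.dEtaCochain P) := by
  refine ⟨⟨fun r s => ?_, fun r s h => GermEq.of_eq (S.dEtaCochain_eq_zero ?_)⟩, fun r hr s => ?_⟩
  · by_cases h₁ : r = 2 ∧ s = 2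
    · obtain ⟨rfl, rfl⟩ := h₁
      exact S.eventually_one fun _ => S.holomorphicAt_bgD_eta₁ hP
    rw [S.dEtaCochain_eq_zero h₁]
    exact Eventually.of_forall fun _ => MForm.holomorphicAt_zero
  · rintro ⟨rfl, rfl⟩; exact h (by simp [hodgeDegrees])
  by_cases h₂ : r = 3 ∧ s = 2
  · obtain ⟨rfl, rfl⟩ := h₂
    refine S.eventually_one fun g hg => ?_
    change bgD (bgD (S.eta₁ P)) g + (-1 : ℂ) ^ 3 • simplicialD (0 : BGForm E G 3 1) g = 0
    rw [S.bgD_bgD_eta₁ hP hg, simplicialD_zero]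
    simp
  by_cases h₃ : r = 2 ∧ s = 3
  · obtain ⟨rfl, rfl⟩ := h₃
    refine S.eventually_one fun g hg => ?_
    change bgD (0 : BGForm E G 1 3) g + (-1 : ℂ) ^ 2 • simplicialD (bgD (S.eta₁ P)) g = 0
    rw [S.simplicialD_bgD_eta₁ hP hg, smul_zero, add_zero]
    exact congr_fun MForm.d_zero g
  refine GermEq.of_eq (totalD_eq_zero (fun r' hr => S.dEtaCochain_eq_zero ?_)
    fun s' hs => S.dEtaCochain_eq_zero ?_) <;> omega

lemma isLocalCochain_betaCochain (hP : IsInvariantQuadratic G P) :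
    IsLocalCochain (hodgeDegrees 2) 3 (S.betaCochain P) := by
  refine ⟨fun r s => ?_, fun r s h => GermEq.of_eq (S.betaCochain_eq_zero ?_)⟩
  · by_cases h₁ : r = 2 ∧ s = 1
    · obtain ⟨rfl, rfl⟩ := h₁
      exact S.eventually_one fun _ => S.holomorphicAt_betaOne hP
    rw [S.betaCochain_eq_zero h₁]
    exact Eventually.of_forall fun _ => MForm.holomorphicAt_zero
  · rintro ⟨rfl, rfl⟩; exact h (by simp [hodgeDegrees])

/-- Collects dβ_{1,1} = ω in degree (3, 1) and δβ_{1,1} = ω₂ − dη₁ in degree (2, 2), where the sign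
(−1)^r of D is +1. -/
lemma totalD_betaCochain (hP : IsInvariantQuadratic G P) (r s : ℕ) :
    GermEq (totalD (S.betaCochain P) r s)
      (fun g => (bssCochain P : BGCochain E G) r s g - S.dEtaCochain P r s g) := by
  by_cases h₁ : r = 3 ∧ s = 1
  · obtain ⟨rfl, rfl⟩ := h₁
    refine S.eventually_one fun g hg => ?_
    change bgD (S.betaOne P) g + (-1 : ℂ) ^ 3 • simplicialD (0 : BGForm E G 3 0) g =
      bssForm₁ P g - 0
    rw [S.bgD_betaOne hP hg, simplicialD_zero]
    simp
  by_cases h₂ : r = 2 ∧ s = 2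
  · obtain ⟨rfl, rfl⟩ := h₂
    refine S.eventually_one fun g hg => ?_
    change bgD (0 : BGForm E G 1 2) g + (-1 : ℂ) ^ 2 • simplicialD (S.betaOne P) g =
      bssForm₂ P g - bgD (S.eta₁ P) g
    rw [S.simplicialD_betaOne hP hg, neg_one_sq, one_smul]
    exact (congr_arg (· + _) (congr_fun MForm.d_zero g)).trans (zero_add _)
  refine GermEq.of_eq ((totalD_eq_zero (fun r' hr => S.betaCochain_eq_zero ?_)
    fun s' hs => S.betaCochain_eq_zero ?_).trans ?_)
  · omega
  · omega
  · rw [bssCochain_eq_zero h₁ h₂, S.dEtaCochain_eq_zero h₂]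
    exact (funext fun g => sub_zero (0 : _ [⋀^Fin r]→L[ℂ] ℂ)).symm

lemma locallyCohomologous_bss_dEta (hP : IsInvariantQuadratic G P) :
    LocallyCohomologous (hodgeDegrees 2) 3 (bssCochain P) (S.dEtaCochain P) :=
  ⟨S.betaCochain P, S.isLocalCochain_betaCochain hP, fun r _ s => S.totalD_betaCochain hP r s⟩

end SimplexSystem

omit [FiniteDimensional ℂ E] [LieGroup 𝓘(ℂ, E) ∞ G] in
lemma IsLocalCochain.neg {A : Set ℕ} {k : ℕ} {c : BGCochain E G} (hc : IsLocalCochain A k c) :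
    IsLocalCochain A k (fun r s g => -c r s g) := by
  refine ⟨fun r s => (hc.1 r s).mono fun g hg => ?_, fun r s h => (hc.2 r s h).mono fun g hg => ?_⟩
  · have h : (fun g => -c r s g) = fun g => (-1 : ℂ) • c r s g :=
      funext fun g => (neg_one_smul ℂ (c r s g)).symm
    change bgHolomorphicAt (fun g => -c r s g) g
    rw [h]
    exact MForm.HolomorphicAt.smul hg _
  · change -c r s g = 0
    rw [hg]
    exact neg_zero

omit [FiniteDimensional ℂ E] [LieGroup 𝓘(ℂ, E) ∞ G] in
lemma LocallyCohomologous.symm {A : Set ℕ} {k : ℕ} {c c' : BGCochain E G}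
    (h : LocallyCohomologous A k c c') : LocallyCohomologous A k c' c := by
  obtain ⟨b, hb, h⟩ := h
  refine ⟨fun r s g => -b r s g, hb.neg, fun r hr s => (h r hr s).mono fun g hg => ?_⟩
  rw [totalD_neg]
  exact (congr_arg Neg.neg hg).trans (neg_sub _ _)

end Cochains

theorem mainTheorem7 {E : Type*} [NormedAddCommGroup E] [NormedSpace ℂ E] [FiniteDimensional ℂ E]
    {G : Type*} [TopologicalSpace G] [ChartedSpace E G] [Group G] [LieGroup 𝓘(ℂ, E) ∞ G]
    (P : E →L[ℂ] E →L[ℂ] ℂ) (hP : IsInvariantQuadratic G P) (S : SimplexSystem E G) :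
    (∀ g ∈ S.W 3, bgHolomorphicAt (S.eta₀ P) g) ∧
    (∀ g ∈ S.W 2, bgHolomorphicAt (S.eta₁ P) g) ∧
    (∀ g ∈ S.W 3, bgD (S.eta₀ P) g = simplicialD (S.eta₁ P) g) ∧
    (∀ g ∈ S.W 4, simplicialD (S.eta₀ P) g = 0) ∧
    IsLocalCocycle (truncDegrees 2) 3 (S.etaCochain P) ∧
    IsLocalCocycle (hodgeDegrees 2) 4 (bssCochain P : BGCochain E G) ∧
    IsLocalCocycle (hodgeDegrees 2) 4 (S.dEtaCochain P) ∧
    LocallyCohomologous (hodgeDegrees 2) 3 (bssCochain P) (S.dEtaCochain P) ∧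
    BoundaryMapsTo 2 3 (S.etaCochain P) (bssCochain P) :=
  ⟨fun _ => S.holomorphicAt_eta₀ hP, fun _ => S.holomorphicAt_eta₁ hP, fun _ => S.bgD_eta₀ hP,
    fun _ => S.simplicialD_eta₀ hP, S.isLocalCocycle_etaCochain hP,
    S.isLocalCocycle_bssCochain hP, S.isLocalCocycle_dEtaCochain hP,
    S.locallyCohomologous_bss_dEta hP,
    -- The lift to the full complex is (η₀, η₁) itself, extended by zero, and its coboundary is (0,
    -- dη₁).
    S.etaCochain P, S.dEtaCochain P,
    S.isLocalCochain_etaCochain hP (mem_univ _) (mem_univ _),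
    fun _ _ _ => GermEq.of_eq rfl, S.isLocalCocycle_dEtaCochain hP, S.totalD_etaCochain hP,
    (S.locallyCohomologous_bss_dEta hP).symm⟩
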